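/- **Setting.** Let $n\ge 4$ and let $Z\in\mathbb R^{n\times 4}$ be totally positive (all maximal minors nonzero and of the same sign), with rows $Z_1,\dots,Z_n$ regarded as points of $\mathbb P^3$; indices are cyclic modulo $n$. Assume that no line $AB$ meets more than four of the lines $Z_iZ_{i+1}$, $i=1,\dots,n$. Let $\mathcal A_n\subset \mathrm{Gr}_{\mathbb R}(2,4)$ be the image of the totally nonnegative Grassmannian $\mathrm{Gr}(2,n)_{\ge 0}$ under $X\mapsto X\cdot Z$, let $\partial\mathcal A_n=\mathcal A_n\setminus\mathrm{int}(\mathcal A_n)$ (Euclidean topology), and let $\partial_a\mathcal A_n$ be the Zariski closure of $\partial\mathcal A_n$ in $\mathrm{Gr}_{\mathbb C}(2,4)\subset\mathbb P^5$. The *closed strata* are the sets obtained from the irreducible components of $\partial_a\mathcal A_n$ by repeatedly taking irreducible components of intersections. For a closed stratum $S$, let $S_{\ge 0}$ be the closure in $S(\mathbb R)$ of the interior, relative to $S(\mathbb R)$, of $S(\mathbb R)\cap\mathcal A_n$. The *boundary face* in $S$ is the relative interior of $S_{\ge0}$ in $S(\mathbb R)$, when this is nonempty; $S_{\ge0}$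 is the corresponding closed face. Define the following sets of lines in $\mathrm{Gr}_{\mathbb C}(2,4)$: - $(3,\mathrm I,i)$: lines meeting $Z_iZ_{i+1}$; - $(2,\mathrm I,i)$: lines through $Z_i$; $(2,\mathrm{II},i)$: lines in the plane $Z_{i-1}Z_iZ_{i+1}$; $(2,\mathrm{III},ij)$, $j\notin\{i-1,i,i+1\}$: lines meeting both $Z_iZ_{i+1}$ and $Z_jZ_{j+1}$; - $(1,\mathrm I,i)$: lines through $Z_i$ meeting $Z_{i-1}Z_{i+1}$; $(1,\mathrm{II},ij)$, $i\notin\{j,j+1\}$: lines through $Z_i$ meeting $Z_jZ_{j+1}$; - $(0,\mathrm I,ij)$, $i\ne j$: the line $Z_iZ_j$. **Proposition.** The closed strata that carry a boundary face are exactly the sets listed above. The closed face in a set of type $(d,\cdot)$ is a $d$-dimensional polytope, in the sense that there is a homeomorphism onto it from a convex $d$-dimensional polytope in $\mathbb R^d$ under which the nonempty faces of that polytope correspond exactly to the closed faces contained in it. More precisely: - *Vertices.* The face in $(0,\mathrm I,ij)$ is the point $Z_iZ_j$. The vertex $(0,\mathrm I,i(i+1))$ lies on exactly four boundary lines (sets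 of type $(1,\mathrm I)$ or $(1,\mathrm{II})$), namely $(1,\mathrm I,i)$, $(1,\mathrm I,i+1)$, $(1,\mathrm{II},i(i+1))$, $(1,\mathrm{II},(i+1)(i-1))$. The vertex $(0,\mathrm I,ij)$ with $j\notin\{i-1,i,i+1\}$ lies on exactly four boundary lines, namely $(1,\mathrm{II},i(j-1))$, $(1,\mathrm{II},ij)$, $(1,\mathrm{II},j(i-1))$, $(1,\mathrm{II},ji)$. - *Line segments.* The closed face in $(1,\mathrm I,i)$ is a line segment with the two vertices $(0,\mathrm I,(i-1)i)$ and $(0,\mathrm I,i(i+1))$. The closed face in $(1,\mathrm{II},ij)$ is a line segment with the two vertices $(0,\mathrm I,ij)$ and $(0,\mathrm I,i(j+1))$. - *Polygons.* The closed face in $(2,\mathrm I,i)$ is a convex $(n-1)$-gon, in an affine chart of Plücker space, with vertices in cyclic order $(0,\mathrm I,ij)$, $j=i+1,\dots,i-1$; its $n-1$ edges lie in the line $(1,\mathrm I,i)$ and the $n-2$ lines $(1,\mathrm{II},ij)$, $j\notin\{i-1,i\}$. The closed face in $(2,\mathrm{II},i)$ is a triangle, in an affine chart of Plücker space, with vertices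 $(0,\mathrm I,(i-1)i)$, $(0,\mathrm I,i(i+1))$, $(0,\mathrm I,(i-1)(i+1))$; its edges lie in $(1,\mathrm{II},(i-1)i)$, $(1,\mathrm I,i)$, $(1,\mathrm{II},(i+1)(i-1))$. The closed face in $(2,\mathrm{III},ij)$ is a quadrilateral with vertices in cyclic order $(0,\mathrm I,ij)$, $(0,\mathrm I,(i+1)j)$, $(0,\mathrm I,(i+1)(j+1))$, $(0,\mathrm I,i(j+1))$; its edges lie in $(1,\mathrm{II},ji)$, $(1,\mathrm{II},(i+1)j)$, $(1,\mathrm{II},(j+1)i)$, $(1,\mathrm{II},ij)$. - *$3$-dimensional polytopes.* The closed face in $(3,\mathrm I,i)$ has exactly $n+1$ facets: the $n-3$ quadrilaterals in $(2,\mathrm{III},ij)$, $j\notin\{i-1,i,i+1\}$, the two $(n-1)$-gons in $(2,\mathrm I,i)$ and $(2,\mathrm I,i+1)$, and the two triangles in $(2,\mathrm{II},i)$ and $(2,\mathrm{II},i+1)$. The planes and quadric surfaces containing these facets form $n-1$ hyperplane sections of $(3,\mathrm I,i)$: the $n-3$ surfaces $(2,\mathrm{III},ij)$ and the two unions $(2,\mathrm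 I,i)\cup(2,\mathrm{II},i)$ and $(2,\mathrm I,i+1)\cup(2,\mathrm{II},i+1)$. -/

import Mathlib

open Module Set

/-- The Grassmannian of two-dimensional subspaces of `𝕜 ^ m`, i.e. of lines in projective
`(m - 1)`-space. -/
@[ext] structure Gr (𝕜 : Type*) [Field 𝕜] (m : ℕ) where
  toSubmodule : Submodule 𝕜 (Fin m → 𝕜)
  finrank_eq : finrank 𝕜 toSubmodule = 2

/-- A basis of a two-dimensional subspace, written as the two rows of a `2 × m` matrix. -/
def Frame (𝕜 : Type*) [Field 𝕜] (m : ℕ) : Type _ :=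
  {M : Matrix (Fin 2) (Fin m) 𝕜 // LinearIndependent 𝕜 M.row}

/-- The row span of a `2 × m` matrix of rank two. -/
def rowSpan {𝕜 : Type*} [Field 𝕜] {m : ℕ} (M : Frame 𝕜 m) : Gr 𝕜 m where
  toSubmodule := Submodule.span 𝕜 (Set.range M.1.row)
  finrank_eq := by
    have h := finrank_span_eq_card M.2
    simpa using h

/-- The Plücker coordinates (all `2 × 2` minors) of a `2 × m` matrix, stored as the full
antisymmetric array; the entries with `a < b` are the usual coordinates. -/
def plucker {𝕜 : Type*} [Field 𝕜] {m : ℕ} (M : Frame 𝕜 m) : Fin m → Fin m → 𝕜 :=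
  fun a b => M.1 0 a * M.1 1 b - M.1 0 b * M.1 1 a

/-- The Euclidean topology on the real Grassmannian: the quotient topology from `2 × m` matrices of
rank two. -/
noncomputable instance euclideanTopology (m : ℕ) : TopologicalSpace (Gr ℝ m) :=
  TopologicalSpace.coinduced rowSpan
    (inferInstanceAs (TopologicalSpace
      {M : Matrix (Fin 2) (Fin m) ℝ // LinearIndependent ℝ M.row}))

/-- A polynomial (meant: homogeneous) in the Plücker coordinates vanishes at a point of the
Grassmannian. -/
def VanishesAt {𝕜 : Type*} [Field 𝕜] {m : ℕ} (f : MvPolynomial (Fin m × Fin m) 𝕜)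
    (W : Gr 𝕜 m) : Prop :=
  ∀ M : Frame 𝕜 m, rowSpan M = W → MvPolynomial.eval (fun ab => plucker M ab.1 ab.2) f = 0

/-- The Zariski topology on the complex Grassmannian: generated by the complements of the zero loci
of homogeneous polynomials in the Plücker coordinates. -/
noncomputable instance zariskiTopology (m : ℕ) : TopologicalSpace (Gr ℂ m) :=
  TopologicalSpace.generateFrom
    {U | ∃ (f : MvPolynomial (Fin m × Fin m) ℂ) (d : ℕ),
      f.IsHomogeneous d ∧ U = {W | ¬ VanishesAt f W}}

/-- A real vector regarded as a complex vector. -/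
def toComplex {m : ℕ} (v : Fin m → ℝ) : Fin m → ℂ := fun k => (v k : ℂ)

theorem linearIndependent_toComplex {m : ℕ} {v : Fin 2 → Fin m → ℝ}
    (hv : LinearIndependent ℝ v) : LinearIndependent ℂ (fun a => toComplex (v a)) := by
  rw [Fintype.linearIndependent_iff] at hv ⊢
  intro g hg a
  have hre := hv (fun a => (g a).re) (by
    funext k
    have h := congrArg Complex.re (congrFun hg k)
    simpa [toComplex] using h) a
  have him := hv (fun a => (g a).im) (by
    funext k
    have h := congrArg Complex.im (congrFun hg k)
    simpa [toComplex] using h) a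
  exact Complex.ext hre him

/-- The inclusion of the real Grassmannian into the complex one: the complex span of a real
subspace. -/
noncomputable def complexify {m : ℕ} (W : Gr ℝ m) : Gr ℂ m where
  toSubmodule := Submodule.span ℂ (toComplex '' (W.toSubmodule : Set (Fin m → ℝ)))
  finrank_eq := by
    have b := finBasisOfFinrankEq ℝ W.toSubmodule W.finrank_eq
    have hb : LinearIndependent ℝ (fun a => (b a : Fin m → ℝ)) :=
      b.linearIndependent.map' W.toSubmodule.subtype (by simp)
    have hspan : Submodule.span ℂ (toComplex '' (W.toSubmodule : Set (Fin m → ℝ))) =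
        Submodule.span ℂ (Set.range (fun a => toComplex (b a : Fin m → ℝ))) := by
      apply le_antisymm
      · rw [Submodule.span_le]
        rintro _ ⟨w, hw, rfl⟩
        have h := b.sum_repr ⟨w, hw⟩
        have h' : w = ∑ a, b.repr ⟨w, hw⟩ a • (b a : Fin m → ℝ) := by
          have h2 := congrArg W.toSubmodule.subtype h
          rw [map_sum] at h2
          exact h2.symm
        have h'' : toComplex w =
            ∑ a, ((b.repr ⟨w, hw⟩ a : ℝ) : ℂ) • toComplex (b a : Fin m → ℝ) := by
          funext k
          have := congrFun h' k
          simp only [toComplex, this, Finset.sum_apply, Pi.smul_apply, smul_eq_mul]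
          push_cast
          rfl
        rw [h'']
        exact Submodule.sum_mem _ fun a _ =>
          Submodule.smul_mem _ _ (Submodule.subset_span ⟨a, rfl⟩)
      · apply Submodule.span_mono
        rintro _ ⟨a, rfl⟩
        exact ⟨_, (b a).2, rfl⟩
    rw [hspan]
    have h := finrank_span_eq_card (linearIndependent_toComplex hb)
    simpa using h

/-- The real points of a subset of the complex Grassmannian. -/
def realPoints (S : Set (Gr ℂ 4)) : Set (Gr ℝ 4) := {W | complexify W ∈ S}

/-- An `n × 4` matrix is totally positive: its maximal minors (rows in increasing order) are nonzero
and all have the same sign. -/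
def IsTotallyPositive {n : ℕ} (Z : Matrix (Fin n) (Fin 4) ℝ) : Prop :=
  ∀ f g : Fin 4 ↪o Fin n, 0 < (Z.submatrix f id).det * (Z.submatrix g id).det

/-- A point of the totally nonnegative Grassmannian: all Plücker coordinates are nonnegative for
some choice of basis, i.e. the nonzero ones have the same sign. -/
def IsTotallyNonneg {n : ℕ} (W : Gr ℝ n) : Prop :=
  ∃ M : Frame ℝ n, rowSpan M = W ∧ ∀ i j, i < j → 0 ≤ plucker M i j

/-- The amplituhedron: the image of the totally nonnegative Grassmannian of two-dimensional
subspaces of `ℝ ^ n` under `X ↦ X · Z`. -/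
def amplituhedron {n : ℕ} (Z : Matrix (Fin n) (Fin 4) ℝ) : Set (Gr ℝ 4) :=
  {U | ∃ W : Gr ℝ n, IsTotallyNonneg W ∧ U.toSubmodule = W.toSubmodule.map Z.vecMulLinear}

/-- The algebraic boundary: the Zariski closure, in the complex Grassmannian, of the Euclidean
boundary. -/
def algebraicBoundary {n : ℕ} (Z : Matrix (Fin n) (Fin 4) ℝ) : Set (Gr ℂ 4) :=
  closure (complexify '' (amplituhedron Z \ interior (amplituhedron Z)))

/-- `S` is an irreducible component of `T`. -/
def IsComponentOf (S T : Set (Gr ℂ 4)) : Prop :=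
  Maximal (fun R : Set (Gr ℂ 4) => IsIrreducible R ∧ R ⊆ T) S

/-- The closed strata of the algebraic boundary: its irreducible components, and all irreducible
components of intersections of strata already obtained. -/
inductive IsStratum {n : ℕ} (Z : Matrix (Fin n) (Fin 4) ℝ) : Set (Gr ℂ 4) → Prop
  | component {S : Set (Gr ℂ 4)} (hS : IsComponentOf S (algebraicBoundary Z)) : IsStratum Z S
  | inter {S T U : Set (Gr ℂ 4)} (hS : IsStratum Z S) (hT : IsStratum Z T)
      (hU : IsComponentOf U (S ∩ T)) : IsStratum Z U

/-- The nonnegative part induced on `S`: the closure, in the real points of `S`, of the interior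
(relative to these real points) of the intersection of `S` with the amplituhedron. -/
def closedFace {n : ℕ} (Z : Matrix (Fin n) (Fin 4) ℝ) (S : Set (Gr ℂ 4)) : Set (Gr ℝ 4) :=
  (Subtype.val : realPoints S → Gr ℝ 4) ''
    closure (interior ((Subtype.val : realPoints S → Gr ℝ 4) ⁻¹' amplituhedron Z))

/-- The face in `S`: the relative interior, in the real points of `S`, of the nonnegative part
induced on `S`. -/
def face {n : ℕ} (Z : Matrix (Fin n) (Fin 4) ℝ) (S : Set (Gr ℂ 4)) : Set (Gr ℝ 4) :=
  (Subtype.val : realPoints S → Gr ℝ 4) ''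
    interior (closure (interior ((Subtype.val : realPoints S → Gr ℝ 4) ⁻¹' amplituhedron Z)))

/-- `S` is a closed stratum of the algebraic boundary that carries a boundary face `face Z S`. -/
def IsBoundaryStratum {n : ℕ} (Z : Matrix (Fin n) (Fin 4) ℝ) (S : Set (Gr ℂ 4)) : Prop :=
  IsStratum Z S ∧ (face Z S).Nonempty

/-- Schubert condition: lines through the point `a`. -/
def schubertV {𝕜 : Type*} [Field 𝕜] (a : Fin 4 → 𝕜) : Set (Gr 𝕜 4) :=
  {W | a ∈ W.toSubmodule}

/-- Schubert condition: lines meeting the line through `a` and `b`. -/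
def schubertL {𝕜 : Type*} [Field 𝕜] (a b : Fin 4 → 𝕜) : Set (Gr 𝕜 4) :=
  {W | W.toSubmodule ⊓ Submodule.span 𝕜 {a, b} ≠ ⊥}

/-- Schubert condition: lines contained in the plane through `a`, `b` and `c`. -/
def schubertP {𝕜 : Type*} [Field 𝕜] (a b c : Fin 4 → 𝕜) : Set (Gr 𝕜 4) :=
  {W | W.toSubmodule ≤ Submodule.span 𝕜 {a, b, c}}

/-- The generality assumption: no line meets more than four of the lines `Z_i Z_{i+1}` (indices in
`Fin n` are cyclic). -/
def IsGeneral {n : ℕ} [NeZero n] (Z : Matrix (Fin n) (Fin 4) ℝ) : Prop :=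
  ∀ W : Gr ℝ 4, {i : Fin n | W ∈ schubertL (Z i) (Z (i + 1))}.ncard ≤ 4

section Types

variable {n : ℕ} [NeZero n] (Z : Matrix (Fin n) (Fin 4) ℝ)

/-- Type (3,I,i): lines meeting `Z_i Z_{i+1}`. -/
def type3I (i : Fin n) : Set (Gr ℂ 4) := schubertL (toComplex (Z i)) (toComplex (Z (i + 1)))

/-- Type (2,I,i): lines through `Z_i`. -/
def type2I (i : Fin n) : Set (Gr ℂ 4) := schubertV (toComplex (Z i))

/-- Type (2,II,i): lines in the plane `Z_{i-1} Z_i Z_{i+1}`. -/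
def type2II (i : Fin n) : Set (Gr ℂ 4) :=
  schubertP (toComplex (Z (i - 1))) (toComplex (Z i)) (toComplex (Z (i + 1)))

/-- Type (2,III,ij): lines meeting `Z_i Z_{i+1}` and `Z_j Z_{j+1}`. -/
def type2III (i j : Fin n) : Set (Gr ℂ 4) :=
  schubertL (toComplex (Z i)) (toComplex (Z (i + 1))) ∩
    schubertL (toComplex (Z j)) (toComplex (Z (j + 1)))

/-- Type (1,I,i): lines through `Z_i` meeting `Z_{i-1} Z_{i+1}`. -/
def type1I (i : Fin n) : Set (Gr ℂ 4) :=
  schubertV (toComplex (Z i)) ∩ schubertL (toComplex (Z (i - 1))) (toComplex (Z (i + 1)))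

/-- Type (1,II,ij): lines through `Z_i` meeting `Z_j Z_{j+1}`. -/
def type1II (i j : Fin n) : Set (Gr ℂ 4) :=
  schubertV (toComplex (Z i)) ∩ schubertL (toComplex (Z j)) (toComplex (Z (j + 1)))

/-- Type (0,I,ij): the line through `Z_i` and `Z_j`. -/
def type0I (i j : Fin n) : Set (Gr ℂ 4) :=
  schubertV (toComplex (Z i)) ∩ schubertV (toComplex (Z j))

/-- All strata of type (0,I). -/
def vertexStrata : Set (Set (Gr ℂ 4)) := {S | ∃ i j, i ≠ j ∧ S = type0I Z i j}

/-- All strata of types (1,I) and (1,II). -/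
def lineStrata : Set (Set (Gr ℂ 4)) :=
  {S | (∃ i, S = type1I Z i) ∨ ∃ i j, i ≠ j ∧ i ≠ j + 1 ∧ S = type1II Z i j}

/-- All strata of types (2,I), (2,II) and (2,III). -/
def surfaceStrata : Set (Set (Gr ℂ 4)) :=
  {S | (∃ i, S = type2I Z i) ∨ (∃ i, S = type2II Z i) ∨
    ∃ i j, j ≠ i - 1 ∧ j ≠ i ∧ j ≠ i + 1 ∧ S = type2III Z i j}

/-- All strata of type (3,I). -/
def threefoldStrata : Set (Set (Gr ℂ 4)) := {S | ∃ i, S = type3I Z i}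

/-- The vertices of the closed face in `T`. -/
def verticesOf (T : Set (Gr ℂ 4)) : Set (Set (Gr ℂ 4)) :=
  {S | S ∈ vertexStrata Z ∧ closedFace Z S ⊆ closedFace Z T}

/-- The edges of the closed face in `T`. -/
def edgesOf (T : Set (Gr ℂ 4)) : Set (Set (Gr ℂ 4)) :=
  {S | S ∈ lineStrata Z ∧ closedFace Z S ⊆ closedFace Z T}

/-- The two-dimensional faces of the closed face in `T`. -/
def polygonsOf (T : Set (Gr ℂ 4)) : Set (Set (Gr ℂ 4)) :=
  {S | S ∈ surfaceStrata Z ∧ closedFace Z S ⊆ closedFace Z T}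

/-- `v 0, v 1, …, v (m - 1)` are the distinct vertices of the polygon in `T`, in cyclic order: the
edges of `T` join cyclically consecutive vertices, and any two consecutive ones are joined. -/
def HasCyclicVertices (T : Set (Gr ℂ 4)) {m : ℕ} (v : Fin m → Set (Gr ℂ 4)) : Prop :=
  Function.Injective v ∧ verticesOf Z T = Set.range v ∧
    (∀ k, ∃ E ∈ edgesOf Z T, verticesOf Z E = {v k, v (finRotate m k)}) ∧
    ∀ E ∈ edgesOf Z T, ∃ k, verticesOf Z E = {v k, v (finRotate m k)}

end Types

/-- The closed face in `S` is a `d`-dimensional polytope: there is a homeomorphism onto it from a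
full-dimensional convex polytope in `ℝ ^ d` under which the nonempty faces of that polytope (itself
included) correspond exactly to the closed boundary faces of the amplituhedron contained in the
closed face in `S`. -/
def IsPolytopeFace {n : ℕ} (Z : Matrix (Fin n) (Fin 4) ℝ) (d : ℕ) (S : Set (Gr ℂ 4)) : Prop :=
  ∃ V : Finset (EuclideanSpace ℝ (Fin d)),
    (interior (convexHull ℝ (V : Set (EuclideanSpace ℝ (Fin d))))).Nonempty ∧
    ∃ h : convexHull ℝ (V : Set (EuclideanSpace ℝ (Fin d))) ≃ₜ closedFace Z S,
      ∀ G : Set (Gr ℝ 4),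
        (∃ Q : Set (EuclideanSpace ℝ (Fin d)), Q.Nonempty ∧
            IsExposed ℝ (convexHull ℝ (V : Set (EuclideanSpace ℝ (Fin d)))) Q ∧
            G = {W | ∃ x, x.1 ∈ Q ∧ (h x : Gr ℝ 4) = W}) ↔
          ∃ S', IsBoundaryStratum Z S' ∧ G = closedFace Z S' ∧ G ⊆ closedFace Z S

/-- The points of `T` in the affine chart `ℓ = 1` of Plücker space: the Plücker vectors of elements
of `T`, scaled so that `ℓ` takes the value one. -/
def chartPoints (ℓ : (Fin 4 → Fin 4 → ℝ) →ₗ[ℝ] ℝ) (T : Set (Gr ℝ 4)) :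
    Set (Fin 4 → Fin 4 → ℝ) :=
  {q | ℓ q = 1 ∧ ∃ M : Frame ℝ 4, rowSpan M ∈ T ∧ q = plucker M}

/-- The closed face in `T` is convex in projective space: it lies in an affine chart of Plücker
space, where it is the convex hull of its vertices, which are in convex position. -/
def IsConvexFace {n : ℕ} [NeZero n] (Z : Matrix (Fin n) (Fin 4) ℝ) (T : Set (Gr ℂ 4)) : Prop :=
  ∃ ℓ : (Fin 4 → Fin 4 → ℝ) →ₗ[ℝ] ℝ,
    (∀ W ∈ closedFace Z T, (chartPoints ℓ {W}).Nonempty) ∧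
    chartPoints ℓ (closedFace Z T) =
      convexHull ℝ (chartPoints ℓ (⋃ S ∈ verticesOf Z T, closedFace Z S)) ∧
    (chartPoints ℓ (closedFace Z T)).extremePoints ℝ =
      chartPoints ℓ (⋃ S ∈ verticesOf Z T, closedFace Z S)

/-- `S` is the section of `T` by a hyperplane of Plücker space that does not contain `T`. -/
def IsHyperplaneSection (T S : Set (Gr ℂ 4)) : Prop :=
  ∃ ℓ : (Fin 4 → Fin 4 → ℂ) →ₗ[ℂ] ℂ,
    ¬ T ⊆ {W | ∀ M : Frame ℂ 4, rowSpan M = W → ℓ (plucker M) = 0} ∧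
    S = T ∩ {W | ∀ M : Frame ℂ 4, rowSpan M = W → ℓ (plucker M) = 0}

/-- The determinant of four vectors in four-space, expanded along pairs of rows. -/
def br {R : Type*} [CommRing R] (u v c d : Fin 4 → R) : R :=
  (u 0 * v 1 - u 1 * v 0) * (c 2 * d 3 - c 3 * d 2)
  - (u 0 * v 2 - u 2 * v 0) * (c 1 * d 3 - c 3 * d 1)
  + (u 0 * v 3 - u 3 * v 0) * (c 1 * d 2 - c 2 * d 1)
  + (u 1 * v 2 - u 2 * v 1) * (c 0 * d 3 - c 3 * d 0)
  - (u 1 * v 3 - u 3 * v 1) * (c 0 * d 2 - c 2 * d 0)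
  + (u 2 * v 3 - u 3 * v 2) * (c 0 * d 1 - c 1 * d 0)

section Bracket
variable {R : Type*} [CommRing R] (a b c d x y : Fin 4 → R) (s t : R)

theorem br_eq_det : br a b c d = (Matrix.of ![a, b, c, d]).det := by
  simp [br, Matrix.det_succ_row_zero, Fin.sum_univ_succ, Fin.succAbove]
  ring

theorem br_swap₁₂ : br b a c d = -br a b c d := by simp only [br]; ring
theorem br_swap₂₃ : br a c b d = -br a b c d := by simp only [br]; ring
theorem br_swap₃₄ : br a b d c = -br a b c d := by simp only [br]; ring
theorem br_swap_pairs : br c d a b = br a b c d := by simp only [br]; ring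

@[simp] theorem br_self₁₂ : br a a c d = 0 := by simp only [br]; ring
@[simp] theorem br_self₁₃ : br a b a d = 0 := by simp only [br]; ring
@[simp] theorem br_self₁₄ : br a b c a = 0 := by simp only [br]; ring
@[simp] theorem br_self₂₃ : br a b b d = 0 := by simp only [br]; ring
@[simp] theorem br_self₂₄ : br a b c b = 0 := by simp only [br]; ring
@[simp] theorem br_self₃₄ : br a b c c = 0 := by simp only [br]; ring

theorem br_add₁ : br (x + y) b c d = br x b c d + br y b c d := by
  simp only [br, Pi.add_apply]; ring
theorem br_add₂ : br a (x + y) c d = br a x c d + br a y c d := by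
  simp only [br, Pi.add_apply]; ring
theorem br_add₃ : br a b (x + y) d = br a b x d + br a b y d := by
  simp only [br, Pi.add_apply]; ring
theorem br_add₄ : br a b c (x + y) = br a b c x + br a b c y := by
  simp only [br, Pi.add_apply]; ring
theorem br_smul₁ : br (s • x) b c d = s * br x b c d := by
  simp only [br, Pi.smul_apply, smul_eq_mul]; ring
theorem br_smul₂ : br a (s • x) c d = s * br a x c d := by
  simp only [br, Pi.smul_apply, smul_eq_mul]; ring
theorem br_smul₃ : br a b (s • x) d = s * br a b x d := by
  simp only [br, Pi.smul_apply, smul_eq_mul]; ring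
theorem br_smul₄ : br a b c (s • x) = s * br a b c x := by
  simp only [br, Pi.smul_apply, smul_eq_mul]; ring
@[simp] theorem br_zero₁ : br 0 b c d = 0 := by simp [br]
@[simp] theorem br_zero₂ : br a 0 c d = 0 := by simp [br]

theorem br_sum₁ {ι : Type*} (s : Finset ι) (f : ι → Fin 4 → R) :
    br (∑ i ∈ s, f i) b c d = ∑ i ∈ s, br (f i) b c d := by
  classical
  induction s using Finset.induction_on with
  | empty => simp
  | insert i s hi ih => rw [Finset.sum_insert hi, Finset.sum_insert hi, br_add₁, ih]

theorem br_sum₂ {ι : Type*} (s : Finset ι) (f : ι → Fin 4 → R) :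
    br a (∑ i ∈ s, f i) c d = ∑ i ∈ s, br a (f i) c d := by
  classical
  induction s using Finset.induction_on with
  | empty => simp
  | insert i s hi ih => rw [Finset.sum_insert hi, Finset.sum_insert hi, br_add₂, ih]

/-- Cramer's rule for five vectors in four-space. -/
theorem br_cramer : br a b c d • x =
    br x b c d • a + br a x c d • b + br a b x d • c + br a b c x • d := by
  ext i
  fin_cases i <;> simp [br] <;> ring

theorem br_lin_comb (s' t' : R) : br (s • x + t • y) (s' • x + t' • y) c d =
    (s * t' - t * s') * br x y c d := by
  simp only [br, Pi.add_apply, Pi.smul_apply, smul_eq_mul]; ring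

end Bracket

section LinAlg
variable {𝕜 : Type*} [Field 𝕜]

theorem linearIndependent_iff_br {a b c d : Fin 4 → 𝕜} :
    LinearIndependent 𝕜 ![a, b, c, d] ↔ br a b c d ≠ 0 := by
  rw [br_eq_det, ← isUnit_iff_ne_zero, ← Matrix.isUnit_iff_isUnit_det,
    ← Matrix.linearIndependent_rows_iff_isUnit]
  rfl

theorem range_vec_pair {α : Type*} (u v : α) : Set.range ![u, v] = {u, v} := by
  ext x; simp [eq_comm]; tauto

theorem range_vec_triple {α : Type*} (a b c : α) : Set.range ![a, b, c] = {a, b, c} := by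
  ext x; simp [eq_comm]; tauto

theorem exists_pair (W : Gr 𝕜 4) : ∃ u v : Fin 4 → 𝕜, LinearIndependent 𝕜 ![u, v] ∧
    W.toSubmodule = Submodule.span 𝕜 {u, v} := by
  have b := finBasisOfFinrankEq 𝕜 W.toSubmodule W.finrank_eq
  have hb : LinearIndependent 𝕜 (fun a => (b a : Fin 4 → 𝕜)) :=
    b.linearIndependent.map' W.toSubmodule.subtype (by simp)
  have hs : Submodule.span 𝕜 (Set.range (fun a => (b a : Fin 4 → 𝕜))) = W.toSubmodule := by
    have := congrArg (Submodule.map W.toSubmodule.subtype) b.span_eq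
    rw [Submodule.map_span, ← Set.range_comp] at this
    simpa [Function.comp_def] using this
  refine ⟨b 0, b 1, ?_, ?_⟩
  · convert hb using 1
    ext i; fin_cases i <;> rfl
  · refine hs.symm.trans (congrArg _ ?_)
    ext x; simp [Fin.exists_fin_two, eq_comm]

/-- The line spanned by two independent vectors. -/
def lineOf (u v : Fin 4 → 𝕜) (h : LinearIndependent 𝕜 ![u, v]) : Gr 𝕜 4 where
  toSubmodule := Submodule.span 𝕜 {u, v}
  finrank_eq := by
    have := finrank_span_eq_card h
    rw [← range_vec_pair]
    simpa using this

theorem exists_lineOf (W : Gr 𝕜 4) : ∃ u v, ∃ h : LinearIndependent 𝕜 ![u, v],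
    W = lineOf u v h := by
  obtain ⟨u, v, h, hW⟩ := exists_pair W
  exact ⟨u, v, h, Gr.ext hW⟩

@[simp] theorem lineOf_toSubmodule (u v : Fin 4 → 𝕜) (h) :
    (lineOf u v h).toSubmodule = Submodule.span 𝕜 {u, v} := rfl

theorem exists_br_ne_zero {u v : Fin 4 → 𝕜} (h : LinearIndependent 𝕜 ![u, v]) {a : Fin 4 → 𝕜}
    (ha : a ∉ Submodule.span 𝕜 {u, v}) : ∃ d, br u v a d ≠ 0 := by
  have h3 : LinearIndependent 𝕜 ![u, v, a] := by
    have := h.finSnoc (x := a) (by rwa [range_vec_pair])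
    have e : (Fin.snoc ![u, v] a : Fin 3 → Fin 4 → 𝕜) = ![u, v, a] := by
      ext i j; fin_cases i <;> rfl
    rwa [e] at this
  have hne : Submodule.span 𝕜 (Set.range ![u, v, a]) ≠ ⊤ := by
    intro htop
    have := finrank_span_eq_card h3
    rw [htop] at this
    simp at this
  obtain ⟨d, -, hd⟩ := SetLike.exists_of_lt (lt_top_iff_ne_top.2 hne)
  refine ⟨d, linearIndependent_iff_br.1 ?_⟩
  have := h3.finSnoc hd
  have e : (Fin.snoc ![u, v, a] d : Fin 4 → Fin 4 → 𝕜) = ![u, v, a, d] := by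
    ext i j; fin_cases i <;> rfl
  rwa [e] at this

theorem mem_span_pair_iff_br {u v : Fin 4 → 𝕜} (h : LinearIndependent 𝕜 ![u, v])
    {a : Fin 4 → 𝕜} : a ∈ Submodule.span 𝕜 {u, v} ↔ ∀ d, br u v a d = 0 := by
  constructor
  · intro ha d
    obtain ⟨s, t, rfl⟩ := Submodule.mem_span_pair.1 ha
    simp [br_add₃, br_smul₃]
  · intro H
    by_contra ha
    obtain ⟨d, hd⟩ := exists_br_ne_zero h ha
    exact hd (H d)

theorem mem_span_triple_iff_br {a b c : Fin 4 → 𝕜} (h : LinearIndependent 𝕜 ![a, b, c])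
    {u : Fin 4 → 𝕜} : u ∈ Submodule.span 𝕜 {a, b, c} ↔ br u a b c = 0 := by
  constructor
  · intro ha
    obtain ⟨r, s, t, rfl⟩ := Submodule.mem_span_triple.1 ha
    simp [br_add₁, br_smul₁]
  · intro H
    by_contra ha
    have hn := h.finCons (x := u) (by rwa [range_vec_triple])
    exact linearIndependent_iff_br.1 hn H

theorem mem_schubertV_lineOf {u v : Fin 4 → 𝕜} (h : LinearIndependent 𝕜 ![u, v])
    {a : Fin 4 → 𝕜} : lineOf u v h ∈ schubertV a ↔ ∀ d, br u v a d = 0 := mem_span_pair_iff_br h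

theorem mem_schubertP_lineOf {u v : Fin 4 → 𝕜} (h : LinearIndependent 𝕜 ![u, v])
    {a b c : Fin 4 → 𝕜} (h' : LinearIndependent 𝕜 ![a, b, c]) :
    lineOf u v h ∈ schubertP a b c ↔ br u a b c = 0 ∧ br v a b c = 0 := by
  rw [← mem_span_triple_iff_br h', ← mem_span_triple_iff_br h']
  simp [schubertP, Submodule.span_le, Set.insert_subset_iff]

theorem exists_comb_of_br_eq_zero {u v a b : Fin 4 → 𝕜} (h0 : br u v a b = 0) :
    ∃ s t p q : 𝕜, s • u + t • v = p • a + q • b ∧ (s ≠ 0 ∨ t ≠ 0 ∨ p ≠ 0 ∨ q ≠ 0) := by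
  have hn : ¬ LinearIndependent 𝕜 ![u, v, a, b] := fun h =>
    linearIndependent_iff_br.1 h h0
  rw [Fintype.not_linearIndependent_iff] at hn
  obtain ⟨g, hg, i, hi⟩ := hn
  simp only [Fin.sum_univ_four] at hg
  refine ⟨g 0, g 1, -g 2, -g 3, ?_, ?_⟩
  · have : g 0 • u + g 1 • v + g 2 • a + g 3 • b = 0 := hg
    linear_combination (norm := module) this
  · fin_cases i <;> simp_all

theorem pair_comb_eq_zero {u v : Fin 4 → 𝕜} (h : LinearIndependent 𝕜 ![u, v]) {s t : 𝕜}
    (h0 : s • u + t • v = 0) : s = 0 ∧ t = 0 := LinearIndependent.pair_iff.1 h s t h0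

theorem mem_schubertL_lineOf {u v : Fin 4 → 𝕜} (h : LinearIndependent 𝕜 ![u, v])
    {a b : Fin 4 → 𝕜} (h' : LinearIndependent 𝕜 ![a, b]) :
    lineOf u v h ∈ schubertL a b ↔ br u v a b = 0 := by
  constructor
  · intro hW
    obtain ⟨x, hx, hx0⟩ := Submodule.exists_mem_ne_zero_of_ne_bot hW
    obtain ⟨s, t, rfl⟩ := Submodule.mem_span_pair.1 hx.1
    obtain ⟨p, q, hpq⟩ := Submodule.mem_span_pair.1 hx.2
    by_contra hne
    have hl := linearIndependent_iff_br.2 hne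
    have := Fintype.linearIndependent_iff.1 hl ![s, t, -p, -q] (by
      simp only [Fin.sum_univ_four]
      change s • u + t • v + (-p) • a + (-q) • b = 0
      linear_combination (norm := module) -hpq)
    have h0 : s = 0 := this 0
    have h1 : t = 0 := this 1
    exact hx0 (by simp [h0, h1])
  · intro h0
    obtain ⟨s, t, p, q, he, hne⟩ := exists_comb_of_br_eq_zero h0
    refine Submodule.ne_bot_iff _ |>.2 ⟨s • u + t • v, ⟨?_, ?_⟩, ?_⟩
    · exact Submodule.mem_span_pair.2 ⟨s, t, rfl⟩
    · exact Submodule.mem_span_pair.2 ⟨p, q, he.symm⟩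
    · intro hz
      obtain ⟨hs, ht⟩ := pair_comb_eq_zero h hz
      rw [hz] at he
      obtain ⟨hp, hq⟩ := pair_comb_eq_zero h' he.symm
      simp_all

theorem lineOf_eq_of_mem {u v : Fin 4 → 𝕜} (h : LinearIndependent 𝕜 ![u, v]) {W : Gr 𝕜 4}
    (hu : u ∈ W.toSubmodule) (hv : v ∈ W.toSubmodule) : W = lineOf u v h := by
  have hle : (lineOf u v h).toSubmodule ≤ W.toSubmodule := by
    simp [Submodule.span_le, Set.insert_subset_iff, hu, hv]
  refine Gr.ext (Submodule.eq_of_le_of_finrank_eq hle ?_).symm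
  rw [(lineOf u v h).finrank_eq, W.finrank_eq]

theorem linearIndependent_pair_of_br {a b c d : Fin 4 → 𝕜} (h : br a b c d ≠ 0) :
    LinearIndependent 𝕜 ![a, b] := by
  rw [LinearIndependent.pair_iff]
  intro s t hst
  have h1 := congrArg (fun x => br x b c d) hst
  have h2 := congrArg (fun x => br a x c d) hst
  simp [br_add₁, br_smul₁, br_add₂, br_smul₂, h] at h1 h2
  exact ⟨h1, h2⟩

theorem linearIndependent_triple_of_br {a b c d : Fin 4 → 𝕜} (h : br a b c d ≠ 0) :
    LinearIndependent 𝕜 ![a, b, c] := by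
  have := (linearIndependent_iff_br.2 h).comp (Fin.castSucc : Fin 3 → Fin 4)
    (Fin.castSucc_injective 3)
  convert this using 1
  ext i j; fin_cases i <;> rfl

/-- A line through a point is spanned by the point and another vector. -/
theorem exists_lineOf_of_mem {W : Gr 𝕜 4} {p : Fin 4 → 𝕜} (hp : p ∈ W.toSubmodule)
    (hp0 : p ≠ 0) : ∃ q, ∃ h : LinearIndependent 𝕜 ![p, q], W = lineOf p q h := by
  have hlt : Submodule.span 𝕜 {p} < W.toSubmodule := by
    refine lt_of_le_of_ne (by simpa using hp) fun he => ?_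
    have h1 := finrank_span_singleton (K := 𝕜) hp0
    rw [he, W.finrank_eq] at h1
    omega
  obtain ⟨q, hq, hq'⟩ := SetLike.exists_of_lt hlt
  have h : LinearIndependent 𝕜 ![p, q] := by
    rw [LinearIndependent.pair_iff' hp0]
    rintro s rfl
    exact hq' (Submodule.mem_span_singleton.2 ⟨s, rfl⟩)
  exact ⟨q, h, lineOf_eq_of_mem h hp hq⟩

end LinAlg

/-- The Plücker vector of two vectors in four-space. -/
def pl {R : Type*} [CommRing R] (u v : Fin 4 → R) : Fin 4 → Fin 4 → R :=
  fun a b => u a * v b - u b * v a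

/-- Pairing of Plücker vectors with the line through `c` and `d`. -/
def brL {R : Type*} [CommRing R] (c d : Fin 4 → R) : (Fin 4 → Fin 4 → R) →ₗ[R] R where
  toFun q := q 0 1 * (c 2 * d 3 - c 3 * d 2) - q 0 2 * (c 1 * d 3 - c 3 * d 1)
    + q 0 3 * (c 1 * d 2 - c 2 * d 1) + q 1 2 * (c 0 * d 3 - c 3 * d 0)
    - q 1 3 * (c 0 * d 2 - c 2 * d 0) + q 2 3 * (c 0 * d 1 - c 1 * d 0)
  map_add' x y := by simp only [Pi.add_apply]; ring
  map_smul' x y := by simp only [Pi.smul_apply, smul_eq_mul, RingHom.id_apply]; ring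

theorem brL_pl {R : Type*} [CommRing R] (u v c d : Fin 4 → R) : brL c d (pl u v) = br u v c d := by
  simp only [brL, pl, br, LinearMap.coe_mk, AddHom.coe_mk]

section Frames
variable {𝕜 : Type*} [Field 𝕜]

theorem plucker_eq_pl (M : Frame 𝕜 4) : plucker M = pl (M.1 0) (M.1 1) := rfl

theorem Frame.linearIndependent {m : ℕ} (M : Frame 𝕜 m) : LinearIndependent 𝕜 ![M.1 0, M.1 1] := by
  have := M.2
  convert this using 1
  ext i j; fin_cases i <;> rfl

theorem rowSpan_eq_lineOf (M : Frame 𝕜 4) :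
    rowSpan M = lineOf (M.1 0) (M.1 1) M.linearIndependent :=
  lineOf_eq_of_mem _ (Submodule.subset_span ⟨0, rfl⟩) (Submodule.subset_span ⟨1, rfl⟩)

/-- The frame with given rows. -/
def frameOf (u v : Fin 4 → 𝕜) (h : LinearIndependent 𝕜 ![u, v]) : Frame 𝕜 4 := ⟨![u, v], h⟩

theorem rowSpan_frameOf (u v : Fin 4 → 𝕜) (h) : rowSpan (frameOf u v h) = lineOf u v h :=
  rowSpan_eq_lineOf _

theorem pl_lin_comb (u v : Fin 4 → 𝕜) (s t s' t' : 𝕜) :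
    pl (s • u + t • v) (s' • u + t' • v) = (s * t' - t * s') • pl u v := by
  ext a b; simp [pl]; ring

theorem pl_ne_zero {u v : Fin 4 → 𝕜} (h : LinearIndependent 𝕜 ![u, v]) : pl u v ≠ 0 := by
  intro h0
  have h' : ∀ a b, u a * v b = u b * v a := fun a b => by
    have := congrFun (congrFun h0 a) b
    simp only [pl, Pi.zero_apply] at this
    linear_combination this
  obtain ⟨a, ha⟩ : ∃ a, u a ≠ 0 := by
    by_contra! hu
    exact h.ne_zero 0 (funext hu)
  have := pair_comb_eq_zero h (s := v a) (t := -u a) (by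
    ext b; simp only [Pi.add_apply, Pi.smul_apply, smul_eq_mul, Pi.zero_apply]
    linear_combination -h' a b)
  exact ha (neg_eq_zero.1 this.2)

theorem linearIndependent_of_pl_ne_zero {u v : Fin 4 → 𝕜} (h : pl u v ≠ 0) :
    LinearIndependent 𝕜 ![u, v] := by
  rw [LinearIndependent.pair_iff]
  intro s t hst
  have h1 : ∀ a, s * u a + t * v a = 0 := fun a => congrFun hst a
  obtain ⟨a, ha⟩ := Function.ne_iff.1 h
  obtain ⟨b, hab⟩ := Function.ne_iff.1 ha
  constructor
  · have : s * (u a * v b - u b * v a) = 0 := by linear_combination v b * h1 a - v a * h1 b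
    exact (mul_eq_zero.1 this).resolve_right hab
  · have : t * (u a * v b - u b * v a) = 0 := by linear_combination u a * h1 b - u b * h1 a
    exact (mul_eq_zero.1 this).resolve_right hab

theorem lineOf_eq_iff {u v u' v' : Fin 4 → 𝕜} {h : LinearIndependent 𝕜 ![u, v]}
    {h' : LinearIndependent 𝕜 ![u', v']} :
    lineOf u v h = lineOf u' v' h' ↔ ∃ k : 𝕜, k ≠ 0 ∧ pl u' v' = k • pl u v := by
  constructor
  · intro he
    have hu : u' ∈ Submodule.span 𝕜 {u, v} := by
      change u' ∈ (lineOf u v h).toSubmodule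
      rw [he]; exact Submodule.subset_span (by simp)
    have hv : v' ∈ Submodule.span 𝕜 {u, v} := by
      change v' ∈ (lineOf u v h).toSubmodule
      rw [he]; exact Submodule.subset_span (by simp)
    obtain ⟨s, t, rfl⟩ := Submodule.mem_span_pair.1 hu
    obtain ⟨s', t', rfl⟩ := Submodule.mem_span_pair.1 hv
    refine ⟨s * t' - t * s', fun h0 => pl_ne_zero h' ?_, pl_lin_comb _ _ _ _ _ _⟩
    rw [pl_lin_comb, h0, zero_smul]
  · rintro ⟨k, hk, he⟩
    refine (lineOf_eq_of_mem h' ?_ ?_)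
    · refine (mem_span_pair_iff_br h).2 fun d => ?_
      have : br u' v' u' d = k * br u v u' d := by
        rw [← brL_pl, he, map_smul, brL_pl, smul_eq_mul]
      simpa [hk] using this.symm
    · refine (mem_span_pair_iff_br h).2 fun d => ?_
      have : br u' v' v' d = k * br u v v' d := by
        rw [← brL_pl, he, map_smul, brL_pl, smul_eq_mul]
      simpa [hk] using this.symm

end Frames

section Topology

instance frameTopology (m : ℕ) : TopologicalSpace (Frame ℝ m) := inferInstanceAs (TopologicalSpace
      {M : Matrix (Fin 2) (Fin m) ℝ // LinearIndependent ℝ M.row})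

theorem continuous_rowSpan {m : ℕ} : Continuous (rowSpan : Frame ℝ m → Gr ℝ m) :=
  continuous_coinduced_rng

theorem continuous_plucker {m : ℕ} : Continuous (plucker : Frame ℝ m → Fin m → Fin m → ℝ) := by
  have h : ∀ i j, Continuous fun M : Frame ℝ m => M.1 i j := fun i j =>
    (continuous_apply_apply (ρ := fun _ _ => ℝ) i j).comp continuous_subtype_val
  exact continuous_pi fun a => continuous_pi fun b =>
    ((h 0 a).mul (h 1 b)).sub ((h 0 b).mul (h 1 a))

theorem isOpen_setOf_pl {φ : (Fin 4 → Fin 4 → ℝ) → Prop} (hφ : IsOpen {q | φ q})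
    (hinv : ∀ k : ℝ, k ≠ 0 → ∀ q, φ q → φ (k • q)) :
    IsOpen {U : Gr ℝ 4 | ∀ u v h, U = lineOf u v h → φ (pl u v)} := by
  refine isOpen_coinduced.2 ?_
  have : rowSpan ⁻¹' {U : Gr ℝ 4 | ∀ u v h, U = lineOf u v h → φ (pl u v)} =
      plucker ⁻¹' {q | φ q} := by
    ext M
    constructor
    · intro h
      exact h _ _ M.linearIndependent (rowSpan_eq_lineOf M)
    · intro h u v huv he
      rw [rowSpan_eq_lineOf] at he
      obtain ⟨k, hk, e⟩ := lineOf_eq_iff.1 he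
      rw [e]; exact hinv k hk _ h
  rw [this]
  exact hφ.preimage continuous_plucker

/-- The lines on which finitely many linear forms in the Plücker coordinates are nonzero and have
the same sign. -/
def sameSign {K : Type*} (f : K → (Fin 4 → Fin 4 → ℝ) →ₗ[ℝ] ℝ) : Set (Gr ℝ 4) :=
  {U | ∀ u v h, U = lineOf u v h → ∀ i j, 0 < f i (pl u v) * f j (pl u v)}

theorem isOpen_sameSign {K : Type*} [Finite K] (f : K → (Fin 4 → Fin 4 → ℝ) →ₗ[ℝ] ℝ) :
    IsOpen (sameSign f) := by
  refine isOpen_setOf_pl (φ := fun q => ∀ i j, 0 < f i q * f j q) ?_ ?_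
  · simp only [Set.ofPred_forall]
    refine isOpen_iInter_of_finite fun i => isOpen_iInter_of_finite fun j => ?_
    exact isOpen_lt continuous_const
      ((f i).continuous_of_finiteDimensional.mul (f j).continuous_of_finiteDimensional)
  · intro k hk q h i j
    have := mul_pos (mul_self_pos.2 hk) (h i j)
    simp only [map_smul, smul_eq_mul]
    linarith

theorem lineOf_mem_sameSign {K : Type*} {f : K → (Fin 4 → Fin 4 → ℝ) →ₗ[ℝ] ℝ}
    {u v : Fin 4 → ℝ} {h : LinearIndependent ℝ ![u, v]} :
    lineOf u v h ∈ sameSign f ↔ ∀ i j, 0 < f i (pl u v) * f j (pl u v) := by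
  constructor
  · intro H; exact H u v h rfl
  · intro H u' v' h' he i j
    obtain ⟨k, hk, e⟩ := lineOf_eq_iff.1 he
    have := mul_pos (mul_self_pos.2 hk) (H i j)
    rw [e]
    simp only [map_smul, smul_eq_mul]
    linarith

/-- A line on which the forms have the same sign has a frame on which they are positive. -/
theorem exists_pos_of_mem_sameSign {K : Type*} {f : K → (Fin 4 → Fin 4 → ℝ) →ₗ[ℝ] ℝ}
    {U : Gr ℝ 4} (hU : U ∈ sameSign f) {p : Fin 4 → ℝ} (hp : p ∈ U.toSubmodule) (hp0 : p ≠ 0) :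
    ∃ q h, U = lineOf p q h ∧ ∀ i, 0 < f i (pl p q) := by
  obtain ⟨q, h, rfl⟩ := exists_lineOf_of_mem hp hp0
  have H := lineOf_mem_sameSign.1 hU
  by_cases hpos : ∀ i, 0 < f i (pl p q)
  · exact ⟨q, h, rfl, hpos⟩
  · push Not at hpos
    obtain ⟨i, hi⟩ := hpos
    have e : pl p (-q) = (-1 : ℝ) • pl p q := by ext a b; simp [pl]; ring
    have h' : LinearIndependent ℝ ![p, -q] := by
      refine linearIndependent_of_pl_ne_zero ?_
      rw [e]; simpa using pl_ne_zero h
    refine ⟨-q, h', lineOf_eq_iff.2 ⟨-1, by norm_num, e⟩, fun j => ?_⟩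
    rw [e]
    simp only [map_smul, smul_eq_mul]
    have h1 := H i i
    have h2 := H i j
    nlinarith

theorem exists_pos_of_mem_sameSign' {K : Type*} {f : K → (Fin 4 → Fin 4 → ℝ) →ₗ[ℝ] ℝ}
    {U : Gr ℝ 4} (hU : U ∈ sameSign f) : ∃ p q h, U = lineOf p q h ∧ ∀ i, 0 < f i (pl p q) := by
  obtain ⟨p, q, h, rfl⟩ := exists_lineOf U
  exact ⟨p, exists_pos_of_mem_sameSign hU (Submodule.subset_span (by simp)) (h.ne_zero 0)⟩

/-- Entries of the normalized square of a Plücker vector. -/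
noncomputable def normSq (q : Fin 4 → Fin 4 → ℝ) : ℝ := ∑ a, ∑ b, q a b ^ 2

theorem normSq_pos {q : Fin 4 → Fin 4 → ℝ} (h : q ≠ 0) : 0 < normSq q := by
  obtain ⟨a, ha⟩ := Function.ne_iff.1 h
  obtain ⟨b, hab⟩ := Function.ne_iff.1 ha
  have hab' : 0 < q a b ^ 2 := by have : q a b ≠ 0 := hab; positivity
  refine Finset.sum_pos' (fun a _ => Finset.sum_nonneg fun b _ => sq_nonneg _)
    ⟨a, Finset.mem_univ _, Finset.sum_pos' (fun b _ => sq_nonneg _) ⟨b, Finset.mem_univ _, hab'⟩⟩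

/-- The normalized square of the Plücker vector of a line. -/
noncomputable def plSq (U : Gr ℝ 4) : Fin 4 → Fin 4 → Fin 4 → Fin 4 → ℝ := fun a b c d =>
    pl (exists_lineOf U).choose (exists_lineOf U).choose_spec.choose a b *
      pl (exists_lineOf U).choose (exists_lineOf U).choose_spec.choose c d /
      normSq (pl (exists_lineOf U).choose (exists_lineOf U).choose_spec.choose)

theorem plSq_lineOf {u v : Fin 4 → ℝ} (h : LinearIndependent ℝ ![u, v]) (a b c d : Fin 4) :
    plSq (lineOf u v h) a b c d = pl u v a b * pl u v c d / normSq (pl u v) := by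
  have hs := (exists_lineOf (lineOf u v h)).choose_spec.choose_spec.choose_spec
  obtain ⟨k, hk, e⟩ := lineOf_eq_iff.1 hs
  rw [plSq, e]
  have e2 : normSq (k • pl u v) = k ^ 2 * normSq (pl u v) := by
    simp only [normSq, Finset.mul_sum, Pi.smul_apply, smul_eq_mul, mul_pow]
  rw [e2]
  simp only [Pi.smul_apply, smul_eq_mul]
  field_simp

theorem plSq_injective : Function.Injective plSq := by
  intro U U' he
  obtain ⟨u, v, h, rfl⟩ := exists_lineOf U
  obtain ⟨u', v', h', rfl⟩ := exists_lineOf U'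
  have hn := (normSq_pos (pl_ne_zero h)).ne'
  have hn' := (normSq_pos (pl_ne_zero h')).ne'
  have H : ∀ a b c d, pl u v a b * pl u v c d / normSq (pl u v) =
      pl u' v' a b * pl u' v' c d / normSq (pl u' v') := fun a b c d => by
    rw [← plSq_lineOf h, he, plSq_lineOf]
  obtain ⟨a, ha⟩ := Function.ne_iff.1 (pl_ne_zero h')
  obtain ⟨b, hab⟩ := Function.ne_iff.1 ha
  simp only [Pi.zero_apply] at hab
  have hab' : pl u v a b ≠ 0 := by
    intro h0
    have := H a b a b
    rw [h0, zero_mul, zero_div, eq_comm, div_eq_zero_iff] at this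
    simp [hab, hn'] at this
  refine lineOf_eq_iff.2 ⟨normSq (pl u' v') * pl u v a b / (normSq (pl u v) * pl u' v' a b),
    by positivity, ?_⟩
  ext c d
  have := H a b c d
  simp only [Pi.smul_apply, smul_eq_mul]
  field_simp at this ⊢
  linear_combination -this

theorem continuous_plSq : Continuous plSq := by
  refine continuous_coinduced_dom.2 ?_
  have : plSq ∘ rowSpan = fun M : Frame ℝ 4 => fun a b c d =>
      plucker M a b * plucker M c d / normSq (plucker M) := by
    ext M a b c d
    rw [Function.comp_apply, rowSpan_eq_lineOf, plSq_lineOf, plucker_eq_pl]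
  rw [this]
  have h : ∀ a b, Continuous fun M : Frame ℝ 4 => plucker M a b := fun a b =>
    (continuous_apply_apply (ρ := fun _ _ => ℝ) a b).comp continuous_plucker
  refine continuous_pi fun a => continuous_pi fun b => continuous_pi fun c => continuous_pi fun d =>
    ((h a b).mul (h c d)).div ?_ fun M => (normSq_pos (by
      rw [plucker_eq_pl]; exact pl_ne_zero M.linearIndependent)).ne'
  exact continuous_finsetSum _ fun a _ => continuous_finsetSum _ fun b _ => (h a b).pow 2

instance : T2Space (Gr ℝ 4) := T2Space.of_injective_continuous plSq_injective continuous_plSq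

/-- A family of lines whose Plücker vectors vary continuously is continuous. -/
theorem continuous_of_pl {X : Type*} [TopologicalSpace X] {W : X → Gr ℝ 4}
    {p : X → Fin 4 → Fin 4 → ℝ} (hp : Continuous p)
    (hW : ∀ x, ∃ u v h, W x = lineOf u v h ∧ pl u v = p x) : Continuous W := by
  rw [continuous_iff_continuousAt]
  intro x₀
  have hc : ∀ a b, Continuous fun x => p x a b := fun a b =>
    (continuous_apply_apply (ρ := fun _ _ => ℝ) a b).comp hp
  obtain ⟨a, b, hab⟩ : ∃ a b, p x₀ a b ≠ 0 := by
    obtain ⟨u, v, h, -, e⟩ := hW x₀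
    obtain ⟨a, ha⟩ := Function.ne_iff.1 (pl_ne_zero h)
    obtain ⟨b, hab⟩ := Function.ne_iff.1 ha
    exact ⟨a, b, by rw [← e]; exact hab⟩
  have hV : IsOpen {x | p x a b ≠ 0} := isOpen_ne_fun (hc a b) continuous_const
  have key : ∀ x : {x | p x a b ≠ 0}, ∃ h : LinearIndependent ℝ ![p x a, p x b],
      W x = lineOf (p x a) (p x b) h := by
    rintro ⟨x, hx⟩
    obtain ⟨u, v, h, hWx, e⟩ := hW x
    have e2 : pl (p x a) (p x b) = p x a b • pl u v := by
      rw [← e]; ext c d; simp [pl]; ring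
    have h2 : LinearIndependent ℝ ![p x a, p x b] := linearIndependent_of_pl_ne_zero (by
      rw [e2]; exact smul_ne_zero hx (pl_ne_zero h))
    exact ⟨h2, by rw [hWx]; exact lineOf_eq_iff.2 ⟨_, hx, e2⟩⟩
  choose hl hWl using key
  refine ContinuousOn.continuousAt (s := {x | p x a b ≠ 0}) ?_ (hV.mem_nhds hab)
  rw [continuousOn_iff_continuous_domRestrict]
  have : Set.domRestrict {x | p x a b ≠ 0} W =
      rowSpan ∘ fun x : {x | p x a b ≠ 0} => frameOf (p x a) (p x b) (hl x) := by
    ext1 x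
    rw [Set.domRestrict_apply, hWl x, Function.comp_apply, rowSpan_frameOf]
  rw [this]
  refine continuous_rowSpan.comp (Continuous.subtype_mk ?_ _)
  refine continuous_pi fun i => ?_
  fin_cases i
  · exact continuous_pi fun c => (hc a c).comp continuous_subtype_val
  · exact continuous_pi fun c => (hc b c).comp continuous_subtype_val

end Topology

section Complexify

theorem br_toComplex (a b c d : Fin 4 → ℝ) :
    br (toComplex a) (toComplex b) (toComplex c) (toComplex d) = ((br a b c d : ℝ) : ℂ) := by
  simp [br, toComplex]

theorem toComplex_independent {u v : Fin 4 → ℝ} (h : LinearIndependent ℝ ![u, v]) :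
    LinearIndependent ℂ ![toComplex u, toComplex v] := by
  have := linearIndependent_toComplex h
  convert this using 1
  ext i j; fin_cases i <;> rfl

theorem complexify_lineOf {u v : Fin 4 → ℝ} (h : LinearIndependent ℝ ![u, v]) :
    complexify (lineOf u v h) = lineOf (toComplex u) (toComplex v) (toComplex_independent h) :=
  lineOf_eq_of_mem _ (Submodule.subset_span ⟨u, Submodule.subset_span (by simp), rfl⟩)
    (Submodule.subset_span ⟨v, Submodule.subset_span (by simp), rfl⟩)

theorem complexify_mem_schubertL {W : Gr ℝ 4} {a b : Fin 4 → ℝ}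
    (h : LinearIndependent ℝ ![a, b]) :
    complexify W ∈ schubertL (toComplex a) (toComplex b) ↔ W ∈ schubertL a b := by
  obtain ⟨u, v, hl, rfl⟩ := exists_lineOf W
  rw [complexify_lineOf, mem_schubertL_lineOf _ (toComplex_independent h),
    mem_schubertL_lineOf _ h, br_toComplex, Complex.ofReal_eq_zero]

theorem complexify_mem_schubertV {W : Gr ℝ 4} {a : Fin 4 → ℝ} :
    complexify W ∈ schubertV (toComplex a) ↔ W ∈ schubertV a := by
  obtain ⟨u, v, hl, rfl⟩ := exists_lineOf W
  constructor
  · rw [complexify_lineOf, mem_schubertV_lineOf, mem_schubertV_lineOf]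
    intro H d
    have := H (toComplex d)
    rwa [br_toComplex, Complex.ofReal_eq_zero] at this
  · intro H
    exact Submodule.subset_span ⟨a, H, rfl⟩

theorem complexify_mem_schubertP {W : Gr ℝ 4} {a b c d : Fin 4 → ℝ} (h : br a b c d ≠ 0) :
    complexify W ∈ schubertP (toComplex a) (toComplex b) (toComplex c) ↔ W ∈ schubertP a b c := by
  obtain ⟨u, v, hl, rfl⟩ := exists_lineOf W
  have h1 := linearIndependent_triple_of_br h
  have h2 : LinearIndependent ℂ ![toComplex a, toComplex b, toComplex c] :=
    linearIndependent_triple_of_br (d := toComplex d) (by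
      rw [br_toComplex]; exact_mod_cast h)
  rw [complexify_lineOf, mem_schubertP_lineOf _ h2, mem_schubertP_lineOf _ h1, br_toComplex,
    br_toComplex, Complex.ofReal_eq_zero, Complex.ofReal_eq_zero]

theorem complexify_injective : Function.Injective (complexify : Gr ℝ 4 → Gr ℂ 4) := by
  intro W W' he
  obtain ⟨u, v, h, rfl⟩ := exists_lineOf W'
  have hu : W ∈ schubertV u := complexify_mem_schubertV.1 (by
    rw [he]; exact Submodule.subset_span ⟨u, Submodule.subset_span (by simp), rfl⟩)
  have hv : W ∈ schubertV v := complexify_mem_schubertV.1 (by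
    rw [he]; exact Submodule.subset_span ⟨v, Submodule.subset_span (by simp), rfl⟩)
  exact lineOf_eq_of_mem h hu hv

end Complexify

section Homogeneous

theorem eval_smul_of_isHomogeneous {σ R : Type*} [CommRing R] {f : MvPolynomial σ R} {d : ℕ}
    (hf : f.IsHomogeneous d) (k : R) (x : σ → R) :
    MvPolynomial.eval (fun i => k * x i) f = k ^ d * MvPolynomial.eval x f := by
  rw [MvPolynomial.eval_eq, MvPolynomial.eval_eq, Finset.mul_sum]
  refine Finset.sum_congr rfl fun e he => ?_
  have h1 := hf (MvPolynomial.mem_support_iff.1 he)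
  simp only [mul_pow, Finset.prod_mul_distrib]
  rw [Finset.prod_pow_eq_pow_sum]
  have : ∑ i ∈ e.support, e i = d := by
    rw [← h1, show Finsupp.weight (1 : σ → ℕ) e = e.degree from
      (DFunLike.congr_fun Finsupp.degree_eq_weight_one e).symm, Finsupp.degree_apply]
  rw [this]; ring

theorem vanishesAt_lineOf {f : MvPolynomial (Fin 4 × Fin 4) ℂ} {d : ℕ} (hf : f.IsHomogeneous d)
    {u v : Fin 4 → ℂ} (h : LinearIndependent ℂ ![u, v]) :
    VanishesAt f (lineOf u v h) ↔ MvPolynomial.eval (fun ab => pl u v ab.1 ab.2) f = 0 := by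
  constructor
  · intro H
    exact H (frameOf u v h) (rowSpan_frameOf u v h)
  · intro H M hM
    rw [rowSpan_eq_lineOf] at hM
    obtain ⟨k, -, e⟩ := lineOf_eq_iff.1 hM.symm
    rw [plucker_eq_pl, e]
    have := eval_smul_of_isHomogeneous hf k (fun ab : Fin 4 × Fin 4 => pl u v ab.1 ab.2)
    rw [H, mul_zero] at this
    exact this

theorem isClosed_vanishesAt {f : MvPolynomial (Fin 4 × Fin 4) ℂ} {d : ℕ}
    (hf : f.IsHomogeneous d) : IsClosed {W : Gr ℂ 4 | VanishesAt f W} :=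
  ⟨TopologicalSpace.isOpen_generateFrom_of_mem ⟨f, d, hf, rfl⟩⟩

/-- Every Zariski neighborhood contains a basic one. -/
theorem exists_basic_subset {o : Set (Gr ℂ 4)} (ho : IsOpen o) {W : Gr ℂ 4} (hW : W ∈ o) :
    ∃ (f : MvPolynomial (Fin 4 × Fin 4) ℂ) (d : ℕ), f.IsHomogeneous d ∧ ¬ VanishesAt f W ∧
      ∀ W', ¬ VanishesAt f W' → W' ∈ o := by
  induction ho with
  | basic s hs =>
    obtain ⟨f, d, hf, rfl⟩ := hs
    exact ⟨f, d, hf, hW, fun _ h => h⟩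
  | univ =>
    refine ⟨1, 0, MvPolynomial.isHomogeneous_one _ _, ?_, fun _ _ => trivial⟩
    obtain ⟨u, v, h, rfl⟩ := exists_lineOf W
    rw [vanishesAt_lineOf (MvPolynomial.isHomogeneous_one _ _)]
    simp
  | inter s t _ _ ihs iht =>
    obtain ⟨f, d, hf, hfW, hfs⟩ := ihs hW.1
    obtain ⟨g, e, hg, hgW, hgt⟩ := iht hW.2
    have key : ∀ W', VanishesAt (f * g) W' ↔ VanishesAt f W' ∨ VanishesAt g W' := by
      intro W'
      obtain ⟨u, v, h, rfl⟩ := exists_lineOf W'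
      rw [vanishesAt_lineOf (hf.mul hg), vanishesAt_lineOf hf, vanishesAt_lineOf hg, map_mul,
        mul_eq_zero]
    refine ⟨f * g, d + e, hf.mul hg, ?_, fun W' h => ?_⟩
    · rw [key]; tauto
    · rw [key] at h
      exact ⟨hfs W' (by tauto), hgt W' (by tauto)⟩
  | sUnion S _ ih =>
    obtain ⟨s, hs, hWs⟩ := hW
    obtain ⟨f, d, hf, hfW, hfs⟩ := ih s hs hWs
    exact ⟨f, d, hf, hfW, fun W' h => ⟨s, hs, hfs W' h⟩⟩

theorem exists_pathPoly (f : MvPolynomial (Fin 4 × Fin 4) ℂ) (p p' q q' : Fin 4 → ℂ) :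
    ∃ F : Polynomial ℂ, ∀ t : ℂ, F.eval t =
      MvPolynomial.eval (fun ab => pl (p + t • p') (q + t • q') ab.1 ab.2) f := by
  let P : Fin 4 → Polynomial ℂ := fun i => Polynomial.C (p i) + Polynomial.X * Polynomial.C (p' i)
  let Q : Fin 4 → Polynomial ℂ := fun i => Polynomial.C (q i) + Polynomial.X * Polynomial.C (q' i)
  refine ⟨MvPolynomial.aeval (fun ab : Fin 4 × Fin 4 => pl P Q ab.1 ab.2) f, fun t => ?_⟩
  have h1 := MvPolynomial.comp_aeval_apply (R := ℂ) (fun ab : Fin 4 × Fin 4 => pl P Q ab.1 ab.2)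
    (Polynomial.aeval t : Polynomial ℂ →ₐ[ℂ] ℂ) f
  rw [Polynomial.coe_aeval_eq_eval] at h1
  rw [h1, MvPolynomial.aeval_eq_eval]
  simp [pl, P, Q, mul_comm t]

end Homogeneous

section Irreducible

theorem isIrreducible_of_paths {S : Set (Gr ℂ 4)} (hne : S.Nonempty)
    (H : ∀ W₁ ∈ S, ∀ W₂ ∈ S, ∃ p₁ q₁ p₂ q₂ h₁ h₂, W₁ = lineOf p₁ q₁ h₁ ∧ W₂ = lineOf p₂ q₂ h₂ ∧
      ∀ (t : ℂ) h, lineOf (p₁ + t • (p₂ - p₁)) (q₁ + t • (q₂ - q₁)) h ∈ S) : IsIrreducible S := by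
  refine ⟨hne, ?_⟩
  rintro o₁ o₂ ho₁ ho₂ ⟨W₁, hW₁, hWo₁⟩ ⟨W₂, hW₂, hWo₂⟩
  obtain ⟨f, d, hf, hfW, hfs⟩ := exists_basic_subset ho₁ hWo₁
  obtain ⟨g, e, hg, hgW, hgs⟩ := exists_basic_subset ho₂ hWo₂
  obtain ⟨p₁, q₁, p₂, q₂, h₁, h₂, rfl, rfl, hS⟩ := H W₁ hW₁ W₂ hW₂
  obtain ⟨a, ha⟩ := Function.ne_iff.1 (pl_ne_zero h₁)
  obtain ⟨b, hab⟩ := Function.ne_iff.1 ha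
  obtain ⟨F, hF⟩ := exists_pathPoly f p₁ (p₂ - p₁) q₁ (q₂ - q₁)
  obtain ⟨G, hG⟩ := exists_pathPoly g p₁ (p₂ - p₁) q₁ (q₂ - q₁)
  obtain ⟨X, hX⟩ := exists_pathPoly (MvPolynomial.X (a, b)) p₁ (p₂ - p₁) q₁ (q₂ - q₁)
  rw [vanishesAt_lineOf hf] at hfW
  rw [vanishesAt_lineOf hg] at hgW
  have hF0 : F ≠ 0 := by
    intro h0
    have := hF 0
    rw [h0] at this
    simp at this
    exact hfW this.symm
  have hG0 : G ≠ 0 := by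
    intro h0
    have := hG 1
    rw [h0] at this
    simp at this
    exact hgW this.symm
  have hX0 : X ≠ 0 := by
    intro h0
    have := hX 0
    rw [h0] at this
    simp at this
    exact hab this.symm
  have hFGX : F * G * X ≠ 0 := mul_ne_zero (mul_ne_zero hF0 hG0) hX0
  obtain ⟨t, ht⟩ : ∃ t, (F * G * X).eval t ≠ 0 := by
    by_contra! hall
    exact hFGX (Polynomial.funext fun t => by simpa using hall t)
  rw [Polynomial.eval_mul, Polynomial.eval_mul, hF, hG, hX] at ht
  have hfg := left_ne_zero_of_mul ht
  have hxx := right_ne_zero_of_mul ht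
  have hl : LinearIndependent ℂ ![p₁ + t • (p₂ - p₁), q₁ + t • (q₂ - q₁)] := by
    refine linearIndependent_of_pl_ne_zero fun h0 => hxx ?_
    rw [h0]; simp
  refine ⟨_, hS t hl, hfs _ ?_, hgs _ ?_⟩
  · rw [vanishesAt_lineOf hf]; exact left_ne_zero_of_mul hfg
  · rw [vanishesAt_lineOf hg]; exact right_ne_zero_of_mul hfg

theorem add_smul_sub_mem {V : Submodule ℂ (Fin 4 → ℂ)} {p q : Fin 4 → ℂ} (hp : p ∈ V)
    (hq : q ∈ V) (t : ℂ) : p + t • (q - p) ∈ V := V.add_mem hp (V.smul_mem t (V.sub_mem hq hp))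

theorem mem_schubertL_iff_exists {𝕜 : Type*} [Field 𝕜] {W : Gr 𝕜 4} {a b : Fin 4 → 𝕜} :
    W ∈ schubertL a b ↔ ∃ p ∈ Submodule.span 𝕜 {a, b}, p ≠ 0 ∧ p ∈ W.toSubmodule := by
  constructor
  · intro h
    obtain ⟨p, hp, h0⟩ := Submodule.exists_mem_ne_zero_of_ne_bot h
    exact ⟨p, hp.2, h0, hp.1⟩
  · rintro ⟨p, hp, h0, hW⟩
    exact (Submodule.ne_bot_iff _).2 ⟨p, ⟨hW, hp⟩, h0⟩

theorem left_mem_lineOf {𝕜 : Type*} [Field 𝕜] (u v : Fin 4 → 𝕜) (h) :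
    u ∈ (lineOf u v h).toSubmodule := Submodule.subset_span (by simp)

theorem right_mem_lineOf {𝕜 : Type*} [Field 𝕜] (u v : Fin 4 → 𝕜) (h) :
    v ∈ (lineOf u v h).toSubmodule := Submodule.subset_span (by simp)

variable {a b c d : Fin 4 → ℂ}

theorem isIrreducible_schubertL (h : LinearIndependent ℂ ![a, b]) :
    IsIrreducible (schubertL a b) := by
  refine isIrreducible_of_paths ⟨lineOf a b h, mem_schubertL_iff_exists.2
    ⟨a, Submodule.subset_span (by simp), h.ne_zero 0, left_mem_lineOf _ _ _⟩⟩ ?_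
  intro W₁ hW₁ W₂ hW₂
  obtain ⟨p₁, hp₁, h01, hm₁⟩ := mem_schubertL_iff_exists.1 hW₁
  obtain ⟨p₂, hp₂, h02, hm₂⟩ := mem_schubertL_iff_exists.1 hW₂
  obtain ⟨q₁, hl₁, e₁⟩ := exists_lineOf_of_mem hm₁ h01
  obtain ⟨q₂, hl₂, e₂⟩ := exists_lineOf_of_mem hm₂ h02
  exact ⟨p₁, q₁, p₂, q₂, hl₁, hl₂, e₁, e₂, fun t h => mem_schubertL_iff_exists.2
    ⟨_, add_smul_sub_mem hp₁ hp₂ t, h.ne_zero 0, left_mem_lineOf _ _ _⟩⟩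

theorem isIrreducible_schubertV (h : LinearIndependent ℂ ![a, b]) :
    IsIrreducible (schubertV a) := by
  refine isIrreducible_of_paths ⟨lineOf a b h, left_mem_lineOf a b h⟩ ?_
  intro W₁ hW₁ W₂ hW₂
  obtain ⟨q₁, hl₁, e₁⟩ := exists_lineOf_of_mem hW₁ (h.ne_zero 0)
  obtain ⟨q₂, hl₂, e₂⟩ := exists_lineOf_of_mem hW₂ (h.ne_zero 0)
  refine ⟨a, q₁, a, q₂, hl₁, hl₂, e₁, e₂, fun t h => ?_⟩
  have := left_mem_lineOf _ _ h
  simpa [schubertV] using this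

theorem isIrreducible_schubertP (h : LinearIndependent ℂ ![a, b]) :
    IsIrreducible (schubertP a b c) := by
  have hab : lineOf a b h ∈ schubertP a b c := by
    exact Submodule.span_mono (by intro x; simp; tauto)
  refine isIrreducible_of_paths ⟨_, hab⟩ ?_
  intro W₁ hW₁ W₂ hW₂
  obtain ⟨p₁, q₁, hl₁, e₁⟩ := exists_lineOf W₁
  obtain ⟨p₂, q₂, hl₂, e₂⟩ := exists_lineOf W₂
  refine ⟨p₁, q₁, p₂, q₂, hl₁, hl₂, e₁, e₂, fun t h => ?_⟩
  subst e₁ e₂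
  simp only [schubertP, Set.mem_ofPred_eq, lineOf_toSubmodule, Submodule.span_le,
    Set.insert_subset_iff, Set.singleton_subset_iff]
  exact ⟨add_smul_sub_mem (hW₁ (left_mem_lineOf _ _ _)) (hW₂ (left_mem_lineOf _ _ _)) t,
    add_smul_sub_mem (hW₁ (right_mem_lineOf _ _ _)) (hW₂ (right_mem_lineOf _ _ _)) t⟩

theorem isIrreducible_schubertV_inter_schubertL (h : LinearIndependent ℂ ![a, b])
    (h' : a ∉ Submodule.span ℂ {b, c}) : IsIrreducible (schubertV a ∩ schubertL b c) := by
  refine isIrreducible_of_paths ⟨lineOf a b h, left_mem_lineOf a b h, mem_schubertL_iff_exists.2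
    ⟨b, Submodule.subset_span (by simp), h.ne_zero 1, right_mem_lineOf _ _ _⟩⟩ ?_
  have key : ∀ W ∈ schubertV a ∩ schubertL b c, ∃ q ∈ Submodule.span ℂ {b, c},
      ∃ h, W = lineOf a q h := by
    rintro W ⟨hWa, hWb⟩
    obtain ⟨q, hq, hq0, hm⟩ := mem_schubertL_iff_exists.1 hWb
    have hl : LinearIndependent ℂ ![a, q] := by
      refine LinearIndependent.pair_symm_iff.1 ((LinearIndependent.pair_iff' hq0).2 ?_)
      rintro s rfl
      exact h' (Submodule.smul_mem _ _ hq)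
    exact ⟨q, hq, hl, lineOf_eq_of_mem hl hWa hm⟩
  intro W₁ hW₁ W₂ hW₂
  obtain ⟨q₁, hq₁, hl₁, e₁⟩ := key W₁ hW₁
  obtain ⟨q₂, hq₂, hl₂, e₂⟩ := key W₂ hW₂
  refine ⟨a, q₁, a, q₂, hl₁, hl₂, e₁, e₂, fun t h => ⟨?_, mem_schubertL_iff_exists.2
    ⟨_, add_smul_sub_mem hq₁ hq₂ t, h.ne_zero 1, right_mem_lineOf _ _ _⟩⟩⟩
  have := left_mem_lineOf _ _ h
  simpa [schubertV] using this

theorem isIrreducible_schubertL_inter_schubertL (h : br a b c d ≠ 0) :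
    IsIrreducible (schubertL a b ∩ schubertL c d) := by
  have hac : LinearIndependent ℂ ![a, c] := linearIndependent_pair_of_br (c := b) (d := d) (by
    rw [br_swap₂₃]; exact neg_ne_zero.2 h)
  have hl4 := linearIndependent_iff_br.2 h
  refine isIrreducible_of_paths ⟨lineOf a c hac, mem_schubertL_iff_exists.2
      ⟨a, Submodule.subset_span (by simp), hac.ne_zero 0, left_mem_lineOf _ _ _⟩,
    mem_schubertL_iff_exists.2
      ⟨c, Submodule.subset_span (by simp), hac.ne_zero 1, right_mem_lineOf _ _ _⟩⟩ ?_
  have key : ∀ W ∈ schubertL a b ∩ schubertL c d, ∃ p ∈ Submodule.span ℂ {a, b},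
      ∃ q ∈ Submodule.span ℂ {c, d}, ∃ h, W = lineOf p q h := by
    rintro W ⟨hWa, hWb⟩
    obtain ⟨p, hp, hp0, hpm⟩ := mem_schubertL_iff_exists.1 hWa
    obtain ⟨q, hq, hq0, hqm⟩ := mem_schubertL_iff_exists.1 hWb
    have hl : LinearIndependent ℂ ![p, q] := by
      rw [LinearIndependent.pair_iff' hp0]
      rintro s rfl
      obtain ⟨x, y, rfl⟩ := Submodule.mem_span_pair.1 hp
      obtain ⟨z, w, hzw⟩ := Submodule.mem_span_pair.1 hq
      have := Fintype.linearIndependent_iff.1 hl4 ![s * x, s * y, -z, -w] (by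
        simp only [Fin.sum_univ_four]
        change (s * x) • a + (s * y) • b + (-z) • c + (-w) • d = 0
        linear_combination (norm := module) -hzw)
      have h0 : s * x = 0 := this 0
      have h1 : s * y = 0 := this 1
      apply hq0
      rw [smul_add, smul_smul, smul_smul, h0, h1]; simp
    exact ⟨p, hp, q, hq, hl, lineOf_eq_of_mem hl hpm hqm⟩
  intro W₁ hW₁ W₂ hW₂
  obtain ⟨p₁, hp₁, q₁, hq₁, hl₁, e₁⟩ := key W₁ hW₁
  obtain ⟨p₂, hp₂, q₂, hq₂, hl₂, e₂⟩ := key W₂ hW₂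
  exact ⟨p₁, q₁, p₂, q₂, hl₁, hl₂, e₁, e₂, fun t h => ⟨mem_schubertL_iff_exists.2
    ⟨_, add_smul_sub_mem hp₁ hp₂ t, h.ne_zero 0, left_mem_lineOf _ _ _⟩, mem_schubertL_iff_exists.2
    ⟨_, add_smul_sub_mem hq₁ hq₂ t, h.ne_zero 1, right_mem_lineOf _ _ _⟩⟩⟩

theorem schubertV_inter_schubertV {𝕜 : Type*} [Field 𝕜] {a b : Fin 4 → 𝕜}
    (h : LinearIndependent 𝕜 ![a, b]) : schubertV a ∩ schubertV b = {lineOf a b h} := by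
  ext W
  constructor
  · rintro ⟨h1, h2⟩; exact lineOf_eq_of_mem h h1 h2
  · rintro rfl; exact ⟨left_mem_lineOf a b h, right_mem_lineOf a b h⟩

end Irreducible

section Closed

theorem isClosed_schubertL {a b : Fin 4 → ℂ} (h : LinearIndependent ℂ ![a, b]) :
    IsClosed (schubertL a b) := by
  let X : Fin 4 → Fin 4 → ℂ → MvPolynomial (Fin 4 × Fin 4) ℂ := fun i j c =>
    MvPolynomial.X (i, j) * MvPolynomial.C c
  let f := X 0 1 (a 2 * b 3 - a 3 * b 2) - X 0 2 (a 1 * b 3 - a 3 * b 1)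
    + X 0 3 (a 1 * b 2 - a 2 * b 1) + X 1 2 (a 0 * b 3 - a 3 * b 0)
    - X 1 3 (a 0 * b 2 - a 2 * b 0) + X 2 3 (a 0 * b 1 - a 1 * b 0)
  have hX : ∀ (i j : Fin 4) (c : ℂ), (X i j c).IsHomogeneous 1 := fun i j c => by
    have := (MvPolynomial.isHomogeneous_X ℂ (i, j)).mul (MvPolynomial.isHomogeneous_C _ c)
    simpa [X] using this
  have hf : f.IsHomogeneous 1 :=
    (((((hX _ _ _).sub (hX _ _ _)).add (hX _ _ _)).add (hX _ _ _)).sub (hX _ _ _)).add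
      (hX _ _ _)
  convert isClosed_vanishesAt hf using 1
  ext W
  obtain ⟨u, v, hl, rfl⟩ := exists_lineOf W
  rw [mem_schubertL_lineOf hl h, Set.mem_ofPred_eq, vanishesAt_lineOf hf]
  simp [f, br, pl, X]

theorem isClosed_schubertV {a : Fin 4 → ℂ} (ha : a ≠ 0) : IsClosed (schubertV a) := by
  have : schubertV a = ⋂ d : {d : Fin 4 → ℂ // LinearIndependent ℂ ![a, d]}, schubertL a d.1 := by
    ext W
    simp only [Set.mem_iInter, Subtype.forall]
    constructor
    · intro h d _
      exact mem_schubertL_iff_exists.2 ⟨a, Submodule.subset_span (by simp), ha, h⟩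
    · intro H
      obtain ⟨u, v, hl, rfl⟩ := exists_lineOf W
      by_contra hW
      obtain ⟨d, hd⟩ := exists_br_ne_zero hl hW
      have had : LinearIndependent ℂ ![a, d] :=
        linearIndependent_pair_of_br (c := u) (d := v) (by rwa [br_swap_pairs])
      exact hd ((mem_schubertL_lineOf hl had).1 (H d had))
  rw [this]
  exact isClosed_iInter fun d => isClosed_schubertL d.2

theorem schubertP_eq {𝕜 : Type*} [Field 𝕜] {a b c : Fin 4 → 𝕜}
    (h : LinearIndependent 𝕜 ![a, b, c]) (hab : LinearIndependent 𝕜 ![a, b])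
    (hac : LinearIndependent 𝕜 ![a, c]) (hbc : LinearIndependent 𝕜 ![b, c]) :
    schubertP a b c = schubertL a b ∩ schubertL a c ∩ schubertL b c := by
  ext W
  obtain ⟨u, v, hl, rfl⟩ := exists_lineOf W
  rw [Set.mem_inter_iff, Set.mem_inter_iff, mem_schubertP_lineOf hl h,
    mem_schubertL_lineOf hl hab, mem_schubertL_lineOf hl hac, mem_schubertL_lineOf hl hbc]
  constructor
  · rintro ⟨h1, h2⟩
    obtain ⟨x, y, z, e1⟩ := Submodule.mem_span_triple.1 ((mem_span_triple_iff_br h).2 h1)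
    obtain ⟨x', y', z', e2⟩ := Submodule.mem_span_triple.1 ((mem_span_triple_iff_br h).2 h2)
    rw [← e1, ← e2]
    refine ⟨⟨?_, ?_⟩, ?_⟩ <;> simp [br_add₁, br_add₂, br_smul₁, br_smul₂]
  · rintro ⟨⟨h1, h2⟩, h3⟩
    have key : ∀ x y : Fin 4 → 𝕜, br x y a b = 0 → br x y a c = 0 → br x y b c = 0 →
        br x a b c ≠ 0 → LinearIndependent 𝕜 ![x, y] → False := by
      intro x y h1 h2 h3 h0 hxy
      have e := br_cramer x a b c y
      have e1 : br x y b c = 0 := h3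
      have e2 : br x a y c = 0 := by rw [br_swap₂₃, h2, neg_zero]
      have e3 : br x a b y = 0 := by rw [br_swap₃₄, br_swap₂₃, h1]; simp
      rw [e1, e2, e3] at e
      have := pair_comb_eq_zero hxy (s := - br y a b c) (t := br x a b c) (by
        rw [e]; module)
      exact h0 this.2
    constructor
    · by_contra h0
      exact key u v h1 h2 h3 h0 hl
    · by_contra h0
      refine key v u ?_ ?_ ?_ h0 (LinearIndependent.pair_symm_iff.1 hl) <;>
        rw [br_swap₁₂] <;> simpa

theorem isClosed_schubertP {a b c d : Fin 4 → ℂ} (h : br a b c d ≠ 0) :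
    IsClosed (schubertP a b c) := by
  have hab : LinearIndependent ℂ ![a, b] := linearIndependent_pair_of_br h
  have hac : LinearIndependent ℂ ![a, c] := linearIndependent_pair_of_br (c := b) (d := d) (by
    rw [br_swap₂₃]; simpa)
  have hbc : LinearIndependent ℂ ![b, c] := linearIndependent_pair_of_br (c := a) (d := d) (by
    rw [br_swap₂₃, br_swap₁₂]; simpa)
  rw [schubertP_eq (linearIndependent_triple_of_br h) hab hac hbc]
  exact ((isClosed_schubertL hab).inter (isClosed_schubertL hac)).inter (isClosed_schubertL hbc)

/-- If a neighborhood of `(0, 0)` in a real two-parameter family of lines lies in `B`, then the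
complex member of the family at `(1, i)` lies in the Zariski closure of `B`. -/
theorem mem_closure_of_real_family {B : Set (Gr ℝ 4)} {p₀ q₀ p₁ q₁ p₂ q₂ : Fin 4 → ℝ} {ε : ℝ}
    (hε : 0 < ε)
    (hB : ∀ s t : ℝ, |s| < ε → |t| < ε → ∃ h,
      lineOf (p₀ + s • (p₁ - p₀) + t • p₂) (q₀ + s • (q₁ - q₀) + t • q₂) h ∈ B)
    {p q : Fin 4 → ℂ} (h : LinearIndependent ℂ ![p, q])
    (hp : p = toComplex p₁ + Complex.I • toComplex p₂)
    (hq : q = toComplex q₁ + Complex.I • toComplex q₂) :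
    lineOf p q h ∈ closure (complexify '' B) := by
  rw [mem_closure_iff]
  intro o ho hW
  obtain ⟨f, d, hf, hfW, hfo⟩ := exists_basic_subset ho hW
  rw [vanishesAt_lineOf hf] at hfW
  by_contra hcon
  have hzero : ∀ s t : ℝ, |s| < ε → |t| < ε → MvPolynomial.eval (fun ab => pl
      (toComplex p₀ + (s : ℂ) • (toComplex p₁ - toComplex p₀) + (t : ℂ) • toComplex p₂)
      (toComplex q₀ + (s : ℂ) • (toComplex q₁ - toComplex q₀) + (t : ℂ) • toComplex q₂)
        ab.1 ab.2) f = 0 := by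
    intro s t hs ht
    obtain ⟨hl, hm⟩ := hB s t hs ht
    by_contra h0
    refine hcon ⟨_, hfo _ ?_, ⟨_, hm, rfl⟩⟩
    rw [complexify_lineOf, vanishesAt_lineOf hf]
    have e : ∀ x y z : Fin 4 → ℝ, toComplex (x + s • (y - x) + t • z) =
        toComplex x + (s : ℂ) • (toComplex y - toComplex x) + (t : ℂ) • toComplex z := by
      intro x y z; ext i; simp [toComplex]
    rwa [e, e]
  have hinf : {z : ℂ | ∃ x : ℝ, |x| < ε ∧ z = x}.Infinite := by
    have : ((fun x : ℝ => (x : ℂ)) '' Set.Ioo (-ε) ε).Infinite :=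
      (Set.Ioo_infinite (by linarith)).image Complex.ofReal_injective.injOn
    refine this.mono ?_
    rintro _ ⟨x, hx, rfl⟩
    exact ⟨x, abs_lt.2 hx, rfl⟩
  have step1 : ∀ s : ℝ, |s| < ε → MvPolynomial.eval (fun ab => pl
      (toComplex p₀ + (s : ℂ) • (toComplex p₁ - toComplex p₀) + Complex.I • toComplex p₂)
      (toComplex q₀ + (s : ℂ) • (toComplex q₁ - toComplex q₀) + Complex.I • toComplex q₂)
        ab.1 ab.2) f = 0 := by
    intro s hs
    obtain ⟨F, hF⟩ := exists_pathPoly f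
      (toComplex p₀ + (s : ℂ) • (toComplex p₁ - toComplex p₀)) (toComplex p₂)
      (toComplex q₀ + (s : ℂ) • (toComplex q₁ - toComplex q₀)) (toComplex q₂)
    have hF0 : F = 0 := Polynomial.eq_zero_of_infinite_isRoot F (hinf.mono (by
      rintro _ ⟨x, hx, rfl⟩
      exact (hF x).trans (hzero s x hs hx)))
    rw [← hF, hF0, Polynomial.eval_zero]
  obtain ⟨F, hF⟩ := exists_pathPoly f
      (toComplex p₀ + Complex.I • toComplex p₂) (toComplex p₁ - toComplex p₀)
      (toComplex q₀ + Complex.I • toComplex q₂) (toComplex q₁ - toComplex q₀)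
  have hF0 : F = 0 := Polynomial.eq_zero_of_infinite_isRoot F (hinf.mono (by
    rintro _ ⟨x, hx, rfl⟩
    refine (hF x).trans ?_
    rw [← step1 x hx, add_right_comm _ (Complex.I • _), add_right_comm _ (Complex.I • _)]))
  have := hF 1
  rw [hF0, Polynomial.eval_zero] at this
  apply hfW
  have e : ∀ x y z : Fin 4 → ℂ, x + Complex.I • z + (1 : ℂ) • (y - x) = y + Complex.I • z := by
    intro x y z; module
  rw [e, e] at this
  rw [this, hp, hq]

end Closed

/-- All minors with increasing rows have the sign of `ε`. -/
class PosConf {n : ℕ} (ε : outParam ℝ) (Z : Matrix (Fin n) (Fin 4) ℝ) : Prop where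
  br_pos : ∀ a b c d : Fin n, a < b → b < c → c < d → 0 < ε * br (Z a) (Z b) (Z c) (Z d)

theorem IsTotallyPositive.exists_posConf {n : ℕ} (hn : 4 ≤ n) {Z : Matrix (Fin n) (Fin 4) ℝ}
    (hZ : IsTotallyPositive Z) : ∃ ε, PosConf ε Z := by
  refine ⟨(Z.submatrix (Fin.castLEOrderEmb hn) id).det, ⟨fun a b c d hab hbc hcd => ?_⟩⟩
  have hm : StrictMono ![a, b, c, d] := by
    rw [Fin.strictMono_iff_lt_succ]
    intro i; fin_cases i <;> simpa
  have h := hZ (Fin.castLEOrderEmb hn) (OrderEmbedding.ofStrictMono _ hm)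
  convert h using 2
  rw [br_eq_det]
  congr 1
  ext i j; fin_cases i <;> rfl

section Cyclic
variable {n : ℕ} [NeZero n] [hn : Fact (4 ≤ n)]

theorem val_succ (k : Fin n) : (k + 1).val = if k.val + 1 = n then 0 else k.val + 1 := by
  have hn := hn.out
  have h1 : (1 : Fin n).val = 1 := by rw [Fin.val_one', Nat.mod_eq_of_lt (by omega)]
  rw [Fin.val_add, h1]
  split_ifs with h
  · rw [h, Nat.mod_self]
  · exact Nat.mod_eq_of_lt (by omega)

theorem val_pred (k : Fin n) : (k - 1).val = if k.val = 0 then n - 1 else k.val - 1 := by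
  have h := val_succ (k - 1)
  rw [sub_add_cancel] at h
  split_ifs at h ⊢ <;> omega

/-- The sign of the twisted cyclic shift. -/
noncomputable def sgn (k : Fin n) : ℝ := if k + 1 = 0 then -1 else 1

theorem sgn_mul_self (k : Fin n) : sgn k * sgn k = 1 := by
  unfold sgn; split_ifs <;> norm_num

theorem sgn_ne_zero (k : Fin n) : sgn k ≠ 0 := by
  unfold sgn; split_ifs <;> norm_num

/-- The twisted cyclic shift of the rows. -/
noncomputable def rotZ (Z : Matrix (Fin n) (Fin 4) ℝ) : Matrix (Fin n) (Fin 4) ℝ :=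
  fun j => sgn j • Z (j + 1)

theorem sgn_of_lt {k : Fin n} (h : k.val + 1 < n) : sgn k = 1 := by
  unfold sgn
  rw [if_neg]
  intro h0
  have := congrArg Fin.val h0
  rw [val_succ] at this
  simp at this; omega

theorem sgn_last {k : Fin n} (h : k.val + 1 = n) : sgn k = -1 := by
  unfold sgn
  rw [if_pos]
  apply Fin.ext
  rw [val_succ, if_pos h]
  simp

theorem succ_ne (k : Fin n) : k ≠ k + 1 := by
  have hn := hn.out
  intro h
  have := congrArg Fin.val h
  rw [val_succ] at this
  split_ifs at * <;> omega

theorem pred_ne (k : Fin n) : k - 1 ≠ k := by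
  have hn := hn.out
  intro h
  have := congrArg Fin.val h
  rw [val_pred] at this
  split_ifs at * <;> omega

theorem pred_ne_succ (k : Fin n) : k - 1 ≠ k + 1 := by
  have hn := hn.out
  intro h
  have := congrArg Fin.val h
  rw [val_pred, val_succ] at this
  split_ifs at * <;> omega

theorem exists_ne_three (a b c : Fin n) : ∃ d, d ≠ a ∧ d ≠ b ∧ d ≠ c := by
  have hn := hn.out
  by_contra! h
  have hsub : (Finset.univ : Finset (Fin n)) ⊆ {a, b, c} := by
    intro d _
    simp only [Finset.mem_insert, Finset.mem_singleton]
    tauto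
  have := (Finset.card_le_card hsub).trans Finset.card_le_three
  simp at this; omega

theorem exists_step {P : ℕ → Prop} {a b : ℕ} (hab : a ≤ b) (ha : P a) (hb : ¬ P b) :
    ∃ i, a ≤ i ∧ i < b ∧ P i ∧ ¬ P (i + 1) := by
  induction b, hab using Nat.le_induction with
  | base => exact absurd ha hb
  | succ b hb' ih =>
    by_cases h : P b
    · exact ⟨b, hb', Nat.lt_succ_self b, h, hb⟩
    · obtain ⟨i, h1, h2, h3⟩ := ih h
      exact ⟨i, h1, by omega, h3⟩

theorem exists_step_fin {P : Fin n → Prop} {a b : Fin n} (hab : a ≤ b) (ha : P a)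
    (hb : ¬ P b) : ∃ i : Fin n, a ≤ i ∧ i < b ∧ P i ∧ ¬ P (i + 1) ∧ (i + 1).val = i.val + 1 := by
  obtain ⟨i, h1, h2, ⟨hi, h3⟩, h4⟩ := exists_step (P := fun m => ∃ hm : m < n, P ⟨m, hm⟩)
    (a := a.val) (b := b.val) hab ⟨a.2, ha⟩ (fun ⟨_, h⟩ => hb h)
  have hi' : i + 1 < n := lt_of_le_of_lt h2 b.2
  have hv : ((⟨i, hi⟩ : Fin n) + 1).val = i + 1 := by
    rw [val_succ, if_neg (by clear h4; simp only; omega)]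
  refine ⟨⟨i, hi⟩, h1, h2, h3, fun h => h4 ⟨hi', ?_⟩, hv⟩
  have : (⟨i + 1, hi'⟩ : Fin n) = ⟨i, hi⟩ + 1 := Fin.ext hv.symm
  rwa [this]

theorem val_one : (1 : Fin n).val = 1 := by
  have hn := hn.out
  rw [Fin.val_one', Nat.mod_eq_of_lt (by omega)]

theorem val_two : (2 : Fin n).val = 2 := Nat.mod_eq_of_lt (hn.out.trans' (by simp))

theorem add_one_add_one_ne (i : Fin n) : i + 1 + 1 ≠ i - 1 := by
  have hn := hn.out
  intro h
  have h' := congrArg Fin.val h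
  rw [val_succ, val_succ, val_pred] at h'
  split_ifs at h' <;> omega

theorem one_add_one_fin : (1 : Fin n) + 1 = 2 := by
  have h1 := val_one (n := n)
  have h2 := val_two (n := n)
  have := val_succ (1 : Fin n)
  apply Fin.ext
  rw [this, h1, h2, if_neg (by omega)]

theorem zero_lt_one_fin : (0 : Fin n) < 1 := by
  have h1 := val_one (n := n)
  have h0 : ((0 : Fin n) : ℕ) = 0 := by simp
  omega

theorem one_lt_two_fin : (1 : Fin n) < 2 := by
  have h1 := val_one (n := n)
  have h2 := val_two (n := n)
  omega

theorem val_zero_fin : ((0 : Fin n) : ℕ) = 0 := by simp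

theorem val_last : ((0 - 1 : Fin n) : ℕ) = n - 1 := by
  rw [val_pred, if_pos val_zero_fin]

theorem cyclic_facts : (∀ k : Fin n, k - 1 + 1 = k) ∧ (∀ k : Fin n, k + 1 - 1 = k) ∧
    (∀ k : Fin n, k ≠ k + 1) ∧ (∀ k : Fin n, k - 1 ≠ k) ∧ (∀ k : Fin n, k - 1 ≠ k + 1) ∧
    (∀ k : Fin n, k + 1 + 1 ≠ k - 1) ∧ ∀ k : Fin n, k - 1 - 1 ≠ k + 1 :=
  ⟨fun k => sub_add_cancel _ _, fun k => add_sub_cancel_right _ _, succ_ne, pred_ne,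
    pred_ne_succ, add_one_add_one_ne,
    fun k h => add_one_add_one_ne (k - 1) (by rw [sub_add_cancel, h])⟩

end Cyclic

section PosConf
variable {n : ℕ} [hn : Fact (4 ≤ n)] {ε : ℝ} {Z : Matrix (Fin n) (Fin 4) ℝ}

theorem PosConf.ne_zero (hZ : PosConf ε Z) : ε ≠ 0 := by
  rintro rfl
  have hn := hn.out
  have := hZ.1 ⟨0, by omega⟩ ⟨1, by omega⟩ ⟨2, by omega⟩ ⟨3, by omega⟩ (by simp) (by simp) (by simp)
  simp at this

variable [hZ : PosConf ε Z]
include ε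

theorem PosConf.br_ne_zero {a b c d : Fin n} (hab : a ≠ b) (hac : a ≠ c)
    (had : a ≠ d) (hbc : b ≠ c) (hbd : b ≠ d) (hcd : c ≠ d) : br (Z a) (Z b) (Z c) (Z d) ≠ 0 := by
  have hcard : ({a, b, c, d} : Finset (Fin n)).card = 4 := by
    rw [Finset.card_insert_of_notMem, Finset.card_insert_of_notMem, Finset.card_insert_of_notMem,
      Finset.card_singleton] <;> simp_all
  let e := Finset.orderEmbOfFin _ hcard
  have hl : LinearIndependent ℝ (fun i => Z (e i)) := by
    have h0 : br (Z (e 0)) (Z (e 1)) (Z (e 2)) (Z (e 3)) ≠ 0 := right_ne_zero_of_mul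
      (hZ.1 _ _ _ _ (e.strictMono (by decide)) (e.strictMono (by decide))
        (e.strictMono (by decide))).ne'
    have e1 : (fun i => Z (e i)) = ![Z (e 0), Z (e 1), Z (e 2), Z (e 3)] := by
      ext i j; fin_cases i <;> rfl
    rw [e1]
    exact linearIndependent_iff_br.2 h0
  have hi : Function.Injective ![a, b, c, d] := by
    intro i j; fin_cases i <;> fin_cases j <;> simp_all [eq_comm]
  have hs : ∀ i : Fin 4, ∃ j, e j = ![a, b, c, d] i := by
    intro i
    have hr := Finset.range_orderEmbOfFin _ hcard
    have : ![a, b, c, d] i ∈ Set.range e := by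
      rw [hr]; fin_cases i <;> simp
    exact this
  choose σ hσ using hs
  have hinj : Function.Injective σ := by
    intro i j hij
    exact hi (by rw [← hσ, ← hσ, hij])
  have e2 : (fun i => Z (e i)) ∘ σ = ![Z a, Z b, Z c, Z d] := by
    ext i j
    simp only [Function.comp_apply, hσ]
    fin_cases i <;> rfl
  have h2 := hl.comp σ hinj
  rw [e2] at h2
  exact linearIndependent_iff_br.1 h2

variable [NeZero n]

instance PosConf.rotZ : PosConf ε (rotZ Z) := by
  constructor; intro a b c d hab hbc hcd
  have ha' := val_succ a
  have hb' := val_succ b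
  have hc' := val_succ c
  have hd' := val_succ d
  rw [if_neg (by omega)] at ha' hb' hc'
  simp only [_root_.rotZ, br_smul₁, br_smul₂, br_smul₃, br_smul₄]
  rw [sgn_of_lt (k := a) (by omega), sgn_of_lt (k := b) (by omega), sgn_of_lt (k := c) (by omega)]
  by_cases hl : d.val + 1 = n
  · rw [sgn_last hl]
    rw [if_pos hl] at hd'
    have := hZ.1 (d + 1) (a + 1) (b + 1) (c + 1) (by omega)
      (by omega) (by omega)
    rw [br_swap₁₂, br_swap₂₃, br_swap₃₄] at this
    linarith
  · rw [sgn_of_lt (by omega)]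
    rw [if_neg hl] at hd'
    have := hZ.1 (a + 1) (b + 1) (c + 1) (d + 1) (by omega)
      (by omega) (by omega)
    linarith

theorem rot_induction {Q : Matrix (Fin n) (Fin 4) ℝ → Fin n → Prop}
    (h0 : ∀ Z [PosConf ε Z], Q Z 0) (hs : ∀ Z i [PosConf ε Z], Q (rotZ Z) i → Q Z (i + 1)) :
    ∀ Z i [PosConf ε Z], Q Z i := by
  have key : ∀ (m : ℕ) (i : Fin n), i.val = m → ∀ Z [PosConf ε Z], Q Z i := by
    intro m
    induction m with
    | zero =>
      intro i hi Z _
      have : i = 0 := Fin.ext (by simpa using hi)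
      rw [this]; exact h0 Z
    | succ m ih =>
      intro i hi Z _
      have h1 := hs Z (i - 1) (ih (i - 1) (by
        rw [val_pred, if_neg (by omega)]; omega) _)
      rwa [sub_add_cancel] at h1
  exact fun Z i _ => key i.val i rfl Z

/-- The bracket with two cyclically consecutive rows has constant sign. -/
theorem PosConf.consecutive {a b k : Fin n} (hab : a < b)
    (h1 : a ≠ k) (h2 : a ≠ k + 1) (h3 : b ≠ k) (h4 : b ≠ k + 1) :
    0 < ε * sgn k * br (Z a) (Z b) (Z k) (Z (k + 1)) := by
  have hk' := val_succ k
  by_cases hl : k.val + 1 = n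
  · rw [if_pos hl] at hk'
    rw [sgn_last hl]
    have := hZ.1 (k + 1) a b k (by omega) hab
      (by omega)
    rw [br_swap₁₂, br_swap₂₃, br_swap₃₄] at this
    linarith
  · rw [if_neg hl] at hk'
    rw [sgn_of_lt (by omega)]
    rcases lt_or_ge b.val k.val with hbk | hbk
    · have := hZ.1 a b k (k + 1) hab hbk (by omega)
      linarith
    · rcases lt_or_ge a.val k.val with hak | hak
      · have := hZ.1 a k (k + 1) b hak (by omega)
          (by omega)
        rw [br_swap₃₄, br_swap₂₃] at this
        linarith
      · have := hZ.1 k (k + 1) a b (by omega)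
          (by omega) hab
        rw [br_swap_pairs] at this
        linarith

/-- Sign of the bracket of `Z_i Z_b` with the two neighbors of `Z_i`. -/
theorem PosConf.neighbors (i : Fin n) : ∃ σ : ℝ, σ ≠ 0 ∧ ∀ a b : Fin n, a < b → a = i ∨ b = i →
      0 ≤ σ * br (Z a) (Z b) (Z (i - 1)) (Z (i + 1)) := by
  have hε := hZ.ne_zero
  have hs := val_succ i
  have hp := val_pred i
  by_cases hmid : i.val = 0 ∨ i.val + 1 = n
  · refine ⟨ε, hε, ?_⟩
    intro a b hab hi'
    by_cases hd : a = i - 1 ∨ a = i + 1 ∨ b = i - 1 ∨ b = i + 1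
    · rcases hd with rfl | rfl | rfl | rfl <;> simp
    have hb := b.2
    rcases hmid with hmid | hmid
    · have : a = i := by
        rcases hi' with h | h
        · exact h
        · subst h; omega
      subst this
      have := hZ.1 a (a + 1) b (a - 1) (by simp only [Fin.lt_def]; split_ifs at * <;> omega)
        (by simp only [Fin.lt_def]; split_ifs at * <;> omega)
        (by simp only [Fin.lt_def]; split_ifs at * <;> omega)
      rw [br_swap₂₃, br_swap₃₄] at this
      linarith
    · have : b = i := by
        rcases hi' with h | h
        · subst h; omega
        · exact h
      subst this
      have := hZ.1 (b + 1) a (b - 1) b (by simp only [Fin.lt_def]; split_ifs at * <;> omega)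
        (by simp only [Fin.lt_def]; split_ifs at * <;> omega)
        (by simp only [Fin.lt_def]; split_ifs at * <;> omega)
      rw [br_swap₁₂, br_swap₂₃, br_swap₃₄, br_swap₂₃] at this
      linarith
  · refine ⟨-ε, neg_ne_zero.2 hε, ?_⟩
    intro a b hab hi'
    by_cases hd : a = i - 1 ∨ a = i + 1 ∨ b = i - 1 ∨ b = i + 1
    · rcases hd with rfl | rfl | rfl | rfl <;> simp
    push Not at hd
    simp only [ne_eq, Fin.ext_iff] at hd
    simp only [Fin.lt_def] at hab
    have hb := b.2
    rcases hi' with h | h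
    · subst h
      have := hZ.1 (a - 1) a (a + 1) b (by simp only [Fin.lt_def]; split_ifs at * <;> omega)
        (by simp only [Fin.lt_def]; split_ifs at * <;> omega)
        (by simp only [Fin.lt_def]; split_ifs at * <;> omega)
      rw [br_swap₁₂, br_swap₃₄, br_swap₂₃] at this
      linarith
    · subst h
      have := hZ.1 a (b - 1) b (b + 1) (by simp only [Fin.lt_def]; split_ifs at * <;> omega)
        (by simp only [Fin.lt_def]; split_ifs at * <;> omega)
        (by simp only [Fin.lt_def]; split_ifs at * <;> omega)
      rw [br_swap₂₃] at this
      linarith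

end PosConf

section Representation
variable {n : ℕ} {ε : ℝ} {Z : Matrix (Fin n) (Fin 4) ℝ}

/-- The combination of the rows of `Z` with coefficients `x`. -/
noncomputable def comb (Z : Matrix (Fin n) (Fin 4) ℝ) (x : Fin n → ℝ) : Fin 4 → ℝ := ∑ a, x a • Z a

/-- `2 × 2` minors of two coefficient vectors. -/
def minor (x y : Fin n → ℝ) (a b : Fin n) : ℝ := x a * y b - x b * y a

theorem minor_swap (x y : Fin n → ℝ) (a b : Fin n) : minor x y b a = -minor x y a b := by
  simp only [minor]; ring

theorem minor_relation (x y : Fin n → ℝ) (a b c d : Fin n) : minor x y a c * minor x y b d =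
      minor x y a b * minor x y c d + minor x y a d * minor x y b c := by
  simp only [minor]; ring

theorem minor_single_ne_zero {a b c d : Fin n} (hab : a ≠ b) :
    minor (Pi.single a (1 : ℝ)) (Pi.single b 1) c d ≠ 0 ↔ (c = a ∧ d = b) ∨ (c = b ∧ d = a) := by
  simp only [minor, Pi.single_apply]
  grind

theorem minor_ne {x y : Fin n → ℝ} {a b : Fin n} (h : minor x y a b ≠ 0) : a ≠ b := by
  rintro rfl; simp [minor] at h

theorem minor_join {i j k l : Fin n} (hij : i < j) (hjk : j < k) (hkl : k < l) (a b c d : ℝ)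
    {p q : Fin n} (hpq : p < q) :
    minor (Pi.single i a + Pi.single j b) (Pi.single k c + Pi.single l d) p q =
      if p = i ∧ q = k then a * c else if p = i ∧ q = l then a * d else
        if p = j ∧ q = k then b * c else if p = j ∧ q = l then b * d else 0 := by
  have hz : (Pi.single i a + Pi.single j b : Fin n → ℝ) q *
      (Pi.single k c + Pi.single l d : Fin n → ℝ) p = 0 := by
    by_cases hq : q = i ∨ q = j
    · have h1 : p ≠ k := by rintro rfl; rcases hq with rfl | rfl <;> order
      have h2 : p ≠ l := by rintro rfl; rcases hq with rfl | rfl <;> order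
      simp [Pi.single_apply, h1, h2]
    · push Not at hq
      simp [Pi.single_apply, hq.1, hq.2]
  rw [minor, hz, sub_zero]
  by_cases hp1 : p = i
  · subst hp1
    by_cases hq1 : q = k
    · subst hq1; simp [hij.ne, hkl.ne]
    · by_cases hq2 : q = l
      · subst hq2; simp [hij.ne, hkl.ne']
      · simp [hq1, hq2]
  · by_cases hp2 : p = j
    · subst hp2
      by_cases hq1 : q = k
      · subst hq1; simp [hij.ne', hkl.ne]
      · by_cases hq2 : q = l
        · subst hq2; simp [hij.ne', hkl.ne']
        · simp [hq1, hq2]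
    · simp [hp1, hp2]

theorem vecMulLinear_eq_comb (x : Fin n → ℝ) : Z.vecMulLinear x = comb Z x := by
  ext j
  simp [comb, Matrix.vecMul, dotProduct, Finset.sum_apply]

/-- `x`, `y` are coefficient vectors with nonnegative minors representing the line `W`. -/
def IsRep (Z : Matrix (Fin n) (Fin 4) ℝ) (W : Gr ℝ 4) (x y : Fin n → ℝ) : Prop :=
  (∀ a b, a < b → 0 ≤ minor x y a b) ∧ ∃ h, W = lineOf (comb Z x) (comb Z y) h

theorem mem_amplituhedron_iff {W : Gr ℝ 4} : W ∈ amplituhedron Z ↔ ∃ x y, IsRep Z W x y := by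
  constructor
  · rintro ⟨X, ⟨M, rfl, hM⟩, hW⟩
    have hspan : W.toSubmodule = Submodule.span ℝ {comb Z (M.1 0), comb Z (M.1 1)} := by
      rw [hW]
      change Submodule.map _ (Submodule.span ℝ (Set.range M.1.row)) = _
      rw [Submodule.map_span, ← Set.range_comp, ← range_vec_pair]
      congr 2
      ext i : 1
      fin_cases i
      · exact vecMulLinear_eq_comb _
      · exact vecMulLinear_eq_comb _
    have hl : LinearIndependent ℝ ![comb Z (M.1 0), comb Z (M.1 1)] := by
      rw [linearIndependent_iff_card_eq_finrank_span, Set.finrank, range_vec_pair, ← hspan,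
        W.finrank_eq]
      rfl
    exact ⟨M.1 0, M.1 1, fun a b hab => hM a b hab, hl, Gr.ext hspan⟩
  · rintro ⟨x, y, hxy, hl, rfl⟩
    have hcomp : ![comb Z x, comb Z y] = Z.vecMulLinear ∘ ![x, y] := by
      ext i : 1
      fin_cases i
      · exact (vecMulLinear_eq_comb _).symm
      · exact (vecMulLinear_eq_comb _).symm
    have hl' : LinearIndependent ℝ ![x, y] := by
      rw [hcomp] at hl
      exact LinearIndependent.of_comp _ hl
    refine ⟨rowSpan ⟨![x, y], hl'⟩, ⟨⟨![x, y], hl'⟩, rfl, fun a b hab => hxy a b hab⟩, ?_⟩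
    change Submodule.span ℝ {comb Z x, comb Z y} =
      Submodule.map _ (Submodule.span ℝ (Set.range ![x, y]))
    rw [Submodule.map_span, ← Set.range_comp, ← hcomp, range_vec_pair]

theorem two_mul_br_comb (x y : Fin n → ℝ) (c d : Fin 4 → ℝ) : 2 * br (comb Z x) (comb Z y) c d =
      ∑ a, ∑ b, minor x y a b * br (Z a) (Z b) c d := by
  have h1 : br (comb Z x) (comb Z y) c d = ∑ a, ∑ b, x a * y b * br (Z a) (Z b) c d := by
    simp only [comb, br_sum₁, br_sum₂, br_smul₁, br_smul₂, Finset.mul_sum]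
    rw [Finset.sum_comm]
    exact by congr! 2; ring
  have h2 : br (comb Z x) (comb Z y) c d = ∑ a, ∑ b, -(x b * y a * br (Z a) (Z b) c d) := by
    refine h1.trans (Finset.sum_comm.trans ?_)
    refine Finset.sum_congr rfl fun a _ => Finset.sum_congr rfl fun b _ => ?_
    rw [br_swap₁₂]; ring
  rw [two_mul]
  nth_rewrite 1 [h1]
  rw [h2, ← Finset.sum_add_distrib]
  refine Finset.sum_congr rfl fun a _ => ?_
  rw [← Finset.sum_add_distrib]
  exact Finset.sum_congr rfl fun b _ => by simp only [minor]; ring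

/-- Nonnegativity on increasing pairs gives nonnegativity of all terms. -/
theorem term_nonneg {x y : Fin n → ℝ} (hxy : ∀ a b, a < b → 0 ≤ minor x y a b) {σ : ℝ}
    {c d : Fin 4 → ℝ} {P : Fin n → Fin n → Prop} (hP : ∀ a b, P a b → P b a)
    (h : ∀ a b, a < b → P a b → 0 ≤ σ * br (Z a) (Z b) c d) (a b : Fin n) (hab : P a b) :
    0 ≤ σ * (minor x y a b * br (Z a) (Z b) c d) := by
  rcases lt_trichotomy a b with hlt | rfl | hlt
  · have := mul_nonneg (hxy a b hlt) (h a b hlt hab)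
    linarith
  · simp
  · have := mul_nonneg (hxy b a hlt) (h b a hlt (hP _ _ hab))
    rw [minor_swap, br_swap₁₂] at this
    linarith

theorem br_comb_eq_zero {x y : Fin n → ℝ} {c d : Fin 4 → ℝ}
    (h : ∀ a b, minor x y a b * br (Z a) (Z b) c d = 0) : br (comb Z x) (comb Z y) c d = 0 := by
  have := two_mul_br_comb (Z := Z) x y c d
  simp only [h, Finset.sum_const_zero] at this
  linarith

theorem br_comb_nonneg {x y : Fin n → ℝ} {c d : Fin 4 → ℝ} {σ : ℝ}
    (h : ∀ a b, 0 ≤ σ * (minor x y a b * br (Z a) (Z b) c d)) :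
    0 ≤ σ * br (comb Z x) (comb Z y) c d := by
  have h1 := two_mul_br_comb (Z := Z) x y c d
  have h2 : 0 ≤ ∑ a, ∑ b, σ * (minor x y a b * br (Z a) (Z b) c d) :=
    Finset.sum_nonneg fun a _ => Finset.sum_nonneg fun b _ => h a b
  simp only [← Finset.mul_sum] at h2
  rw [← h1] at h2
  linarith

theorem terms_eq_zero {x y : Fin n → ℝ} {c d : Fin 4 → ℝ} {σ : ℝ} (hσ : σ ≠ 0)
    (h : ∀ a b, 0 ≤ σ * (minor x y a b * br (Z a) (Z b) c d))
    (h0 : br (comb Z x) (comb Z y) c d = 0) (a b : Fin n) :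
    minor x y a b * br (Z a) (Z b) c d = 0 := by
  have h1 := two_mul_br_comb (Z := Z) x y c d
  have h2 : ∑ a, ∑ b, σ * (minor x y a b * br (Z a) (Z b) c d) = 0 := by
    simp only [← Finset.mul_sum]
    rw [← h1, h0]; ring
  rw [Finset.sum_eq_zero_iff_of_nonneg fun a _ => Finset.sum_nonneg fun b _ => h a b] at h2
  have h3 := h2 a (Finset.mem_univ _)
  rw [Finset.sum_eq_zero_iff_of_nonneg fun b _ => h a b] at h3
  exact (mul_eq_zero.1 (h3 b (Finset.mem_univ _))).resolve_left hσ

variable [NeZero n] [hn : Fact (4 ≤ n)] [hZ : PosConf ε Z]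
include ε

theorem consecutive_term_nonneg {x y : Fin n → ℝ}
    (hxy : ∀ a b, a < b → 0 ≤ minor x y a b) (k a b : Fin n) :
    0 ≤ ε * sgn k * (minor x y a b * br (Z a) (Z b) (Z k) (Z (k + 1))) := by
  refine term_nonneg hxy (P := fun _ _ => True) (fun _ _ _ => trivial) ?_ a b trivial
  intro a b hab _
  by_cases hd : a = k ∨ a = k + 1 ∨ b = k ∨ b = k + 1
  · rcases hd with rfl | rfl | rfl | rfl <;> simp
  · push Not at hd
    exact (hZ.consecutive hab hd.1 hd.2.1 hd.2.2.1 hd.2.2.2).le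

/-- On the amplituhedron the (twisted) brackets with consecutive rows are nonnegative. -/
theorem IsRep.consecutive_nonneg {x y : Fin n → ℝ}
    (hxy : ∀ a b, a < b → 0 ≤ minor x y a b) (k : Fin n) :
    0 ≤ ε * sgn k * br (comb Z x) (comb Z y) (Z k) (Z (k + 1)) :=
  br_comb_nonneg (consecutive_term_nonneg hxy k)

theorem PosConf.triple {a b c : Fin n} (hab : a ≠ b) (hac : a ≠ c)
    (hbc : b ≠ c) : ∃ d, br (Z a) (Z b) (Z c) (Z d) ≠ 0 := by
  obtain ⟨d, h1, h2, h3⟩ := exists_ne_three a b c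
  exact ⟨d, hZ.br_ne_zero hab hac h1.symm hbc h2.symm h3.symm⟩

theorem PosConf.triple_independent {a b c : Fin n} (hab : a ≠ b)
    (hac : a ≠ c) (hbc : b ≠ c) : LinearIndependent ℝ ![Z a, Z b, Z c] :=
  let ⟨_, hd⟩ := hZ.triple hab hac hbc
  linearIndependent_triple_of_br hd

theorem PosConf.pair_independent {a b : Fin n} (hab : a ≠ b) : LinearIndependent ℝ ![Z a, Z b] := by
  obtain ⟨c, h1, h2, -⟩ := exists_ne_three a b b
  obtain ⟨d, hd⟩ := hZ.triple hab h1.symm h2.symm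
  exact linearIndependent_pair_of_br hd

theorem supp_schubertL {W : Gr ℝ 4} {x y : Fin n → ℝ}
    (hr : IsRep Z W x y) (k : Fin n) : W ∈ schubertL (Z k) (Z (k + 1)) ↔
      ∀ a b, minor x y a b ≠ 0 → a = k ∨ a = k + 1 ∨ b = k ∨ b = k + 1 := by
  obtain ⟨hxy, hl, rfl⟩ := hr
  rw [mem_schubertL_lineOf hl (hZ.pair_independent (succ_ne k))]
  constructor
  · intro h0 a b hm
    by_contra! hd
    have h1 := terms_eq_zero (mul_ne_zero hZ.ne_zero (sgn_ne_zero k))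
      (consecutive_term_nonneg hxy k) h0 a b
    have hab : a ≠ b := by rintro rfl; simp [minor] at hm
    exact mul_ne_zero hm
      (hZ.br_ne_zero hab hd.1 hd.2.1 hd.2.2.1 hd.2.2.2 (succ_ne k)) h1
  · intro H
    refine br_comb_eq_zero fun a b => ?_
    by_cases hm : minor x y a b = 0
    · rw [hm, zero_mul]
    · rcases H a b hm with rfl | rfl | rfl | rfl <;> simp

/-- Lines through two consecutive boundary conditions. -/
theorem supp_consecutive {W : Gr ℝ 4} {x y : Fin n → ℝ}
    (hr : IsRep Z W x y) (i : Fin n) (h1 : W ∈ schubertL (Z (i - 1)) (Z i))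
    (h2 : W ∈ schubertL (Z i) (Z (i + 1))) (a b : Fin n) (hm : minor x y a b ≠ 0) :
    a = i ∨ b = i ∨ (a = i - 1 ∧ b = i + 1) ∨ (a = i + 1 ∧ b = i - 1) := by
  have h1' : W ∈ schubertL (Z (i - 1)) (Z (i - 1 + 1)) := by rwa [sub_add_cancel]
  have e1 := (supp_schubertL hr (i - 1)).1 h1' a b hm
  have e2 := (supp_schubertL hr i).1 h2 a b hm
  have := pred_ne_succ i
  by_contra! hcon
  rcases e1 with h | h | h | h <;> rcases e2 with h' | h' | h' | h' <;> grind

theorem supp_schubertV {W : Gr ℝ 4} {x y : Fin n → ℝ}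
    (hr : IsRep Z W x y) (i : Fin n) : W ∈ schubertV (Z i) ↔
      ∀ a b, minor x y a b ≠ 0 → a = i ∨ b = i := by
  constructor
  · intro hW a b hm
    have hne : Z i ≠ 0 := (hZ.pair_independent (succ_ne i)).ne_zero 0
    have h1 : W ∈ schubertL (Z (i - 1)) (Z i) := mem_schubertL_iff_exists.2
      ⟨Z i, Submodule.subset_span (by simp), hne, hW⟩
    have h2 : W ∈ schubertL (Z i) (Z (i + 1)) := mem_schubertL_iff_exists.2
      ⟨Z i, Submodule.subset_span (by simp), hne, hW⟩
    have H := supp_consecutive hr i h1 h2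
    by_contra! hcon
    have hm' : minor x y (i - 1) (i + 1) ≠ 0 := by
      rcases H a b hm with h | h | ⟨rfl, rfl⟩ | ⟨rfl, rfl⟩
      · exact absurd h hcon.1
      · exact absurd h hcon.2
      · exact hm
      · rw [minor_swap]; exact neg_ne_zero.2 hm
    obtain ⟨d, hd⟩ := hZ.triple (pred_ne_succ i) (pred_ne i) (succ_ne i).symm
    obtain ⟨hxy, hl, rfl⟩ := hr
    have h0 := (mem_schubertV_lineOf hl).1 hW (Z d)
    set τ := minor x y (i - 1) (i + 1) * br (Z (i - 1)) (Z (i + 1)) (Z i) (Z d) with hτ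
    have hτ0 : τ ≠ 0 := mul_ne_zero hm' hd
    refine hτ0 (terms_eq_zero hτ0 ?_ h0 (i - 1) (i + 1))
    intro a b
    by_cases hab : minor x y a b = 0
    · rw [hab, zero_mul, mul_zero]
    rcases H a b hab with rfl | rfl | ⟨rfl, rfl⟩ | ⟨rfl, rfl⟩
    · simp
    · simp
    · exact mul_self_nonneg _
    · rw [minor_swap, br_swap₁₂, neg_mul_neg]
      exact mul_self_nonneg _
  · intro H
    obtain ⟨hxy, hl, rfl⟩ := hr
    rw [mem_schubertV_lineOf]
    intro d
    refine br_comb_eq_zero fun a b => ?_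
    by_cases hm : minor x y a b = 0
    · rw [hm, zero_mul]
    · rcases H a b hm with rfl | rfl <;> simp

theorem PosConf.schubertP_eq (i : Fin n) :
    schubertP (Z (i - 1)) (Z i) (Z (i + 1)) = schubertL (Z (i - 1)) (Z i) ∩
      schubertL (Z (i - 1)) (Z (i + 1)) ∩ schubertL (Z i) (Z (i + 1)) :=
  _root_.schubertP_eq (hZ.triple_independent (pred_ne i) (pred_ne_succ i) (succ_ne i))
    (hZ.pair_independent (pred_ne i)) (hZ.pair_independent (pred_ne_succ i))
    (hZ.pair_independent (succ_ne i))

theorem supp_schubertP {W : Gr ℝ 4} {x y : Fin n → ℝ}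
    (hr : IsRep Z W x y) (i : Fin n) : W ∈ schubertP (Z (i - 1)) (Z i) (Z (i + 1)) ↔
      ∀ a b, minor x y a b ≠ 0 →
        (a = i - 1 ∨ a = i ∨ a = i + 1) ∧ (b = i - 1 ∨ b = i ∨ b = i + 1) := by
  rw [hZ.schubertP_eq]
  constructor
  · rintro ⟨⟨h1, h2⟩, h3⟩ a b hm
    have H := supp_consecutive hr i h1 h3
    by_contra hcon
    obtain ⟨c, hc, hc1, hc2⟩ : ∃ c, minor x y i c ≠ 0 ∧ c ≠ i - 1 ∧ c ≠ i + 1 := by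
      rcases H a b hm with rfl | rfl | ⟨rfl, rfl⟩ | ⟨rfl, rfl⟩
      · exact ⟨b, hm, by tauto, by tauto⟩
      · exact ⟨a, by rw [minor_swap]; exact neg_ne_zero.2 hm, by tauto, by tauto⟩
      · tauto
      · tauto
    have hci : c ≠ i := by rintro rfl; simp [minor] at hc
    have hpi := pred_ne i
    have hsi := succ_ne i
    have hps := pred_ne_succ i
    have h10 : minor x y (i - 1) c = 0 := by
      by_contra h0
      grind
    have h20 : minor x y (i + 1) c = 0 := by
      by_contra h0
      grind
    have hpm : minor x y (i - 1) (i + 1) = 0 := by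
      have h4 := minor_relation x y (i - 1) i (i + 1) c
      rw [h10, h20] at h4
      simpa [hc] using h4
    have H' : ∀ a b, minor x y a b ≠ 0 → a = i ∨ b = i := by
      intro a b hab
      rcases H a b hab with h | h | ⟨rfl, rfl⟩ | ⟨rfl, rfl⟩
      · exact .inl h
      · exact .inr h
      · exact absurd hpm hab
      · rw [minor_swap, hpm, neg_zero] at hab; exact absurd rfl hab
    obtain ⟨σ, hσ, hs⟩ := hZ.neighbors i
    obtain ⟨hxy, hl, rfl⟩ := hr
    have h0 := (mem_schubertL_lineOf hl (hZ.pair_independent hps)).1 h2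
    have := terms_eq_zero hσ (fun a b => by
      by_cases hab : minor x y a b = 0
      · simp [hab]
      · exact term_nonneg hxy (P := fun a b => a = i ∨ b = i) (fun _ _ => Or.symm)
          hs a b (H' a b hab)) h0 i c
    exact mul_ne_zero hc (hZ.br_ne_zero hci.symm hpi.symm hsi hc1 hc2 hps) this
  · intro H
    obtain ⟨hxy, hl, rfl⟩ := hr
    rw [Set.mem_inter_iff, Set.mem_inter_iff,
      mem_schubertL_lineOf hl (hZ.pair_independent (pred_ne i)),
      mem_schubertL_lineOf hl (hZ.pair_independent (pred_ne_succ i)),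
      mem_schubertL_lineOf hl (hZ.pair_independent (succ_ne i))]
    refine ⟨⟨?_, ?_⟩, ?_⟩ <;>
    · refine br_comb_eq_zero fun a b => ?_
      by_cases hm : minor x y a b = 0
      · rw [hm, zero_mul]
      · obtain ⟨ha, hb⟩ := H a b hm
        rcases ha with rfl | rfl | rfl <;> rcases hb with hb | hb | hb <;> simp [hb]

end Representation

section Rotation
variable {n : ℕ} [NeZero n] [hn : Fact (4 ≤ n)] {Z : Matrix (Fin n) (Fin 4) ℝ}

theorem amplituhedron_rotZ : amplituhedron (rotZ Z) = amplituhedron Z := by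
  ext W
  rw [mem_amplituhedron_iff, mem_amplituhedron_iff]
  constructor
  · rintro ⟨x, y, hxy, hl, rfl⟩
    have hc : ∀ x : Fin n → ℝ, comb Z (fun a => sgn (a - 1) * x (a - 1)) = comb (rotZ Z) x := by
      intro x
      simp only [comb, rotZ]
      rw [← Equiv.sum_comp (Equiv.addRight (1 : Fin n))]
      refine Finset.sum_congr rfl fun a _ => ?_
      simp [smul_smul, mul_comm]
    refine ⟨fun a => sgn (a - 1) * x (a - 1), fun a => sgn (a - 1) * y (a - 1), ?_, ?_⟩
    · intro a b hab
      have : minor (fun a => sgn (a - 1) * x (a - 1)) (fun a => sgn (a - 1) * y (a - 1)) a b =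
          sgn (a - 1) * sgn (b - 1) * minor x y (a - 1) (b - 1) := by simp only [minor]; ring
      rw [this]
      have ha := val_pred a
      have hb := val_pred b
      have hbn := b.2
      rw [if_neg (by omega)] at hb
      rw [sgn_of_lt (k := b - 1) (by omega)]
      split_ifs at ha with h0
      · rw [sgn_last (by omega), minor_swap]
        have := hxy (b - 1) (a - 1) (by simp only [Fin.lt_def]; omega)
        linarith
      · rw [sgn_of_lt (by omega)]
        have := hxy (a - 1) (b - 1) (by simp only [Fin.lt_def]; omega)
        linarith
    · simp only [hc]
      exact ⟨hl, trivial⟩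
  · rintro ⟨x, y, hxy, hl, rfl⟩
    have hc : ∀ x : Fin n → ℝ, comb (rotZ Z) (fun a => sgn a * x (a + 1)) = comb Z x := by
      intro x
      simp only [comb, rotZ]
      rw [← Equiv.sum_comp (Equiv.addRight (1 : Fin n)) (fun a => x a • Z a)]
      refine Finset.sum_congr rfl fun a _ => ?_
      rw [smul_smul, mul_right_comm, sgn_mul_self]
      simp
    refine ⟨fun a => sgn a * x (a + 1), fun a => sgn a * y (a + 1), ?_, ?_⟩
    · intro a b hab
      have : minor (fun a => sgn a * x (a + 1)) (fun a => sgn a * y (a + 1)) a b =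
          sgn a * sgn b * minor x y (a + 1) (b + 1) := by simp only [minor]; ring
      rw [this]
      have ha := val_succ a
      have hb := val_succ b
      have hbn := b.2
      simp only [Fin.lt_def] at hab
      rw [if_neg (by omega)] at ha
      rw [sgn_of_lt (k := a) (by omega)]
      split_ifs at hb with h0
      · rw [sgn_last (by omega), minor_swap]
        have := hxy (b + 1) (a + 1) (by simp only [Fin.lt_def]; omega)
        linarith
      · rw [sgn_of_lt (by omega)]
        have := hxy (a + 1) (b + 1) (by simp only [Fin.lt_def]; omega)
        linarith
    · simp only [hc]
      exact ⟨hl, trivial⟩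

theorem schubertL_smul {𝕜 : Type*} [Field 𝕜] {s t : 𝕜} (hs : s ≠ 0) (ht : t ≠ 0)
    (a b : Fin 4 → 𝕜) : schubertL (s • a) (t • b) = schubertL a b := by
  have : Submodule.span 𝕜 {s • a, t • b} = Submodule.span 𝕜 {a, b} := by
    rw [Submodule.span_insert, Submodule.span_insert,
      Submodule.span_singleton_smul_eq hs.isUnit, Submodule.span_singleton_smul_eq ht.isUnit]
  simp only [schubertL, this]

theorem schubertV_smul {𝕜 : Type*} [Field 𝕜] {s : 𝕜} (hs : s ≠ 0) (a : Fin 4 → 𝕜) :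
    schubertV (s • a) = schubertV a := by
  ext W
  exact Submodule.smul_mem_iff _ hs

theorem schubertP_smul {𝕜 : Type*} [Field 𝕜] {r s t : 𝕜} (hr : r ≠ 0) (hs : s ≠ 0) (ht : t ≠ 0)
    (a b c : Fin 4 → 𝕜) : schubertP (r • a) (s • b) (t • c) = schubertP a b c := by
  have : Submodule.span 𝕜 {r • a, s • b, t • c} = Submodule.span 𝕜 {a, b, c} := by
    simp only [Submodule.span_insert, Submodule.span_singleton_smul_eq hs.isUnit,
      Submodule.span_singleton_smul_eq hr.isUnit, Submodule.span_singleton_smul_eq ht.isUnit]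
  simp only [schubertP, this]

theorem toComplex_rotZ (j : Fin n) :
    toComplex (rotZ Z j) = (sgn j : ℂ) • toComplex (Z (j + 1)) := by
  ext i; simp [toComplex, rotZ]

theorem sgn_ne_zero' (j : Fin n) : (sgn j : ℂ) ≠ 0 := by exact_mod_cast sgn_ne_zero j

theorem type3I_rotZ (i : Fin n) : type3I (rotZ Z) i = type3I Z (i + 1) := by
  simp only [type3I, toComplex_rotZ, schubertL_smul (sgn_ne_zero' _) (sgn_ne_zero' _)]

theorem type2I_rotZ (i : Fin n) : type2I (rotZ Z) i = type2I Z (i + 1) := by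
  simp only [type2I, toComplex_rotZ, schubertV_smul (sgn_ne_zero' _)]

theorem type2II_rotZ (i : Fin n) : type2II (rotZ Z) i = type2II Z (i + 1) := by
  simp only [type2II, toComplex_rotZ,
    schubertP_smul (sgn_ne_zero' _) (sgn_ne_zero' _) (sgn_ne_zero' _),
    sub_add_cancel, add_sub_cancel_right]

theorem type2III_rotZ (i j : Fin n) : type2III (rotZ Z) i j = type2III Z (i + 1) (j + 1) :=
  congrArg₂ (· ∩ ·) (type3I_rotZ i) (type3I_rotZ j)

theorem type1I_rotZ (i : Fin n) : type1I (rotZ Z) i = type1I Z (i + 1) := by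
  simp only [type1I, toComplex_rotZ, schubertV_smul (sgn_ne_zero' _),
    schubertL_smul (sgn_ne_zero' _) (sgn_ne_zero' _), sub_add_cancel, add_sub_cancel_right]

theorem type1II_rotZ (i j : Fin n) : type1II (rotZ Z) i j = type1II Z (i + 1) (j + 1) :=
  congrArg₂ (· ∩ ·) (type2I_rotZ i) (type3I_rotZ j)

theorem type0I_rotZ (i j : Fin n) : type0I (rotZ Z) i j = type0I Z (i + 1) (j + 1) :=
  congrArg₂ (· ∩ ·) (type2I_rotZ i) (type2I_rotZ j)

end Rotation

variable {n : ℕ} [NeZero n] [hn : Fact (4 ≤ n)] {ε : ℝ} {Z : Matrix (Fin n) (Fin 4) ℝ}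
  [hZ : PosConf ε Z] {S T : Set (Gr ℂ 4)} {a b i j : Fin n}

section RealPoints
include ε

theorem realPoints_type3I (i : Fin n) : realPoints (type3I Z i) = schubertL (Z i) (Z (i + 1)) := by
  ext W; exact complexify_mem_schubertL (hZ.pair_independent (succ_ne i))

theorem realPoints_type2I (i : Fin n) : realPoints (type2I Z i) = schubertV (Z i) := by
  ext W; exact complexify_mem_schubertV

theorem realPoints_type2II (i : Fin n) :
    realPoints (type2II Z i) = schubertP (Z (i - 1)) (Z i) (Z (i + 1)) := by
  ext W
  obtain ⟨d, hd⟩ := hZ.triple (pred_ne i) (pred_ne_succ i) (succ_ne i)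
  exact complexify_mem_schubertP hd

end RealPoints

/-- The point in which a line meets a plane. -/
theorem plane_section_mem (u v x y z : Fin 4 → ℝ) (r : ℝ) :
    (r * br u v y z) • x + (r * br u v z x) • y + (r * br u v x y) • z ∈
      Submodule.span ℝ {u, v} := by
  have h := br_cramer u x y z v
  rw [show br u x v z = br u v z x by simp only [br]; ring,
    show br u x y v = br u v x y by simp only [br]; ring] at h
  refine Submodule.mem_span_pair.2 ⟨-(r * br v x y z), r * br u x y z, ?_⟩
  rw [mul_smul r (br u x y z), h]
  module

section OffBoundary
include ε

theorem comb_add (x y : Fin n → ℝ) : comb Z (x + y) = comb Z x + comb Z y := by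
  simp only [comb, Pi.add_apply, add_smul, Finset.sum_add_distrib]

theorem comb_single (i : Fin n) (r : ℝ) : comb Z (Pi.single i r) = r • Z i := by
  simp only [comb, Pi.single_apply, ite_smul, zero_smul]
  simp

/-- A line with nonnegative consecutive brackets for which the sequence of brackets with `Z_0 Z_j`
takes a negative value lies in the amplituhedron. -/
theorem mem_amplituhedron_of_signs {u v : Fin 4 → ℝ}
    (h : LinearIndependent ℝ ![u, v])
    (hE : ∀ k, 0 ≤ ε * sgn k * br u v (Z k) (Z (k + 1))) {j : Fin n}
    (hj : ε * br u v (Z 0) (Z j) < 0) : lineOf u v h ∈ amplituhedron Z := by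
  have h1 := val_one (n := n)
  have h1s : 0 ≤ ε * br u v (Z 0) (Z 1) := by
    have := hE 0
    rw [sgn_of_lt (by simp; omega), zero_add] at this
    linarith
  let L : Fin n := ⟨n - 1, by omega⟩
  have hL1 : L + 1 = 0 := by
    apply Fin.ext; rw [val_succ, if_pos (by simp [L]; omega)]; simp
  have hLs : 0 ≤ ε * br u v (Z 0) (Z L) := by
    have := hE L
    rw [sgn_last (by simp [L]; omega), hL1, br_swap₃₄] at this
    linarith
  have hj1 : 1 < j.val := by
    by_contra hcon
    have : j = 0 ∨ j = 1 := by
      have : j.val = 0 ∨ j.val = 1 := by omega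
      rcases this with h0 | h0
      · left; apply Fin.ext; simpa using h0
      · right; apply Fin.ext; omega
    rcases this with rfl | rfl
    · simp at hj
    · linarith
  -- sign changes before and after `j`
  obtain ⟨i, hi1, hij, hγ, hin, hi'⟩ := exists_step_fin
    (P := fun m => 0 ≤ ε * br u v (Z 0) (Z m)) (a := 1) (b := j)
    (by rw [Fin.le_def, h1]; omega) h1s (not_le.2 hj)
  obtain ⟨k, hkj, hkL, hγ', hkn, hk'⟩ := exists_step_fin
    (P := fun m => ε * br u v (Z 0) (Z m) < 0) (a := j) (b := L)
    (by rw [Fin.le_def]; simp only [L]; omega) hj (not_lt.2 hLs)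
  have hβ : 0 ≤ ε * br u v (Z (i + 1)) (Z 0) ∧ 0 < ε * br u v (Z (i + 1)) (Z 0) := by
    rw [br_swap₃₄]
    constructor <;> linarith
  have hα : 0 ≤ ε * br u v (Z i) (Z (i + 1)) := by
    have := hE i
    rw [sgn_of_lt (by omega)] at this; linarith
  have hα' : 0 ≤ ε * br u v (Z k) (Z (k + 1)) := by
    have := hE k
    rw [sgn_of_lt (by omega)] at this; linarith
  set α := ε * br u v (Z i) (Z (i + 1)) with hα_def
  set β := ε * br u v (Z (i + 1)) (Z 0) with hβ_def
  set γ := ε * br u v (Z 0) (Z i) with hγ_def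
  set α' := -ε * br u v (Z k) (Z (k + 1)) with hα'_def
  set β' := -ε * br u v (Z (k + 1)) (Z 0) with hβ'_def
  set γ' := -ε * br u v (Z 0) (Z k) with hγ'_def
  have hβ'0 : 0 ≤ β' := by rw [hβ'_def, br_swap₃₄]; linarith
  have hγ'0 : 0 < γ' := by rw [hγ'_def]; linarith
  have hα'0 : α' ≤ 0 := by rw [hα'_def]; linarith
  let x : Fin n → ℝ := Pi.single 0 α + Pi.single i β + Pi.single (i + 1) γ
  let y : Fin n → ℝ := Pi.single 0 α' + Pi.single k β' + Pi.single (k + 1) γ'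
  have hx : comb Z x = α • Z 0 + β • Z i + γ • Z (i + 1) := by
    simp only [x, comb_add, comb_single]
  have hy : comb Z y = α' • Z 0 + β' • Z k + γ' • Z (k + 1) := by
    simp only [y, comb_add, comb_single]
  have hxm : comb Z x ∈ (lineOf u v h).toSubmodule := by
    rw [hx]; exact plane_section_mem u v (Z 0) (Z i) (Z (i + 1)) ε
  have hym : comb Z y ∈ (lineOf u v h).toSubmodule := by
    rw [hy]; exact plane_section_mem u v (Z 0) (Z k) (Z (k + 1)) (-ε)
  have hpos : 0 < -(ε * br (comb Z x) (comb Z y) (Z 0) (Z k)) := by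
    have h0v : ((0 : Fin n) : ℕ) = 0 := by simp
    have h0i : (0 : Fin n) < i := by omega
    have hik : i < k := by omega
    have hkk : k < k + 1 := by omega
    have t1 : 0 < β * γ' * (ε * br (Z 0) (Z i) (Z k) (Z (k + 1))) :=
      mul_pos (mul_pos hβ.2 hγ'0) (hZ.1 _ _ _ _ h0i hik hkk)
    have t2 : 0 ≤ γ * γ' * (ε * br (Z 0) (Z (i + 1)) (Z k) (Z (k + 1))) := by
      by_cases hik' : i + 1 = k
      · rw [hik']; simp
      · refine mul_nonneg (mul_nonneg hγ hγ'0.le) (hZ.1 _ _ _ _ ?_ ?_ hkk).le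
        · simp only [Fin.lt_def, hi']; simp
        · have : (i + 1).val ≠ k.val := fun h => hik' (Fin.ext h)
          omega
    rw [hx, hy]
    have e : br (α • Z 0 + β • Z i + γ • Z (i + 1)) (α' • Z 0 + β' • Z k + γ' • Z (k + 1))
        (Z 0) (Z k) = -(β * γ' * br (Z 0) (Z i) (Z k) (Z (k + 1)))
          - γ * γ' * br (Z 0) (Z (i + 1)) (Z k) (Z (k + 1)) := by
      simp only [br, Pi.add_apply, Pi.smul_apply, smul_eq_mul]; ring
    rw [e]; linarith
  have hl : LinearIndependent ℝ ![comb Z x, comb Z y] :=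
    linearIndependent_pair_of_br (c := Z 0) (d := Z k) (by
      intro h0; rw [h0] at hpos; simp at hpos)
  rw [mem_amplituhedron_iff]
  refine ⟨x, y, fun a b hab => ?_, hl, lineOf_eq_of_mem hl hxm hym⟩
  have hx0 : ∀ a, 0 ≤ x a := fun a => by
    simp only [x, Pi.add_apply, Pi.single_apply]
    have := hβ.1
    split_ifs <;> positivity
  have hy0 : ∀ a, a ≠ 0 → 0 ≤ y a := fun a ha => by
    simp only [y, Pi.add_apply, Pi.single_apply, if_neg ha]
    split_ifs <;> positivity
  have hb0 : b ≠ 0 := by rintro rfl; simp at hab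
  have p1 := mul_nonneg (hx0 a) (hy0 b hb0)
  have p2 : x b * y a ≤ 0 := by
    by_cases ha : a = 0
    · subst ha
      have : y 0 ≤ 0 := by
        have e1 : (0 : Fin n) ≠ k := by
          intro h0; have := congrArg Fin.val h0; simp at this; omega
        have e2 : (0 : Fin n) ≠ k + 1 := by
          intro h0; have := congrArg Fin.val h0; rw [hk'] at this; simp at this
        simp only [y, Pi.add_apply, Pi.single_apply, if_neg e1, if_neg e2]
        simpa using hα'0
      exact mul_nonpos_of_nonneg_of_nonpos (hx0 b) this
    · apply le_of_eq
      simp only [Fin.lt_def] at hab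
      by_cases hb : b.val ≤ i.val + 1
      · have e1 : a ≠ k := by rintro rfl; omega
        have e2 : a ≠ k + 1 := by rintro rfl; rw [hk'] at hab; omega
        simp [y, ha, e1, e2]
      · have e1 : b ≠ i := by rintro rfl; omega
        have e2 : b ≠ i + 1 := by rintro rfl; rw [hi'] at hb; omega
        simp [x, hb0, e1, e2]
  simp only [minor]; linarith

/-- On the complement of the boundary hyperplane sections some bracket with `Z_0` is negative. -/
theorem IsRep.exists_neg {W : Gr ℝ 4} {x y : Fin n → ℝ}
    (hr : IsRep Z W x y) (hW : ∀ k, W ∉ schubertL (Z k) (Z (k + 1))) :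
    ∃ j, ε * br (comb Z x) (comb Z y) (Z 0) (Z j) < 0 := by
  by_contra! hs
  have hε := hZ.ne_zero
  have hr' := hr
  obtain ⟨hxy, hl, hWe⟩ := hr'
  have hE : ∀ k, 0 < ε * sgn k * br (comb Z x) (comb Z y) (Z k) (Z (k + 1)) := by
    intro k
    refine lt_of_le_of_ne (IsRep.consecutive_nonneg hxy k) fun h0 => hW k ?_
    rw [hWe, mem_schubertL_lineOf hl (hZ.pair_independent (succ_ne k))]
    exact (mul_eq_zero.1 h0.symm).resolve_left (mul_ne_zero hε (sgn_ne_zero k))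
  set s : Fin n → ℝ := fun j => ε * br (comb Z x) (comb Z y) (Z 0) (Z j) with hs_def
  have h1 := val_one (n := n)
  have hs1 : 0 < s 1 := by
    have := hE 0
    rw [sgn_of_lt (by simp; omega), zero_add] at this
    simp only [hs_def]; linarith
  let L : Fin n := ⟨n - 1, by omega⟩
  have hL1 : L + 1 = 0 := by
    apply Fin.ext; rw [val_succ, if_pos (by simp [L]; omega)]; simp
  have hbr : ∀ z : Fin n → ℝ, ε * br (comb Z x) (comb Z y) (Z 0) (comb Z z) = ∑ j, z j * s j := by
    intro z
    have : ∀ w, br (comb Z x) (comb Z y) (Z 0) w = br w (comb Z y) (comb Z x) (Z 0) := by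
      intro w; simp only [br]; ring
    simp only [hs_def, this]
    rw [comb, br_sum₁, Finset.mul_sum]
    refine Finset.sum_congr rfl fun j _ => ?_
    rw [br_smul₁]; ring
  have hsum : ∀ i, ∑ j, s j * minor x y i j = 0 := by
    intro i
    have e1 := hbr x
    have e2 := hbr y
    have : ∑ j, s j * minor x y i j = x i * ∑ j, y j * s j - y i * ∑ j, x j * s j := by
      rw [Finset.mul_sum, Finset.mul_sum, ← Finset.sum_sub_distrib]
      exact Finset.sum_congr rfl fun j _ => by simp only [minor]; ring
    rw [this, ← e1, ← e2]; simp
  have hpar : ∀ m : ℕ, ∀ a : Fin n, a.val = m → (a = 0 ∨ 0 < s a) → ∀ b, 0 < s b →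
      minor x y a b = 0 := by
    intro m
    induction m using Nat.strong_induction_on with
    | _ m ih =>
      intro a ham ha b hb
      have hnn : ∀ j ∈ Finset.univ, 0 ≤ s j * minor x y a j := by
        intro j _
        rcases lt_trichotomy a j with hlt | rfl | hlt
        · exact mul_nonneg (hs j) (hxy a j hlt)
        · simp [minor]
        · rcases (hs j).lt_or_eq with hj | hj
          · have ha' : 0 < s a := by
              rcases ha with rfl | ha
              · simp at hlt
              · exact ha
            have := ih j.val (by simp only [Fin.lt_def] at hlt; omega) j rfl (.inr hj) a ha'
            rw [minor_swap, this]; simp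
          · have : s j = 0 := hj.symm
            rw [this]; simp
      have := (Finset.sum_eq_zero_iff_of_nonneg hnn).1 (hsum a) b (Finset.mem_univ _)
      exact (mul_eq_zero.1 this).resolve_left hb.ne'
  have hadj : ∀ j k : Fin n, j ≠ 0 → s j = 0 → s k = 0 → j < k → k.val = j.val + 1 := by
    intro j k hj0 hj hk hjk
    by_contra hne
    let m : Fin n := ⟨j.val + 1, by have := k.2; omega⟩
    have h0v : ((0 : Fin n) : ℕ) = 0 := by simp
    have hj1' : j.val ≠ 1 := fun h => by
      have : j = 1 := by omega
      rw [this] at hj; linarith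
    have c := br_cramer (Z 1) (Z 0) (Z j) (Z k) (Z m)
    have c' := congrArg (fun w => ε * br (comb Z x) (comb Z y) (Z 0) w) c
    simp only [br_add₄, br_smul₄] at c'
    have q1 := hZ.1 0 1 j k (by omega)
      (by omega) hjk
    have q2 := hZ.1 0 j m k (by omega)
      (by simp only [Fin.lt_def, m]; omega) (by simp only [Fin.lt_def, m]; omega)
    have g1 : br (Z 1) (Z 0) (Z j) (Z k) = -br (Z 0) (Z 1) (Z j) (Z k) := br_swap₁₂ _ _ _ _
    have g2 : br (Z m) (Z 0) (Z j) (Z k) = br (Z 0) (Z j) (Z m) (Z k) := by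
      simp only [br]; ring
    have hsm := hs m
    have hj' : ε * br (comb Z x) (comb Z y) (Z 0) (Z j) = 0 := hj
    have hk' : ε * br (comb Z x) (comb Z y) (Z 0) (Z k) = 0 := hk
    rw [br_self₃₄, g1, g2] at c'
    have c2 : -(ε * br (Z 0) (Z 1) (Z j) (Z k)) * s m = (ε * br (Z 0) (Z j) (Z m) (Z k)) * s 1 := by
      linear_combination ε * c' + ε * br (Z 1) (Z 0) (Z m) (Z k) * hj' +
        ε * br (Z 1) (Z 0) (Z j) (Z m) * hk'
    have := mul_pos q2 hs1
    have := mul_nonneg q1.le hsm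
    linarith
  obtain ⟨c, hc⟩ : ∃ c : Fin n, ∀ j, j ≠ 0 → s j = 0 → j = c ∨ j = c + 1 := by
    by_cases hex : ∃ j, j ≠ 0 ∧ s j = 0
    · classical
      obtain ⟨c, ⟨hc0, hcs⟩, hmin⟩ : ∃ c, (c ≠ 0 ∧ s c = 0) ∧ ∀ j, j ≠ 0 ∧ s j = 0 → c ≤ j := by
        obtain ⟨c, hc, hm⟩ := (Finset.univ.filter fun j => j ≠ 0 ∧ s j = 0).exists_minimal
          (by obtain ⟨j, hj⟩ := hex; exact ⟨j, by simpa using hj⟩)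
        simp only [Finset.mem_filter, Finset.mem_univ, true_and] at hc hm
        refine ⟨c, hc, fun j hj => ?_⟩
        rcases le_total c j with h | h
        · exact h
        · exact hm hj h
      refine ⟨c, fun j hj0 hj => ?_⟩
      rcases (hmin j ⟨hj0, hj⟩).lt_or_eq with hlt | heq
      · right
        apply Fin.ext
        have := hadj c j hc0 hcs hj hlt
        have h2 := j.2
        rw [val_succ, if_neg (by omega), this]
      · left; exact heq.symm
    · push Not at hex
      exact ⟨0, fun j hj0 hj => absurd hj (hex j hj0)⟩
  refine hW c ((supp_schubertL hr c).2 fun a b hm => ?_)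
  by_contra! hcon
  have key : ∀ a, a ≠ c → a ≠ c + 1 → a = 0 ∨ 0 < s a := by
    intro a h1 h2
    by_cases h0 : a = 0
    · exact .inl h0
    · right
      refine lt_of_le_of_ne (hs a) fun h => ?_
      rcases hc a h0 h.symm with h | h
      · exact h1 h
      · exact h2 h
  rcases key a hcon.1 hcon.2.1 with ha | ha
  · rcases key b hcon.2.2.1 hcon.2.2.2 with hb | hb
    · rw [ha, hb] at hm; simp [minor] at hm
    · exact hm (hpar _ a rfl (.inl ha) b hb)
  · rcases key b hcon.2.2.1 hcon.2.2.2 with hb | hb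
    · rw [minor_swap, hpar _ b rfl (.inl hb) a ha] at hm; simp at hm
    · exact hm (hpar _ a rfl (.inr ha) b hb)

/-- The linear form `q ↦ ± ⟨q, Z_k Z_{k+1}⟩`, nonnegative on the amplituhedron. -/
noncomputable def consForm (ε : ℝ) (Z : Matrix (Fin n) (Fin 4) ℝ) (k : Fin n) :
    (Fin 4 → Fin 4 → ℝ) →ₗ[ℝ] ℝ := (ε * sgn k) • brL (Z k) (Z (k + 1))

theorem consForm_pl (k : Fin n) (u v : Fin 4 → ℝ) :
    consForm ε Z k (pl u v) = ε * sgn k * br u v (Z k) (Z (k + 1)) := by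
  simp [consForm, brL_pl]

theorem consForm_eq_zero_iff (k : Fin n) {u v : Fin 4 → ℝ}
    (h : LinearIndependent ℝ ![u, v]) :
    consForm ε Z k (pl u v) = 0 ↔ lineOf u v h ∈ schubertL (Z k) (Z (k + 1)) := by
  rw [mem_schubertL_lineOf h (hZ.pair_independent (succ_ne k)), consForm_pl]
  simp [hZ.ne_zero, sgn_ne_zero]

/-- A point of the amplituhedron off the hyperplane sections is an interior point. -/
theorem mem_interior_amplituhedron {W : Gr ℝ 4}
    (hA : W ∈ amplituhedron Z) (hW : ∀ k, W ∉ schubertL (Z k) (Z (k + 1))) :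
    W ∈ interior (amplituhedron Z) := by
  obtain ⟨x, y, hr⟩ := mem_amplituhedron_iff.1 hA
  obtain ⟨j, hj⟩ := hr.exists_neg hW
  let f : Option (Fin n) → (Fin 4 → Fin 4 → ℝ) →ₗ[ℝ] ℝ := fun o =>
    o.elim ((-ε) • brL (Z 0) (Z j)) (consForm ε Z)
  refine mem_interior.2 ⟨sameSign f, ?_, isOpen_sameSign f, ?_⟩
  · intro U hU
    obtain ⟨p, q, h, rfl, hpos⟩ := exists_pos_of_mem_sameSign' hU
    refine mem_amplituhedron_of_signs h (fun k => ?_) (j := j) ?_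
    · have := hpos (some k)
      simp only [f, Option.elim] at this
      exact this.le
    · have := hpos none
      simp only [f, Option.elim, LinearMap.smul_apply, smul_eq_mul, brL_pl] at this
      linarith
  · obtain ⟨hxy, hl, rfl⟩ := hr
    have hpos : ∀ o, 0 < f o (pl (comb Z x) (comb Z y)) := by
      intro o
      rcases o with _ | k
      · simp only [f, Option.elim, LinearMap.smul_apply, smul_eq_mul, brL_pl]; linarith
      · simp only [f, Option.elim]
        refine lt_of_le_of_ne ?_ fun h0 => hW k ((consForm_eq_zero_iff k hl).1 h0.symm)
        rw [consForm_pl]; exact IsRep.consecutive_nonneg hxy k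
    exact lineOf_mem_sameSign.2 fun i j => mul_pos (hpos i) (hpos j)

end OffBoundary

theorem eventually_lineOf_mem {X : Type*} [TopologicalSpace X] {O : Set (Gr ℝ 4)} (hO : IsOpen O)
    {p q : X → Fin 4 → ℝ} (hp : Continuous p) (hq : Continuous q) {x₀ : X}
    {h : LinearIndependent ℝ ![p x₀, q x₀]} (hm : lineOf (p x₀) (q x₀) h ∈ O) :
    ∃ N, IsOpen N ∧ x₀ ∈ N ∧ ∀ x ∈ N, ∃ h', lineOf (p x) (q x) h' ∈ O := by
  have hpl : Continuous fun x => pl (p x) (q x) := by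
    refine continuous_pi fun a => continuous_pi fun b => ?_
    simp only [pl]
    fun_prop
  have hX : IsOpen {x | pl (p x) (q x) ≠ 0} := isOpen_ne_fun hpl continuous_const
  let W : {x | pl (p x) (q x) ≠ 0} → Gr ℝ 4 := fun x =>
    lineOf (p x.1) (q x.1) (linearIndependent_of_pl_ne_zero x.2)
  have hW : Continuous W := continuous_of_pl (hpl.comp continuous_subtype_val)
    fun x => ⟨_, _, _, rfl, rfl⟩
  refine ⟨Subtype.val '' (W ⁻¹' O), hX.isOpenMap_subtype_val _ (hO.preimage hW),
    ⟨⟨x₀, pl_ne_zero h⟩, hm, rfl⟩, ?_⟩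
  rintro _ ⟨x, hx, rfl⟩
  exact ⟨_, hx⟩

theorem exists_re_im (q : Fin 4 → ℂ) : ∃ q₁ q₂ : Fin 4 → ℝ,
    q = toComplex q₁ + Complex.I • toComplex q₂ := by
  refine ⟨fun k => (q k).re, fun k => (q k).im, ?_⟩
  ext k
  simp only [toComplex, Pi.add_apply, Pi.smul_apply, smul_eq_mul]
  rw [mul_comm]; exact (Complex.re_add_im _).symm

section Boundary
include ε

theorem consForm_mul_nonneg {u v : Fin 4 → ℝ}
    {h : LinearIndependent ℝ ![u, v]} (hA : lineOf u v h ∈ amplituhedron Z) (j k : Fin n) :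
    0 ≤ consForm ε Z j (pl u v) * consForm ε Z k (pl u v) := by
  obtain ⟨x, y, hxy, hl, hW⟩ := mem_amplituhedron_iff.1 hA
  obtain ⟨c, hc, he⟩ := lineOf_eq_iff.1 hW.symm
  have hj := IsRep.consecutive_nonneg (Z := Z) hxy j
  have hk := IsRep.consecutive_nonneg (Z := Z) hxy k
  rw [← consForm_pl] at hj hk
  rw [he, map_smul, map_smul, smul_eq_mul, smul_eq_mul]
  have := mul_nonneg (mul_nonneg hj hk) (mul_self_nonneg c)
  linarith

/-- The forms whose common strict positivity cuts out, in the real points of the divisor of lines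
meeting `Z_0 Z_1`, an open subset of the amplituhedron. -/
noncomputable def divisorForms (ε : ℝ) (Z : Matrix (Fin n) (Fin 4) ℝ) (k : Fin n) :
    (Fin 4 → Fin 4 → ℝ) →ₗ[ℝ] ℝ := if k = 0 then (-ε) • brL (Z 0) (Z 2) else consForm ε Z k

theorem divisorForms_zero_pl (u v : Fin 4 → ℝ) :
    divisorForms ε Z 0 (pl u v) = -(ε * br u v (Z 0) (Z 2)) := by
  simp [divisorForms, brL_pl]

theorem divisorForms_of_ne {k : Fin n} (hk : k ≠ 0) : divisorForms ε Z k = consForm ε Z k := by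
  simp [divisorForms, hk]

theorem mem_amplituhedron_of_divisorForms {W : Gr ℝ 4}
    (hW : W ∈ sameSign (divisorForms ε Z)) (h0 : W ∈ schubertL (Z 0) (Z 1)) :
    W ∈ amplituhedron Z := by
  obtain ⟨p, q, h, rfl, hpos⟩ := exists_pos_of_mem_sameSign' hW
  refine mem_amplituhedron_of_signs h (fun k => ?_) (j := 2) ?_
  · by_cases hk : k = 0
    · subst hk
      rw [zero_add, (mem_schubertL_lineOf h
        (by simpa using hZ.pair_independent (succ_ne 0))).1 h0, mul_zero]
    · have := hpos k
      rw [divisorForms_of_ne hk, consForm_pl] at this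
      exact this.le
  · have := hpos 0
    rw [divisorForms_zero_pl] at this
    linarith

theorem not_mem_interior_of_divisorForms {W : Gr ℝ 4}
    (hW : W ∈ sameSign (divisorForms ε Z)) (h0 : W ∈ schubertL (Z 0) (Z 1)) :
    W ∉ interior (amplituhedron Z) := by
  intro hint
  have h1 := val_one (n := n)
  have h10 : (1 : Fin n) ≠ 0 := fun h => by
    have h0v : ((0 : Fin n) : ℕ) = 0 := by simp
    omega
  obtain ⟨p, hps, hp0, hpW⟩ := mem_schubertL_iff_exists.1 h0
  obtain ⟨q, h, rfl, hpos⟩ := exists_pos_of_mem_sameSign hW hpW hp0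
  have hl01 : LinearIndependent ℝ ![Z 0, Z 1] := by
    simpa using hZ.pair_independent (succ_ne 0)
  have hc1 := hpos 1
  rw [divisorForms_of_ne h10] at hc1
  have hq : q ∉ Submodule.span ℝ {Z 0, Z 1} := by
    intro hq
    obtain ⟨a, b, rfl⟩ := Submodule.mem_span_pair.1 hps
    obtain ⟨c, d, rfl⟩ := Submodule.mem_span_pair.1 hq
    rw [consForm_pl, br_lin_comb] at hc1
    simp at hc1
  obtain ⟨w, hw⟩ := exists_br_ne_zero hl01 hq
  have hw' : consForm ε Z 0 (pl w q) ≠ 0 := by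
    rw [consForm_pl, zero_add]
    refine mul_ne_zero (mul_ne_zero hZ.ne_zero (sgn_ne_zero 0)) ?_
    have : br w q (Z 0) (Z 1) = -br (Z 0) (Z 1) q w := by simp only [br]; ring
    rw [this]; exact neg_ne_zero.2 hw
  set e := consForm ε Z 0 (pl w q) with he
  have hz : consForm ε Z 0 (pl p q) = 0 := by
    rw [consForm_pl, zero_add, (mem_schubertL_lineOf h hl01).1 h0, mul_zero]
  obtain ⟨N, hN, h0N, hN'⟩ := eventually_lineOf_mem (X := ℝ) isOpen_interior
    (p := fun τ => p + τ • w) (q := fun _ => q) (x₀ := 0) (by fun_prop) continuous_const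
    (h := by simpa using h) (by simpa using hint)
  have hcont : Continuous fun τ : ℝ => consForm ε Z 1 (pl (p + τ • w) q) := by
    simp only [consForm_pl, br_add₁, br_smul₁]
    fun_prop
  have hM : IsOpen {τ : ℝ | 0 < consForm ε Z 1 (pl (p + τ • w) q)} :=
    isOpen_lt continuous_const hcont
  obtain ⟨δ, hδ, hball⟩ := Metric.isOpen_iff.1 (hN.inter hM) 0 ⟨h0N, by simpa using hc1⟩
  have key : ∀ τ, |τ| < δ → 0 ≤ τ * e := by
    intro τ hτ
    obtain ⟨⟨h', hA⟩, hpos1⟩ := (fun x : τ ∈ N ∩ _ => (⟨hN' τ x.1, x.2⟩ :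
      (∃ h', _) ∧ _)) (hball (by simpa [Real.dist_eq] using hτ))
    have := consForm_mul_nonneg (interior_subset hA) 0 1
    have e0 : consForm ε Z 0 (pl (p + τ • w) q) = τ * e := by
      rw [consForm_pl] at hz
      rw [he, consForm_pl, consForm_pl, br_add₁, br_smul₁]
      linear_combination hz
    rw [e0] at this
    exact nonneg_of_mul_nonneg_left this hpos1
  have k1 := key (δ / 2) (by rw [abs_of_pos (by linarith)]; linarith)
  have k2 := key (-(δ / 2)) (by rw [abs_neg, abs_of_pos (by linarith)]; linarith)
  have : δ / 2 * e = 0 := by linarith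
  exact hw' ((mul_eq_zero.1 this).resolve_left (by linarith))

theorem exists_rep_divisorForms : ∃ q, ∃ h : LinearIndependent ℝ ![Z 0 + Z 1, q],
      lineOf (Z 0 + Z 1) q h ∈ sameSign (divisorForms ε Z) := by
  have hn := hn.out
  have h1 := val_one (n := n)
  have h0v : ((0 : Fin n) : ℕ) = 0 := by simp
  have h2 : (2 : Fin n).val = 2 := val_two
  let L : Fin n := ⟨n - 1, by omega⟩
  have hL : L.val = n - 1 := rfl
  have n1 : (0 : Fin n) ≠ 1 := by omega
  have n2 : (0 : Fin n) ≠ 2 := by omega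
  have n3 : (0 : Fin n) ≠ L := by omega
  have n4 : (1 : Fin n) ≠ 2 := by omega
  have n5 : (1 : Fin n) ≠ L := by omega
  have n6 : (2 : Fin n) ≠ L := by omega
  let x : Fin n → ℝ := Pi.single 0 1 + Pi.single 1 1
  let y : Fin n → ℝ := Pi.single 0 (-1) + Pi.single 1 1 + Pi.single 2 1 + Pi.single L 1
  have hx : comb Z x = Z 0 + Z 1 := by simp only [x, comb_add, comb_single, one_smul]
  have hy : comb Z y = -Z 0 + Z 1 + Z 2 + Z L := by
    simp only [y, comb_add, comb_single, one_smul, neg_smul]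
  have hxy : ∀ a b, a < b → 0 ≤ minor x y a b := by
    intro a b hab
    have hb0 : b ≠ 0 := by rintro rfl; simp at hab
    have yb : 0 ≤ y b := by
      simp only [y, Pi.add_apply, Pi.single_apply, if_neg hb0]
      split_ifs <;> norm_num
    have xa : 0 ≤ x a := by
      simp only [x, Pi.add_apply, Pi.single_apply]; split_ifs <;> norm_num
    have p1 := mul_nonneg xa yb
    have p2 : x b * y a ≤ 0 := by
      by_cases hb1 : b = 1
      · have : a = 0 := by
          subst hb1; rw [Fin.lt_def, h1] at hab; apply Fin.ext; rw [h0v]; omega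
        subst this hb1
        simp [x, y, n1, n1.symm, n2, n3]
      · simp [x, hb0, hb1]
    simp only [minor]; linarith
  have h02 : minor x y 0 2 = 1 := by simp [minor, x, y, n1, n2, n2.symm, n3, n4.symm, n6]
  have h0L : minor x y 0 L = 1 := by
    simp [minor, x, y, n1, n2, n3, n3.symm, n5.symm, n6.symm]
  have h01 : minor x y 0 1 = 2 := by
    simp [minor, x, y, n1, n1.symm, n2, n3, n4, n5]; norm_num
  have h12 : minor x y 1 2 = 1 := by
    simp [minor, x, y, n1.symm, n2.symm, n4, n4.symm, n5, n6]
  have hb : 0 < -(ε * br (comb Z x) (comb Z y) (Z 0) (Z 2)) := by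
    have := hZ.1 0 1 2 L (by omega) (by omega)
      (by omega)
    rw [hx, hy]
    have e : br (Z 0 + Z 1) (-Z 0 + Z 1 + Z 2 + Z L) (Z 0) (Z 2) =
      -br (Z 0) (Z 1) (Z 2) (Z L) := by simp only [br, Pi.add_apply, Pi.neg_apply]; ring
    rw [e]; linarith
  have hl : LinearIndependent ℝ ![comb Z x, comb Z y] :=
    linearIndependent_pair_of_br (c := Z 0) (d := Z 2) (by intro h0; rw [h0] at hb; simp at hb)
  have hr : IsRep Z (lineOf _ _ hl) x y := ⟨hxy, hl, rfl⟩
  have hpos : ∀ k, 0 < divisorForms ε Z k (pl (comb Z x) (comb Z y)) := by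
    intro k
    by_cases hk : k = 0
    · subst hk; rw [divisorForms_zero_pl]; exact hb
    · rw [divisorForms_of_ne hk]
      refine lt_of_le_of_ne ?_ fun h0 => ?_
      · rw [consForm_pl]; exact IsRep.consecutive_nonneg hxy k
      · have hs := (supp_schubertL hr k).1 ((consForm_eq_zero_iff k hl).1 h0.symm)
        have s1 := hs 0 2 (by rw [h02]; norm_num)
        have s2 := hs 0 L (by rw [h0L]; norm_num)
        have s3 := hs 0 1 (by rw [h01]; norm_num)
        have s4 := hs 1 2 (by rw [h12]; norm_num)
        have hks := val_succ k
        by_cases hkn : k.val + 1 = n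
        · rw [if_pos hkn] at hks
          omega
        · rw [if_neg hkn] at hks
          omega
  have := lineOf_mem_sameSign (h := hl).2 fun i j => mul_pos (hpos i) (hpos j)
  rw [← hx]
  exact ⟨_, hl, this⟩

theorem type3I_zero_subset :
    type3I Z 0 ⊆ algebraicBoundary Z := by
  intro W hW
  have hl01 : LinearIndependent ℝ ![Z 0, Z 1] := by
    simpa using hZ.pair_independent (succ_ne 0)
  rw [type3I, zero_add] at hW
  obtain ⟨p, hps, hp0, hpW⟩ := mem_schubertL_iff_exists.1 hW
  obtain ⟨q, h, rfl⟩ := exists_lineOf_of_mem hpW hp0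
  obtain ⟨α, β, hp⟩ := Submodule.mem_span_pair.1 hps
  obtain ⟨q₁, q₂, hq⟩ := exists_re_im q
  obtain ⟨q₀, h0, hm⟩ := exists_rep_divisorForms (Z := Z)
  set p₀ := Z 0 + Z 1
  set p₁ := α.re • Z 0 + β.re • Z 1
  set p₂ := α.im • Z 0 + β.im • Z 1
  have hp' : p = toComplex p₁ + Complex.I • toComplex p₂ := by
    rw [← hp]
    ext k
    simp only [p₁, p₂, toComplex, Pi.add_apply, Pi.smul_apply, smul_eq_mul]
    push_cast
    conv_lhs => rw [← Complex.re_add_im α, ← Complex.re_add_im β]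
    ring
  obtain ⟨N, hN, h0N, hN'⟩ := eventually_lineOf_mem (X := ℝ × ℝ)
    (isOpen_sameSign (divisorForms ε Z))
    (p := fun x => p₀ + x.1 • (p₁ - p₀) + x.2 • p₂)
    (q := fun x => q₀ + x.1 • (q₁ - q₀) + x.2 • q₂) (x₀ := (0, 0)) (by fun_prop) (by fun_prop)
    (h := by simpa using h0) (by simpa using hm)
  obtain ⟨δ, hδ, hball⟩ := Metric.isOpen_iff.1 hN _ h0N
  refine mem_closure_of_real_family (p₀ := p₀) (q₀ := q₀) hδ (fun s t hs ht => ?_) h hp' hq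
  obtain ⟨h', hm'⟩ := hN' (s, t) (hball (by simp [Prod.dist_eq, hs, ht]))
  have hD : lineOf _ _ h' ∈ schubertL (Z 0) (Z 1) := by
    rw [mem_schubertL_lineOf h' hl01]
    simp only [p₀, p₁, p₂, br, Pi.add_apply, Pi.sub_apply, Pi.smul_apply, smul_eq_mul]
    ring
  exact ⟨h', mem_amplituhedron_of_divisorForms hm' hD, not_mem_interior_of_divisorForms hm' hD⟩

theorem algebraicBoundary_rotZ :
    algebraicBoundary (rotZ Z) = algebraicBoundary Z := by
  simp only [algebraicBoundary, amplituhedron_rotZ]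

theorem toComplex_pair_independent {a b : Fin n} (hab : a ≠ b) :
    LinearIndependent ℂ ![toComplex (Z a), toComplex (Z b)] :=
  toComplex_independent (hZ.pair_independent hab)

theorem isClosed_type3I (i : Fin n) : IsClosed (type3I Z i) :=
  isClosed_schubertL (toComplex_pair_independent (succ_ne i))

theorem algebraicBoundary_eq :
    algebraicBoundary Z = ⋃ i, type3I Z i := by
  refine subset_antisymm ?_ (iUnion_subset fun i => ?_)
  · refine closure_minimal ?_ (isClosed_iUnion_of_finite fun i => isClosed_type3I i)
    rintro _ ⟨W, ⟨hA, hW⟩, rfl⟩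
    by_contra hcon
    refine hW (mem_interior_amplituhedron hA fun k hk => hcon (mem_iUnion.2 ⟨k, ?_⟩))
    rw [← realPoints_type3I] at hk
    exact hk
  · refine rot_induction (Q := fun Z i => type3I Z i ⊆ algebraicBoundary Z)
      (fun Z _ => type3I_zero_subset) (fun Z i _ h => ?_) Z i
    rwa [type3I_rotZ, algebraicBoundary_rotZ] at h

end Boundary

section SchubertRelations
variable {𝕜 : Type*} [Field 𝕜] {a b c d : Fin 4 → 𝕜}

theorem schubertV_subset_schubertL_left (ha : a ≠ 0) : schubertV a ⊆ schubertL a b := fun _ hW =>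
  mem_schubertL_iff_exists.2 ⟨a, Submodule.subset_span (by simp), ha, hW⟩

theorem schubertV_subset_schubertL_right (hb : b ≠ 0) : schubertV b ⊆ schubertL a b := fun _ hW =>
  mem_schubertL_iff_exists.2 ⟨b, Submodule.subset_span (by simp), hb, hW⟩

theorem schubertL_inter_subset (h : LinearIndependent 𝕜 ![a, b, c]) :
    schubertL a b ∩ schubertL b c ⊆ schubertV b ∪ schubertP a b c := by
  rintro W ⟨h1, h2⟩
  obtain ⟨p, hp, hp0, hpW⟩ := mem_schubertL_iff_exists.1 h1
  obtain ⟨q, hq, hq0, hqW⟩ := mem_schubertL_iff_exists.1 h2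
  obtain ⟨α, β, rfl⟩ := Submodule.mem_span_pair.1 hp
  obtain ⟨γ, δ, rfl⟩ := Submodule.mem_span_pair.1 hq
  by_cases hα : α = 0
  · left
    subst hα
    have hβ : β ≠ 0 := by rintro rfl; simp at hp0
    exact (W.toSubmodule.smul_mem_iff hβ).1 (by simpa using hpW)
  by_cases hδ : δ = 0
  · left
    subst hδ
    have hγ : γ ≠ 0 := by rintro rfl; simp at hq0
    exact (W.toSubmodule.smul_mem_iff hγ).1 (by simpa using hqW)
  right
  have hl : LinearIndependent 𝕜 ![α • a + β • b, γ • b + δ • c] := by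
    rw [LinearIndependent.pair_iff]
    intro s t hst
    have := Fintype.linearIndependent_iff.1 h ![s * α, s * β + t * γ, t * δ] (by
      simp only [Fin.sum_univ_three, Matrix.cons_val]
      linear_combination (norm := module) hst)
    have e0 := this 0
    have e2 := this 2
    exact ⟨(mul_eq_zero.1 e0).resolve_right hα, (mul_eq_zero.1 e2).resolve_right hδ⟩
  rw [lineOf_eq_of_mem hl hpW hqW]
  change (lineOf _ _ hl).toSubmodule ≤ _
  rw [lineOf_toSubmodule, Submodule.span_le]
  have ha : a ∈ Submodule.span 𝕜 {a, b, c} := Submodule.subset_span (by simp)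
  have hb : b ∈ Submodule.span 𝕜 {a, b, c} := Submodule.subset_span (by simp)
  have hc : c ∈ Submodule.span 𝕜 {a, b, c} := Submodule.subset_span (by simp)
  rintro x (rfl | rfl)
  · exact add_mem (Submodule.smul_mem _ _ ha) (Submodule.smul_mem _ _ hb)
  · exact add_mem (Submodule.smul_mem _ _ hb) (Submodule.smul_mem _ _ hc)

/-- In a pencil of lines, every line is a combination of any two distinct ones. -/
theorem pencil_comb (h : a ∉ Submodule.span 𝕜 {b, c}) {W W₁ W₂ : Gr 𝕜 4}
    (hW : W ∈ schubertV a ∩ schubertL b c) (h₁ : W₁ ∈ schubertV a ∩ schubertL b c)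
    (h₂ : W₂ ∈ schubertV a ∩ schubertL b c) (hne : W₁ ≠ W₂) :
    ∃ (q₁ q₂ : Fin 4 → 𝕜) (s t : 𝕜) (l : _) (l₁ : _) (l₂ : _), W = lineOf a (s • q₁ + t • q₂) l ∧ W₁ = lineOf a q₁ l₁ ∧
      W₂ = lineOf a q₂ l₂ := by
  have key : ∀ W ∈ schubertV a ∩ schubertL b c, ∃ q ∈ Submodule.span 𝕜 {b, c}, ∃ l,
      W = lineOf a q l := by
    rintro W ⟨hV, hL⟩
    obtain ⟨q, hq, hq0, hqW⟩ := mem_schubertL_iff_exists.1 hL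
    have l : LinearIndependent 𝕜 ![a, q] := by
      rw [LinearIndependent.pair_iff]
      intro s t hst
      have hs : s = 0 := by
        by_contra hs
        refine h ((Submodule.smul_mem_iff _ hs).1 ?_)
        rw [eq_neg_of_add_eq_zero_left hst]
        exact neg_mem (Submodule.smul_mem _ _ hq)
      subst hs
      simpa [hq0] using hst
    exact ⟨q, hq, l, lineOf_eq_of_mem l hV hqW⟩
  obtain ⟨q₁, hq₁, l₁, e₁⟩ := key W₁ h₁
  obtain ⟨q₂, hq₂, l₂, e₂⟩ := key W₂ h₂
  obtain ⟨q, hq, l, e⟩ := key W hW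
  have hl : LinearIndependent 𝕜 ![q₁, q₂] := by
    by_contra hcon
    refine hne ?_
    rw [LinearIndependent.pair_iff] at hcon
    push Not at hcon
    obtain ⟨s, t, hst, hne'⟩ := hcon
    have hq10 : q₁ ≠ 0 := by simpa using l₁.ne_zero 1
    have ht : t ≠ 0 := by
      rintro rfl
      have : s ≠ 0 := fun h => hne' h rfl
      simp [this, hq10] at hst
    rw [e₁]
    symm
    refine lineOf_eq_of_mem l₁ ?_ ?_
    · rw [e₂]; exact left_mem_lineOf _ _ _
    · have hq20 : q₂ ≠ 0 := by simpa using l₂.ne_zero 1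
      have hs : s ≠ 0 := by
        rintro rfl
        simp [ht, hq20] at hst
      refine (Submodule.smul_mem_iff _ hs).1 ?_
      rw [eq_neg_of_add_eq_zero_left hst, e₂]
      exact neg_mem (Submodule.smul_mem _ _ (right_mem_lineOf _ _ _))
  have hspan : q ∈ Submodule.span 𝕜 {q₁, q₂} := by
    have hle : Submodule.span 𝕜 {q₁, q₂} ≤ Submodule.span 𝕜 {b, c} := by
      rw [Submodule.span_le]; rintro x (rfl | rfl) <;> assumption
    have hf : finrank 𝕜 (Submodule.span 𝕜 {b, c}) ≤ finrank 𝕜 (Submodule.span 𝕜 {q₁, q₂}) := by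
      have e : finrank 𝕜 (Submodule.span 𝕜 {q₁, q₂}) = 2 := (lineOf q₁ q₂ hl).finrank_eq
      have := finrank_range_le_card (R := 𝕜) ![b, c]
      rw [range_vec_pair, Fintype.card_fin] at this
      exact this.trans e.ge
    rw [Submodule.eq_of_le_of_finrank_le hle hf]; exact hq
  obtain ⟨s, t, rfl⟩ := Submodule.mem_span_pair.1 hspan
  exact ⟨q₁, q₂, s, t, l, l₁, l₂, e, e₁, e₂⟩

theorem pencil_subset_schubertL (h : a ∉ Submodule.span 𝕜 {b, c}) {d e : Fin 4 → 𝕜}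
    (hde : LinearIndependent 𝕜 ![d, e]) {W₁ W₂ : Gr 𝕜 4}
    (h₁ : W₁ ∈ schubertV a ∩ schubertL b c ∩ schubertL d e)
    (h₂ : W₂ ∈ schubertV a ∩ schubertL b c ∩ schubertL d e) (hne : W₁ ≠ W₂) :
    schubertV a ∩ schubertL b c ⊆ schubertL d e := by
  intro W hW
  obtain ⟨q₁, q₂, s, t, l, l₁, l₂, rfl, rfl, rfl⟩ := pencil_comb h hW h₁.1 h₂.1 hne
  have e₁ := (mem_schubertL_lineOf l₁ hde).1 h₁.2
  have e₂ := (mem_schubertL_lineOf l₂ hde).1 h₂.2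
  rw [mem_schubertL_lineOf l hde, br_add₂, br_smul₂, br_smul₂, e₁, e₂]
  ring

theorem pencil_subset_schubertV (h : a ∉ Submodule.span 𝕜 {b, c}) {d : Fin 4 → 𝕜}
    {W₁ W₂ : Gr 𝕜 4} (h₁ : W₁ ∈ schubertV a ∩ schubertL b c ∩ schubertV d)
    (h₂ : W₂ ∈ schubertV a ∩ schubertL b c ∩ schubertV d) (hne : W₁ ≠ W₂) :
    schubertV a ∩ schubertL b c ⊆ schubertV d := by
  intro W hW
  obtain ⟨q₁, q₂, s, t, l, l₁, l₂, rfl, rfl, rfl⟩ := pencil_comb h hW h₁.1 h₂.1 hne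
  have e₁ := (mem_schubertV_lineOf l₁).1 h₁.2
  have e₂ := (mem_schubertV_lineOf l₂).1 h₂.2
  rw [mem_schubertV_lineOf l]
  intro x
  rw [br_add₂, br_smul₂, br_smul₂, e₁, e₂]
  ring

theorem pencil_subset_schubertP (h : a ∉ Submodule.span 𝕜 {b, c}) {d e f : Fin 4 → 𝕜}
    {W₁ W₂ : Gr 𝕜 4} (h₁ : W₁ ∈ schubertV a ∩ schubertL b c ∩ schubertP d e f)
    (h₂ : W₂ ∈ schubertV a ∩ schubertL b c ∩ schubertP d e f) (hne : W₁ ≠ W₂) :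
    schubertV a ∩ schubertL b c ⊆ schubertP d e f := by
  intro W hW
  obtain ⟨q₁, q₂, s, t, l, l₁, l₂, rfl, rfl, rfl⟩ := pencil_comb h hW h₁.1 h₂.1 hne
  have m₁ : (lineOf a q₁ l₁).toSubmodule ≤ _ := h₁.2
  have m₂ : (lineOf a q₂ l₂).toSubmodule ≤ _ := h₂.2
  change (lineOf _ _ l).toSubmodule ≤ _
  rw [lineOf_toSubmodule, Submodule.span_le]
  rintro x (rfl | rfl)
  · exact m₁ (left_mem_lineOf _ _ _)
  · exact add_mem (Submodule.smul_mem _ _ (m₁ (right_mem_lineOf _ _ _)))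
      (Submodule.smul_mem _ _ (m₂ (right_mem_lineOf _ _ _)))

theorem schubertV_inter_schubertL_subset (ha : a ∉ Submodule.span 𝕜 {b, c}) :
    schubertV a ∩ schubertL b c ⊆ schubertP a b c := by
  rintro W ⟨hV, hL⟩
  obtain ⟨q, hq, hq0, hqW⟩ := mem_schubertL_iff_exists.1 hL
  have l : LinearIndependent 𝕜 ![a, q] := by
    rw [LinearIndependent.pair_iff]
    intro s t hst
    have hs : s = 0 := by
      by_contra hs
      refine ha ((Submodule.smul_mem_iff _ hs).1 ?_)
      rw [eq_neg_of_add_eq_zero_left hst]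
      exact neg_mem (Submodule.smul_mem _ _ hq)
    subst hs
    simpa [hq0] using hst
  rw [lineOf_eq_of_mem l hV hqW]
  change (lineOf _ _ l).toSubmodule ≤ _
  rw [lineOf_toSubmodule, Submodule.span_le]
  rintro x (rfl | rfl)
  · exact Submodule.subset_span (by simp)
  · exact Submodule.span_mono (by intro y; simp; tauto) hq

theorem schubertP_comm₁₂ : schubertP a b c = schubertP b a c := by
  rw [schubertP, schubertP, insert_comm]

theorem schubertP_comm₂₃ : schubertP a b c = schubertP a c b := by
  rw [schubertP, schubertP, pair_comm]

theorem schubertP_inter_schubertL_subset (h : br a b c d ≠ 0) :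
    schubertP a b c ∩ schubertL c d ⊆ schubertV c := by
  rintro W ⟨hP, hL⟩
  obtain ⟨q, hq, hq0, hqW⟩ := mem_schubertL_iff_exists.1 hL
  obtain ⟨γ, δ, rfl⟩ := Submodule.mem_span_pair.1 hq
  have h1 := (mem_span_triple_iff_br (linearIndependent_triple_of_br h)).1 (hP hqW)
  have hδ : δ = 0 := by
    have : br (γ • c + δ • d) a b c = -(δ * br a b c d) := by
      simp only [br, Pi.add_apply, Pi.smul_apply, smul_eq_mul]; ring
    rw [this] at h1
    simpa [h] using h1
  subst hδ
  have hγ : γ ≠ 0 := by rintro rfl; simp at hq0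
  exact (W.toSubmodule.smul_mem_iff hγ).1 (by simpa using hqW)

/-- Two distinct planes have at most one line in common. -/
theorem schubertP_inter_subsingleton {a' b' c' : Fin 4 → 𝕜}
    (hd : ¬ Submodule.span 𝕜 {a', b', c'} ≤ Submodule.span 𝕜 {a, b, c}) {W₁ W₂ : Gr 𝕜 4}
    (h₁ : W₁ ∈ schubertP a b c ∩ schubertP a' b' c')
    (h₂ : W₂ ∈ schubertP a b c ∩ schubertP a' b' c') : W₁ = W₂ := by
  set P := Submodule.span 𝕜 {a, b, c}
  set P' := Submodule.span 𝕜 {a', b', c'}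
  have hlt : P ⊓ P' < P' := lt_of_le_of_ne inf_le_right fun h => hd (inf_eq_right.1 h)
  have h3 : finrank 𝕜 P' ≤ 3 := by
    have := finrank_range_le_card (R := 𝕜) ![a', b', c']
    rwa [range_vec_triple, Fintype.card_fin] at this
  have h4 := Submodule.finrank_lt_finrank_of_lt hlt
  have key : ∀ W ∈ schubertP a b c ∩ schubertP a' b' c', W.toSubmodule = P ⊓ P' := fun W hW =>
    Submodule.eq_of_le_of_finrank_le (le_inf hW.1 hW.2) (by rw [W.finrank_eq]; omega)
  exact Gr.ext ((key _ h₁).trans (key _ h₂).symm)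

end SchubertRelations

section Vertices
include ε

/-- The line `Z_a Z_b` belongs to `S`. -/
def VertIn (Z : Matrix (Fin n) (Fin 4) ℝ) (S : Set (Gr ℂ 4)) (a b : Fin n) : Prop :=
  type0I Z a b ⊆ S

theorem type0I_comm (a b : Fin n) : type0I Z a b = type0I Z b a := inter_comm _ _

theorem VertIn.symm (h : VertIn Z S a b) : VertIn Z S b a := by
  rwa [VertIn, type0I_comm]

theorem VertIn.ne (h : VertIn Z S a b) (h' : ¬ VertIn Z T a b) : S ≠ T := fun e => h' (e ▸ h)

theorem vertIn_inter :
    VertIn Z (S ∩ T) a b ↔ VertIn Z S a b ∧ VertIn Z T a b := subset_inter_iff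

theorem type0I_eq (hab : a ≠ b) :
    type0I Z a b = {complexify (lineOf (Z a) (Z b) (hZ.pair_independent hab))} := by
  rw [complexify_lineOf]
  exact schubertV_inter_schubertV _

theorem vertIn_iff
    (hab : a ≠ b) : VertIn Z S a b ↔
      lineOf (Z a) (Z b) (hZ.pair_independent hab) ∈ realPoints S := by
  rw [VertIn, type0I_eq hab, singleton_subset_iff]
  rfl

theorem isRep_vertex (hab : a < b) :
    IsRep Z (lineOf (Z a) (Z b) (hZ.pair_independent hab.ne)) (Pi.single a 1)
      (Pi.single b 1) := by
  have hx : comb Z (Pi.single a (1 : ℝ)) = Z a := by rw [comb_single, one_smul]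
  have hy : comb Z (Pi.single b (1 : ℝ)) = Z b := by rw [comb_single, one_smul]
  refine ⟨fun c d hcd => ?_, ?_, ?_⟩
  · simp only [minor, Pi.single_apply]
    split_ifs <;> subst_vars <;> simp_all
    exact absurd hcd (not_lt.2 hab.le)
  · rw [hx, hy]; exact hZ.pair_independent hab.ne
  · simp only [hx, hy]

theorem vertex_mem_amplituhedron (hab : a ≠ b) :
    lineOf (Z a) (Z b) (hZ.pair_independent hab) ∈ amplituhedron Z := by
  rcases lt_or_gt_of_ne hab with h | h
  · exact mem_amplituhedron_iff.2 ⟨_, _, isRep_vertex h⟩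
  · have e : lineOf (Z a) (Z b) (hZ.pair_independent hab) =
        lineOf (Z b) (Z a) (hZ.pair_independent hab.symm) :=
      lineOf_eq_of_mem _ (right_mem_lineOf _ _ _) (left_mem_lineOf _ _ _)
    rw [e]
    exact mem_amplituhedron_iff.2 ⟨_, _, isRep_vertex h⟩

/-- The property that membership in `S` of a point of the amplituhedron is decided by the vertices
in its support. -/
def SuppDetermined (Z : Matrix (Fin n) (Fin 4) ℝ) (S : Set (Gr ℂ 4)) : Prop :=
  ∀ U x y, IsRep Z U x y → (U ∈ realPoints S ↔ ∀ a b, minor x y a b ≠ 0 → VertIn Z S a b)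

theorem SuppDetermined.inter (hS : SuppDetermined Z S)
    (hT : SuppDetermined Z T) : SuppDetermined Z (S ∩ T) := fun U x y hr => by
  change U ∈ realPoints S ∧ U ∈ realPoints T ↔ _
  rw [hS U x y hr, hT U x y hr]
  simp only [vertIn_inter]
  exact ⟨fun h a b hm => ⟨h.1 a b hm, h.2 a b hm⟩,
    fun h => ⟨fun a b hm => (h a b hm).1, fun a b hm => (h a b hm).2⟩⟩

theorem vertIn_of_supp
    {P : Fin n → Fin n → Prop} (hP : ∀ a b, P a b → P b a)
    (hS : ∀ U x y, IsRep Z U x y → (U ∈ realPoints S ↔ ∀ a b, minor x y a b ≠ 0 → P a b))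
    (hab : a ≠ b) : VertIn Z S a b ↔ P a b := by
  have key : ∀ a b : Fin n, a < b → (VertIn Z S a b ↔ P a b) := by
    intro a b hab
    rw [vertIn_iff hab.ne, hS _ _ _ (isRep_vertex hab)]
    simp only [minor_single_ne_zero hab.ne]
    constructor
    · intro h; exact h a b (.inl ⟨rfl, rfl⟩)
    · rintro h c d (⟨rfl, rfl⟩ | ⟨rfl, rfl⟩)
      · exact h
      · exact hP _ _ h
  rcases lt_or_gt_of_ne hab with h | h
  · exact key a b h
  · exact ⟨fun hv => hP _ _ ((key b a h).1 hv.symm), fun hv => ((key b a h).2 (hP _ _ hv)).symm⟩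

theorem suppDetermined_of_supp
    {P : Fin n → Fin n → Prop} (hP : ∀ a b, P a b → P b a)
    (hS : ∀ U x y, IsRep Z U x y → (U ∈ realPoints S ↔ ∀ a b, minor x y a b ≠ 0 → P a b)) :
    SuppDetermined Z S := fun U x y hr => by
  rw [hS U x y hr]
  refine forall₂_congr fun a b => forall_congr' fun hm => ?_
  rw [vertIn_of_supp hP hS (minor_ne hm)]

theorem supp_type3I (k : Fin n) (U : Gr ℝ 4) (x y : Fin n → ℝ)
    (hr : IsRep Z U x y) : U ∈ realPoints (type3I Z k) ↔
      ∀ a b, minor x y a b ≠ 0 → a = k ∨ a = k + 1 ∨ b = k ∨ b = k + 1 := by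
  rw [realPoints_type3I]; exact supp_schubertL hr k

theorem supp_type2I (k : Fin n) (U : Gr ℝ 4) (x y : Fin n → ℝ)
    (hr : IsRep Z U x y) : U ∈ realPoints (type2I Z k) ↔
      ∀ a b, minor x y a b ≠ 0 → a = k ∨ b = k := by
  rw [realPoints_type2I]; exact supp_schubertV hr k

theorem supp_type2II (k : Fin n) (U : Gr ℝ 4) (x y : Fin n → ℝ)
    (hr : IsRep Z U x y) : U ∈ realPoints (type2II Z k) ↔ ∀ a b, minor x y a b ≠ 0 →
      (a = k - 1 ∨ a = k ∨ a = k + 1) ∧ (b = k - 1 ∨ b = k ∨ b = k + 1) := by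
  rw [realPoints_type2II]; exact supp_schubertP hr k

theorem suppDetermined_type3I (k : Fin n) : SuppDetermined Z (type3I Z k) :=
  suppDetermined_of_supp (by tauto) (supp_type3I k)

theorem suppDetermined_type2I (k : Fin n) : SuppDetermined Z (type2I Z k) :=
  suppDetermined_of_supp (by tauto) (supp_type2I k)

theorem suppDetermined_type2II (k : Fin n) : SuppDetermined Z (type2II Z k) :=
  suppDetermined_of_supp (by tauto) (supp_type2II k)

theorem vertIn_type3I {k a b : Fin n} (hab : a ≠ b) :
    VertIn Z (type3I Z k) a b ↔ a = k ∨ a = k + 1 ∨ b = k ∨ b = k + 1 :=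
  vertIn_of_supp (P := fun a b => a = k ∨ a = k + 1 ∨ b = k ∨ b = k + 1) (by tauto)
    (supp_type3I k) hab

theorem vertIn_type2I {k a b : Fin n} (hab : a ≠ b) : VertIn Z (type2I Z k) a b ↔ a = k ∨ b = k :=
  vertIn_of_supp (P := fun a b => a = k ∨ b = k) (by tauto) (supp_type2I k) hab

theorem vertIn_type2II {k a b : Fin n} (hab : a ≠ b) : VertIn Z (type2II Z k) a b ↔
      (a = k - 1 ∨ a = k ∨ a = k + 1) ∧ (b = k - 1 ∨ b = k ∨ b = k + 1) := vertIn_of_supp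
    (P := fun a b => (a = k - 1 ∨ a = k ∨ a = k + 1) ∧ (b = k - 1 ∨ b = k ∨ b = k + 1))
    (by tauto) (supp_type2II k) hab

theorem vertIn_type2III {i j a b : Fin n} (hab : a ≠ b) :
    VertIn Z (type2III Z i j) a b ↔ (a = i ∨ a = i + 1 ∨ b = i ∨ b = i + 1) ∧
      (a = j ∨ a = j + 1 ∨ b = j ∨ b = j + 1) := by
  rw [← vertIn_type3I (Z := Z) hab, ← vertIn_type3I (Z := Z) hab]; exact vertIn_inter

theorem vertIn_type1II {i j a b : Fin n} (hab : a ≠ b) :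
    VertIn Z (type1II Z i j) a b ↔ (a = i ∨ b = i) ∧ (a = j ∨ a = j + 1 ∨ b = j ∨ b = j + 1) := by
  rw [← vertIn_type2I (Z := Z) hab, ← vertIn_type3I (Z := Z) hab]; exact vertIn_inter

theorem vertIn_type0I {i j a b : Fin n} (hab : a ≠ b) :
    VertIn Z (type0I Z i j) a b ↔ (a = i ∨ b = i) ∧ (a = j ∨ b = j) := by
  rw [← vertIn_type2I (Z := Z) hab, ← vertIn_type2I (Z := Z) hab]; exact vertIn_inter

theorem toComplex_triple {a b c : Fin n} (hab : a ≠ b)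
    (hac : a ≠ c) (hbc : b ≠ c) :
    LinearIndependent ℂ ![toComplex (Z a), toComplex (Z b), toComplex (Z c)] := by
  obtain ⟨d, hd⟩ := hZ.triple hab hac hbc
  exact linearIndependent_triple_of_br (d := toComplex (Z d)) (by rw [br_toComplex]; exact_mod_cast hd)

theorem toComplex_notMem {a b c : Fin n} (hab : a ≠ b)
    (hac : a ≠ c) (hbc : b ≠ c) :
    toComplex (Z a) ∉ Submodule.span ℂ {toComplex (Z b), toComplex (Z c)} := by
  obtain ⟨d, hd⟩ := hZ.triple hbc hab.symm hac.symm
  rw [mem_span_pair_iff_br (toComplex_pair_independent hbc)]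
  intro h
  have := h (toComplex (Z d))
  rw [br_toComplex] at this
  exact hd (by exact_mod_cast this)

theorem toComplex_br {a b c d : Fin n} (hab : a ≠ b) (hac : a ≠ c)
    (had : a ≠ d) (hbc : b ≠ c) (hbd : b ≠ d) (hcd : c ≠ d) :
    br (toComplex (Z a)) (toComplex (Z b)) (toComplex (Z c)) (toComplex (Z d)) ≠ 0 := by
  rw [br_toComplex]; exact_mod_cast hZ.br_ne_zero hab hac had hbc hbd hcd

theorem toComplex_ne_zero (a : Fin n) : toComplex (Z a) ≠ 0 := by
  simpa using (toComplex_pair_independent (succ_ne a)).ne_zero 0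

theorem type2I_subset_type3I (i : Fin n) :
    type2I Z i ⊆ type3I Z i := schubertV_subset_schubertL_left (toComplex_ne_zero i)

theorem type2I_succ_subset_type3I (i : Fin n) :
    type2I Z (i + 1) ⊆ type3I Z i := schubertV_subset_schubertL_right (toComplex_ne_zero _)

theorem type2II_eq (i : Fin n) : type2II Z i = schubertL (toComplex (Z (i - 1))) (toComplex (Z i)) ∩
      schubertL (toComplex (Z (i - 1))) (toComplex (Z (i + 1))) ∩ type3I Z i :=
  schubertP_eq (toComplex_triple (pred_ne i) (pred_ne_succ i) (succ_ne i))
    (toComplex_pair_independent (pred_ne i))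
    (toComplex_pair_independent (pred_ne_succ i))
    (toComplex_pair_independent (succ_ne i))

theorem type2II_subset_type3I (i : Fin n) : type2II Z i ⊆ type3I Z i := by
  rw [type2II_eq]; exact inter_subset_right

theorem type2II_succ_subset_type3I (i : Fin n) : type2II Z (i + 1) ⊆ type3I Z i := by
  rw [type2II_eq, add_sub_cancel_right]
  exact fun _ h => h.1.1

theorem type3I_inter_succ (i : Fin n) :
    type3I Z i ∩ type3I Z (i + 1) = type2I Z (i + 1) ∪ type2II Z (i + 1) := by
  refine subset_antisymm ?_ (union_subset
    (subset_inter (type2I_succ_subset_type3I i) (type2I_subset_type3I _))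
    (subset_inter (type2II_succ_subset_type3I i) (type2II_subset_type3I _)))
  have h := schubertL_inter_subset (toComplex_triple (Z := Z) (pred_ne (i + 1))
    (pred_ne_succ (i + 1)) (succ_ne (i + 1)))
  rw [add_sub_cancel_right] at h
  rw [type2II, add_sub_cancel_right]
  exact h

theorem type1I_eq (i : Fin n) : type1I Z i = type2I Z i ∩ type2II Z i := by
  refine subset_antisymm (subset_inter inter_subset_left ?_) ?_
  · have := schubertV_inter_schubertL_subset
      (toComplex_notMem (Z := Z) (pred_ne i).symm (succ_ne i) (pred_ne_succ i))
    rw [schubertP_comm₁₂] at this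
    exact this
  · rintro W ⟨h1, h2⟩
    rw [type2II_eq] at h2
    exact ⟨h1, h2.1.2⟩

theorem type1II_pred_eq (i : Fin n) : type1II Z (i - 1) i = type2I Z (i - 1) ∩ type2II Z i :=
  subset_antisymm (subset_inter inter_subset_left (schubertV_inter_schubertL_subset
      (toComplex_notMem (pred_ne i) (pred_ne_succ i) (succ_ne i))))
    (inter_subset_inter_right _ (type2II_subset_type3I i))

theorem type1II_succ_eq (i : Fin n) :
    type1II Z (i + 1) (i - 1) = type2I Z (i + 1) ∩ type2II Z i := by
  rw [type1II, sub_add_cancel]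
  refine subset_antisymm (subset_inter inter_subset_left ?_) ?_
  · have := schubertV_inter_schubertL_subset
      (toComplex_notMem (Z := Z) (pred_ne_succ i).symm (succ_ne i).symm (pred_ne i))
    rw [schubertP_comm₁₂, schubertP_comm₂₃] at this
    exact this
  · rintro W ⟨h1, h2⟩
    rw [type2II_eq] at h2
    exact ⟨h1, h2.1.1⟩

theorem vertIn_type1I {i a b : Fin n} (hab : a ≠ b) : VertIn Z (type1I Z i) a b ↔ (a = i ∨ b = i) ∧
      (a = i - 1 ∨ a = i ∨ a = i + 1) ∧ (b = i - 1 ∨ b = i ∨ b = i + 1) := by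
  rw [← vertIn_type2I (Z := Z) hab, ← vertIn_type2II (Z := Z) hab, type1I_eq]; exact vertIn_inter

theorem type2II_inter_type3I_succ (i : Fin n) :
    type2II Z i ∩ type3I Z (i + 1) = type1II Z (i + 1) (i - 1) := by
  rw [type1II_succ_eq]
  refine subset_antisymm (fun W h => ⟨?_, h.1⟩) fun W h => ⟨h.2, type2I_subset_type3I _ h.1⟩
  exact schubertP_inter_schubertL_subset (toComplex_br (pred_ne i) (pred_ne_succ i)
    (add_one_add_one_ne i).symm (succ_ne i) (by
      have := pred_ne_succ (i + 1); rwa [add_sub_cancel_right] at this) (succ_ne _)) h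

theorem type2II_inter_type3I_pred (i : Fin n) :
    type2II Z i ∩ type3I Z (i - 1 - 1) = type1II Z (i - 1) i := by
  rw [type1II_pred_eq]
  refine subset_antisymm ?_ ?_
  · rintro W ⟨h1, h2⟩
    refine ⟨?_, h1⟩
    rw [type3I, sub_add_cancel, schubertL, pair_comm] at h2
    rw [type2II, schubertP_comm₁₂, schubertP_comm₂₃, schubertP_comm₁₂] at h1
    refine schubertP_inter_schubertL_subset (toComplex_br ?_ ?_ ?_ ?_ ?_ ?_) ⟨h1, h2⟩
    · exact (succ_ne i).symm
    · exact (pred_ne_succ i).symm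
    · have := add_one_add_one_ne (i - 1); rwa [sub_add_cancel] at this
    · exact (pred_ne i).symm
    · have := pred_ne_succ (i - 1); rw [sub_add_cancel] at this; exact this.symm
    · exact (pred_ne _).symm
  · rintro W ⟨h1, h2⟩
    refine ⟨h2, ?_⟩
    have := type2I_succ_subset_type3I (Z := Z) (i - 1 - 1)
    rw [sub_add_cancel] at this
    exact this h1

/-- The hypersurfaces and planes in the Grassmannian of which all listed strata are
intersections. -/
def generators (Z : Matrix (Fin n) (Fin 4) ℝ) : Set (Set (Gr ℂ 4)) :=
  {g | (∃ i, g = type3I Z i) ∨ (∃ i, g = type2I Z i) ∨ ∃ i, g = type2II Z i}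

/-- All listed strata. -/
def listed (Z : Matrix (Fin n) (Fin 4) ℝ) : Set (Set (Gr ℂ 4)) :=
  vertexStrata Z ∪ lineStrata Z ∪ surfaceStrata Z ∪ threefoldStrata Z

/-- The listed strata other than the quadric surfaces. -/
def linearStrata (Z : Matrix (Fin n) (Fin 4) ℝ) : Set (Set (Gr ℂ 4)) :=
  generators Z ∪ (lineStrata Z ∪ vertexStrata Z)

theorem type3I_mem_generators (i : Fin n) : type3I Z i ∈ generators Z := Or.inl ⟨i, rfl⟩
theorem type2I_mem_generators (i : Fin n) : type2I Z i ∈ generators Z := Or.inr (Or.inl ⟨i, rfl⟩)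
theorem type2II_mem_generators (i : Fin n) : type2II Z i ∈ generators Z := .inr (.inr ⟨i, rfl⟩)

theorem linearStrata_subset_listed : linearStrata Z ⊆ listed Z := by
  rintro S ((⟨i, rfl⟩ | ⟨i, rfl⟩ | ⟨i, rfl⟩) | h | h)
  · exact .inr ⟨i, rfl⟩
  · exact .inl (.inr (.inl ⟨i, rfl⟩))
  · exact .inl (.inr (.inr (.inl ⟨i, rfl⟩)))
  · exact .inl (.inl (.inr h))
  · exact .inl (.inl (.inl h))

theorem suppDetermined_generators {g : Set (Gr ℂ 4)}
    (hg : g ∈ generators Z) : SuppDetermined Z g := by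
  rcases hg with ⟨i, rfl⟩ | ⟨i, rfl⟩ | ⟨i, rfl⟩
  · exact suppDetermined_type3I i
  · exact suppDetermined_type2I i
  · exact suppDetermined_type2II i

theorem isClosed_generators {g : Set (Gr ℂ 4)}
    (hg : g ∈ generators Z) : IsClosed g := by
  rcases hg with ⟨i, rfl⟩ | ⟨i, rfl⟩ | ⟨i, rfl⟩
  · exact isClosed_type3I i
  · exact isClosed_schubertV (toComplex_ne_zero i)
  · obtain ⟨d, hd⟩ := hZ.triple (pred_ne i) (pred_ne_succ i) (succ_ne i)
    exact isClosed_schubertP (d := toComplex (Z d)) (by rw [br_toComplex]; exact_mod_cast hd)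

/-- Every listed stratum is the intersection of two generators. -/
theorem listed_eq_inter (hS : S ∈ listed Z) :
    ∃ g ∈ generators Z, ∃ g' ∈ generators Z, S = g ∩ g' := by
  rcases hS with ((⟨i, j, _, rfl⟩ | (⟨i, rfl⟩ | ⟨i, j, _, _, rfl⟩)) |
    (⟨i, rfl⟩ | ⟨i, rfl⟩ | ⟨i, j, _, _, _, rfl⟩)) | ⟨i, rfl⟩
  · exact ⟨_, type2I_mem_generators i, _, type2I_mem_generators j, rfl⟩
  · exact ⟨_, type2I_mem_generators i, _, type2II_mem_generators i, type1I_eq i⟩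
  · exact ⟨_, type2I_mem_generators i, _, type3I_mem_generators j, rfl⟩
  · exact ⟨_, type2I_mem_generators i, _, type2I_mem_generators i, (inter_self _).symm⟩
  · exact ⟨_, type2II_mem_generators i, _, type2II_mem_generators i, (inter_self _).symm⟩
  · exact ⟨_, type3I_mem_generators i, _, type3I_mem_generators j, rfl⟩
  · exact ⟨_, type3I_mem_generators i, _, type3I_mem_generators i, (inter_self _).symm⟩

theorem suppDetermined_listed
    (hS : S ∈ listed Z) : SuppDetermined Z S := by
  obtain ⟨g, hg, g', hg', rfl⟩ := listed_eq_inter hS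
  exact (suppDetermined_generators hg).inter (suppDetermined_generators hg')

theorem IsRep.exists_minor_ne_zero {U : Gr ℝ 4} {x y : Fin n → ℝ} (hr : IsRep Z U x y) :
    ∃ a b, minor x y a b ≠ 0 := by
  obtain ⟨-, hl, -⟩ := hr
  by_contra! h
  rw [LinearIndependent.pair_iff] at hl
  have hy : ∃ b, y b ≠ 0 := by
    by_contra! hy
    have : comb Z y = 0 := by simp [comb, hy]
    have := hl 0 1 (by rw [this]; simp)
    exact one_ne_zero this.2
  obtain ⟨b, hb⟩ := hy
  refine hb (hl (y b) (-x b) ?_).1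
  simp only [comb, Finset.smul_sum, ← Finset.sum_add_distrib]
  refine Finset.sum_eq_zero fun a _ => ?_
  rw [smul_smul, smul_smul, ← add_smul]
  have := h a b
  simp only [minor] at this
  rw [show y b * x a + -x b * y a = 0 by linarith, zero_smul]

theorem exists_common_vertex {U : Gr ℝ 4} (hU : U ∈ amplituhedron Z) : ∃ a b, a ≠ b ∧
    ∀ S, SuppDetermined Z S → U ∈ realPoints S → VertIn Z S a b := by
  obtain ⟨x, y, hr⟩ := mem_amplituhedron_iff.1 hU
  obtain ⟨a, b, hm⟩ := hr.exists_minor_ne_zero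
  exact ⟨a, b, minor_ne hm, fun S hS h => (hS U x y hr).1 h a b hm⟩

theorem vertex_of_subsingleton {R C : Set (Gr ℂ 4)} {U : Gr ℝ 4}
    (hU : U ∈ amplituhedron Z) (hUR : complexify U ∈ R) (hRC : R ⊆ C) (hC : SuppDetermined Z C)
    (h : ∀ W₁ ∈ C, ∀ W₂ ∈ C, W₁ = W₂) : ∃ S ∈ vertexStrata Z, R ⊆ S ∧ S ⊆ C := by
  obtain ⟨a, b, hab, hv⟩ := exists_common_vertex hU
  have hv' := hv C hC (hRC hUR)
  refine ⟨_, ⟨a, b, hab, rfl⟩, fun W hW => ?_, hv'⟩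
  rw [VertIn, type0I_eq hab] at hv'
  rw [type0I_eq hab]
  exact h _ (hRC hW) _ (hv' rfl)

section Capture
variable {R : Set (Gr ℂ 4)} {U : Gr ℝ 4}
  (hU : U ∈ amplituhedron Z) (hUR : complexify U ∈ R)
include hU hUR

theorem capture_type2I_type3I (hR : R ⊆ type2I Z i ∩ type3I Z j) :
    ∃ S ∈ linearStrata Z, R ⊆ S ∧ S ⊆ type2I Z i ∩ type3I Z j := by
  by_cases h1 : i = j
  · subst h1
    exact ⟨_, .inl (type2I_mem_generators i), fun W hW => (hR hW).1,
      subset_inter subset_rfl (type2I_subset_type3I i)⟩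
  by_cases h2 : i = j + 1
  · subst h2
    exact ⟨_, .inl (type2I_mem_generators _), fun W hW => (hR hW).1,
      subset_inter subset_rfl (type2I_succ_subset_type3I j)⟩
  exact ⟨_, .inr (.inl (.inr ⟨i, j, h1, h2, rfl⟩)), hR, subset_rfl⟩

theorem capture_type2II_type3I (hR : R ⊆ type2II Z i ∩ type3I Z j) :
    ∃ S ∈ linearStrata Z, R ⊆ S ∧ S ⊆ type2II Z i ∩ type3I Z j := by
  by_cases h1 : i = j
  · subst h1
    exact ⟨_, .inl (type2II_mem_generators i), fun W hW => (hR hW).1,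
      subset_inter subset_rfl (type2II_subset_type3I i)⟩
  by_cases h2 : i = j + 1
  · subst h2
    exact ⟨_, .inl (type2II_mem_generators _), fun W hW => (hR hW).1,
      subset_inter subset_rfl (type2II_succ_subset_type3I j)⟩
  obtain ⟨a, b, hab, hv⟩ := exists_common_vertex hU
  have v1 := (vertIn_type2II hab).1 (hv _ (suppDetermined_type2II i) (hR hUR).1)
  have v2 := (vertIn_type3I hab).1 (hv _ (suppDetermined_type3I j) (hR hUR).2)
  have : j = i + 1 ∨ j = i - 1 - 1 := by
    have e : ∀ k : Fin n, j + 1 = k → j = k - 1 := fun k h => by rw [← h, add_sub_cancel_right]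
    have e1 := e (i + 1)
    grind
  rcases this with rfl | rfl
  · rw [type2II_inter_type3I_succ] at hR ⊢
    exact ⟨_, .inr (.inl (.inr ⟨_, _, (pred_ne_succ i).symm,
      by rw [sub_add_cancel]; exact (succ_ne i).symm, rfl⟩)), hR, subset_rfl⟩
  · rw [type2II_inter_type3I_pred] at hR ⊢
    exact ⟨_, .inr (.inl (.inr ⟨_, _, pred_ne i, pred_ne_succ i, rfl⟩)), hR, subset_rfl⟩

theorem capture_type2I_type2I (hR : R ⊆ type2I Z i ∩ type2I Z j) :
    ∃ S ∈ linearStrata Z, R ⊆ S ∧ S ⊆ type2I Z i ∩ type2I Z j := by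
  by_cases h : i = j
  · subst h
    exact ⟨_, .inl (type2I_mem_generators i), fun W hW => (hR hW).1, subset_inter subset_rfl
      subset_rfl⟩
  · exact ⟨_, .inr (.inr ⟨i, j, h, rfl⟩), hR, subset_rfl⟩

theorem capture_type2I_type2II (hR : R ⊆ type2I Z i ∩ type2II Z j) :
    ∃ S ∈ linearStrata Z, R ⊆ S ∧ S ⊆ type2I Z i ∩ type2II Z j := by
  obtain ⟨a, b, hab, hv⟩ := exists_common_vertex hU
  have v1 := (vertIn_type2I hab).1 (hv _ (suppDetermined_type2I i) (hR hUR).1)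
  have v2 := (vertIn_type2II hab).1 (hv _ (suppDetermined_type2II j) (hR hUR).2)
  have : i = j - 1 ∨ i = j ∨ i = j + 1 := by grind
  rcases this with rfl | rfl | rfl
  · rw [← type1II_pred_eq] at hR ⊢
    exact ⟨_, .inr (.inl (.inr ⟨_, _, pred_ne j, pred_ne_succ j, rfl⟩)), hR, subset_rfl⟩
  · rw [← type1I_eq] at hR ⊢
    exact ⟨_, .inr (.inl (.inl ⟨i, rfl⟩)), hR, subset_rfl⟩
  · rw [← type1II_succ_eq] at hR ⊢
    exact ⟨_, .inr (.inl (.inr ⟨_, _, (pred_ne_succ j).symm,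
      by rw [sub_add_cancel]; exact (succ_ne j).symm, rfl⟩)), hR, subset_rfl⟩

theorem capture_type2II_type2II (hR : R ⊆ type2II Z i ∩ type2II Z j) :
    ∃ S ∈ linearStrata Z, R ⊆ S ∧ S ⊆ type2II Z i ∩ type2II Z j := by
  by_cases h : i = j
  · subst h
    exact ⟨_, .inl (type2II_mem_generators i), fun W hW => (hR hW).1, subset_inter subset_rfl
      subset_rfl⟩
  have hc : ∃ c, (c = j - 1 ∨ c = j ∨ c = j + 1) ∧ c ≠ i - 1 ∧ c ≠ i ∧ c ≠ i + 1 := by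
    by_contra! hcon
    have h1 := hcon (j - 1) (by simp)
    have h2 := hcon j (by simp)
    have h3 := hcon (j + 1) (by simp)
    have f3 := add_one_add_one_ne (i - 1)
    have f4 := pred_ne_succ (i - 1)
    have f5 := pred_ne_succ (i + 1)
    have f8 := add_one_add_one_ne (i + 1)
    grind
  obtain ⟨c, hc, hc'⟩ := hc
  obtain ⟨S, hS, h1, h2⟩ := vertex_of_subsingleton hU hUR hR
    ((suppDetermined_type2II i).inter (suppDetermined_type2II j))
    (fun W₁ h₁ W₂ h₂ => schubertP_inter_subsingleton (fun hle => by
      have hm : toComplex (Z c) ∈ Submodule.span ℂ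
          {toComplex (Z (j - 1)), toComplex (Z j), toComplex (Z (j + 1))} :=
        Submodule.subset_span (by rcases hc with rfl | rfl | rfl <;> simp)
      have := (mem_span_triple_iff_br (toComplex_triple (pred_ne i) (pred_ne_succ i)
        (succ_ne i))).1 (hle hm)
      exact toComplex_br hc'.1 hc'.2.1 hc'.2.2 (pred_ne i) (pred_ne_succ i)
        (succ_ne i) this) h₁ h₂)
  exact ⟨S, .inr (.inr hS), h1, h2⟩

/-- A linear stratum of the second or third codimension meets a generator in a linear stratum. -/
theorem capture_linear_generator {g g' : Set (Gr ℂ 4)}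
    (hg : (∃ i, g = type2I Z i) ∨ ∃ i, g = type2II Z i) (hg' : g' ∈ generators Z)
    (hR : R ⊆ g ∩ g') : ∃ S ∈ linearStrata Z, R ⊆ S ∧ S ⊆ g ∩ g' := by
  rcases hg with ⟨i, rfl⟩ | ⟨i, rfl⟩ <;> rcases hg' with ⟨j, rfl⟩ | ⟨j, rfl⟩ | ⟨j, rfl⟩
  · exact capture_type2I_type3I hU hUR hR
  · exact capture_type2I_type2I hU hUR hR
  · exact capture_type2I_type2II hU hUR hR
  · exact capture_type2II_type3I hU hUR hR
  · rw [inter_comm] at hR ⊢; exact capture_type2I_type2II hU hUR hR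
  · exact capture_type2II_type2II hU hUR hR

theorem capture_pencil {a b c : Fin n} (hab : a ≠ b) (hac : a ≠ c) (hbc : b ≠ c)
    (hS : schubertV (toComplex (Z a)) ∩ schubertL (toComplex (Z b)) (toComplex (Z c)) ∈
      lineStrata Z) {g : Set (Gr ℂ 4)} (hg : g ∈ generators Z)
    (hR : R ⊆ schubertV (toComplex (Z a)) ∩ schubertL (toComplex (Z b)) (toComplex (Z c)) ∩ g) :
    ∃ S ∈ linearStrata Z, R ⊆ S ∧
      S ⊆ schubertV (toComplex (Z a)) ∩ schubertL (toComplex (Z b)) (toComplex (Z c)) ∩ g := by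
  set T := schubertV (toComplex (Z a)) ∩ schubertL (toComplex (Z b)) (toComplex (Z c))
  by_cases hs : ∀ W₁ ∈ T ∩ g, ∀ W₂ ∈ T ∩ g, W₁ = W₂
  · obtain ⟨S, hS, h1, h2⟩ := vertex_of_subsingleton hU hUR hR
      ((suppDetermined_listed (.inl (.inl (.inr hS)))).inter
        (suppDetermined_generators hg)) hs
    exact ⟨S, .inr (.inr hS), h1, h2⟩
  · push Not at hs
    obtain ⟨W₁, h₁, W₂, h₂, hne⟩ := hs
    have hT : T ⊆ g := by
      rcases hg with ⟨i, rfl⟩ | ⟨i, rfl⟩ | ⟨i, rfl⟩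
      · exact pencil_subset_schubertL (toComplex_notMem hab hac hbc)
          (toComplex_pair_independent (succ_ne i)) h₁ h₂ hne
      · exact pencil_subset_schubertV (toComplex_notMem hab hac hbc) h₁ h₂ hne
      · exact pencil_subset_schubertP (toComplex_notMem hab hac hbc) h₁ h₂ hne
    exact ⟨T, .inr (.inl hS), fun W hW => (hR hW).1, subset_inter subset_rfl hT⟩

theorem capture_lineStrata {S g : Set (Gr ℂ 4)} (hS : S ∈ lineStrata Z) (hg : g ∈ generators Z)
    (hR : R ⊆ S ∩ g) : ∃ S' ∈ linearStrata Z, R ⊆ S' ∧ S' ⊆ S ∩ g := by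
  have hS' := hS
  rcases hS with ⟨i, rfl⟩ | ⟨i, j, h1, h2, rfl⟩
  · exact capture_pencil hU hUR (pred_ne i).symm (succ_ne i) (pred_ne_succ i) hS'
      hg hR
  · exact capture_pencil hU hUR h1 h2 (succ_ne j) hS' hg hR

variable (hRi : IsIrreducible R)
include hRi

theorem capture_type3I_type3I (hR : R ⊆ type3I Z i ∩ type3I Z j) :
    ∃ S ∈ listed Z, R ⊆ S ∧ S ⊆ type3I Z i ∩ type3I Z j := by
  have key : ∀ i, R ⊆ type3I Z i ∩ type3I Z (i + 1) →
      ∃ S ∈ listed Z, R ⊆ S ∧ S ⊆ type3I Z i ∩ type3I Z (i + 1) := by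
    intro i hR
    rw [type3I_inter_succ] at hR ⊢
    rcases isPreirreducible_iff_isClosed_union_isClosed.1 hRi.isPreirreducible _ _
      (isClosed_generators (type2I_mem_generators (i + 1)))
      (isClosed_generators (type2II_mem_generators (i + 1))) hR with h | h
    · exact ⟨_, linearStrata_subset_listed (.inl (type2I_mem_generators _)), h, subset_union_left⟩
    · exact ⟨_, linearStrata_subset_listed (.inl (type2II_mem_generators _)), h, subset_union_right⟩
  by_cases h0 : j = i
  · subst h0
    exact ⟨_, linearStrata_subset_listed (.inl (type3I_mem_generators j)),
      fun W hW => (hR hW).1, subset_inter subset_rfl subset_rfl⟩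
  by_cases h1 : j = i + 1
  · subst h1; exact key i hR
  by_cases h2 : j = i - 1
  · have h : i = j + 1 := by rw [h2, sub_add_cancel]
    subst h
    rw [inter_comm] at hR ⊢
    exact key j hR
  exact ⟨_, .inl (.inr (.inr (.inr ⟨i, j, h2, h0, h1, rfl⟩))), hR, subset_rfl⟩

theorem capture_linearStrata {S g : Set (Gr ℂ 4)} (hS : S ∈ linearStrata Z)
    (hg : g ∈ generators Z) (hR : R ⊆ S ∩ g) : ∃ S' ∈ listed Z, R ⊆ S' ∧ S' ⊆ S ∩ g := by
  rcases hS with (⟨i, rfl⟩ | hS) | hS | hS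
  · rcases hg with ⟨j, rfl⟩ | hg
    · exact capture_type3I_type3I hU hUR hRi hR
    · rw [inter_comm] at hR ⊢
      obtain ⟨S, hS, h⟩ := capture_linear_generator hU hUR hg (type3I_mem_generators i) hR
      exact ⟨S, linearStrata_subset_listed hS, h⟩
  · obtain ⟨S, hS, h⟩ := capture_linear_generator hU hUR hS hg hR
    exact ⟨S, linearStrata_subset_listed hS, h⟩
  · obtain ⟨S, hS, h⟩ := capture_lineStrata hU hUR hS hg hR
    exact ⟨S, linearStrata_subset_listed hS, h⟩
  · obtain ⟨a, b, hab, rfl⟩ := hS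
    refine ⟨_, .inl (.inl (.inl ⟨a, b, hab, rfl⟩)), fun W hW => (hR hW).1,
      subset_inter subset_rfl ?_⟩
    have := (hR hUR).1
    rw [type0I_eq hab] at this ⊢
    rintro _ rfl
    rw [← this]
    exact (hR hUR).2

theorem capture_type2III (h1 : j ≠ i - 1) (h2 : j ≠ i) (h3 : j ≠ i + 1)
    {g : Set (Gr ℂ 4)} (hg : g ∈ generators Z) (hR : R ⊆ type2III Z i j ∩ g) :
    ∃ S' ∈ listed Z, R ⊆ S' ∧ S' ⊆ type2III Z i j ∩ g := by
  have key : ∀ g, ((∃ i, g = type2I Z i) ∨ ∃ i, g = type2II Z i) → R ⊆ type2III Z i j ∩ g →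
      ∃ S' ∈ listed Z, R ⊆ S' ∧ S' ⊆ type2III Z i j ∩ g := by
    intro g hg hR
    obtain ⟨S, hS, hRS, hS'⟩ := capture_linear_generator hU hUR hg (type3I_mem_generators i)
      (fun W hW => ⟨(hR hW).2, (hR hW).1.1⟩)
    obtain ⟨T, hT, hRT, hT'⟩ := capture_linearStrata hU hUR hRi hS (type3I_mem_generators j)
      (fun W hW => ⟨hRS hW, (hR hW).1.2⟩)
    exact ⟨T, hT, hRT, fun W hW => ⟨⟨(hS' (hT' hW).1).2, (hT' hW).2⟩, (hS' (hT' hW).1).1⟩⟩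
  rcases hg with ⟨k, rfl⟩ | hg
  swap
  · exact key g hg hR
  have hQ : type2III Z i j ∈ listed Z := .inl (.inr (.inr (.inr ⟨i, j, h1, h2, h3, rfl⟩)))
  -- a divisor adjacent to one of the two
  have adj : ∀ l, (R ⊆ type3I Z l ∩ type3I Z (l + 1)) →
      (type2III Z i j ∩ (type3I Z l ∩ type3I Z (l + 1)) ⊆ type2III Z i j ∩ type3I Z k) →
      ∃ S' ∈ listed Z, R ⊆ S' ∧ S' ⊆ type2III Z i j ∩ type3I Z k := by
    intro l hl hsub
    rw [type3I_inter_succ] at hl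
    rcases isPreirreducible_iff_isClosed_union_isClosed.1 hRi.isPreirreducible _ _
      (isClosed_generators (type2I_mem_generators (l + 1)))
      (isClosed_generators (type2II_mem_generators (l + 1))) hl with h | h
    · obtain ⟨S, hS, hRS, hS'⟩ := key _ (.inl ⟨l + 1, rfl⟩)
        (subset_inter (fun W hW => (hR hW).1) h)
      refine ⟨S, hS, hRS, fun W hW => hsub ⟨(hS' hW).1, ?_⟩⟩
      rw [type3I_inter_succ]
      exact .inl (hS' hW).2
    · obtain ⟨S, hS, hRS, hS'⟩ := key _ (.inr ⟨l + 1, rfl⟩)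
        (subset_inter (fun W hW => (hR hW).1) h)
      refine ⟨S, hS, hRS, fun W hW => hsub ⟨(hS' hW).1, ?_⟩⟩
      rw [type3I_inter_succ]
      exact .inr (hS' hW).2
  have hRi' : R ⊆ type3I Z i := fun W hW => (hR hW).1.1
  have hRj' : R ⊆ type3I Z j := fun W hW => (hR hW).1.2
  have hRk' : R ⊆ type3I Z k := fun W hW => (hR hW).2
  by_cases k0 : k = i
  · subst k0; exact ⟨_, hQ, fun W hW => (hR hW).1, fun W hW => ⟨hW, hW.1⟩⟩
  by_cases k1 : k = j
  · subst k1; exact ⟨_, hQ, fun W hW => (hR hW).1, fun W hW => ⟨hW, hW.2⟩⟩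
  by_cases k2 : k = i + 1
  · subst k2; exact adj i (subset_inter hRi' hRk') fun W h => ⟨h.1, h.2.2⟩
  by_cases k3 : k = j + 1
  · subst k3; exact adj j (subset_inter hRj' hRk') fun W h => ⟨h.1, h.2.2⟩
  by_cases k4 : k + 1 = i
  · subst k4; exact adj k (subset_inter hRk' hRi') fun W h => ⟨h.1, h.2.1⟩
  by_cases k5 : k + 1 = j
  · subst k5; exact adj k (subset_inter hRk' hRj') fun W h => ⟨h.1, h.2.1⟩
  exfalso
  obtain ⟨a, b, hab, hv⟩ := exists_common_vertex hU
  have v1 := (vertIn_type3I hab).1 (hv _ (suppDetermined_type3I i) (hRi' hUR))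
  have v2 := (vertIn_type3I hab).1 (hv _ (suppDetermined_type3I j) (hRj' hUR))
  have v3 := (vertIn_type3I hab).1 (hv _ (suppDetermined_type3I k) (hRk' hUR))
  grind

theorem capture_listed_generator {S g : Set (Gr ℂ 4)} (hS : S ∈ listed Z)
    (hg : g ∈ generators Z) (hR : R ⊆ S ∩ g) : ∃ S' ∈ listed Z, R ⊆ S' ∧ S' ⊆ S ∩ g := by
  rcases hS with ((hS | hS) | (hS | hS | ⟨i, j, h1, h2, h3, rfl⟩)) | hS
  · exact capture_linearStrata hU hUR hRi (.inr (.inr hS)) hg hR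
  · exact capture_linearStrata hU hUR hRi (.inr (.inl hS)) hg hR
  · exact capture_linearStrata hU hUR hRi (.inl (.inr (.inl hS))) hg hR
  · exact capture_linearStrata hU hUR hRi (.inl (.inr (.inr hS))) hg hR
  · exact capture_type2III hU hUR hRi h1 h2 h3 hg hR
  · exact capture_linearStrata hU hUR hRi (.inl (.inl hS)) hg hR

/-- Near a point of the amplituhedron, irreducible subsets of the intersection of two listed strata
lie in a listed stratum. -/
theorem capture_listed (hS : S ∈ listed Z) (hT : T ∈ listed Z)
    (hR : R ⊆ S ∩ T) : ∃ S' ∈ listed Z, R ⊆ S' ∧ S' ⊆ S ∩ T := by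
  obtain ⟨g, hg, g', hg', rfl⟩ := listed_eq_inter hT
  obtain ⟨S₁, hS₁, hR₁, h₁⟩ := capture_listed_generator hU hUR hRi hS hg
    (fun W hW => ⟨(hR hW).1, (hR hW).2.1⟩)
  obtain ⟨S₂, hS₂, hR₂, h₂⟩ := capture_listed_generator hU hUR hRi hS₁ hg'
    (fun W hW => ⟨hR₁ hW, (hR hW).2.2⟩)
  exact ⟨S₂, hS₂, hR₂, fun W hW => ⟨(h₁ (h₂ hW).1).1, (h₁ (h₂ hW).1).2, (h₂ hW).2⟩⟩

end Capture

theorem exists_listed_subset_inter {U : Gr ℝ 4}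
    (hU : U ∈ amplituhedron Z) {S T : Set (Gr ℂ 4)} (hS : S ∈ listed Z) (hT : T ∈ listed Z)
    (h1 : U ∈ realPoints S) (h2 : U ∈ realPoints T) :
    ∃ S' ∈ listed Z, U ∈ realPoints S' ∧ S' ⊆ S ∩ T := by
  obtain ⟨S', hS', hR, h⟩ := capture_listed hU (R := {complexify U}) rfl
    isIrreducible_singleton hS hT (by rintro _ rfl; exact ⟨h1, h2⟩)
  exact ⟨S', hS', hR rfl, h⟩

theorem subset_type3I_of_isIrreducible {R : Set (Gr ℂ 4)}
    (hR : IsIrreducible R) (h : R ⊆ algebraicBoundary Z) : ∃ i, R ⊆ type3I Z i := by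
  rw [algebraicBoundary_eq] at h
  obtain ⟨z, hz, hRz⟩ := isIrreducible_iff_sUnion_isClosed.1 hR (Finset.univ.image (type3I Z))
    (by simpa using fun i => isClosed_type3I i) (by simpa using h)
  obtain ⟨i, -, rfl⟩ := Finset.mem_image.1 hz
  exact ⟨i, hRz⟩

theorem isIrreducible_type3I (i : Fin n) : IsIrreducible (type3I Z i) :=
  isIrreducible_schubertL (toComplex_pair_independent (succ_ne i))

theorem isIrreducible_listed {S : Set (Gr ℂ 4)}
    (hS : S ∈ listed Z) : IsIrreducible S := by
  rcases hS with ((⟨i, j, hij, rfl⟩ | (⟨i, rfl⟩ | ⟨i, j, h1, h2, rfl⟩)) |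
    (⟨i, rfl⟩ | ⟨i, rfl⟩ | ⟨i, j, h1, h2, h3, rfl⟩)) | ⟨i, rfl⟩
  · rw [type0I_eq hij]; exact isIrreducible_singleton
  · exact isIrreducible_schubertV_inter_schubertL
      (toComplex_pair_independent (pred_ne i).symm)
      (toComplex_notMem (pred_ne i).symm (succ_ne i) (pred_ne_succ i))
  · exact isIrreducible_schubertV_inter_schubertL (toComplex_pair_independent h1)
      (toComplex_notMem h1 h2 (succ_ne j))
  · exact isIrreducible_schubertV (toComplex_pair_independent (succ_ne i))
  · exact isIrreducible_schubertP (toComplex_pair_independent (pred_ne i))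
  · refine isIrreducible_schubertL_inter_schubertL (toComplex_br (succ_ne i) h2.symm ?_
      h3.symm ?_ (succ_ne j))
    · rintro rfl; exact h1 (by rw [add_sub_cancel_right])
    · exact fun h => h2 (add_right_cancel h).symm
  · exact isIrreducible_type3I i

/-- A stratum containing a point of the amplituhedron is listed. -/
theorem IsStratum.mem_listed {S : Set (Gr ℂ 4)}
    (hS : IsStratum Z S) {U : Gr ℝ 4} (hU : U ∈ amplituhedron Z) (hUS : U ∈ realPoints S) :
    S ∈ listed Z := by
  induction hS with
  | @component S h =>
    obtain ⟨i, hi⟩ := subset_type3I_of_isIrreducible h.prop.1 h.prop.2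
    have : S = type3I Z i := subset_antisymm hi (h.le_of_ge ⟨isIrreducible_type3I i, by
      rw [algebraicBoundary_eq]; exact subset_iUnion _ i⟩ hi)
    exact .inr ⟨i, this⟩
  | @inter S T R _ _ h ihS ihT =>
    obtain ⟨S', hS', h1, h2⟩ := capture_listed hU hUS h.prop.1 (ihS (h.prop.2 hUS).1)
      (ihT (h.prop.2 hUS).2) h.prop.2
    have e : R = S' := subset_antisymm h1 (h.le_of_ge ⟨isIrreducible_listed hS', h2⟩ h1)
    rw [e]
    exact hS'

theorem isStratum_inter {S T : Set (Gr ℂ 4)} (hS : IsStratum Z S) (hT : IsStratum Z T)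
    (h : IsIrreducible (S ∩ T)) : IsStratum Z (S ∩ T) :=
  IsStratum.inter hS hT ⟨⟨h, subset_rfl⟩, fun _ hR _ => hR.2⟩

theorem VertIn.mono {S T : Set (Gr ℂ 4)} (h : S ⊆ T) {a b : Fin n} (hv : VertIn Z S a b) :
    VertIn Z T a b := hv.trans h

theorem eq_of_type3I_subset {i j : Fin n}
    (h : type3I Z i ⊆ type3I Z j) : i = j := by
  by_contra hij
  have ha : ∃ a, (a = i ∨ a = i + 1) ∧ a ≠ j ∧ a ≠ j + 1 := by
    by_cases h1 : i = j + 1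
    · refine ⟨i + 1, .inr rfl, fun h2 => ?_, fun h2 => hij (add_right_cancel h2)⟩
      have := pred_ne_succ i
      rw [h2, h1, add_sub_cancel_right] at this
      exact this rfl
    · exact ⟨i, .inl rfl, hij, h1⟩
  obtain ⟨a, ha, h1, h2⟩ := ha
  obtain ⟨b, hb1, hb2, hb3⟩ := exists_ne_three a j (j + 1)
  have := (vertIn_type3I hb1.symm).1
    (((vertIn_type3I (k := i) hb1.symm).2 (by tauto)).mono h)
  tauto

theorem isStratum_type3I (i : Fin n) : IsStratum Z (type3I Z i) := by
  refine IsStratum.component ⟨⟨isIrreducible_type3I i, ?_⟩, fun R hR h => ?_⟩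
  · rw [algebraicBoundary_eq]; exact subset_iUnion _ i
  · obtain ⟨j, hj⟩ := subset_type3I_of_isIrreducible hR.1 hR.2
    rw [eq_of_type3I_subset ((show type3I Z i ⊆ R from h).trans hj)]
    exact hj

theorem not_type2I_subset_type2II (i : Fin n) : ¬ type2I Z i ⊆ type2II Z i := by
  intro h
  obtain ⟨b, hb1, hb2, hb3⟩ := exists_ne_three (i - 1) i (i + 1)
  have := (vertIn_type2II hb2).1 (((vertIn_type2I (k := i) hb2).2 (by tauto)).mono h)
  tauto

theorem not_type2II_subset_type2I (i : Fin n) : ¬ type2II Z i ⊆ type2I Z i := by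
  intro h
  have := (vertIn_type2I (pred_ne_succ i)).1
    (((vertIn_type2II (k := i) (pred_ne_succ i)).2 (by simp)).mono h)
  rcases this with h | h
  · exact pred_ne i h
  · exact (succ_ne i).symm h

theorem type3I_pred_inter (i : Fin n) :
    type3I Z (i - 1) ∩ type3I Z i = type2I Z i ∪ type2II Z i := by
  simpa using type3I_inter_succ (Z := Z) (i - 1)

theorem isStratum_type2I (i : Fin n) : IsStratum Z (type2I Z i) := by
  refine IsStratum.inter (isStratum_type3I (i - 1)) (isStratum_type3I i)
    ⟨⟨isIrreducible_listed (linearStrata_subset_listed (.inl (type2I_mem_generators i))),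
      ?_⟩, fun R hR h => ?_⟩
  · rw [type3I_pred_inter]; exact subset_union_left
  · have h2 := hR.2
    rw [type3I_pred_inter] at h2
    rcases isPreirreducible_iff_isClosed_union_isClosed.1 hR.1.isPreirreducible _ _
      (isClosed_generators (type2I_mem_generators i))
      (isClosed_generators (type2II_mem_generators i)) h2 with h' | h'
    · exact h'
    · exact absurd ((show type2I Z i ⊆ R from h).trans h') (not_type2I_subset_type2II i)

theorem isStratum_type2II (i : Fin n) : IsStratum Z (type2II Z i) := by
  refine IsStratum.inter (isStratum_type3I (i - 1)) (isStratum_type3I i)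
    ⟨⟨isIrreducible_listed (linearStrata_subset_listed (.inl (type2II_mem_generators i))),
      ?_⟩, fun R hR h => ?_⟩
  · rw [type3I_pred_inter]; exact subset_union_right
  · have h2 := hR.2
    rw [type3I_pred_inter] at h2
    rcases isPreirreducible_iff_isClosed_union_isClosed.1 hR.1.isPreirreducible _ _
      (isClosed_generators (type2I_mem_generators i))
      (isClosed_generators (type2II_mem_generators i)) h2 with h' | h'
    · exact absurd ((show type2II Z i ⊆ R from h).trans h') (not_type2II_subset_type2I i)
    · exact h'

/-- Every listed set is a stratum. -/
theorem isStratum_listed {S : Set (Gr ℂ 4)} (hS : S ∈ listed Z) : IsStratum Z S := by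
  have hirr := isIrreducible_listed hS
  rcases hS with ((⟨i, j, _, rfl⟩ | (⟨i, rfl⟩ | ⟨i, j, _, _, rfl⟩)) |
    (⟨i, rfl⟩ | ⟨i, rfl⟩ | ⟨i, j, _, _, _, rfl⟩)) | ⟨i, rfl⟩
  · exact isStratum_inter (isStratum_type2I i) (isStratum_type2I j) hirr
  · rw [type1I_eq] at hirr ⊢
    exact isStratum_inter (isStratum_type2I i) (isStratum_type2II i) hirr
  · exact isStratum_inter (isStratum_type2I i) (isStratum_type3I j) hirr
  · exact isStratum_type2I i
  · exact isStratum_type2II i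
  · exact isStratum_inter (isStratum_type3I i) (isStratum_type3I j) hirr
  · exact isStratum_type3I i

end Vertices

section HPolytope
variable {E K : Type*} [NormedAddCommGroup E] [NormedSpace ℝ E] [Finite K]
  {c : K → ℝ} {f : K → E →L[ℝ] ℝ}

/-- The solution set of a system of affine inequalities. -/
def hpoly (c : K → ℝ) (f : K → E →L[ℝ] ℝ) : Set E := {x | ∀ k, 0 ≤ c k + f k x}

theorem convex_hpoly : Convex ℝ (hpoly c f) := by
  intro x hx y hy a b ha hb hab k
  have h1 := mul_nonneg ha (hx k)
  have h2 := mul_nonneg hb (hy k)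
  simp only [map_add, map_smul, smul_eq_mul]
  have : c k = a * c k + b * c k := by rw [← add_mul, hab, one_mul]
  rw [this]
  linarith

theorem isClosed_hpoly : IsClosed (hpoly c f) := by
  have : hpoly c f = ⋂ k, {x | 0 ≤ c k + f k x} := by ext; simp [hpoly]
  rw [this]
  exact isClosed_iInter fun k => isClosed_le continuous_const (by fun_prop)

theorem isOpen_strict : IsOpen {x : E | ∀ k, 0 < c k + f k x} := by
  have : {x : E | ∀ k, 0 < c k + f k x} = ⋂ k, {x | 0 < c k + f k x} := by ext; simp
  rw [this]
  exact isOpen_iInter_of_finite fun k => isOpen_lt continuous_const (by fun_prop)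

theorem mem_closure_strict {x₀ : E} (h₀ : ∀ k, 0 < c k + f k x₀) {x : E} (hx : x ∈ hpoly c f) :
    x ∈ closure {x : E | ∀ k, 0 < c k + f k x} := by
  have h0 : (0 : ℝ) ∈ closure (Ioc (0 : ℝ) 1) := by
    rw [closure_Ioc (by simp)]; simp
  have := map_mem_closure (f := fun τ : ℝ => x + τ • (x₀ - x)) (by fun_prop) h0
    (t := {x : E | ∀ k, 0 < c k + f k x}) (by
      rintro τ ⟨h1, h2⟩ k
      have e1 := mul_pos h1 (h₀ k)
      have e2 := mul_nonneg (sub_nonneg.2 h2) (hx k)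
      simp only [map_add, map_smul, map_sub, smul_eq_mul]
      linarith)
  simpa using this

theorem exists_add_smul_mem_hpoly {x v : E} (hx : x ∈ hpoly c f)
    (hv : ∀ k, c k + f k x = 0 → f k v = 0) : ∃ τ : ℝ, 0 < τ ∧ x + τ • v ∈ hpoly c f := by
  have : ∀ k, ∀ᶠ τ : ℝ in nhdsWithin 0 (Ioi 0), 0 ≤ c k + f k (x + τ • v) := by
    intro k
    by_cases h : c k + f k x = 0
    · filter_upwards with τ
      rw [map_add, map_smul, hv k h, smul_zero, add_zero, h]
    · have hpos : 0 < c k + f k (x + (0 : ℝ) • v) := by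
        simpa using lt_of_le_of_ne (hx k) (Ne.symm h)
      have hc : Continuous fun τ : ℝ => c k + f k (x + τ • v) := by fun_prop
      have := (hc.tendsto 0).eventually (eventually_gt_nhds hpos)
      filter_upwards [nhdsWithin_le_nhds this] with τ hτ using hτ.le
  obtain ⟨τ, h1, h2⟩ := ((Filter.eventually_all.2 this).and self_mem_nhdsWithin).exists
  exact ⟨τ, h2, h1⟩

theorem exists_generic_point {Q : Set E} (hQ : Q ⊆ hpoly c f) (hc : Convex ℝ Q)
    (hne : Q.Nonempty) : ∃ x₀ ∈ Q, ∀ k, c k + f k x₀ = 0 → ∀ x ∈ Q, c k + f k x = 0 := by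
  classical
  cases nonempty_fintype K
  have : ∀ s : Finset K, ∃ x₀ ∈ Q, ∀ k ∈ s, c k + f k x₀ = 0 → ∀ x ∈ Q, c k + f k x = 0 := by
    intro s
    induction s using Finset.induction_on with
    | empty => obtain ⟨x, hx⟩ := hne; exact ⟨x, hx, by simp⟩
    | insert k s _ ih =>
      obtain ⟨x₀, hx₀, h⟩ := ih
      by_cases hk : ∀ x ∈ Q, c k + f k x = 0
      · refine ⟨x₀, hx₀, fun j hj => ?_⟩
        rcases Finset.mem_insert.1 hj with rfl | hj
        · exact fun _ => hk
        · exact h j hj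
      · push Not at hk
        obtain ⟨x₁, hx₁, hk⟩ := hk
        have key : ∀ j, c j + f j ((1 / 2 : ℝ) • x₀ + (1 / 2 : ℝ) • x₁) = 0 →
            c j + f j x₀ = 0 ∧ c j + f j x₁ = 0 := by
          intro j hj
          have h0 := hQ hx₀ j
          have h1 := hQ hx₁ j
          simp only [map_add, map_smul, smul_eq_mul] at hj
          constructor <;> linarith
        refine ⟨_, hc hx₀ hx₁ (a := 1 / 2) (b := 1 / 2) (by simp) (by simp) (by norm_num),
          fun j hj h0 => ?_⟩
        rcases Finset.mem_insert.1 hj with rfl | hj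
        · exact absurd (key _ h0).2 hk
        · exact h j hj (key j h0).1
  obtain ⟨x₀, h1, h2⟩ := this Finset.univ
  exact ⟨x₀, h1, fun k => h2 k (Finset.mem_univ k)⟩

theorem mem_exposed_of_active {Q : Set E} (hQ : IsExposed ℝ (hpoly c f) Q) {x₀ x : E}
    (hx₀ : x₀ ∈ Q) (hx : x ∈ hpoly c f) (h : ∀ k, c k + f k x₀ = 0 → c k + f k x = 0) : x ∈ Q := by
  obtain ⟨l, rfl⟩ := hQ ⟨x₀, hx₀⟩
  obtain ⟨τ, hτ, hm⟩ := exists_add_smul_mem_hpoly (v := x₀ - x) hx₀.1 fun k hk => by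
    rw [map_sub]; have := h k hk; linarith
  refine ⟨hx, fun y hy => (hx₀.2 y hy).trans ?_⟩
  have := hx₀.2 _ hm
  rw [map_add, map_smul, map_sub, smul_eq_mul] at this
  nlinarith

theorem isExposed_active (J : Set K) : IsExposed ℝ (hpoly c f)
    {x | x ∈ hpoly c f ∧ ∀ k ∈ J, c k + f k x = 0} := by
  classical
  cases nonempty_fintype K
  rintro ⟨x₀, hx₀, h₀⟩
  refine ⟨-∑ k ∈ Finset.univ.filter (· ∈ J), f k, ?_⟩
  have e : ∀ x, (-∑ k ∈ Finset.univ.filter (· ∈ J), f k) x =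
      -∑ k ∈ Finset.univ.filter (· ∈ J), (c k + f k x) + ∑ k ∈ Finset.univ.filter (· ∈ J), c k := by
    intro x
    rw [Finset.sum_add_distrib]
    simp
  have hz : ∀ x, x ∈ hpoly c f → 0 ≤ ∑ k ∈ Finset.univ.filter (· ∈ J), (c k + f k x) :=
    fun x hx => Finset.sum_nonneg fun k _ => hx k
  ext x
  constructor
  · rintro ⟨hx, h⟩
    refine ⟨hx, fun y hy => ?_⟩
    have h1 : ∑ k ∈ Finset.univ.filter (· ∈ J), (c k + f k x) = 0 :=
      Finset.sum_eq_zero fun k hk => h k (by simpa using hk)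
    rw [e, e, h1]
    have := hz y hy
    linarith
  · rintro ⟨hx, h⟩
    refine ⟨hx, fun k hk => ?_⟩
    have h1 : ∑ k ∈ Finset.univ.filter (· ∈ J), (c k + f k x₀) = 0 :=
      Finset.sum_eq_zero fun k hk => h₀ k (by simpa using hk)
    have := h x₀ hx₀
    rw [e, e, h1] at this
    have h2 : ∑ k ∈ Finset.univ.filter (· ∈ J), (c k + f k x) = 0 :=
      le_antisymm (by linarith) (hz x hx)
    exact (Finset.sum_eq_zero_iff_of_nonneg fun k _ => hx k).1 h2 k (by simpa using hk)

theorem finite_extremePoints_hpoly : ((hpoly c f).extremePoints ℝ).Finite := by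
  refine Set.Finite.of_injOn (f := fun x => {k | c k + f k x = 0}) (t := univ) (fun _ _ => mem_univ _)
    ?_ finite_univ
  intro x hx y hy hxy
  have hxy' : ∀ k, c k + f k x = 0 ↔ c k + f k y = 0 := fun k => Set.ext_iff.1 hxy k
  obtain ⟨τ, hτ, hm⟩ := exists_add_smul_mem_hpoly (v := x - y) hx.1 fun k hk => by
    have := (hxy' k).1 hk
    rw [map_sub]; linarith
  have := (mem_extremePoints.1 hx).2 y hy.1 _ hm ⟨τ / (1 + τ), 1 / (1 + τ), by positivity,
    by positivity, by field_simp; ring, by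
      rw [smul_add, smul_smul]
      have e : (1 : ℝ) / (1 + τ) = 1 - τ / (1 + τ) := by field_simp; ring
      have e2 : (1 : ℝ) / (1 + τ) * τ = τ / (1 + τ) := by ring
      rw [e2, e]
      module⟩
  exact this.1.symm

theorem exists_finset_convexHull [ProperSpace E] (hb : Bornology.IsBounded (hpoly c f)) :
    ∃ V : Finset E, convexHull ℝ (V : Set E) = hpoly c f := by
  have hfin := finite_extremePoints_hpoly (c := c) (f := f)
  refine ⟨hfin.toFinset, ?_⟩
  rw [hfin.coe_toFinset, ← (hfin.isClosed_convexHull ℝ).closure_eq]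
  exact closure_convexHull_extremePoints (Metric.isCompact_of_isClosed_isBounded isClosed_hpoly hb)
    convex_hpoly

end HPolytope

section FaceModel

/-- Near `U`, the real points of `T` lie in `A`. -/
def OpenAt (A : Set (Gr ℝ 4)) (T : Set (Gr ℂ 4)) (U : Gr ℝ 4) : Prop :=
  ∃ O, IsOpen O ∧ U ∈ O ∧ O ∩ realPoints T ⊆ A

theorem OpenAt.mem_interior {A : Set (Gr ℝ 4)} {T : Set (Gr ℂ 4)} {U : realPoints T}
    (h : OpenAt A T U) : U ∈ interior ((Subtype.val : realPoints T → Gr ℝ 4) ⁻¹' A) := by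
  obtain ⟨O, h1, h2, h3⟩ := h
  exact _root_.mem_interior.2 ⟨Subtype.val ⁻¹' O, fun V hV => h3 ⟨hV, V.2⟩,
    h1.preimage continuous_subtype_val, h2⟩

/-- A parametrization of the part in `A` of the real points of `T` by a polytope given by linear
inequalities, under which the facets correspond to the members of `F`. -/
def HasModel (A : Set (Gr ℝ 4)) (T : Set (Gr ℂ 4)) (d : ℕ) (F : Set (Set (Gr ℂ 4))) : Prop :=
  ∃ (K : Type) (_ : Finite K) (c : K → ℝ) (f : K → EuclideanSpace ℝ (Fin d) →L[ℝ] ℝ)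
    (S : K → Set (Gr ℂ 4)) (W : EuclideanSpace ℝ (Fin d) → Gr ℝ 4),
    Function.Injective S ∧ Set.range S = F ∧ Bornology.IsBounded (hpoly c f) ∧ (∃ x, ∀ k, 0 < c k + f k x) ∧
    ContinuousOn W (hpoly c f) ∧ InjOn W (hpoly c f) ∧ W '' hpoly c f = A ∩ realPoints T ∧
    (∀ x ∈ hpoly c f, ∀ k, c k + f k x = 0 ↔ W x ∈ realPoints (S k)) ∧
    ∀ x, (∀ k, 0 < c k + f k x) → OpenAt A T (W x)

variable {n : ℕ} {Z : Matrix (Fin n) (Fin 4) ℝ} {T : Set (Gr ℂ 4)} {d : ℕ}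
  {F : Set (Set (Gr ℂ 4))}

theorem strict_subset_hpoly {E K : Type*} [NormedAddCommGroup E] [NormedSpace ℝ E]
    {c : K → ℝ} {f : K → E →L[ℝ] ℝ} {x : E} (h : ∀ k, 0 < c k + f k x) : x ∈ hpoly c f :=
  fun k => (h k).le

theorem HasModel.closedFace_eq (h : HasModel (amplituhedron Z) T d F) :
    closedFace Z T = amplituhedron Z ∩ realPoints T := by
  obtain ⟨K, _, c, f, S, W, -, -, hb, ⟨x₀, hx₀⟩, hW, -, him, -, hO⟩ := h
  have hcomp : IsCompact (W '' hpoly c f) :=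
    (Metric.isCompact_of_isClosed_isBounded isClosed_hpoly hb).image_of_continuousOn hW
  rw [him] at hcomp
  apply subset_antisymm
  · rintro _ ⟨U, hU, rfl⟩
    refine ⟨?_, U.2⟩
    have hcl : IsClosed ((Subtype.val : realPoints T → Gr ℝ 4) ⁻¹' amplituhedron Z) := by
      have : (Subtype.val : realPoints T → Gr ℝ 4) ⁻¹' amplituhedron Z =
          Subtype.val ⁻¹' (amplituhedron Z ∩ realPoints T) := by ext x; simp
      rw [this]
      exact hcomp.isClosed.preimage continuous_subtype_val
    exact closure_minimal interior_subset hcl hU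
  · intro U hU
    rw [← him] at hU
    obtain ⟨x, hx, rfl⟩ := hU
    have hm : ∀ x ∈ hpoly c f, W x ∈ realPoints T := fun x hx =>
      (him.subset (mem_image_of_mem W hx)).2
    let w : hpoly c f → realPoints T := fun x => ⟨W x, hm x x.2⟩
    have hw : Continuous w := (continuousOn_iff_continuous_domRestrict.1 hW).subtype_mk _
    refine ⟨w ⟨x, hx⟩, map_mem_closure hw (s := {y | ∀ k, 0 < c k + f k y.1}) ?_ ?_, rfl⟩
    · rw [closure_subtype]
      have : Subtype.val '' {y : hpoly c f | ∀ k, 0 < c k + f k y.1} =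
          {y | ∀ k, 0 < c k + f k y} := by
        ext y
        constructor
        · rintro ⟨y, hy, rfl⟩; exact hy
        · exact fun hy => ⟨⟨y, strict_subset_hpoly hy⟩, hy, rfl⟩
      rw [this]
      exact mem_closure_strict hx₀ hx
    · exact fun y hy => (hO y.1 hy).mem_interior

theorem HasModel.face_nonempty (h : HasModel (amplituhedron Z) T d F) : (face Z T).Nonempty := by
  obtain ⟨K, _, c, f, S, W, -, -, -, ⟨x₀, hx₀⟩, -, -, him, -, hO⟩ := h
  have hT := (him.subset (mem_image_of_mem W (strict_subset_hpoly hx₀))).2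
  refine ⟨W x₀, ⟨W x₀, hT⟩, interior_mono subset_closure ?_, rfl⟩
  rw [interior_interior]
  exact (hO x₀ hx₀).mem_interior

/-- A parametrized stratum is a polytope, provided that its faces are the intersections of its
facets. -/
theorem HasModel.isPolytopeFace (h : HasModel (amplituhedron Z) T d F) {𝓛 : Set (Set (Gr ℂ 4))}
    (hb : ∀ S, IsBoundaryStratum Z S ↔ S ∈ 𝓛)
    (hcl : ∀ S ∈ 𝓛, closedFace Z S = amplituhedron Z ∩ realPoints S)
    (hne : ∀ S ∈ 𝓛, (amplituhedron Z ∩ realPoints S).Nonempty) (hT : T ∈ 𝓛) (hF : F ⊆ 𝓛)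
    (hint : ∀ U ∈ amplituhedron Z, ∀ S ∈ 𝓛, ∀ S' ∈ 𝓛, U ∈ realPoints S → U ∈ realPoints S' →
      ∃ R ∈ 𝓛, U ∈ realPoints R ∧ R ⊆ S ∩ S')
    (hsep : ∀ S ∈ 𝓛, amplituhedron Z ∩ realPoints S ⊆ realPoints T →
      ∀ U ∈ amplituhedron Z ∩ realPoints T, U ∉ realPoints S →
        ∃ G ∈ F, amplituhedron Z ∩ realPoints S ⊆ realPoints G ∧ U ∉ realPoints G) :
    IsPolytopeFace Z d T := by
  have hTA := h.closedFace_eq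
  obtain ⟨K, _, c, f, S, W, -, rfl, hbd, ⟨x₀, hx₀⟩, hW, hinj, him, hfac, -⟩ := h
  obtain ⟨V, hV⟩ := exists_finset_convexHull hbd
  refine ⟨V, ?_⟩
  rw [hV, hTA, ← him]
  refine ⟨⟨x₀, mem_interior.2 ⟨_, fun x => strict_subset_hpoly, isOpen_strict, hx₀⟩⟩, ?_⟩
  have : CompactSpace (hpoly c f) := isCompact_iff_compactSpace.1
    (Metric.isCompact_of_isClosed_isBounded isClosed_hpoly hbd)
  let e : hpoly c f ≃ W '' hpoly c f := Equiv.Set.imageOfInjOn W _ hinj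
  have he : Continuous e := (continuousOn_iff_continuous_domRestrict.1 hW).subtype_mk _
  refine ⟨he.homeoOfEquivCompactToT2, fun G => ?_⟩
  have hG : ∀ Q ⊆ hpoly c f, {U | ∃ x : hpoly c f, x.1 ∈ Q ∧
      (he.homeoOfEquivCompactToT2 x : Gr ℝ 4) = U} = W '' Q := by
    intro Q hQ
    ext U
    constructor
    · rintro ⟨x, hx, rfl⟩; exact ⟨x.1, hx, rfl⟩
    · rintro ⟨x, hx, rfl⟩; exact ⟨⟨x, hQ hx⟩, hx, rfl⟩
  have hWA : ∀ x ∈ hpoly c f, W x ∈ amplituhedron Z ∩ realPoints T := fun x hx =>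
    him.subset (mem_image_of_mem W hx)
  constructor
  · rintro ⟨Q, hQne, hQ, rfl⟩
    have hQP : Q ⊆ hpoly c f := hQ.subset
    rw [hG Q hQP]
    obtain ⟨y, hy, hgen⟩ := exists_generic_point hQP (hQ.convex convex_hpoly) hQne
    -- a stratum through the generic point inside all facets through it
    have hR : ∃ R ∈ 𝓛, W y ∈ realPoints R ∧ R ⊆ T ∧ ∀ k, c k + f k y = 0 → R ⊆ S k := by
      classical
      cases nonempty_fintype K
      have : ∀ s : Finset K, ∃ R ∈ 𝓛, W y ∈ realPoints R ∧ R ⊆ T ∧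
          ∀ k ∈ s, c k + f k y = 0 → R ⊆ S k := by
        intro s
        induction s using Finset.induction_on with
        | empty => exact ⟨T, hT, (hWA y (hQP hy)).2, subset_rfl, by simp⟩
        | insert k s _ ih =>
          obtain ⟨R, h1, h2, h3, h4⟩ := ih
          by_cases hk : c k + f k y = 0
          · obtain ⟨R', g1, g2, g3⟩ := hint _ (hWA y (hQP hy)).1 R h1 (S k) (hF ⟨k, rfl⟩) h2
              ((hfac y (hQP hy) k).1 hk)
            refine ⟨R', g1, g2, fun x hx => h3 (g3 hx).1, fun j hj hj0 => ?_⟩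
            rcases Finset.mem_insert.1 hj with rfl | hj
            · exact fun x hx => (g3 hx).2
            · exact fun x hx => h4 j hj hj0 (g3 hx).1
          · refine ⟨R, h1, h2, h3, fun j hj hj0 => ?_⟩
            rcases Finset.mem_insert.1 hj with rfl | hj
            · exact absurd hj0 hk
            · exact h4 j hj hj0
      obtain ⟨R, h1, h2, h3, h4⟩ := this Finset.univ
      exact ⟨R, h1, h2, h3, fun k => h4 k (Finset.mem_univ k)⟩
    obtain ⟨R, hR, hyR, hRT, hRS⟩ := hR
    refine ⟨R, (hb R).2 hR, ?_, ?_⟩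
    · rw [hcl R hR]
      apply subset_antisymm
      · rintro _ ⟨x, hx, rfl⟩
        refine ⟨(hWA x (hQP hx)).1, ?_⟩
        by_contra hxR
        obtain ⟨_, ⟨k, rfl⟩, hk1, hk2⟩ := hsep R hR (fun U hU => hRT hU.2) _ (hWA x (hQP hx)) hxR
        refine hk2 ((hfac x (hQP hx) k).1 (hgen k ?_ x hx))
        exact (hfac y (hQP hy) k).2 (hk1 ⟨(hWA y (hQP hy)).1, hyR⟩)
      · rintro U ⟨hUA, hUR⟩
        have hUT : U ∈ W '' hpoly c f := by rw [him]; exact ⟨hUA, hRT hUR⟩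
        obtain ⟨x, hx, rfl⟩ := hUT
        refine ⟨x, mem_exposed_of_active hQ hy hx fun k hk => ?_, rfl⟩
        exact (hfac x hx k).2 (hRS k hk hUR)
    · exact image_mono hQP
  · rintro ⟨R, hRb, rfl, hRT⟩
    have hR := (hb R).1 hRb
    rw [hcl R hR] at hRT ⊢
    rw [him] at hRT
    let J : Set K := {k | amplituhedron Z ∩ realPoints R ⊆ realPoints (S k)}
    have hsub : {x | x ∈ hpoly c f ∧ ∀ k ∈ J, c k + f k x = 0} ⊆ hpoly c f := fun x hx => hx.1
    have himage : W '' {x | x ∈ hpoly c f ∧ ∀ k ∈ J, c k + f k x = 0} =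
        amplituhedron Z ∩ realPoints R := by
      apply subset_antisymm
      · rintro _ ⟨x, ⟨hx, hJ⟩, rfl⟩
        refine ⟨(hWA x hx).1, ?_⟩
        by_contra hxR
        obtain ⟨_, ⟨k, rfl⟩, hk1, hk2⟩ := hsep R hR (fun U hU => (hRT hU).2) _ (hWA x hx) hxR
        exact hk2 ((hfac x hx k).1 (hJ k hk1))
      · intro U hU
        have hUT : U ∈ W '' hpoly c f := by rw [him]; exact hRT hU
        obtain ⟨x, hx, rfl⟩ := hUT
        exact ⟨x, ⟨hx, fun k hk => (hfac x hx k).2 (hk hU)⟩, rfl⟩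
    refine ⟨_, ?_, isExposed_active J, ?_⟩
    · have := hne R hR
      rw [← himage] at this
      exact this.of_image
    · rw [hG _ hsub, himage]

end FaceModel

theorem pl_add_right (u v w : Fin 4 → ℝ) : pl u (v + w) = pl u v + pl u w := by
  ext a b; simp only [pl, Pi.add_apply]; ring

theorem pl_add_left (u v w : Fin 4 → ℝ) : pl (u + v) w = pl u w + pl v w := by
  ext a b; simp only [pl, Pi.add_apply]; ring

theorem pl_smul_right (r : ℝ) (u v : Fin 4 → ℝ) : pl u (r • v) = r • pl u v := by
  ext a b; simp only [pl, Pi.smul_apply, smul_eq_mul]; ring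

theorem pl_smul_left (r : ℝ) (u v : Fin 4 → ℝ) : pl (r • u) v = r • pl u v := by
  ext a b; simp only [pl, Pi.smul_apply, smul_eq_mul]; ring

theorem pl_self (u : Fin 4 → ℝ) : pl u u = 0 := by
  ext a b; simp only [pl, Pi.zero_apply]; ring

theorem pl_swap (u v : Fin 4 → ℝ) : pl v u = -pl u v := by
  ext a b; simp only [pl, Pi.neg_apply]; ring

section PluckerCombination
include ε

theorem pl_comb_right (u : Fin 4 → ℝ) (y : Fin n → ℝ) :
    pl u (comb Z y) = ∑ b, y b • pl u (Z b) := by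
  ext c d
  simp only [pl, comb, Finset.sum_apply, Pi.smul_apply, smul_eq_mul, Finset.mul_sum]
  rw [← Finset.sum_sub_distrib]
  exact Finset.sum_congr rfl fun b _ => by ring

theorem two_smul_pl_comb (x y : Fin n → ℝ) :
    (2 : ℝ) • pl (comb Z x) (comb Z y) = ∑ a, ∑ b, minor x y a b • pl (Z a) (Z b) := by
  have h1 : pl (comb Z x) (comb Z y) = ∑ a, ∑ b, (x a * y b) • pl (Z a) (Z b) := by
    rw [pl_comb_right, Finset.sum_comm]
    refine Finset.sum_congr rfl fun b _ => ?_
    rw [pl_swap, pl_comb_right, smul_neg, Finset.smul_sum, ← Finset.sum_neg_distrib]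
    refine Finset.sum_congr rfl fun a _ => ?_
    rw [pl_swap (Z a) (Z b)]
    module
  have h2 : pl (comb Z x) (comb Z y) = ∑ a, ∑ b, (-(x b * y a)) • pl (Z a) (Z b) := by
    rw [h1, Finset.sum_comm]
    refine Finset.sum_congr rfl fun b _ => Finset.sum_congr rfl fun a _ => ?_
    rw [pl_swap (Z b) (Z a)]; module
  rw [two_smul]
  nth_rewrite 1 [h1]
  rw [h2, ← Finset.sum_add_distrib]
  refine Finset.sum_congr rfl fun a _ => ?_
  rw [← Finset.sum_add_distrib]
  refine Finset.sum_congr rfl fun b _ => ?_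
  rw [← add_smul, minor, sub_eq_add_neg]

/-- The Plücker vector of a line of the amplituhedron that meets `Z_i Z_j`, sorted by these two
points. -/
theorem pl_comb_of_supp {x y : Fin n → ℝ} {i j : Fin n} (hij : i ≠ j)
    (h : ∀ a b, minor x y a b ≠ 0 → a = i ∨ a = j ∨ b = i ∨ b = j) :
    pl (comb Z x) (comb Z y) = pl (Z i) (comb Z (minor x y i)) +
      pl (Z j) (comb Z (Function.update (minor x y j) i 0)) := by
  set g : Fin n → Fin n → Fin 4 → Fin 4 → ℝ := fun a b => minor x y a b • pl (Z a) (Z b) with hg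
  have hsymm : ∀ a b, g a b = g b a := by
    intro a b
    simp only [hg]
    rw [minor_swap x y b a, pl_swap (Z b) (Z a), smul_neg, neg_smul, neg_neg]
  have hself : ∀ a, g a a = 0 := by intro a; simp [hg, pl_self]
  have hz : ∀ a b, a ≠ i → a ≠ j → b ≠ i → b ≠ j → g a b = 0 := by
    intro a b h1 h2 h3 h4
    have : minor x y a b = 0 := by by_contra hm; have := h a b hm; tauto
    simp [hg, this]
  have hrow : ∀ a, ∑ b, g a b = (if a = i then ∑ b, g i b - g i j else 0) +
      (if a = j then ∑ b, g j b - g j i else 0) + (g a i + g a j) := by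
    intro a
    by_cases hi : a = i
    · subst hi; rw [if_pos rfl, if_neg hij, hself]; abel
    by_cases hj : a = j
    · subst hj; rw [if_pos rfl, if_neg hi, hself]; abel
    rw [if_neg hi, if_neg hj, zero_add, zero_add, ← Finset.sum_pair (f := g a) hij]
    symm
    refine Finset.sum_subset (Finset.subset_univ _) fun b _ hb => ?_
    simp only [Finset.mem_insert, Finset.mem_singleton, not_or] at hb
    exact hz a b hi hj hb.1 hb.2
  have e1 : pl (Z i) (comb Z (minor x y i)) = ∑ b, g i b := pl_comb_right _ _
  have e2 : pl (Z j) (comb Z (Function.update (minor x y j) i 0)) = ∑ b, g j b - g j i := by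
    rw [pl_comb_right, eq_sub_iff_add_eq, ← Finset.add_sum_erase _ _ (Finset.mem_univ i),
      ← Finset.add_sum_erase Finset.univ (g j) (Finset.mem_univ i)]
    rw [Function.update_self, zero_smul, zero_add, add_comm]
    congr 1
    refine Finset.sum_congr rfl fun b hb => ?_
    rw [Function.update_of_ne (Finset.ne_of_mem_erase hb)]
  have e3 : ∑ a, ∑ b, g a b = (2 : ℝ) • (∑ b, g i b + (∑ b, g j b - g j i)) := by
    rw [Finset.sum_congr rfl fun a _ => hrow a]
    rw [Finset.sum_add_distrib, Finset.sum_add_distrib, Finset.sum_add_distrib,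
      Finset.sum_ite_eq' Finset.univ i, Finset.sum_ite_eq' Finset.univ j,
      if_pos (Finset.mem_univ _), if_pos (Finset.mem_univ _)]
    have s1 : ∑ a, g a i = ∑ a, g i a := Finset.sum_congr rfl fun a _ => hsymm a i
    have s2 : ∑ a, g a j = ∑ a, g j a := Finset.sum_congr rfl fun a _ => hsymm a j
    rw [s1, s2, hsymm i j, two_smul]
    abel
  have h2 := two_smul_pl_comb (Z := Z) x y
  rw [e1, e2]
  exact smul_right_injective _ (two_ne_zero (α := ℝ)) (h2.trans e3)

end PluckerCombination

section Parametrization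

instance : Nonempty (Gr ℝ 4) :=
  ⟨lineOf ![1, 0, 0, 0] ![0, 1, 0, 0] (linearIndependent_pair_of_br (c := ![0, 0, 1, 0])
    (d := ![0, 0, 0, 1]) (by simp [br]))⟩

open Classical in
/-- The line with given Plücker vector. -/
noncomputable def ofPl (q : Fin 4 → Fin 4 → ℝ) : Gr ℝ 4 :=
  if h : ∃ (u v : Fin 4 → ℝ), ∃ _ : LinearIndependent ℝ ![u, v], pl u v = q then
    lineOf h.choose h.choose_spec.choose h.choose_spec.choose_spec.choose
  else Classical.arbitrary _

theorem ofPl_pl {u v : Fin 4 → ℝ} (h : LinearIndependent ℝ ![u, v]) :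
    ofPl (pl u v) = lineOf u v h := by
  have hex : ∃ (u' v' : Fin 4 → ℝ), ∃ _ : LinearIndependent ℝ ![u', v'], pl u' v' = pl u v :=
    ⟨u, v, h, rfl⟩
  rw [ofPl, dif_pos hex, lineOf_eq_iff]
  refine ⟨1, one_ne_zero, ?_⟩
  rw [one_smul, hex.choose_spec.choose_spec.choose_spec]

theorem continuousOn_ofPl {X : Type*} [TopologicalSpace X] {p : X → Fin 4 → Fin 4 → ℝ}
    {s : Set X} (hp : ContinuousOn p s)
    (h : ∀ x ∈ s, ∃ (u v : Fin 4 → ℝ), ∃ _ : LinearIndependent ℝ ![u, v], pl u v = p x) :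
    ContinuousOn (fun x => ofPl (p x)) s := by
  rw [continuousOn_iff_continuous_domRestrict]
  refine continuous_of_pl (p := fun x : s => p x)
    (continuousOn_iff_continuous_domRestrict.1 hp) fun x => ?_
  obtain ⟨u, v, hl, he⟩ := h x x.2
  exact ⟨u, v, hl, by simp only [domRestrict_apply, ← he]; exact ofPl_pl hl, he⟩

theorem ofPl_eq_iff {u v u' v' : Fin 4 → ℝ} (h : LinearIndependent ℝ ![u, v])
    (h' : LinearIndependent ℝ ![u', v']) :
    ofPl (pl u v) = ofPl (pl u' v') ↔ ∃ k : ℝ, k ≠ 0 ∧ pl u' v' = k • pl u v := by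
  rw [ofPl_pl h, ofPl_pl h', lineOf_eq_iff]

theorem isBounded_of_coord {d : ℕ} {s : Set (EuclideanSpace ℝ (Fin d))} {C : ℝ}
    (h : ∀ x ∈ s, ∀ i, |x i| ≤ C) : Bornology.IsBounded s := by
  rw [isBounded_iff_forall_norm_le]
  refine ⟨√(∑ _i : Fin d, C ^ 2), fun x hx => ?_⟩
  rw [EuclideanSpace.norm_eq]
  refine Real.sqrt_le_sqrt (Finset.sum_le_sum fun i _ => ?_)
  rw [Real.norm_eq_abs]
  exact pow_le_pow_left₀ (abs_nonneg _) (h x hx i) 2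

end Parametrization

section ModelOfFrames

/-- The linear form with given coefficients. -/
noncomputable def coeffForm {d : ℕ} (m : Fin d → ℝ) : EuclideanSpace ℝ (Fin d) →L[ℝ] ℝ :=
  ∑ i, m i • EuclideanSpace.proj i

theorem coeffForm_apply {d : ℕ} (m : Fin d → ℝ) (x : EuclideanSpace ℝ (Fin d)) :
    coeffForm m x = ∑ i, m i * x i := by
  simp [coeffForm]

/-- A criterion for `HasModel` in terms of a family of frames. -/
theorem hasModel_of_frames {A : Set (Gr ℝ 4)} {T : Set (Gr ℂ 4)} {d : ℕ} {K : Type} [Finite K]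
    {ι : Type*} [Finite ι] (c : K → ℝ) (m : K → Fin d → ℝ) (S : K → Set (Gr ℂ 4))
    (hS : Function.Injective S) (P : Set (Fin d → ℝ)) (hP : ∀ x, x ∈ P ↔ ∀ k, 0 ≤ c k + ∑ i, m k i * x i)
    (u v : (Fin d → ℝ) → Fin 4 → ℝ) (g : ι → (Fin 4 → Fin 4 → ℝ) →ₗ[ℝ] ℝ)
    {C : ℝ} (hb : ∀ x ∈ P, ∀ i, |x i| ≤ C)
    (hne : ∃ x : Fin d → ℝ, ∀ k, 0 < c k + ∑ i, m k i * x i)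
    (hcont : ContinuousOn (fun x => pl (u x) (v x)) P)
    (hli : ∀ x ∈ P, LinearIndependent ℝ ![u x, v x])
    (hinj : ∀ x ∈ P, ∀ x' ∈ P, ∀ k : ℝ, k ≠ 0 → pl (u x') (v x') = k • pl (u x) (v x) → x = x')
    (hmem : ∀ x ∈ P, ∀ h, lineOf (u x) (v x) h ∈ A ∩ realPoints T)
    (hsurj : ∀ U ∈ A, U ∈ realPoints T → ∃ x ∈ P, ∃ u' v' h, U = lineOf u' v' h ∧
      ∃ k : ℝ, k ≠ 0 ∧ pl u' v' = k • pl (u x) (v x))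
    (hfac : ∀ x ∈ P, ∀ k, ∀ h, c k + ∑ i, m k i * x i = 0 ↔ lineOf (u x) (v x) h ∈ realPoints (S k))
    (hopen : ∀ U ∈ sameSign g, U ∈ realPoints T → U ∈ A)
    (hstrict : ∀ x, (∀ k, 0 < c k + ∑ i, m k i * x i) → ∀ i, 0 < g i (pl (u x) (v x))) :
    HasModel A T d (Set.range S) := by
  have hpol : ∀ x, x ∈ hpoly c (fun k => coeffForm (m k)) ↔ x.ofLp ∈ P := by
    intro x; rw [hP]; simp only [hpoly, mem_ofPred_eq, coeffForm_apply]
  have hof : Continuous fun x : EuclideanSpace ℝ (Fin d) => x.ofLp := by fun_prop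
  refine ⟨K, inferInstance, c, fun k => coeffForm (m k), S,
    fun x => ofPl (pl (u x.ofLp) (v x.ofLp)), hS, rfl, ?_, ?_, ?_, ?_, ?_, ?_,
    fun x hx => ⟨sameSign g, isOpen_sameSign g, ?_, fun U hU => hopen U hU.1 hU.2⟩⟩
  · exact isBounded_of_coord fun x hx i => hb _ ((hpol x).1 hx) i
  · obtain ⟨x, hx⟩ := hne
    exact ⟨WithLp.toLp 2 x, fun k => by rw [coeffForm_apply]; exact hx k⟩
  · exact continuousOn_ofPl (hcont.comp hof.continuousOn fun x hx => (hpol x).1 hx)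
      fun x hx => ⟨_, _, hli _ ((hpol x).1 hx), rfl⟩
  · intro x hx x' hx' h
    rw [hpol] at hx hx'
    obtain ⟨k, hk, he⟩ := (ofPl_eq_iff (hli _ hx) (hli _ hx')).1 h
    exact WithLp.ofLp_injective 2 (hinj _ hx _ hx' k hk he)
  · apply subset_antisymm
    · rintro _ ⟨x, hx, rfl⟩
      rw [hpol] at hx
      simp only
      rw [ofPl_pl (hli _ hx)]
      exact hmem _ hx _
    · rintro U ⟨hA, hT⟩
      obtain ⟨x, hx, u', v', h, rfl, he⟩ := hsurj U hA hT
      refine ⟨WithLp.toLp 2 x, (hpol _).2 hx, ?_⟩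
      simp only
      rw [ofPl_pl (hli _ hx), lineOf_eq_iff]
      exact he
  · intro x hx k
    rw [hpol] at hx
    beta_reduce
    rw [coeffForm_apply, ofPl_pl (hli _ hx)]
    exact hfac _ hx k _
  · simp only [coeffForm_apply] at hx
    beta_reduce
    rw [ofPl_pl (hli _ ((hP _).2 fun k => (hx k).le)), lineOf_mem_sameSign]
    have := hstrict _ hx
    exact fun i j => mul_pos (this i) (this j)

end ModelOfFrames

section SmallModels
include ε

theorem realPoints_type0I {a b : Fin n} (hab : a ≠ b) :
    realPoints (type0I Z a b) = {lineOf (Z a) (Z b) (hZ.pair_independent hab)} := by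
  ext W
  rw [type0I_eq hab]
  exact complexify_injective.eq_iff

theorem hasModel_type0I {a b : Fin n} (hab : a ≠ b) :
    HasModel (amplituhedron Z) (type0I Z a b) 0 ∅ := by
  have hA := vertex_mem_amplituhedron (Z := Z) hab
  have hsub : (amplituhedron Z) ∩ realPoints (type0I Z a b) =
      {lineOf (Z a) (Z b) (hZ.pair_independent hab)} := by
    rw [realPoints_type0I hab]; exact inter_eq_self_of_subset_right (by simpa using hA)
  refine ⟨Empty, inferInstance, fun k => k.elim, fun k => k.elim, fun k => k.elim,
    fun _ => lineOf (Z a) (Z b) (hZ.pair_independent hab),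
    Function.injective_of_subsingleton _, Set.range_eq_empty _,
    Set.subsingleton_of_subsingleton.finite.isBounded, ⟨0, fun k => k.elim⟩, continuousOn_const,
    injOn_of_subsingleton _ _, ?_, fun _ _ k => k.elim, fun _ _ => ⟨univ, isOpen_univ, mem_univ _, ?_⟩⟩
  · rw [hsub]
    exact Nonempty.image_const ⟨0, fun k => k.elim⟩ _
  · rw [univ_inter, realPoints_type0I hab]
    simpa using hA

/-- A line through `Z_0` and a nonnegative combination of the other points lies in the
amplituhedron. -/
theorem mem_amplituhedron_of_nonneg {y : Fin n → ℝ} (hy : ∀ b, 0 ≤ y b) {q : Fin 4 → ℝ}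
    (hq : comb Z y = q) (h : LinearIndependent ℝ ![Z 0, q]) : lineOf _ _ h ∈ amplituhedron Z := by
  subst hq
  have hx : comb Z (Pi.single 0 (1 : ℝ)) = Z 0 := by rw [comb_single, one_smul]
  refine mem_amplituhedron_iff.2 ⟨Pi.single 0 1, y, fun a b hab => ?_, by rwa [hx], by simp only [hx]⟩
  have hb : b ≠ 0 := by rintro rfl; simp at hab
  have e : minor (Pi.single 0 (1 : ℝ)) y a b = if a = 0 then y b else 0 := by
    simp [minor, Pi.single_apply, hb]
  rw [e]
  split_ifs
  · exact hy b
  · rfl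

theorem isRep_of_pl {x y : Fin n → ℝ} (hxy : ∀ a b, a < b → 0 ≤ minor x y a b)
    {u v : Fin 4 → ℝ} (h : LinearIndependent ℝ ![u, v])
    (he : pl (comb Z x) (comb Z y) = pl u v) : IsRep Z (lineOf u v h) x y := by
  have hl : LinearIndependent ℝ ![comb Z x, comb Z y] :=
    linearIndependent_of_pl_ne_zero (he ▸ pl_ne_zero h)
  exact ⟨hxy, hl, lineOf_eq_iff.2 ⟨1, one_ne_zero, by rw [he, one_smul]⟩⟩

/-- Coefficient vectors with prescribed minors in three positions. -/
theorem exists_minors {i j k : Fin n} (hij : i < j) (hjk : j < k) (α β γ : ℝ) :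
    ∃ x y : Fin n → ℝ, (∀ a b, a < b → minor x y a b =
      if a = i ∧ b = j then α else if a = i ∧ b = k then β else
        if a = j ∧ b = k then γ else 0) ∧ pl (comb Z x) (comb Z y) =
        α • pl (Z i) (Z j) + β • pl (Z i) (Z k) + γ • pl (Z j) (Z k) := by
  by_cases hβ : β = 0
  · refine ⟨Pi.single j 1, Pi.single i (-α) + Pi.single k γ, fun a b hab => ?_, ?_⟩
    · simp only [minor, Pi.add_apply, Pi.single_apply]
      grind
    · simp only [comb_add, comb_single, pl_add_right, pl_smul_right, pl_smul_left]
      rw [pl_swap (Z i) (Z j), hβ]; module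
  · refine ⟨Pi.single i β + Pi.single j γ, Pi.single j (α / β) + Pi.single k 1,
      fun a b hab => ?_, ?_⟩
    · have : β * (α / β) = α := by field_simp
      simp only [minor, Pi.add_apply, Pi.single_apply]
      grind
    · have : β * (α / β) = α := by field_simp
      simp only [comb_add, comb_single, pl_add_right, pl_add_left, pl_smul_right, pl_smul_left,
        pl_self, smul_zero]
      conv_rhs => rw [← this]
      module

/-- A line joining the segments `Z_i Z_j` and `Z_k Z_l`, where `i < j < k < l`. -/
theorem isRep_join {i j k l : Fin n} (hij : i < j) (hjk : j < k) (hkl : k < l) {a b c d : ℝ}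
    (ha : 0 ≤ a) (hb : 0 ≤ b) (hc : 0 ≤ c) (hd : 0 ≤ d)
    (h : LinearIndependent ℝ ![a • Z i + b • Z j, c • Z k + d • Z l]) :
    IsRep Z (lineOf _ _ h) (Pi.single i a + Pi.single j b) (Pi.single k c + Pi.single l d) := by
  refine isRep_of_pl (fun p q hpq => ?_) h (by simp only [comb_add, comb_single])
  rw [minor_join hij hjk hkl a b c d hpq]
  split_ifs <;> first | exact le_rfl | exact mul_nonneg ‹_› ‹_›

end SmallModels

section Fan
/-- The indices `k` for which `k` and `k + 1` both differ from `0` and `1`. -/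
abbrev FanIndex (n : ℕ) : Type := {k : Fin n // 2 ≤ k.val ∧ k.val + 1 < n}

theorem FanIndex.val_succ (k : FanIndex n) : (k.1 + 1).val = k.1.val + 1 := by
  rw [_root_.val_succ, if_neg]; have := k.2.2; omega

theorem FanIndex.ne (k : FanIndex n) :
    (0 : Fin n) ≠ k.1 ∧ (0 : Fin n) ≠ k.1 + 1 ∧ (1 : Fin n) ≠ k.1 ∧ (1 : Fin n) ≠ k.1 + 1 := by
  have h0 := val_zero_fin (n := n)
  have h1 := val_one (n := n)
  have hk := k.val_succ
  refine ⟨?_, ?_, ?_, ?_⟩ <;> intro h <;> have := congrArg Fin.val h <;> omega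

theorem nonempty_fanIndex : Nonempty (FanIndex n) :=
  ⟨⟨2, val_two.ge, by rw [val_two]; exact hn.out⟩⟩

theorem FanIndex.one_lt (k : FanIndex n) : 1 < k.1 ∧ 1 < k.1 + 1 := by
  have h1 := val_one (n := n)
  have := k.val_succ
  constructor <;> rw [Fin.lt_def] <;> omega

include ε

theorem PosConf.fan_pos (k : FanIndex n)
    (hab : a < b) (h1 : a ≠ k.1) (h2 : a ≠ k.1 + 1) (h3 : b ≠ k.1) (h4 : b ≠ k.1 + 1) :
    0 < ε * br (Z a) (Z b) (Z k.1) (Z (k.1 + 1)) := by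
  have := hZ.consecutive hab h1 h2 h3 h4
  rwa [sgn_of_lt k.2.2, mul_one] at this

/-- The coefficient of the last vector in `Z_a ∧ Q`, for `a` equal to `0` or `1`, with respect to
`Z_0`, `Z_1`, `Z_k`, `Z_{k+1}`. -/
noncomputable def fanCoeff (Z : Matrix (Fin n) (Fin 4) ℝ) (a k : Fin n) (Q : Fin 4 → ℝ) : ℝ :=
  br (Z a) Q (Z k) (Z (k + 1)) / br (Z 0) (Z 1) (Z k) (Z (k + 1))

theorem fanCoeff_add (a k : Fin n) (Q R : Fin 4 → ℝ) :
    fanCoeff Z a k (Q + R) = fanCoeff Z a k Q + fanCoeff Z a k R := by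
  simp only [fanCoeff, br_add₂, add_div]

theorem fanCoeff_smul (a k : Fin n) (t : ℝ) (Q : Fin 4 → ℝ) :
    fanCoeff Z a k (t • Q) = t * fanCoeff Z a k Q := by
  simp only [fanCoeff, br_smul₂, mul_div_assoc]

theorem PosConf.fan_det_ne (k : FanIndex n) : br (Z 0) (Z 1) (Z k.1) (Z (k.1 + 1)) ≠ 0 := by
  obtain ⟨h1, h2, h3, h4⟩ := k.ne
  exact hZ.br_ne_zero zero_lt_one_fin.ne h1 h2 h3 h4 (succ_ne k.1)

theorem br_eq_fanCoeff (a : Fin n) (k : FanIndex n)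
    (Q : Fin 4 → ℝ) : br (Z a) Q (Z k.1) (Z (k.1 + 1)) =
      fanCoeff Z a k.1 Q * br (Z 0) (Z 1) (Z k.1) (Z (k.1 + 1)) := by
  rw [fanCoeff, div_mul_cancel₀ _ (hZ.fan_det_ne k)]

theorem fanCoeff_left (k : FanIndex n) : fanCoeff Z 0 k.1 (Z 0) = 0 ∧ fanCoeff Z 0 k.1 (Z 1) = 1 ∧
      fanCoeff Z 1 k.1 (Z 0) = -1 ∧ fanCoeff Z 1 k.1 (Z 1) = 0 := by
  have h := hZ.fan_det_ne k
  refine ⟨by simp [fanCoeff], div_self h, ?_, by simp [fanCoeff]⟩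
  rw [fanCoeff, br_swap₁₂, neg_div, div_self h]

theorem fanCoeff_pos (k : FanIndex n)
    (ha : a = 0 ∨ a = 1) (hb : 1 < b) (h3 : b ≠ k.1) (h4 : b ≠ k.1 + 1) :
    0 < fanCoeff Z a k.1 (Z b) := by
  obtain ⟨n1, n2, n3, n4⟩ := k.ne
  have h01 := zero_lt_one_fin (n := n)
  have hD := hZ.fan_pos k h01 n1 n2 n3 n4
  have hN : 0 < ε * br (Z a) (Z b) (Z k.1) (Z (k.1 + 1)) := by
    rcases ha with rfl | rfl
    · exact hZ.fan_pos k (h01.trans hb) n1 n2 h3 h4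
    · exact hZ.fan_pos k hb n3 n4 h3 h4
  rw [fanCoeff, ← mul_div_mul_left _ _ hZ.ne_zero]
  exact div_pos hN hD

theorem fanCoeff_self (k b a : Fin n) (h : b = k ∨ b = k + 1) : fanCoeff Z a k (Z b) = 0 := by
  rcases h with rfl | rfl <;> simp [fanCoeff]

theorem fanCoeff_nonneg (k : FanIndex n)
    (ha : a = 0 ∨ a = 1) (hb : 1 < b) : 0 ≤ fanCoeff Z a k.1 (Z b) := by
  by_cases h : b = k.1 ∨ b = k.1 + 1
  · rw [fanCoeff_self _ _ _ h]
  · push Not at h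
    exact (fanCoeff_pos k ha hb h.1 h.2).le

/-- Modulo `Z_0` and `Z_1`, a vector in the cone of `Z_2, …, Z_{n-1}` lies in the cone of two
consecutive vectors. -/
theorem exists_fan {Q : Fin 4 → ℝ}
    (h2 : ε * br (Z 0) (Z 1) Q (Z 2) ≤ 0) (hL : 0 ≤ ε * br (Z 0) (Z 1) Q (Z (0 - 1))) :
    ∃ (k : FanIndex n) (b c : ℝ), 0 ≤ b ∧ 0 ≤ c ∧ Q = (-fanCoeff Z 1 k.1 Q) • Z 0 +
      fanCoeff Z 0 k.1 Q • Z 1 + b • Z k.1 + c • Z (k.1 + 1) := by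
  have hn := hn.out
  have v2 := val_two (n := n)
  have vL := val_last (n := n)
  obtain ⟨k, hk1, hk2, ⟨hk3, hk4⟩, hk5, hk6⟩ := exists_step_fin
    (P := fun b => ε * br (Z 0) (Z 1) Q (Z b) ≤ 0 ∧ b ≠ 0 - 1) (a := 2) (b := 0 - 1)
    (by rw [Fin.le_def]; omega)
    ⟨h2, fun h => by omega⟩ (by simp)
  rw [Fin.le_def, v2] at hk1
  have hk : k.val + 1 < n := by
    omega
  let K : FanIndex n := ⟨k, hk1, hk⟩
  have hs : 0 ≤ ε * br (Z 0) (Z 1) Q (Z (k + 1)) := by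
    by_cases h : k + 1 = 0 - 1
    · rw [h]; exact hL
    · by_contra h'
      exact hk5 ⟨(not_le.1 h').le, h⟩
  have hd : br (Z 0) (Z 1) (Z k) (Z (k + 1)) ≠ 0 := hZ.fan_det_ne K
  obtain ⟨n1, n2, n3, n4⟩ := K.ne
  have hD : 0 < ε * br (Z 0) (Z 1) (Z k) (Z (k + 1)) := hZ.fan_pos K zero_lt_one_fin n1 n2 n3 n4
  refine ⟨K, br (Z 0) (Z 1) Q (Z (k + 1)) / br (Z 0) (Z 1) (Z k) (Z (k + 1)),
    br (Z 0) (Z 1) (Z k) Q / br (Z 0) (Z 1) (Z k) (Z (k + 1)), ?_, ?_, ?_⟩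
  · rw [← mul_div_mul_left _ _ hZ.ne_zero]
    exact div_nonneg hs hD.le
  · rw [← mul_div_mul_left _ _ hZ.ne_zero, br_swap₃₄]
    exact div_nonneg (by linarith) hD.le
  · have h := br_cramer (Z 0) (Z 1) (Z k) (Z (k + 1)) Q
    refine smul_right_injective _ hd ?_
    beta_reduce
    rw [h]
    simp only [smul_add, smul_smul, fanCoeff, K]
    congr 1; congr 1; congr 1
    all_goals congr 1; field_simp
    simp only [br]; ring

theorem fan_le {Q : Fin 4 → ℝ} {k : FanIndex n} {b c : ℝ}
    (hb : 0 ≤ b) (hc : 0 ≤ c) (hQ : Q = (-fanCoeff Z 1 k.1 Q) • Z 0 +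
      fanCoeff Z 0 k.1 Q • Z 1 + b • Z k.1 + c • Z (k.1 + 1)) (m : FanIndex n) :
    fanCoeff Z 0 k.1 Q ≤ fanCoeff Z 0 m.1 Q ∧ fanCoeff Z 1 k.1 Q ≤ fanCoeff Z 1 m.1 Q ∧
      (fanCoeff Z 0 m.1 Q = fanCoeff Z 0 k.1 Q ↔ fanCoeff Z 1 m.1 Q = fanCoeff Z 1 k.1 Q) := by
  obtain ⟨l1, l2, l3, l4⟩ := fanCoeff_left (Z := Z) m
  obtain ⟨k1, k2⟩ := k.one_lt
  have e0 : fanCoeff Z 0 m.1 Q = fanCoeff Z 0 k.1 Q +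
      (b * fanCoeff Z 0 m.1 (Z k.1) + c * fanCoeff Z 0 m.1 (Z (k.1 + 1))) := by
    conv_lhs => rw [hQ]
    simp only [fanCoeff_add, fanCoeff_smul, l1, l2]; ring
  have e1 : fanCoeff Z 1 m.1 Q = fanCoeff Z 1 k.1 Q +
      (b * fanCoeff Z 1 m.1 (Z k.1) + c * fanCoeff Z 1 m.1 (Z (k.1 + 1))) := by
    conv_lhs => rw [hQ]
    simp only [fanCoeff_add, fanCoeff_smul, l3, l4]; ring
  have key : ∀ a : Fin n, (a = 0 ∨ a = 1) →
      0 ≤ b * fanCoeff Z a m.1 (Z k.1) + c * fanCoeff Z a m.1 (Z (k.1 + 1)) ∧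
      (b * fanCoeff Z a m.1 (Z k.1) + c * fanCoeff Z a m.1 (Z (k.1 + 1)) = 0 ↔
        (b = 0 ∨ k.1 = m.1 ∨ k.1 = m.1 + 1) ∧ (c = 0 ∨ k.1 + 1 = m.1 ∨ k.1 + 1 = m.1 + 1)) := by
    intro a ha
    have t1 := mul_nonneg hb (fanCoeff_nonneg (Z := Z) m ha k1)
    have t2 := mul_nonneg hc (fanCoeff_nonneg (Z := Z) m ha k2)
    refine ⟨add_nonneg t1 t2, ?_⟩
    rw [add_eq_zero_iff_of_nonneg t1 t2, mul_eq_zero, mul_eq_zero]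
    have z : ∀ j, 1 < j → (fanCoeff Z a m.1 (Z j) = 0 ↔ j = m.1 ∨ j = m.1 + 1) := by
      intro j hj
      refine ⟨fun h => ?_, fun h => fanCoeff_self _ _ _ h⟩
      by_contra hne
      push Not at hne
      exact (fanCoeff_pos m ha hj hne.1 hne.2).ne' h
    rw [z _ k1, z _ k2]
  obtain ⟨a1, a2⟩ := key 0 (.inl rfl)
  obtain ⟨b1, b2⟩ := key 1 (.inr rfl)
  rw [e0, e1]
  refine ⟨by linarith, by linarith, ?_⟩
  rw [add_eq_left, add_eq_left, a2, b2]

theorem exists_fan_bound : ∃ C : ℝ, ∀ k : FanIndex n,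
    fanCoeff Z 0 k.1 (Z 2) + 1 ≤ C ∧ fanCoeff Z 0 k.1 (Z (0 - 1)) + 1 ≤ C := by
  obtain ⟨C₁, h₁⟩ := (Set.finite_range fun k : FanIndex n => fanCoeff Z 0 k.1 (Z 2) + 1).bddAbove
  obtain ⟨C₂, h₂⟩ :=
    (Set.finite_range fun k : FanIndex n => fanCoeff Z 0 k.1 (Z (0 - 1)) + 1).bddAbove
  exact ⟨max C₁ C₂, fun k => ⟨(h₁ ⟨k, rfl⟩).trans (le_max_left _ _),
    (h₂ ⟨k, rfl⟩).trans (le_max_right _ _)⟩⟩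

/-- A line through `Z_0` satisfying the inequalities of the polygon of lines through `Z_0`. -/
theorem lineOf_zero_mem_amplituhedron {q : Fin 4 → ℝ}
    (h : LinearIndependent ℝ ![Z 0, q]) (h1 : 0 ≤ ε * br (Z 0) q (Z 1) (Z 2))
    (h2 : 0 ≤ -(ε * br (Z 0) q (Z 1) (Z (0 - 1))))
    (h3 : ∀ k : FanIndex n, 0 ≤ fanCoeff Z 0 k.1 q) : lineOf (Z 0) q h ∈ amplituhedron Z := by
  obtain ⟨k, b, c, hb, hc, hq⟩ := exists_fan (Z := Z) (Q := q)
    (by rw [show br (Z 0) (Z 1) q (Z 2) = -br (Z 0) q (Z 1) (Z 2) by simp only [br]; ring]; linarith)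
    (by rw [show br (Z 0) (Z 1) q (Z (0 - 1)) = -br (Z 0) q (Z 1) (Z (0 - 1)) by
      simp only [br]; ring]; linarith)
  have s1 : (0 : Fin n → ℝ) ≤ Pi.single 1 (fanCoeff Z 0 k.1 q) := Pi.single_nonneg.2 (h3 k)
  have s2 : (0 : Fin n → ℝ) ≤ Pi.single k.1 b := Pi.single_nonneg.2 hb
  have s3 : (0 : Fin n → ℝ) ≤ Pi.single (k.1 + 1) c := Pi.single_nonneg.2 hc
  have he : pl (Z 0) (fanCoeff Z 0 k.1 q • Z 1 + b • Z k.1 + c • Z (k.1 + 1)) =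
      (1 : ℝ) • pl (Z 0) q := by
    conv_rhs => rw [hq]
    simp only [pl_add_right, pl_smul_right, pl_self]; module
  have hl : LinearIndependent ℝ ![Z 0, fanCoeff Z 0 k.1 q • Z 1 + b • Z k.1 + c • Z (k.1 + 1)] :=
    linearIndependent_of_pl_ne_zero (by rw [he, one_smul]; exact pl_ne_zero h)
  rw [(lineOf_eq_iff (h' := hl)).2 ⟨1, one_ne_zero, he⟩]
  exact mem_amplituhedron_of_nonneg (y := Pi.single 1 (fanCoeff Z 0 k.1 q) + Pi.single k.1 b +
    Pi.single (k.1 + 1) c) (fun j => add_nonneg (add_nonneg (s1 j) (s2 j)) (s3 j))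
    (by simp only [comb_add, comb_single]) hl

/-- Coordinates with respect to `Z_1`, `Z_2`, `Z_{n-1}` modulo `Z_0`. -/
theorem exists_coord (q : Fin 4 → ℝ) :
    ∃ a₀ α β γ : ℝ, q = a₀ • Z 0 + α • Z 1 + β • Z 2 + γ • Z (0 - 1) := by
  have hn := hn.out
  have h0 := val_zero_fin (n := n)
  have h1 := val_one (n := n)
  have h2 := val_two (n := n)
  have hL := val_last (n := n)
  have hd : br (Z 0) (Z 1) (Z 2) (Z (0 - 1)) ≠ 0 := by
    refine hZ.br_ne_zero ?_ ?_ ?_ ?_ ?_ ?_ <;> intro h <;> have := congrArg Fin.val h <;> omega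
  refine ⟨br q (Z 1) (Z 2) (Z (0 - 1)) / br (Z 0) (Z 1) (Z 2) (Z (0 - 1)),
    br (Z 0) q (Z 2) (Z (0 - 1)) / br (Z 0) (Z 1) (Z 2) (Z (0 - 1)),
    br (Z 0) (Z 1) q (Z (0 - 1)) / br (Z 0) (Z 1) (Z 2) (Z (0 - 1)),
    br (Z 0) (Z 1) (Z 2) q / br (Z 0) (Z 1) (Z 2) (Z (0 - 1)), ?_⟩
  refine smul_right_injective _ hd ?_
  beta_reduce
  rw [br_cramer]
  simp only [smul_add, smul_smul]
  congr 1; congr 1; congr 1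
  all_goals congr 1; field_simp

theorem PosConf.pos_012L :
    0 < ε * br (Z 0) (Z 1) (Z 2) (Z (0 - 1)) := by
  have hn := hn.out
  have h0 := val_zero_fin (n := n)
  have h1 := val_one (n := n)
  have h2 := val_two (n := n)
  have hL := val_last (n := n)
  refine hZ.1 _ _ _ _ ?_ ?_ ?_ <;> rw [Fin.lt_def] <;> omega

end Fan

theorem continuousOn_ratio_smul {E : Type*} [NormedAddCommGroup E] [NormedSpace ℝ E]
    {P : Set (Fin 3 → ℝ)} (hP : ∀ x ∈ P, 0 ≤ x 2 ∧ x 2 ≤ x 0) {Φ : (Fin 3 → ℝ) → E}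
    (hΦ : Continuous Φ) (h0 : ∀ x ∈ P, x 0 = 0 → Φ x = 0) :
    ContinuousOn (fun x => (x 2 / x 0) • Φ x) P := by
  intro x hx
  by_cases hx0 : x 0 = 0
  · rw [ContinuousWithinAt, h0 x hx hx0, smul_zero]
    have hlim : Filter.Tendsto (fun y => ‖Φ y‖) (nhdsWithin x P) (nhds 0) := by
      have := (hΦ.norm.tendsto x).mono_left (nhdsWithin_le_nhds (s := P))
      rwa [h0 x hx hx0, norm_zero] at this
    refine squeeze_zero_norm' ?_ hlim
    filter_upwards [self_mem_nhdsWithin] with y hy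
    obtain ⟨h1, h2⟩ := hP y hy
    rw [norm_smul, Real.norm_eq_abs, abs_of_nonneg (div_nonneg h1 (h1.trans h2))]
    exact mul_le_of_le_one_left (norm_nonneg _) (div_le_one_of_le₀ h2 (h1.trans h2))
  · refine ContinuousAt.continuousWithinAt (ContinuousAt.smul ?_ hΦ.continuousAt)
    exact ContinuousAt.div (continuous_apply 2).continuousAt (continuous_apply 0).continuousAt hx0

section FanMin
include ε

theorem comb_smul (t : ℝ) (x : Fin n → ℝ) : comb Z (t • x) = t • comb Z x := by
  rw [comb, comb, Finset.smul_sum]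
  exact Finset.sum_congr rfl fun b _ => by rw [Pi.smul_apply, smul_eq_mul, mul_smul]

theorem br_comb₂ (a c d : Fin 4 → ℝ) (w : Fin n → ℝ) :
    br a (comb Z w) c d = ∑ b, w b * br a (Z b) c d := by
  rw [comb, br_sum₂]
  exact Finset.sum_congr rfl fun b _ => by rw [br_smul₂]

theorem fanCoeff_comb (a k : Fin n) (w : Fin n → ℝ) :
    fanCoeff Z a k (comb Z w) = ∑ b, w b * fanCoeff Z a k (Z b) := by
  rw [fanCoeff, br_comb₂, Finset.sum_div]
  exact Finset.sum_congr rfl fun b _ => by rw [fanCoeff, mul_div_assoc]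

/-- The concave piecewise linear function whose linear pieces are the `fanCoeff`s. -/
noncomputable def fanMin (Z : Matrix (Fin n) (Fin 4) ℝ) (a : Fin n) (Q : Fin 4 → ℝ) : ℝ :=
  ⨅ k : FanIndex n, fanCoeff Z a k.1 Q

theorem fanMin_eq {a : Fin n} {Q : Fin 4 → ℝ} (k : FanIndex n)
    (h : ∀ m : FanIndex n, fanCoeff Z a k.1 Q ≤ fanCoeff Z a m.1 Q) :
    fanMin Z a Q = fanCoeff Z a k.1 Q := by
  have : Nonempty (FanIndex n) := ⟨k⟩
  exact le_antisymm (ciInf_le (Set.finite_range _).bddBelow k) (le_ciInf h)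

theorem fanMin_smul (a : Fin n) {t : ℝ} (ht : 0 ≤ t) (Q : Fin 4 → ℝ) :
    fanMin Z a (t • Q) = t * fanMin Z a Q := by
  simp only [fanMin, fanCoeff_smul]
  rw [Real.mul_iInf_of_nonneg ht]

theorem continuous_fanMin {X : Type*} [TopologicalSpace X] (a : Fin n)
    {Q : X → Fin 4 → ℝ} (hQ : Continuous Q) : Continuous fun x => fanMin Z a (Q x) := by
  have := nonempty_fanIndex (n := n)
  have : (fun x => fanMin Z a (Q x)) = fun x => Finset.univ.inf' Finset.univ_nonempty
      fun k : FanIndex n => fanCoeff Z a k.1 (Q x) := by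
    funext x
    rw [fanMin, Finset.inf'_univ_eq_ciInf]
  rw [this]
  refine Continuous.finset_inf'_apply _ fun k _ => ?_
  simp only [fanCoeff, br]
  fun_prop

theorem exists_fanMin {β γ : ℝ} (hβ : 0 ≤ β) (hγ : 0 ≤ γ)
    {Q : Fin 4 → ℝ} (hQ : Q = β • Z 2 + γ • Z (0 - 1)) :
    ∃ (k : FanIndex n) (b c : ℝ), 0 ≤ b ∧ 0 ≤ c ∧ Q = (-fanMin Z 1 Q) • Z 0 +
      fanMin Z 0 Q • Z 1 + b • Z k.1 + c • Z (k.1 + 1) ∧ fanMin Z 0 Q = fanCoeff Z 0 k.1 Q ∧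
      fanMin Z 1 Q = fanCoeff Z 1 k.1 Q ∧
      ∀ m : FanIndex n, fanMin Z 0 Q ≤ fanCoeff Z 0 m.1 Q ∧ fanMin Z 1 Q ≤ fanCoeff Z 1 m.1 Q ∧
        (fanCoeff Z 0 m.1 Q = fanMin Z 0 Q ↔ fanCoeff Z 1 m.1 Q = fanMin Z 1 Q) := by
  have hpos := hZ.pos_012L
  obtain ⟨k, b, c, hb, hc, hk⟩ := exists_fan (Z := Z) (Q := Q)
    (by
      have : br (Z 0) (Z 1) Q (Z 2) = -(γ * br (Z 0) (Z 1) (Z 2) (Z (0 - 1))) := by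
        rw [hQ]; simp only [br, Pi.add_apply, Pi.smul_apply, smul_eq_mul]; ring
      rw [this]
      have := mul_nonneg hγ hpos.le
      linarith)
    (by
      have : br (Z 0) (Z 1) Q (Z (0 - 1)) = β * br (Z 0) (Z 1) (Z 2) (Z (0 - 1)) := by
        rw [hQ]; simp only [br, Pi.add_apply, Pi.smul_apply, smul_eq_mul]; ring
      rw [this]
      have := mul_nonneg hβ hpos.le
      linarith)
  have hm := fan_le hb hc hk
  have e0 := fanMin_eq k fun m => (hm m).1
  have e1 := fanMin_eq k fun m => (hm m).2.1
  refine ⟨k, b, c, hb, hc, ?_, e0, e1, ?_⟩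
  · rw [e0, e1]; exact hk
  · rw [e0, e1]; exact hm

/-- A line meeting the segment `Z_0 Z_1`, spanned by a point of that segment and a point of the
cone over `Z_k` and `Z_{k+1}`, together with a nonnegative multiple of `Z_0 ∧ Z_1`. -/
theorem mem_amplituhedron_of_fan (k : FanIndex n) {s b c e : ℝ} (hs : 0 ≤ s)
    (hs' : s ≤ 1) (hb : 0 ≤ b) (hc : 0 ≤ c) (he : 0 ≤ e) {u v : Fin 4 → ℝ}
    (h : LinearIndependent ℝ ![u, v])
    (hp : pl u v = (1 - s) • pl (Z 0) (b • Z k.1 + c • Z (k.1 + 1)) +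
      s • pl (Z 1) (b • Z k.1 + c • Z (k.1 + 1)) + e • pl (Z 0) (Z 1)) :
    lineOf u v h ∈ amplituhedron Z := by
  set y : Fin n → ℝ := Pi.single k.1 b + Pi.single (k.1 + 1) c with hy
  have hy0 : ∀ j, 0 ≤ y j := by
    have s2 : (0 : Fin n → ℝ) ≤ Pi.single k.1 b := Pi.single_nonneg.2 hb
    have s3 : (0 : Fin n → ℝ) ≤ Pi.single (k.1 + 1) c := Pi.single_nonneg.2 hc
    exact fun j => add_nonneg (s2 j) (s3 j)
  obtain ⟨n1, n2, n3, n4⟩ := k.ne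
  have h01 := zero_lt_one_fin (n := n)
  have y0 : y 0 = 0 := by simp [hy, n1, n2]
  have y1 : y 1 = 0 := by simp [hy, n3, n4]
  refine mem_amplituhedron_iff.2 ⟨Pi.single 0 (1 - s) + Pi.single 1 s,
    Pi.single 0 (-e) + Pi.single 1 e + y, isRep_of_pl (fun p q hpq => ?_) h ?_⟩
  · have hq0 : q ≠ 0 := by rintro rfl; simp at hpq
    by_cases hq1 : q = 1
    · subst hq1
      have hp0 : p = 0 := by
        have := val_one (n := n)
        apply Fin.ext; rw [val_zero_fin]; omega
      subst hp0
      simp only [minor, Pi.add_apply, Pi.single_apply, y0, y1, if_pos, if_neg h01.ne, if_neg h01.ne']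
      ring_nf
      exact he
    · have : minor (Pi.single 0 (1 - s) + Pi.single 1 s) (Pi.single 0 (-e) + Pi.single 1 e + y) p q
          = (Pi.single 0 (1 - s) + Pi.single 1 s : Fin n → ℝ) p * y q := by
        simp [minor, Pi.single_apply, hq0, hq1]
      rw [this]
      have s2 : (0 : Fin n → ℝ) ≤ Pi.single 0 (1 - s) := Pi.single_nonneg.2 (by linarith)
      have s3 : (0 : Fin n → ℝ) ≤ Pi.single 1 s := Pi.single_nonneg.2 hs
      exact mul_nonneg (add_nonneg (s2 p) (s3 p)) (hy0 q)
  · rw [hp, hy]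
    simp only [comb_add, comb_single, pl_add_left, pl_add_right, pl_smul_left, pl_smul_right,
      pl_self]
    rw [pl_swap (Z 0) (Z 1)]
    module

/-- A line of the amplituhedron meeting `Z_0 Z_1`: its Plücker vector in terms of a point of the
segment `Z_0 Z_1` and a nonnegative combination of the other points. -/
theorem exists_pl_eq_of_mem_type3I {x y : Fin n → ℝ}
    (hxy : ∀ a b, a < b → 0 ≤ minor x y a b)
    (hs : ∀ a b, minor x y a b ≠ 0 → a = 0 ∨ a = 1 ∨ b = 0 ∨ b = 1) :
    ∃ (s e : ℝ) (w : Fin n → ℝ), 0 ≤ s ∧ s ≤ 1 ∧ 0 ≤ e ∧ (∀ b, 0 ≤ w b) ∧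
      (∀ b, w b ≠ 0 → 1 < b) ∧ pl (comb Z x) (comb Z y) = (1 - s) • pl (Z 0) (comb Z w) +
        s • pl (Z 1) (comb Z w) + e • pl (Z 0) (Z 1) := by
  have h01 := zero_lt_one_fin (n := n)
  have h0 := val_zero_fin (n := n)
  have h1 := val_one (n := n)
  have hge : ∀ b : Fin n, 1 < b ∨ b = 0 ∨ b = 1 := by
    intro b
    by_cases b0 : b = 0
    · exact .inr (.inl b0)
    by_cases b1 : b = 1
    · exact .inr (.inr b1)
    left
    have a := Fin.val_ne_of_ne b0; have c := Fin.val_ne_of_ne b1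
    rw [Fin.lt_def]; omega
  have hp := pl_comb_of_supp (Z := Z) h01.ne hs
  have hn0 : ∀ b, 1 < b → 0 ≤ minor x y 0 b := fun b hb => hxy _ _ (h01.trans hb)
  have hn1 : ∀ b, 1 < b → 0 ≤ minor x y 1 b := fun b hb => hxy _ _ hb
  have hrel : ∀ c d, 1 < c → 1 < d → minor x y 0 c * minor x y 1 d =
      minor x y 0 d * minor x y 1 c := by
    intro c d hc hd
    have := minor_relation x y 0 1 c d
    have hz : minor x y c d = 0 := by
      by_contra hm
      have := hs c d hm
      have c0 := (h01.trans hc).ne'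
      have d0 := (h01.trans hd).ne'
      have c1 := hc.ne'
      have d1 := hd.ne'
      tauto
    rwa [hz, mul_zero, zero_add] at this
  set w : Fin n → ℝ := fun b => if 1 < b then minor x y 0 b + minor x y 1 b else 0 with hw
  have hwb : ∀ b, 1 < b → w b = minor x y 0 b + minor x y 1 b := fun b hb => if_pos hb
  have hw0 : ∀ b, 0 ≤ w b := by
    intro b
    simp only [hw]
    split_ifs with h
    · exact add_nonneg (hn0 b h) (hn1 b h)
    · exact le_rfl
  obtain ⟨s, s0, s1, hsw⟩ : ∃ s : ℝ, 0 ≤ s ∧ s ≤ 1 ∧ ∀ b, 1 < b → minor x y 1 b = s * w b := by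
    by_cases hall : ∀ b, 1 < b → w b = 0
    · refine ⟨0, le_rfl, zero_le_one, fun b hb => ?_⟩
      have a1 := hall b hb
      rw [hwb b hb] at a1
      have a2 := hn0 b hb; have a3 := hn1 b hb
      linarith
    · push Not at hall
      obtain ⟨c, hc, hwc⟩ := hall
      have hpos : 0 < w c := lt_of_le_of_ne (hw0 c) (Ne.symm hwc)
      refine ⟨minor x y 1 c / w c, div_nonneg (hn1 c hc) hpos.le, ?_, fun b hb => ?_⟩
      · rw [div_le_one hpos, hwb c hc]; have := hn0 c hc; linarith
      · rw [div_mul_eq_mul_div, eq_div_iff hwc, hwb c hc, hwb b hb]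
        linear_combination hrel c b hc hb
  have hw0' : w 0 = 0 := if_neg (by simp)
  have hw1' : w 1 = 0 := if_neg (lt_irrefl _)
  refine ⟨s, minor x y 0 1, w, s0, s1, hxy _ _ h01, hw0, fun b hb => ?_, ?_⟩
  · by_contra hlt
    exact hb (if_neg hlt)
  · have m0 : minor x y 0 = Pi.single 1 (minor x y 0 1) + (1 - s) • w := by
      funext b
      rcases hge b with hb | rfl | rfl
      · have := hwb b hb
        have := hsw b hb
        simp only [Pi.add_apply, Pi.smul_apply, smul_eq_mul, Pi.single_apply, if_neg hb.ne']
        linarith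
      · simp [hw0', minor, h01.ne]
      · simp [hw1']
    have m1 : Function.update (minor x y 1) 0 0 = s • w := by
      funext b
      rcases hge b with hb | rfl | rfl
      · rw [Function.update_of_ne (h01.trans hb).ne', hsw b hb]; rfl
      · simp [hw0']
      · rw [Function.update_of_ne h01.ne']; simp [hw1', minor]
    rw [hp, m1]
    conv_lhs => rw [m0]
    simp only [comb_add, comb_smul, comb_single, pl_add_right, pl_smul_right]
    abel

theorem range_facets_type3I_zero :
    range (Sum.elim ![type2II Z (0 + 1), type2II Z 0, type2I Z 0, type2I Z (0 + 1)]
      fun k : FanIndex n => type2III Z 0 k.1) =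
      ({S | ∃ j, j ≠ 0 - 1 ∧ j ≠ 0 ∧ j ≠ 0 + 1 ∧ S = type2III Z 0 j} ∪
          {type2I Z 0, type2I Z (0 + 1)} ∪ {type2II Z 0, type2II Z (0 + 1)}) := by
  have h0 := val_zero_fin (n := n)
  have h1 := val_one (n := n)
  have hL := val_last (n := n)
  have e1 : (0 : Fin n) + 1 = 1 := zero_add 1
  have hK : ∀ S, (∃ k : FanIndex n, type2III Z 0 k.1 = S) ↔
      ∃ j, j ≠ 0 - 1 ∧ j ≠ 0 ∧ j ≠ 0 + 1 ∧ S = type2III Z 0 j := by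
    intro S
    constructor
    · rintro ⟨k, h⟩
      refine ⟨k.1, fun h => ?_, k.ne.1.symm, ?_, h.symm⟩
      · have := congrArg Fin.val h; have := k.2.2; omega
      · rw [e1]; exact k.ne.2.2.1.symm
    · rintro ⟨j, hj1, hj2, hj3, h⟩
      have a := Fin.val_ne_of_ne hj2; have b := Fin.val_ne_of_ne hj3
      have d := Fin.val_ne_of_ne hj1
      exact ⟨⟨j, by omega, by omega⟩, h.symm⟩
  ext S
  simp only [mem_range, Sum.exists, Sum.elim_inl, Sum.elim_inr, mem_union, mem_ofPred_eq,
    mem_insert_iff, mem_singleton_iff, hK]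
  simp only [Fin.exists_fin_succ, IsEmpty.exists_iff]
  generalize (∃ j, j ≠ 0 - 1 ∧ j ≠ 0 ∧ j ≠ 0 + 1 ∧ S = type2III Z 0 j) = E
  tauto

theorem facets_type3I_zero_injective : Function.Injective
    (Sum.elim ![type2II Z (0 + 1), type2II Z 0, type2I Z 0, type2I Z (0 + 1)]
      fun k : FanIndex n => type2III Z 0 k.1) := by
  have hn := hn.out
  have v2 := val_two (n := n)
  have hL := val_last (n := n)
  have e1 : (0 : Fin n) + 1 = 1 := zero_add 1
  have e2 := one_add_one_fin (n := n)
  have n01 := (zero_lt_one_fin (n := n)).ne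
  have n12 := (one_lt_two_fin (n := n)).ne
  have n02 := ((zero_lt_one_fin).trans (one_lt_two_fin (n := n))).ne
  have n2L : (2 : Fin n) ≠ 0 - 1 := fun h => by have := congrArg Fin.val h; omega
  have hleft : ∀ i, VertIn Z (![type2II Z (0 + 1), type2II Z 0, type2I Z 0, type2I Z (0 + 1)] i)
      0 1 := by
    intro i
    fin_cases i <;> simp [vertIn_type2I n01, vertIn_type2II n01]
  have hright : ∀ k : FanIndex n, ¬ VertIn Z (type2III Z 0 k.1) 0 1 := by
    intro k
    obtain ⟨a1, a2, a3, a4⟩ := k.ne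
    rw [vertIn_type2III n01]
    tauto
  have hlt : ∀ k l : FanIndex n, type2III Z 0 k.1 = type2III Z 0 l.1 → ¬ k.1 < l.1 := by
    intro k l h hkl
    have a := (l.ne).2.1
    have := (vertIn_type2III (Z := Z) (i := 0) (j := l.1) a).2 (by simp)
    rw [← h, vertIn_type2III a] at this
    rcases this.2 with h | h | h | h
    · exact (k.ne).1 h
    · exact (k.ne).2.1 h
    · have := congrArg Fin.val h; rw [l.val_succ] at this; rw [Fin.lt_def] at hkl; omega
    · have := congrArg Fin.val h; rw [l.val_succ, k.val_succ] at this
      rw [Fin.lt_def] at hkl; omega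
  rintro (i | k) (j | l) h
  · simp only [Sum.elim_inl] at h
    have k1 := congrArg (VertIn Z · 0 2) h
    have k2 := congrArg (VertIn Z · 1 2) h
    fin_cases i <;> fin_cases j <;> first | rfl | (simp [vertIn_type2I n02,
      vertIn_type2I n12, vertIn_type2II n02, vertIn_type2II n12, -zero_sub, e1, e2,
      n01, n01.symm, n12, n12.symm, n02.symm, n2L] at k1 k2)
  · exact absurd (Eq.subst (motive := (VertIn Z · 0 1)) h (hleft i)) (hright l)
  · exact absurd (Eq.subst (motive := (VertIn Z · 0 1)) h.symm (hleft j)) (hright k)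
  · rcases lt_trichotomy k.1 l.1 with hkl | hkl | hkl
    · exact absurd hkl (hlt k l h)
    · exact congrArg Sum.inr (Subtype.ext hkl)
    · exact absurd hkl (hlt l k h.symm)

set_option maxHeartbeats 4000000 in
theorem hasModel_type3I_zero :
    HasModel (amplituhedron Z) (type3I Z 0) 3
      ({S | ∃ j, j ≠ 0 - 1 ∧ j ≠ 0 ∧ j ≠ 0 + 1 ∧ S = type2III Z 0 j} ∪
          {type2I Z 0, type2I Z (0 + 1)} ∪ {type2II Z 0, type2II Z (0 + 1)}) := by
  have hn := hn.out
  have h0 := val_zero_fin (n := n)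
  have h1 := val_one (n := n)
  have v2 := val_two (n := n)
  have hL := val_last (n := n)
  have h01 := zero_lt_one_fin (n := n)
  have h12 := one_lt_two_fin (n := n)
  have e1 : (0 : Fin n) + 1 = 1 := zero_add 1
  have e2 := one_add_one_fin (n := n)
  have eL : (0 - 1 : Fin n) + 1 = 0 := sub_add_cancel 0 1
  obtain ⟨C, hC⟩ := exists_fan_bound (Z := Z)
  have hpos := hZ.pos_012L
  have hfan : ∀ β γ : ℝ, 0 ≤ β → 0 ≤ γ → _ := fun β γ hβ hγ =>
    exists_fanMin hβ hγ (Q := β • Z 2 + γ • Z (0 - 1)) rfl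
  set L : Fin n := 0 - 1 with hLdef
  have n1L : (1 : Fin n) ≠ L := fun h => by have := congrArg Fin.val h; omega
  have n0L : (0 : Fin n) ≠ L := fun h => by have := congrArg Fin.val h; omega
  set D := br (Z 0) (Z 1) (Z 2) (Z L) with hD
  have hd : D ≠ 0 := fun h => by rw [h, mul_zero] at hpos; exact lt_irrefl _ hpos
  set Q : (Fin 3 → ℝ) → Fin 4 → ℝ := fun x => (x 0 - x 1) • Z 2 + x 1 • Z L with hQ
  set s : (Fin 3 → ℝ) → ℝ := fun x => x 2 / x 0 with hs
  set c : (Fin 3 → ℝ) → ℝ := fun x =>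
    1 - C * x 0 + s x * (fanMin Z 0 (Q x) - fanMin Z 1 (Q x)) with hc
  set u : (Fin 3 → ℝ) → Fin 4 → ℝ := fun x => (1 - s x) • Z 0 + s x • Z 1 with hu
  set v : (Fin 3 → ℝ) → Fin 4 → ℝ := fun x => Q x + c x • (Z 1 - Z 0) with hv
  have hsub : ∀ a b w : Fin 4 → ℝ, pl a (b - w) = pl a b - pl a w := by
    intro a b w; ext i j; simp only [pl, Pi.sub_apply]; ring
  have hpl : ∀ x, pl (u x) (v x) = (1 - s x) • pl (Z 0) (Q x) + s x • pl (Z 1) (Q x) +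
      c x • pl (Z 0) (Z 1) := by
    intro x
    simp only [hu, hv, pl_add_left, pl_add_right, pl_smul_left, pl_smul_right, hsub, pl_self]
    rw [pl_swap (Z 0) (Z 1)]
    module
  have F1 : ∀ x, brL (Z 1) (Z L) (pl (u x) (v x)) = -((1 - s x) * (x 0 - x 1) * D) := by
    intro x; rw [hpl]
    simp only [map_add, map_smul, brL_pl, smul_eq_mul, hQ, hD, br, Pi.add_apply, Pi.smul_apply]; ring
  have F2 : ∀ x, brL (Z 0) (Z L) (pl (u x) (v x)) = s x * (x 0 - x 1) * D := by
    intro x; rw [hpl]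
    simp only [map_add, map_smul, brL_pl, smul_eq_mul, hQ, hD, br, Pi.add_apply, Pi.smul_apply]; ring
  have F3 : ∀ x, brL (Z 1) (Z 2) (pl (u x) (v x)) = (1 - s x) * x 1 * D := by
    intro x; rw [hpl]
    simp only [map_add, map_smul, brL_pl, smul_eq_mul, hQ, hD, br, Pi.add_apply, Pi.smul_apply]; ring
  have F4 : ∀ x, brL (Z 0) (Z 2) (pl (u x) (v x)) = -(s x * x 1 * D) := by
    intro x; rw [hpl]
    simp only [map_add, map_smul, brL_pl, smul_eq_mul, hQ, hD, br, Pi.add_apply, Pi.smul_apply]; ring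
  have F5 : ∀ x, brL (Z 2) (Z L) (pl (u x) (v x)) = c x * D := by
    intro x; rw [hpl]
    simp only [map_add, map_smul, brL_pl, smul_eq_mul, hQ, hD, br, Pi.add_apply, Pi.smul_apply]; ring
  have F6 : ∀ (k : FanIndex n) x, brL (Z k.1) (Z (k.1 + 1)) (pl (u x) (v x)) =
      ((1 - s x) * fanCoeff Z 0 k.1 (Q x) + s x * fanCoeff Z 1 k.1 (Q x) + c x) *
        br (Z 0) (Z 1) (Z k.1) (Z (k.1 + 1)) := by
    intro k x; rw [hpl]
    simp only [map_add, map_smul, brL_pl, smul_eq_mul, br_eq_fanCoeff _ k (Q x)]; ring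
  have hQk : ∀ (a : Fin n) (k : FanIndex n) x, fanCoeff Z a k.1 (Q x) =
      (x 0 - x 1) * fanCoeff Z a k.1 (Z 2) + x 1 * fanCoeff Z a k.1 (Z L) := by
    intro a k x; simp only [hQ, fanCoeff_add, fanCoeff_smul]
  set P : Set (Fin 3 → ℝ) := {x | 0 ≤ x 1 ∧ 0 ≤ x 0 - x 1 ∧ 0 ≤ x 2 ∧ 0 ≤ x 0 - x 2 ∧
    ∀ k : FanIndex n, 0 ≤ 1 - C * x 0 + fanCoeff Z 0 k.1 (Q x)} with hP
  obtain ⟨k₀⟩ := nonempty_fanIndex (n := n)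
  have hbd : ∀ β γ : ℝ, 0 ≤ β → 0 ≤ γ → ∀ k : FanIndex n,
      fanCoeff Z 0 k.1 (β • Z 2 + γ • Z L) ≤ (C - 1) * (β + γ) := by
    intro β γ hβ hγ k
    have t1 := mul_le_mul_of_nonneg_left (hC k).1 hβ
    have t2 := mul_le_mul_of_nonneg_left (hC k).2 hγ
    rw [fanCoeff_add, fanCoeff_smul, fanCoeff_smul]
    linarith
  have hx01 : ∀ x ∈ P, x 0 ≤ 1 := by
    rintro x ⟨a1, a2, -, -, a5⟩
    have := hbd _ _ a2 a1 k₀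
    have := a5 k₀
    simp only [hQ] at this
    linarith
  have hs0 : ∀ x ∈ P, 0 ≤ s x := fun x hx => div_nonneg hx.2.2.1 (by have := hx.1; have := hx.2.1; linarith)
  have hs1 : ∀ x ∈ P, s x ≤ 1 := fun x hx =>
    div_le_one_of_le₀ (by have := hx.2.2.2.1; linarith) (by have := hx.1; have := hx.2.1; linarith)
  have hsr : ∀ x ∈ P, s x * x 0 = x 2 := by
    rintro x ⟨a1, a2, a3, a4, -⟩
    by_cases h : x 0 = 0
    · rw [h, mul_zero]; linarith
    · exact div_mul_cancel₀ _ h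
  have hc0 : ∀ x ∈ P, x 0 = 0 → x 1 = 0 ∧ x 2 = 0 ∧ c x = 1 := by
    rintro x ⟨a1, a2, a3, a4, -⟩ h
    refine ⟨by linarith, by linarith, ?_⟩
    simp only [hc, hs, h, div_zero, mul_zero, zero_mul]; ring
  have hfanx : ∀ x ∈ P, ∃ (k : FanIndex n) (b c : ℝ), 0 ≤ b ∧ 0 ≤ c ∧
      Q x = (-fanMin Z 1 (Q x)) • Z 0 + fanMin Z 0 (Q x) • Z 1 + b • Z k.1 + c • Z (k.1 + 1) ∧
      fanMin Z 0 (Q x) = fanCoeff Z 0 k.1 (Q x) ∧ fanMin Z 1 (Q x) = fanCoeff Z 1 k.1 (Q x) ∧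
      ∀ m : FanIndex n, fanMin Z 0 (Q x) ≤ fanCoeff Z 0 m.1 (Q x) ∧
        fanMin Z 1 (Q x) ≤ fanCoeff Z 1 m.1 (Q x) ∧
        (fanCoeff Z 0 m.1 (Q x) = fanMin Z 0 (Q x) ↔ fanCoeff Z 1 m.1 (Q x) = fanMin Z 1 (Q x)) :=
    fun x hx => hfan _ _ hx.2.1 hx.1
  have hli : ∀ x ∈ P, LinearIndependent ℝ ![u x, v x] := by
    intro x hx
    refine linearIndependent_of_pl_ne_zero fun h => ?_
    have a1 := F1 x
    have a2 := F2 x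
    have a3 := F3 x
    have a4 := F4 x
    have a5 := F5 x
    rw [h, map_zero] at a1 a2 a3 a4 a5
    have hz : x 0 * D = 0 := by linarith
    have hx0 := (mul_eq_zero.1 hz).resolve_right hd
    rw [(hc0 x hx hx0).2.2, one_mul] at a5
    exact hd a5.symm
  -- the value of the form `Z_m Z_{m+1}`
  have hsplit : ∀ (m : FanIndex n) x, (1 - s x) * fanCoeff Z 0 m.1 (Q x) +
      s x * fanCoeff Z 1 m.1 (Q x) + c x = (1 - s x) * (fanCoeff Z 0 m.1 (Q x) - fanMin Z 0 (Q x)) +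
      s x * (fanCoeff Z 1 m.1 (Q x) - fanMin Z 1 (Q x)) + (1 - C * x 0 + fanMin Z 0 (Q x)) := by
    intro m x; simp only [hc]; ring
  have hmem : ∀ x ∈ P, ∀ h, lineOf (u x) (v x) h ∈ amplituhedron Z := by
    intro x hx h
    obtain ⟨k, b, d, hb, hd', hq, hA, hB, hm⟩ := hfanx x hx
    have he : 0 ≤ 1 - C * x 0 + fanMin Z 0 (Q x) := by rw [hA]; exact hx.2.2.2.2 k
    refine mem_amplituhedron_of_fan k (hs0 x hx) (hs1 x hx) hb hd' he h ?_
    rw [hpl]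
    have e : ∀ a, pl (Z a) (Q x) = (-fanMin Z 1 (Q x)) • pl (Z a) (Z 0) +
        fanMin Z 0 (Q x) • pl (Z a) (Z 1) + pl (Z a) (b • Z k.1 + d • Z (k.1 + 1)) := by
      intro a
      conv_lhs => rw [hq]
      simp only [pl_add_right, pl_smul_right]; abel
    rw [e, e, pl_self, pl_self, pl_swap (Z 0) (Z 1)]
    simp only [hc]
    module
  rw [← range_facets_type3I_zero]
  obtain ⟨cc, mm, hcon⟩ : ∃ (cc : Fin 4 ⊕ FanIndex n → ℝ) (mm : Fin 4 ⊕ FanIndex n → Fin 3 → ℝ),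
      ∀ (x : Fin 3 → ℝ) k, cc k + ∑ i, mm k i * x i = Sum.elim ![x 1, x 0 - x 1, x 2, x 0 - x 2]
        (fun k : FanIndex n => 1 - C * x 0 + fanCoeff Z 0 k.1 (Q x)) k := by
    refine ⟨Sum.elim (fun _ => 0) fun _ => 1,
      Sum.elim ![![0, 1, 0], ![1, -1, 0], ![0, 0, 1], ![1, 0, -1]]
      fun k => ![fanCoeff Z 0 k.1 (Z 2) - C, fanCoeff Z 0 k.1 (Z L) - fanCoeff Z 0 k.1 (Z 2), 0],
      fun x k => ?_⟩
    rcases k with k | k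
    · fin_cases k <;> simp [Fin.sum_univ_three] <;> ring
    · simp only [Sum.elim_inr, Fin.sum_univ_three, hQk, Matrix.cons_val]; ring
  have hPcon : ∀ x : Fin 3 → ℝ, (∀ k, 0 ≤ cc k + ∑ i, mm k i * x i) ↔ x ∈ P := by
    intro x
    constructor
    · intro h
      have h' := fun k => hcon x k ▸ h k
      exact ⟨h' (Sum.inl 0), h' (Sum.inl 1), h' (Sum.inl 2), h' (Sum.inl 3), fun k => h' (Sum.inr k)⟩
    · rintro ⟨a1, a2, a3, a4, a5⟩ k
      rw [hcon]
      rcases k with k | k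
      · fin_cases k
        exacts [a1, a2, a3, a4]
      · exact a5 k
  refine hasModel_of_frames cc mm _ (facets_type3I_zero_injective) P
    (fun x => (hPcon x).symm) u v (divisorForms ε Z) (C := 1)
    ?_ ?_ ?_ hli ?_ ?_ ?_ ?_ ?_ ?_
  · intro x hx i
    have b0 := hx01 x hx
    obtain ⟨a1, a2, a3, a4, -⟩ := hx
    fin_cases i
    · simp only [Fin.zero_eta]; rw [abs_of_nonneg (by linarith)]; exact b0
    · simp only [Fin.mk_one]; rw [abs_of_nonneg a1]; linarith
    · simp only [Fin.reduceFinMk]; rw [abs_of_nonneg a3]; linarith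
  · obtain ⟨M, hM⟩ := (Set.finite_range fun k : FanIndex n =>
      2 * C - fanCoeff Z 0 k.1 (Z 2) - fanCoeff Z 0 k.1 (Z L)).bddAbove
    have hM0 : 0 < M := by
      have := hM ⟨k₀, rfl⟩
      have t1 := (hC k₀).1
      have t2 := (hC k₀).2
      simp only at this
      linarith
    have hM1 : 0 < 1 / (M + 1) := by positivity
    have x0 : (![2 * (1 / (M + 1)), 1 / (M + 1), 1 / (M + 1)] : Fin 3 → ℝ) 0 = 2 * (1 / (M + 1)) := rfl
    have x1 : (![2 * (1 / (M + 1)), 1 / (M + 1), 1 / (M + 1)] : Fin 3 → ℝ) 1 = 1 / (M + 1) := rfl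
    have x2 : (![2 * (1 / (M + 1)), 1 / (M + 1), 1 / (M + 1)] : Fin 3 → ℝ) 2 = 1 / (M + 1) := rfl
    refine ⟨![2 * (1 / (M + 1)), 1 / (M + 1), 1 / (M + 1)], fun k => ?_⟩
    rw [hcon]
    rcases k with k | k
    · rw [Sum.elim_inl, x0, x1, x2]
      fin_cases k
      · exact hM1
      · change 0 < 2 * (1 / (M + 1)) - 1 / (M + 1); linarith
      · exact hM1
      · change 0 < 2 * (1 / (M + 1)) - 1 / (M + 1); linarith
    · have := hM ⟨k, rfl⟩
      simp only at this
      rw [Sum.elim_inr, hQk, x0, x1]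
      have e : 1 - C * (2 * (1 / (M + 1))) + ((2 * (1 / (M + 1)) - 1 / (M + 1)) *
          fanCoeff Z 0 k.1 (Z 2) + 1 / (M + 1) * fanCoeff Z 0 k.1 (Z L)) =
          (M + 1 - (2 * C - fanCoeff Z 0 k.1 (Z 2) -
            fanCoeff Z 0 k.1 (Z L))) / (M + 1) := by field_simp; ring
      rw [e]
      exact div_pos (by linarith) (by linarith)
  · have hQc : Continuous Q := by
      refine continuous_pi fun i => ?_
      simp only [hQ, Pi.add_apply, Pi.smul_apply, smul_eq_mul]
      fun_prop
    have hA := continuous_fanMin (Z := Z) 0 hQc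
    have hB := continuous_fanMin (Z := Z) 1 hQc
    have hp0 : ∀ a, Continuous fun x => pl (Z a) (Q x) := by
      intro a
      refine continuous_pi fun i => continuous_pi fun j => ?_
      simp only [pl]
      have hi := (continuous_apply i).comp hQc
      have hj := (continuous_apply j).comp hQc
      exact (continuous_const.mul hj).sub (continuous_const.mul hi)
    have hΦ : Continuous fun x => -pl (Z 0) (Q x) + pl (Z 1) (Q x) +
        (fanMin Z 0 (Q x) - fanMin Z 1 (Q x)) • pl (Z 0) (Z 1) :=
      ((hp0 0).neg.add (hp0 1)).add ((hA.sub hB).smul continuous_const)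
    have h2 := continuousOn_ratio_smul (P := P)
      (fun x hx => ⟨hx.2.2.1, by have := hx.2.2.2.1; linarith⟩) hΦ (fun x hx hx0 => by
        have hq : Q x = (0 : ℝ) • Q x := by
          simp only [hQ, hx0, (hc0 x hx hx0).1]; simp
        rw [hq, fanMin_smul _ le_rfl, fanMin_smul _ le_rfl]
        simp only [pl_smul_right]; simp)
    have h3 : Continuous fun x : Fin 3 → ℝ => pl (Z 0) (Q x) + (1 - C * x 0) • pl (Z 0) (Z 1) :=
      (hp0 0).add (Continuous.smul (by fun_prop : Continuous fun x : Fin 3 → ℝ => 1 - C * x 0)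
        continuous_const)
    refine (h3.continuousOn.add h2).congr fun x _ => ?_
    rw [hpl]
    change _ = (pl (Z 0) (Q x) + (1 - C * x 0) • pl (Z 0) (Z 1)) + (x 2 / x 0) •
      (-pl (Z 0) (Q x) + pl (Z 1) (Q x) + (fanMin Z 0 (Q x) - fanMin Z 1 (Q x)) • pl (Z 0) (Z 1))
    simp only [hc, hs]
    module
  · intro x hx x' hx' k hk he
    have a1 := congrArg (brL (Z 1) (Z L)) he
    have a2 := congrArg (brL (Z 0) (Z L)) he
    have a3 := congrArg (brL (Z 1) (Z 2)) he
    have a4 := congrArg (brL (Z 0) (Z 2)) he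
    have a5 := congrArg (brL (Z 2) (Z L)) he
    rw [map_smul, F1, F1, smul_eq_mul, mul_neg, neg_inj, ← mul_assoc] at a1
    rw [map_smul, F2, F2, smul_eq_mul, ← mul_assoc] at a2
    rw [map_smul, F3, F3, smul_eq_mul, ← mul_assoc] at a3
    rw [map_smul, F4, F4, smul_eq_mul, mul_neg, neg_inj, ← mul_assoc] at a4
    rw [map_smul, F5, F5, smul_eq_mul, ← mul_assoc] at a5
    replace a1 := mul_right_cancel₀ hd a1
    replace a2 := mul_right_cancel₀ hd a2
    replace a3 := mul_right_cancel₀ hd a3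
    replace a4 := mul_right_cancel₀ hd a4
    replace a5 := mul_right_cancel₀ hd a5
    have b0 : x' 0 = k * x 0 := by linarith
    have b1 : x' 1 = k * x 1 := by linarith
    have b2 : x' 2 = k * x 2 := by
      rw [← hsr x hx, ← hsr x' hx']; linarith
    have hk1 : k = 1 := by
      by_cases hx0 : x 0 = 0
      · rw [hx0, mul_zero] at b0
        rw [(hc0 x hx hx0).2.2, (hc0 x' hx' b0).2.2] at a5
        linarith
      · have p0 : 0 < x 0 := lt_of_le_of_ne (by have := hx.1; have := hx.2.1; linarith) (Ne.symm hx0)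
        have p0' : 0 ≤ k * x 0 := by rw [← b0]; have := hx'.1; have := hx'.2.1; linarith
        have kpos : 0 ≤ k := nonneg_of_mul_nonneg_left p0' p0
        have hss : s x' = s x := by
          simp only [hs]; rw [b0, b2, mul_div_mul_left _ _ hk]
        have hQQ : Q x' = k • Q x := by
          simp only [hQ]; rw [b0, b1]; module
        simp only [hc] at a5
        rw [hss, hQQ, fanMin_smul _ kpos, fanMin_smul _ kpos, b0] at a5
        linarith
    subst hk1
    ext i; fin_cases i
    · simp only [Fin.zero_eta]; linarith
    · simp only [Fin.mk_one]; linarith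
    · simp only [Fin.reduceFinMk]; linarith
  · intro x hx h
    refine ⟨hmem x hx h, ?_⟩
    rw [realPoints_type3I, e1]
    refine (mem_schubertL_lineOf h (hZ.pair_independent h01.ne)).2 ?_
    rw [← brL_pl, hpl]
    simp only [map_add, map_smul, brL_pl, br_self₁₃, br_self₁₄, smul_eq_mul, mul_zero, add_zero]
  · intro U hA hU
    obtain ⟨x, y, hr⟩ := mem_amplituhedron_iff.1 hA
    have hsupp := (supp_type3I 0 U x y hr).1 hU
    rw [e1] at hsupp
    obtain ⟨hxy, hl, rfl⟩ := hr
    obtain ⟨σ, e, w, s0, s1, he0, hw0, hw1, hp⟩ := exists_pl_eq_of_mem_type3I (Z := Z) hxy hsupp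
    obtain ⟨q₀, q₁, β, γ, hq⟩ := exists_coord (Z := Z) (comb Z w)
    rw [← hLdef] at hq
    have hβ : 0 ≤ β := by
      have t : 0 ≤ ε * br (Z 0) (comb Z w) (Z L) (Z 1) := by
        rw [br_comb₂, Finset.mul_sum]
        refine Finset.sum_nonneg fun b _ => ?_
        by_cases hb : w b = 0
        · rw [hb]; simp
        by_cases hbL : b = L
        · subst hbL; simp
        have hb1 := hw1 b hb
        have c := Fin.val_ne_of_ne hbL
        rw [hL] at c
        have := b.2
        have := hZ.1 0 1 b L h01 hb1 (by rw [Fin.lt_def]; omega)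
        have e' : br (Z 0) (Z b) (Z L) (Z 1) = br (Z 0) (Z 1) (Z b) (Z L) := by
          simp only [br]; ring
        rw [e']
        have := mul_nonneg (hw0 b) this.le
        linarith
      rw [hq] at t
      have e' : br (Z 0) (q₀ • Z 0 + q₁ • Z 1 + β • Z 2 + γ • Z L) (Z L) (Z 1) = β * D := by
        simp only [hD, br, Pi.add_apply, Pi.smul_apply, smul_eq_mul]; ring
      rw [e'] at t
      exact nonneg_of_mul_nonneg_left (b := ε * D) (by linarith) hpos
    have hγ : 0 ≤ γ := by
      have t : 0 ≤ ε * br (Z 0) (comb Z w) (Z 1) (Z 2) := by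
        rw [br_comb₂, Finset.mul_sum]
        refine Finset.sum_nonneg fun b _ => ?_
        by_cases hb : w b = 0
        · rw [hb]; simp
        by_cases hb2 : b = 2
        · subst hb2; simp
        have hb1 := hw1 b hb
        have c := Fin.val_ne_of_ne hb2
        rw [v2] at c
        rw [Fin.lt_def, h1] at hb1
        have := hZ.1 0 1 2 b h01 h12 (by rw [Fin.lt_def]; omega)
        have e' : br (Z 0) (Z b) (Z 1) (Z 2) = br (Z 0) (Z 1) (Z 2) (Z b) := by
          simp only [br]; ring
        rw [e']
        have := mul_nonneg (hw0 b) this.le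
        linarith
      rw [hq] at t
      have e' : br (Z 0) (q₀ • Z 0 + q₁ • Z 1 + β • Z 2 + γ • Z L) (Z 1) (Z 2) = γ * D := by
        simp only [hD, br, Pi.add_apply, Pi.smul_apply, smul_eq_mul]; ring
      rw [e'] at t
      exact nonneg_of_mul_nonneg_left (b := ε * D) (by linarith) hpos
    have hf : ∀ (a : Fin n) (k : FanIndex n), (a = 0 ∨ a = 1) → 0 ≤ fanCoeff Z a k.1 (comb Z w) := by
      intro a k ha
      rw [fanCoeff_comb]
      refine Finset.sum_nonneg fun b _ => ?_
      by_cases hb : w b = 0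
      · rw [hb]; simp
      · exact mul_nonneg (hw0 b) (fanCoeff_nonneg k ha (hw1 b hb))
    set Q' := β • Z 2 + γ • Z L with hQ'
    have hq' : comb Z w = q₀ • Z 0 + q₁ • Z 1 + Q' := by rw [hq, hQ']; abel
    obtain ⟨k, b, d, hb, hd', hqk, hA', hB', hm⟩ := hfan β γ hβ hγ
    rw [← hQ'] at hqk hA' hB' hm
    set A' := fanMin Z 0 Q'
    set B' := fanMin Z 1 Q'
    obtain ⟨l1, l2, l3, l4⟩ := fanCoeff_left (Z := Z) k
    have i1 : 0 ≤ q₁ + A' := by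
      have := hf 0 k (Or.inl rfl)
      rw [hq', fanCoeff_add, fanCoeff_add, fanCoeff_smul, fanCoeff_smul, l1, l2, ← hA'] at this
      linarith
    have i2 : 0 ≤ B' - q₀ := by
      have := hf 1 k (Or.inr rfl)
      rw [hq', fanCoeff_add, fanCoeff_add, fanCoeff_smul, fanCoeff_smul, l3, l4, ← hB'] at this
      linarith
    have i3 := hbd β γ hβ hγ k
    rw [← hQ', ← hA'] at i3
    have j1 := mul_nonneg (by linarith : 0 ≤ 1 - σ) i1
    have j2 := mul_nonneg s0 i2
    have hp' : pl (comb Z x) (comb Z y) = (1 - σ) • pl (Z 0) Q' + σ • pl (Z 1) Q' +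
        ((1 - σ) * q₁ - σ * q₀ + e) • pl (Z 0) (Z 1) := by
      rw [hp, hq']
      simp only [pl_add_right, pl_smul_right, pl_self]
      rw [pl_swap (Z 0) (Z 1)]
      module
    by_cases hρ : β + γ = 0
    · have b0 : β = 0 := by linarith
      have g0 : γ = 0 := by linarith
      have hQ0 : Q' = (0 : ℝ) • Q' := by simp only [hQ', b0, g0]; simp
      have z0 : pl (Z 0) Q' = 0 := by rw [hQ0, pl_smul_right, zero_smul]
      have z1 : pl (Z 1) Q' = 0 := by rw [hQ0, pl_smul_right, zero_smul]
      rw [z0, z1, smul_zero, smul_zero, zero_add, zero_add] at hp'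
      have hQx : Q 0 = 0 := by simp [hQ]
      have hfz : ∀ k : FanIndex n, fanCoeff Z 0 k.1 (0 : Fin 4 → ℝ) = 0 := by
        intro k
        have := fanCoeff_smul (Z := Z) 0 k.1 0 (0 : Fin 4 → ℝ)
        rwa [zero_smul, zero_mul] at this
      have hP0 : (0 : Fin 3 → ℝ) ∈ P := by
        refine ⟨by simp, by simp, by simp, by simp, fun k => ?_⟩
        rw [hQx, hfz]; simp
      have hz : ∀ a : Fin n, pl (Z a) 0 = 0 := by intro a; ext i j; simp [pl]
      refine ⟨0, hP0, _, _, hl, rfl, (1 - σ) * q₁ - σ * q₀ + e, fun h => ?_, ?_⟩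
      · rw [h, zero_smul] at hp'
        exact pl_ne_zero hl hp'
      · rw [hpl, (hc0 0 hP0 rfl).2.2, hQx, hz, hz, hp']; simp
    · have hρ0 : 0 < β + γ := lt_of_le_of_ne (add_nonneg hβ hγ) (Ne.symm hρ)
      obtain ⟨t, ht⟩ : ∃ t, t = C * (β + γ) - σ * (A' - B') + (1 - σ) * q₁ - σ * q₀ + e := ⟨_, rfl⟩
      have ht0 : 0 < t := by linarith
      have x0 : (![(β + γ) / t, γ / t, σ * ((β + γ) / t)] : Fin 3 → ℝ) 0 = (β + γ) / t := rfl
      have x1 : (![(β + γ) / t, γ / t, σ * ((β + γ) / t)] : Fin 3 → ℝ) 1 = γ / t := rfl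
      have x2 : (![(β + γ) / t, γ / t, σ * ((β + γ) / t)] : Fin 3 → ℝ) 2 = σ * ((β + γ) / t) := rfl
      set X : Fin 3 → ℝ := ![(β + γ) / t, γ / t, σ * ((β + γ) / t)]
      have hr0 : 0 < (β + γ) / t := div_pos hρ0 ht0
      have hsX : s X = σ := by simp only [hs]; rw [x0, x2, mul_div_assoc, div_self hr0.ne', mul_one]
      have hQX : Q X = t⁻¹ • Q' := by
        simp only [hQ, hQ', smul_add, smul_smul]
        rw [x0, x1]
        congr 2
        · rw [← sub_div, add_sub_cancel_right, div_eq_inv_mul]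
        · rw [div_eq_inv_mul]
      have hti : 0 ≤ t⁻¹ := (inv_pos.2 ht0).le
      have hcX : t * c X = (1 - σ) * q₁ - σ * q₀ + e := by
        simp only [hc]
        rw [hsX, hQX, fanMin_smul _ hti, fanMin_smul _ hti, x0]
        have e1 : t * (1 - C * ((β + γ) / t) + σ * (t⁻¹ * A' - t⁻¹ * B')) =
          t - C * (β + γ) + σ * (A' - B') := by field_simp
        rw [e1, ht]; ring
      refine ⟨X, ⟨?_, ?_, ?_, ?_, fun m => ?_⟩, _, _, hl, rfl, t, ht0.ne', ?_⟩
      · rw [x1]; exact div_nonneg hγ ht0.le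
      · rw [x0, x1, ← sub_div, add_sub_cancel_right]; exact div_nonneg hβ ht0.le
      · rw [x2]; exact mul_nonneg s0 hr0.le
      · rw [x0, x2]
        have := mul_nonneg (by linarith : 0 ≤ 1 - σ) hr0.le
        linarith
      · rw [hQX, fanCoeff_smul, x0]
        have e1 : 1 - C * ((β + γ) / t) + t⁻¹ * fanCoeff Z 0 m.1 Q' =
          t⁻¹ * (t - C * (β + γ) + fanCoeff Z 0 m.1 Q') := by field_simp
        rw [e1]
        have := (hm m).1
        exact mul_nonneg hti (by linarith)
      · rw [hp', hpl, hsX, hQX, ← hcX]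
        simp only [pl_smul_right, smul_add, smul_smul]
        congr 3
        · field_simp
        · field_simp
  · intro x hx k h
    rw [hcon]
    have D0 : ∀ {t : ℝ}, t * D = 0 ↔ t = 0 := mul_eq_zero_iff_right hd
    have hsx := hsr x hx
    rcases k with k | k
    · rw [Sum.elim_inl, Sum.elim_inl]
      fin_cases k
      · change x 1 = 0 ↔ _ ∈ realPoints (type2II Z (0 + 1))
        obtain ⟨d, hdd⟩ := hZ.triple h01.ne (h01.trans h12).ne h12.ne
        rw [realPoints_type2II, add_sub_cancel_right, e1, e2,
          mem_schubertP_lineOf h (linearIndependent_triple_of_br hdd)]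
        have t1 : br (u x) (Z 0) (Z 1) (Z 2) = 0 := by
          simp only [hu, br_add₁, br_smul₁]; simp
        have t2 : br (v x) (Z 0) (Z 1) (Z 2) = -(x 1 * D) := by
          simp only [hv, hQ, hD, br, Pi.add_apply, Pi.sub_apply, Pi.smul_apply, smul_eq_mul]; ring
        rw [t1, t2, neg_eq_zero, D0]
        simp
      · change x 0 - x 1 = 0 ↔ _ ∈ realPoints (type2II Z 0)
        rw [realPoints_type2II, ← hLdef, e1,
          mem_schubertP_lineOf h (hZ.triple_independent n0L.symm n1L.symm h01.ne)]
        have t1 : br (u x) (Z L) (Z 0) (Z 1) = 0 := by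
          simp only [hu, br_add₁, br_smul₁]; simp
        have t2 : br (v x) (Z L) (Z 0) (Z 1) = (x 0 - x 1) * D := by
          simp only [hv, hQ, hD, br, Pi.add_apply, Pi.sub_apply, Pi.smul_apply, smul_eq_mul]; ring
        rw [t1, t2, D0]
        simp
      · change x 2 = 0 ↔ _ ∈ realPoints (type2I Z 0)
        rw [realPoints_type2I]
        constructor
        · intro hz
          have : s x = 0 := by simp only [hs]; rw [hz, zero_div]
          have hux : u x = Z 0 := by simp only [hu, this]; simp
          rw [mem_schubertV_lineOf]
          intro d
          rw [hux, br_self₁₃]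
        · intro hz
          rw [mem_schubertV_lineOf] at hz
          have t1 := hz (Z L)
          have t2 := hz (Z 2)
          rw [← brL_pl, F2, D0] at t1
          rw [← brL_pl, F4, neg_eq_zero, D0] at t2
          rw [← hsx]; linarith
      · change x 0 - x 2 = 0 ↔ _ ∈ realPoints (type2I Z (0 + 1))
        rw [realPoints_type2I, e1, mem_schubertV_lineOf]
        constructor
        · intro hz d
          have z0 : (1 - s x) • Q x = 0 := by
            by_cases hx0 : x 0 = 0
            · have : Q x = 0 := by simp only [hQ]; rw [(hc0 x hx hx0).1, hx0]; simp
              rw [this, smul_zero]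
            · have : s x = 1 := by
                have : s x * x 0 = 1 * x 0 := by rw [hsx]; linarith
                exact mul_right_cancel₀ hx0 this
              rw [this, sub_self, zero_smul]
          rw [← brL_pl, hpl, ← pl_smul_right, z0]
          simp only [map_add, map_smul, brL_pl, br_self₁₃, br_self₂₃, smul_eq_mul, mul_zero,
            add_zero]
          simp [br]
        · intro hz
          have t1 := hz (Z L)
          have t2 := hz (Z 2)
          rw [← brL_pl, F1, neg_eq_zero, D0] at t1
          rw [← brL_pl, F3, D0] at t2
          linarith
    · rw [Sum.elim_inr, Sum.elim_inr]
      have hT : lineOf (u x) (v x) h ∈ realPoints (type2III Z 0 k.1) ↔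
          br (u x) (v x) (Z k.1) (Z (k.1 + 1)) = 0 := by
        rw [← mem_schubertL_lineOf h (hZ.pair_independent (succ_ne k.1)), ← realPoints_type3I]
        refine and_iff_right ?_
        change _ ∈ realPoints (type3I Z 0)
        rw [realPoints_type3I, e1]
        refine (mem_schubertL_lineOf h (hZ.pair_independent h01.ne)).2 ?_
        rw [← brL_pl, hpl]
        simp only [map_add, map_smul, brL_pl, br_self₁₃, br_self₁₄, smul_eq_mul, mul_zero, add_zero]
      rw [hT, ← brL_pl, F6, mul_eq_zero_iff_right (hZ.fan_det_ne k), hsplit]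
      obtain ⟨k', b, d, hb, hd', hqk, hA', hB', hm⟩ := hfanx x hx
      obtain ⟨m1, m2, m3⟩ := hm k
      have hmin : 0 ≤ 1 - C * x 0 + fanMin Z 0 (Q x) := by rw [hA']; exact hx.2.2.2.2 k'
      have p0 := hs0 x hx
      have p1 := hs1 x hx
      have t1 : 0 ≤ (1 - s x) * (fanCoeff Z 0 k.1 (Q x) - fanMin Z 0 (Q x)) :=
        mul_nonneg (by linarith) (by linarith)
      have t2 : 0 ≤ s x * (fanCoeff Z 1 k.1 (Q x) - fanMin Z 1 (Q x)) := mul_nonneg p0 (by linarith)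
      constructor
      · intro hz
        have : fanCoeff Z 0 k.1 (Q x) = fanMin Z 0 (Q x) := by linarith
        rw [this, m3.1 this, sub_self, sub_self, mul_zero, mul_zero]
        linarith
      · intro hz
        have z1 : (1 - s x) * (fanCoeff Z 0 k.1 (Q x) - fanMin Z 0 (Q x)) = 0 := by linarith
        have z2 : s x * (fanCoeff Z 1 k.1 (Q x) - fanMin Z 1 (Q x)) = 0 := by linarith
        have z3 : fanCoeff Z 0 k.1 (Q x) = fanMin Z 0 (Q x) := by
          rcases mul_eq_zero.1 z1 with h' | h'
          · rw [show s x = 1 by linarith, one_mul] at z2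
            exact m3.2 (by linarith)
          · linarith
        linarith
  · intro U hO hU
    rw [realPoints_type3I, e1] at hU
    exact mem_amplituhedron_of_divisorForms hO hU
  · intro x hx
    have hxP : x ∈ P := (hPcon x).1 fun k => (hx k).le
    have hx' := fun k => hcon x k ▸ hx k
    have y1 : 0 < x 1 := hx' (Sum.inl 0)
    have y2 : 0 < x 0 - x 1 := hx' (Sum.inl 1)
    have y3 : 0 < x 2 := hx' (Sum.inl 2)
    have y4 : 0 < x 0 - x 2 := hx' (Sum.inl 3)
    have y5 : ∀ k : FanIndex n, 0 < 1 - C * x 0 + fanCoeff Z 0 k.1 (Q x) := fun k => hx' (Sum.inr k)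
    have s0 : 0 < s x := div_pos y3 (by linarith)
    have s1 : s x < 1 := (div_lt_one (by linarith)).2 (by linarith)
    intro i
    by_cases i0 : i = 0
    · subst i0
      rw [divisorForms_zero_pl, ← brL_pl, F4]
      have := mul_pos (mul_pos s0 y1) hpos
      linarith
    rw [divisorForms_of_ne i0, consForm_pl, ← brL_pl]
    by_cases i1 : i = 1
    · subst i1
      rw [e2, F3, sgn_of_lt (by omega)]
      have := mul_pos (mul_pos (by linarith : 0 < 1 - s x) y1) hpos
      linarith
    by_cases iL : i = L
    · subst iL
      have hsw : ∀ q, brL (Z L) (Z 0) q = -brL (Z 0) (Z L) q := by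
        intro q; simp only [brL, LinearMap.coe_mk, AddHom.coe_mk]; ring
      rw [eL, sgn_last (by omega), hsw, F2]
      have := mul_pos (mul_pos s0 y2) hpos
      linarith
    have a := Fin.val_ne_of_ne i0; have b := Fin.val_ne_of_ne i1
    have d := Fin.val_ne_of_ne iL
    rw [h0] at a; rw [h1] at b; rw [hL] at d
    have := i.2
    let k : FanIndex n := ⟨i, by omega, by omega⟩
    change 0 < ε * sgn k.1 * brL (Z k.1) (Z (k.1 + 1)) _
    rw [F6, sgn_of_lt k.2.2, mul_one, hsplit]
    obtain ⟨k', b, d, hb, hd', hqk, hA', hB', hm⟩ := hfanx x hxP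
    obtain ⟨m1, m2, -⟩ := hm k
    have hmin : 0 < 1 - C * x 0 + fanMin Z 0 (Q x) := by rw [hA']; exact y5 k'
    have t1 : 0 ≤ (1 - s x) * (fanCoeff Z 0 k.1 (Q x) - fanMin Z 0 (Q x)) :=
      mul_nonneg (by linarith) (by linarith)
    have t2 : 0 ≤ s x * (fanCoeff Z 1 k.1 (Q x) - fanMin Z 1 (Q x)) :=
      mul_nonneg s0.le (by linarith)
    obtain ⟨n1, n2, n3, n4⟩ := k.ne
    have := mul_pos (by linarith : 0 < (1 - s x) * (fanCoeff Z 0 k.1 (Q x) - fanMin Z 0 (Q x)) +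
      s x * (fanCoeff Z 1 k.1 (Q x) - fanMin Z 1 (Q x)) + (1 - C * x 0 + fanMin Z 0 (Q x)))
      (hZ.fan_pos k h01 n1 n2 n3 n4)
    linarith

end FanMin

section Models
variable {X Y : Set (Gr ℂ 4)}
  {F : Set (Set (Gr ℂ 4))}
include ε

/-- The quadrics among the facets of the threefold `(3,I,i)`. -/
abbrev quadrics3I (Z : Matrix (Fin n) (Fin 4) ℝ) (i : Fin n) : Set (Set (Gr ℂ 4)) :=
  {S | ∃ j, j ≠ i - 1 ∧ j ≠ i ∧ j ≠ i + 1 ∧ S = type2III Z i j}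

/-- The facets of the threefold `(3,I,i)`. -/
abbrev facets3I (Z : Matrix (Fin n) (Fin 4) ℝ) (i : Fin n) : Set (Set (Gr ℂ 4)) :=
  quadrics3I Z i ∪ {type2I Z i, type2I Z (i + 1)} ∪ {type2II Z i, type2II Z (i + 1)}

theorem hasModel_type3I (i : Fin n) : HasModel (amplituhedron Z) (type3I Z i) 3 (facets3I Z i) := by
  refine rot_induction (Q := fun Z i => HasModel (amplituhedron Z) (type3I Z i) 3 (facets3I Z i))
    (fun Z _ => hasModel_type3I_zero) (fun Z i _ h => ?_) Z i
  have e : quadrics3I (rotZ Z) i = quadrics3I Z (i + 1) := by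
    ext S
    constructor
    · rintro ⟨j, h1, h2, h3, rfl⟩
      refine ⟨j + 1, ?_, ?_, ?_, type2III_rotZ i j⟩
      · intro h; apply h1; rw [add_sub_cancel_right] at h; rw [← h, add_sub_cancel_right]
      · exact fun h => h2 (add_right_cancel h)
      · exact fun h => h3 (add_right_cancel h)
    · rintro ⟨j, h1, h2, h3, rfl⟩
      refine ⟨j - 1, ?_, ?_, ?_, by rw [type2III_rotZ, sub_add_cancel]⟩
      · intro h; apply h1; rw [add_sub_cancel_right]; exact sub_left_injective h
      · intro h; apply h2; rw [← h, sub_add_cancel]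
      · intro h; apply h3; rw [← h, sub_add_cancel]
  rw [amplituhedron_rotZ, type3I_rotZ, facets3I, e, type2I_rotZ, type2I_rotZ, type2II_rotZ,
    type2II_rotZ] at h
  exact h

/-- Inclusion of listed strata on the level of the amplituhedron is detected by vertices. -/
theorem inter_subset_iff
    (hS : S ∈ listed Z) (hT : T ∈ listed Z) : amplituhedron Z ∩ realPoints S ⊆ realPoints T ↔
      ∀ a b, a ≠ b → VertIn Z S a b → VertIn Z T a b := by
  constructor
  · intro h a b hab hv
    rw [vertIn_iff hab] at hv ⊢
    exact h ⟨vertex_mem_amplituhedron hab, hv⟩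
  · rintro h U ⟨hA, hU⟩
    obtain ⟨x, y, hr⟩ := mem_amplituhedron_iff.1 hA
    rw [suppDetermined_listed hT U x y hr]
    exact fun a b hm => h a b (minor_ne hm)
      ((suppDetermined_listed hS U x y hr).1 hU a b hm)

/-- A face of `T` is cut out by facets, on the level of vertices. -/
def Separated (Z : Matrix (Fin n) (Fin 4) ℝ) (T : Set (Gr ℂ 4)) (F : Set (Set (Gr ℂ 4)))
    (X : Set (Gr ℂ 4)) : Prop := ∀ a b, a ≠ b → VertIn Z T a b → ¬ VertIn Z X a b →
    ∃ G ∈ F, (∀ c d, c ≠ d → VertIn Z T c d → VertIn Z X c d → VertIn Z G c d) ∧ ¬ VertIn Z G a b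

theorem Separated.inter (hX : Separated Z T F X) (hY : Separated Z T F Y) : Separated Z T F (X ∩ Y) := by
  intro a b hab hT hXY
  by_cases h : VertIn Z X a b
  · obtain ⟨G, hG, h1, h2⟩ := hY a b hab hT fun h' => hXY (vertIn_inter.2 ⟨h, h'⟩)
    exact ⟨G, hG, fun c d hcd h3 h4 => h1 c d hcd h3 (vertIn_inter.1 h4).2, h2⟩
  · obtain ⟨G, hG, h1, h2⟩ := hX a b hab hT h
    exact ⟨G, hG, fun c d hcd h3 h4 => h1 c d hcd h3 (vertIn_inter.1 h4).1, h2⟩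

theorem Separated.congr (hX : Separated Z T F X)
    (h : ∀ a b, a ≠ b → VertIn Z T a b → (VertIn Z X a b ↔ VertIn Z Y a b)) :
    Separated Z T F Y := by
  intro a b hab hT hY
  obtain ⟨G, hG, h1, h2⟩ := hX a b hab hT (by rwa [h a b hab hT])
  exact ⟨G, hG, fun c d hcd h3 h4 => h1 c d hcd h3 ((h c d hcd h3).2 h4), h2⟩

theorem separated_of_mem {G : Set (Gr ℂ 4)} (hG : G ∈ F)
    (h : ∀ a b, a ≠ b → VertIn Z T a b → (VertIn Z G a b ↔ VertIn Z X a b)) : Separated Z T F X :=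
  Separated.congr (X := G) (fun _ _ _ _ h' => ⟨G, hG, fun _ _ _ _ h => h, h'⟩) h

theorem separated_of_le (h : ∀ a b, a ≠ b → VertIn Z T a b → VertIn Z X a b) : Separated Z T F X :=
  fun a b hab hT hX => (hX (h a b hab hT)).elim

theorem separated_of_disjoint (hF : ∀ a b, a ≠ b → VertIn Z T a b → ∃ G ∈ F, ¬ VertIn Z G a b)
    (h : ∀ a b, a ≠ b → VertIn Z T a b → ¬ VertIn Z X a b) : Separated Z T F X := by
  intro a b hab hT _
  obtain ⟨G, hG, h1⟩ := hF a b hab hT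
  exact ⟨G, hG, fun c d hcd h2 h3 => (h c d hcd h2 h3).elim, h1⟩

theorem separated_of_generators
    (hV : ∀ k, Separated Z T F (type2I Z k)) (hP : ∀ k, Separated Z T F (type2II Z k))
    (h1 : ∀ k l, k ≠ l → k ≠ l + 1 →
      (∀ a b, a ≠ b → VertIn Z (type1II Z k l) a b → VertIn Z T a b) →
        Separated Z T F (type1II Z k l))
    (h2 : ∀ k l, l ≠ k - 1 → l ≠ k → l ≠ k + 1 →
      (∀ a b, a ≠ b → VertIn Z (type2III Z k l) a b → VertIn Z T a b) →
        Separated Z T F (type2III Z k l))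
    (h3 : ∀ k, (∀ a b, a ≠ b → VertIn Z (type3I Z k) a b → VertIn Z T a b) →
        Separated Z T F (type3I Z k)) (hS : S ∈ listed Z)
    (hST : ∀ a b, a ≠ b → VertIn Z S a b → VertIn Z T a b) : Separated Z T F S := by
  rcases hS with ((⟨i, j, hij, rfl⟩ | (⟨i, rfl⟩ | ⟨i, j, h4, h5, rfl⟩)) |
    (⟨i, rfl⟩ | ⟨i, rfl⟩ | ⟨i, j, h4, h5, h6, rfl⟩)) | ⟨i, rfl⟩
  · exact (hV i).inter (hV j)
  · rw [type1I_eq]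
    exact (hV i).inter (hP i)
  · exact h1 i j h4 h5 hST
  · exact hV i
  · exact hP i
  · exact h2 i j h4 h5 h6 hST
  · exact h3 i hST

theorem exists_vertIn (hS : S ∈ listed Z) : ∃ a b, a ≠ b ∧ VertIn Z S a b := by
  rcases hS with ((⟨i, j, hij, rfl⟩ | (⟨i, rfl⟩ | ⟨i, j, h4, h5, rfl⟩)) |
    (⟨i, rfl⟩ | ⟨i, rfl⟩ | ⟨i, j, h4, h5, h6, rfl⟩)) | ⟨i, rfl⟩
  · exact ⟨i, j, hij, by simp [vertIn_type0I hij]⟩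
  · exact ⟨i, i + 1, (succ_ne i), by simp [vertIn_type1I (succ_ne i)]⟩
  · exact ⟨i, j, h4, by simp [vertIn_type1II h4]⟩
  · exact ⟨i, i + 1, (succ_ne i), by simp [vertIn_type2I (succ_ne i)]⟩
  · exact ⟨i, i + 1, (succ_ne i), by simp [vertIn_type2II (succ_ne i)]⟩
  · exact ⟨i, j, h5.symm, by simp [vertIn_type2III h5.symm]⟩
  · exact ⟨i, i + 1, (succ_ne i), by simp [vertIn_type3I (succ_ne i)]⟩

/-- A listed stratum with a polytopal parametrization, all of whose faces are cut out by listed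
facets. -/
structure PolytopeModel (Z : Matrix (Fin n) (Fin 4) ℝ) (T : Set (Gr ℂ 4)) (d : ℕ)
    (F : Set (Set (Gr ℂ 4))) : Prop where
  mem : T ∈ listed Z
  subset : F ⊆ listed Z
  model : HasModel (amplituhedron Z) T d F
  sep : ∀ S ∈ listed Z, (∀ a b, a ≠ b → VertIn Z S a b → VertIn Z T a b) → Separated Z T F S

theorem polytopeModel_type0I (hij : i ≠ j) : PolytopeModel Z (type0I Z i j) 0 ∅ := by
  refine ⟨.inl (.inl (.inl ⟨i, j, hij, rfl⟩)), empty_subset _, hasModel_type0I hij,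
    fun S hS hv => ?_⟩
  obtain ⟨a, b, hab, h⟩ := exists_vertIn hS
  refine separated_of_le fun c d hcd h' => ?_
  have h1 := (vertIn_type0I hab).1 (hv a b hab h)
  have h2 := (vertIn_type0I hcd).1 h'
  have : (c = a ∧ d = b) ∨ (c = b ∧ d = a) := by grind
  rcases this with ⟨rfl, rfl⟩ | ⟨rfl, rfl⟩
  · exact h
  · rwa [VertIn, type0I_comm]

theorem polytopeModel_type3I (i : Fin n) : PolytopeModel Z (type3I Z i) 3 (facets3I Z i) := by
  obtain ⟨c1, c2, c3, c4, c5, c6, c7⟩ := cyclic_facts (n := n)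
  have hM := hasModel_type3I (Z := Z) i
  set F := facets3I Z i with hFdef
  have hF : F ⊆ listed Z := by
    rintro _ ((⟨j, h1, h2, h3, rfl⟩ | (rfl | rfl)) | (rfl | rfl))
    · exact .inl (.inr (.inr (.inr ⟨_, _, h1, h2, h3, rfl⟩)))
    · exact .inl (.inr (.inl ⟨_, rfl⟩))
    · exact .inl (.inr (.inl ⟨_, rfl⟩))
    · exact .inl (.inr (.inr (.inl ⟨_, rfl⟩)))
    · exact .inl (.inr (.inr (.inl ⟨_, rfl⟩)))
  have v1 : Separated Z (type3I Z i) F (type2I Z i) :=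
    separated_of_mem (.inl (.inr (.inl rfl))) fun _ _ _ _ => Iff.rfl
  have v2 : Separated Z (type3I Z i) F (type2I Z (i + 1)) :=
    separated_of_mem (.inl (.inr (.inr rfl))) fun _ _ _ _ => Iff.rfl
  have p1 : Separated Z (type3I Z i) F (type2II Z i) :=
    separated_of_mem (.inr (.inl rfl)) fun _ _ _ _ => Iff.rfl
  have p2 : Separated Z (type3I Z i) F (type2II Z (i + 1)) :=
    separated_of_mem (.inr (.inr rfl)) fun _ _ _ _ => Iff.rfl
  have q : ∀ j, j ≠ i - 1 → j ≠ i + 1 → Separated Z (type3I Z i) F (type3I Z j) := by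
    intro j h1 h2
    by_cases h3 : j = i
    · subst h3
      exact separated_of_le fun _ _ _ h => h
    · refine separated_of_mem (.inl (.inl ⟨j, h1, h3, h2, rfl⟩)) fun a b hab h => ?_
      rw [type2III]
      exact vertIn_inter.trans (and_iff_right h)
  have s0 : ∀ a b, a ≠ b → VertIn Z (type3I Z i) a b → ∃ G ∈ F, ¬ VertIn Z G a b := by
    intro a b hab h
    by_cases h1 : a = i ∨ b = i
    · by_cases h2 : a = i + 1 ∨ b = i + 1
      · refine ⟨_, .inl (.inl ⟨i + 1 + 1, c6 i, ?_, (c3 _).symm, rfl⟩), ?_⟩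
        · exact fun h => c5 i (by rw [← c2 (i + 1), h])
        · rw [vertIn_type2III hab]
          grind only
      · refine ⟨_, .inl (.inr (.inr rfl)), ?_⟩
        rwa [vertIn_type2I hab]
    · refine ⟨_, .inl (.inr (.inl rfl)), ?_⟩
      rwa [vertIn_type2I hab]
  have hV : ∀ k, Separated Z (type3I Z i) F (type2I Z k) := by
    intro k
    by_cases k1 : k = i
    · rwa [k1]
    by_cases k2 : k = i + 1
    · rwa [k2]
    by_cases k3 : k = i + 1 + 1
    · refine ((q k (by rw [k3]; exact c6 i) k2).inter p2).congr fun a b hab h => ?_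
      rw [vertIn_type3I hab] at h
      rw [vertIn_inter, vertIn_type3I hab, vertIn_type2I hab, vertIn_type2II hab]
      grind only
    by_cases k4 : k = i - 1
    · refine ((q (k - 1) (by rw [k4]; exact c4 _) (by rw [k4]; exact c7 i)).inter p1).congr
        fun a b hab h => ?_
      rw [vertIn_type3I hab] at h
      rw [vertIn_inter, vertIn_type3I hab, vertIn_type2I hab, vertIn_type2II hab]
      grind only
    refine ((q k k4 k2).inter (q (k - 1) (fun h => k1 (by rw [← c1 k, h, c1]))
      (fun h => k3 (by rw [← c1 k, h])))).congr fun a b hab h => ?_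
    rw [vertIn_type3I hab] at h
    rw [vertIn_inter, vertIn_type3I hab, vertIn_type3I hab, vertIn_type2I hab]
    grind only
  have hP : ∀ k, Separated Z (type3I Z i) F (type2II Z k) := by
    intro k
    by_cases k1 : k = i
    · rwa [k1]
    by_cases k2 : k = i + 1
    · rwa [k2]
    by_cases k3 : k = i + 1 + 1
    · refine ((q k (by rw [k3]; exact c6 i) k2).inter v2).congr fun a b hab h => ?_
      rw [vertIn_type3I hab] at h
      rw [vertIn_inter, vertIn_type3I hab, vertIn_type2I hab, vertIn_type2II hab]
      grind only
    by_cases k4 : k = i - 1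
    · refine ((q (k - 1) (by rw [k4]; exact c4 _) (by rw [k4]; exact c7 i)).inter v1).congr
        fun a b hab h => ?_
      rw [vertIn_type3I hab] at h
      rw [vertIn_inter, vertIn_type3I hab, vertIn_type2I hab, vertIn_type2II hab]
      grind only
    refine separated_of_disjoint s0 fun a b hab h => ?_
    rw [vertIn_type3I hab] at h
    rw [vertIn_type2II hab]
    grind only
  refine ⟨.inr ⟨i, rfl⟩, hF, hM, fun S hS hv =>
    separated_of_generators hV hP (fun k l k1 k2 hv => ?_) (fun k l k1 k2 k3 hv => ?_)
    (fun k hv => ?_) hS hv⟩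
  · have e1 := hv k l k1 (by simp [vertIn_type1II k1])
    have e2 := hv k (l + 1) k2 (by simp [vertIn_type1II k2])
    rw [vertIn_type3I k1] at e1
    rw [vertIn_type3I k2] at e2
    by_cases l1 : l = i + 1
    · refine ((hV k).inter (hP (i + 1))).congr fun a b hab h => ?_
      rw [vertIn_inter, vertIn_type1II hab, vertIn_type2I hab, vertIn_type2II hab]
      grind only
    by_cases l2 : l = i - 1
    · refine ((hV k).inter (hP i)).congr fun a b hab h => ?_
      rw [vertIn_inter, vertIn_type1II hab, vertIn_type2I hab, vertIn_type2II hab]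
      grind only
    exact (hV k).inter (q l l2 l1)
  · have k4 : k ≠ l + 1 := fun h => k1 (by rw [h, c2])
    have k5 : k + 1 ≠ l + 1 := fun h => k2 (add_right_cancel h).symm
    have e1 := hv k l k2.symm (by simp [vertIn_type2III k2.symm])
    have e2 := hv (k + 1) l k3.symm (by simp [vertIn_type2III k3.symm])
    have e3 := hv k (l + 1) k4 (by simp [vertIn_type2III k4])
    have e4 := hv (k + 1) (l + 1) k5 (by simp [vertIn_type2III k5])
    rw [vertIn_type3I k3.symm] at e2
    rw [vertIn_type3I k4] at e3
    have : k ≠ i - 1 ∧ k ≠ i + 1 ∧ l ≠ i - 1 ∧ l ≠ i + 1 := by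
      grind only
    exact (q k this.1 this.2.1).inter (q l this.2.2.1 this.2.2.2)
  · have e1 := hv k (k - 1) (c4 k).symm (by simp [vertIn_type3I (c4 k).symm])
    have k1 : k + 1 ≠ k + 1 + 1 := c3 _
    have e2 := hv (k + 1) (k + 1 + 1) k1 (by simp [vertIn_type3I k1])
    rw [vertIn_type3I (c4 k).symm] at e1
    rw [vertIn_type3I k1] at e2
    have : k ≠ i - 1 ∧ k ≠ i + 1 := by
      grind only
    exact q k this.1 this.2

end Models

section Openness
include ε

theorem generators_rotZ : generators (rotZ Z) = generators Z := by
  ext g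
  simp only [generators, mem_ofPred_eq, type3I_rotZ, type2I_rotZ, type2II_rotZ]
  have e : ∀ p : Fin n → Prop, (∃ i, p (i + 1)) ↔ ∃ i, p i := fun p =>
    ⟨fun ⟨i, h⟩ => ⟨_, h⟩, fun ⟨i, h⟩ => ⟨i - 1, by rwa [sub_add_cancel]⟩⟩
  rw [e (g = type3I Z ·), e (g = type2I Z ·), e (g = type2II Z ·)]

/-- Near each line that lies on no generator beyond those through all of `S`, the real points of
`S` lie in the amplituhedron. -/
def GenericOpen (Z : Matrix (Fin n) (Fin 4) ℝ) (S : Set (Gr ℂ 4)) : Prop :=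
  ∀ U ∈ amplituhedron Z ∩ realPoints S,
    (∀ g ∈ generators Z, U ∈ realPoints g → amplituhedron Z ∩ realPoints S ⊆ realPoints g) →
      OpenAt (amplituhedron Z) S U

theorem genericOpen_rotZ : GenericOpen (rotZ Z) S ↔ GenericOpen Z S := by
  rw [GenericOpen, GenericOpen, amplituhedron_rotZ, generators_rotZ]

/-- Openness follows from finitely many forms that are nonnegative at the vertices of `S` and vanish
only at the vertices on a generator. -/
theorem genericOpen_of_forms (hS : SuppDetermined Z S) {ι : Type*}
    [Finite ι] (σ : ι → ℝ) (c d : ι → Fin 4 → ℝ) (G : ι → Set (Gr ℂ 4)) (hG : ∀ i, G i ∈ generators Z)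
    (hpos : ∀ i a b, a < b → VertIn Z S a b → 0 ≤ σ i * br (Z a) (Z b) (c i) (d i))
    (hne : ∀ i a b, a < b → VertIn Z S a b → ¬ VertIn Z (G i) a b →
      σ i * br (Z a) (Z b) (c i) (d i) ≠ 0)
    (hex : ∀ i, ∃ a b, a ≠ b ∧ VertIn Z S a b ∧ ¬ VertIn Z (G i) a b)
    (hmem : ∀ U ∈ sameSign fun i => σ i • brL (c i) (d i), U ∈ realPoints S →
      U ∈ amplituhedron Z) : GenericOpen Z S := by
  rintro U ⟨hA, hU⟩ hgen
  refine ⟨_, isOpen_sameSign _, ?_, fun U hU => hmem U hU.1 hU.2⟩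
  obtain ⟨x, y, hr⟩ := mem_amplituhedron_iff.1 hA
  have hv := (hS U x y hr).1 hU
  have key : ∀ i, 0 < σ i * br (comb Z x) (comb Z y) (c i) (d i) := by
    intro i
    have ht : ∀ a b, 0 ≤ σ i * (minor x y a b * br (Z a) (Z b) (c i) (d i)) := by
      intro a b
      by_cases hm : minor x y a b = 0
      · simp [hm]
      · exact term_nonneg hr.1 (P := VertIn Z S) (fun _ _ h => h.symm) (hpos i) a b (hv a b hm)
    refine lt_of_le_of_ne (br_comb_nonneg ht) fun h0 => ?_
    obtain ⟨a, b, hab, h1, h2⟩ := hex i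
    have hσ : σ i ≠ 0 := by
      rcases hab.lt_or_gt with h | h
      · exact left_ne_zero_of_mul (hne i a b h h1 h2)
      · exact left_ne_zero_of_mul (hne i b a h h1.symm fun h => h2 h.symm)
    have hz := terms_eq_zero hσ ht ((mul_eq_zero.1 h0.symm).resolve_left hσ)
    have hUG : U ∈ realPoints (G i) := by
      rw [suppDetermined_generators (hG i) U x y hr]
      intro p q hm
      by_contra hq
      have hb := (mul_eq_zero.1 (hz p q)).resolve_left hm
      rcases (minor_ne hm).lt_or_gt with h | h
      · exact hne i p q h (hv p q hm) hq (by rw [hb, mul_zero])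
      · exact hne i q p h (hv p q hm).symm (fun h => hq h.symm)
          (by rw [br_swap₁₂, hb, neg_zero, mul_zero])
    refine h2 ((vertIn_iff hab).2 (hgen _ (hG i) hUG ⟨vertex_mem_amplituhedron hab, ?_⟩))
    exact (vertIn_iff hab).1 h1
  obtain ⟨-, hl, rfl⟩ := hr
  rw [lineOf_mem_sameSign]
  exact fun i j => by
    simpa only [LinearMap.smul_apply, brL_pl, smul_eq_mul] using mul_pos (key i) (key j)

theorem genericOpen_pencil {b c : Fin n} (hb : b ≠ 0) (hc : c ≠ 0)
    (hbc : b ≠ c)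
    (hT : S = schubertV (toComplex (Z 0)) ∩ schubertL (toComplex (Z b)) (toComplex (Z c)))
    (hS : SuppDetermined Z S) (hv : ∀ p q, p ≠ q → (VertIn Z S p q ↔
      (p = 0 ∧ (q = b ∨ q = c)) ∨ (q = 0 ∧ (p = b ∨ p = c)))) : GenericOpen Z S := by
  obtain ⟨d, hd⟩ := hZ.triple hb.symm hc.symm hbc
  have hd2 := mul_self_pos.2 hd
  set D := br (Z 0) (Z b) (Z c) (Z d) with hD
  have hD' : br (Z 0) (Z c) (Z b) (Z d) = -D := br_swap₂₃ _ _ _ _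
  have hlt : ∀ p q : Fin n, p < q → VertIn Z S p q → p = 0 ∧ (q = b ∨ q = c) := by
    intro p q hpq h
    rcases (hv p q hpq.ne).1 h with h | h
    · exact h
    · rw [h.1] at hpq; exact absurd hpq (Fin.not_lt_zero _)
  refine genericOpen_of_forms hS ![D, -D] ![Z c, Z b] ![Z d, Z d]
    ![type2I Z c, type2I Z b] ?_ ?_ ?_ ?_ ?_
  · intro i; fin_cases i <;> exact .inr (.inl ⟨_, rfl⟩)
  · intro i p q hpq h
    obtain ⟨rfl, rfl | rfl⟩ := hlt p q hpq h <;> fin_cases i <;> simp [← hD, hD', hd2.le]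
  · intro i p q hpq h
    obtain ⟨rfl, rfl | rfl⟩ := hlt p q hpq h <;> fin_cases i <;>
      simp [← hD, hD', hd, vertIn_type2I hpq.ne]
  · intro i
    fin_cases i
    · exact ⟨0, b, hb.symm, (hv _ _ hb.symm).2 (by simp), by
        simp [vertIn_type2I hb.symm, hbc, hc.symm]⟩
    · exact ⟨0, c, hc.symm, (hv _ _ hc.symm).2 (by simp), by
        simp [vertIn_type2I hc.symm, hbc.symm, hb.symm]⟩
  · intro U hO hU
    rw [hT] at hU
    have hU1 := complexify_mem_schubertV.1 hU.1
    have hU2 := (complexify_mem_schubertL (hZ.pair_independent hbc)).1 hU.2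
    obtain ⟨q, hq, hq0, hqU⟩ := mem_schubertL_iff_exists.1 hU2
    obtain ⟨β, γ, rfl⟩ := Submodule.mem_span_pair.1 hq
    have f1 : ∀ β γ : ℝ, br (Z 0) (β • Z b + γ • Z c) (Z c) (Z d) = β * D := by
      intro β γ; simp only [hD, br, Pi.add_apply, Pi.smul_apply, smul_eq_mul]; ring
    have f2 : ∀ β γ : ℝ, br (Z 0) (β • Z b + γ • Z c) (Z b) (Z d) = -(γ * D) := by
      intro β γ; simp only [hD, br, Pi.add_apply, Pi.smul_apply, smul_eq_mul]; ring
    have hl : LinearIndependent ℝ ![Z 0, β • Z b + γ • Z c] := by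
      by_cases h : β = 0
      · refine linearIndependent_pair_of_br (c := Z b) (d := Z d) ?_
        rw [f2]
        refine neg_ne_zero.2 (mul_ne_zero ?_ hd)
        rintro rfl
        simp [h] at hq0
      · exact linearIndependent_pair_of_br (c := Z c) (d := Z d) (by rw [f1]; exact mul_ne_zero h hd)
    obtain rfl := lineOf_eq_of_mem hl hU1 hqU
    have o := lineOf_mem_sameSign.1 hO 0 1
    simp only [Matrix.cons_val, LinearMap.smul_apply, smul_eq_mul, brL_pl, f1, f2] at o
    have hβγ : 0 < β * γ := pos_of_mul_pos_left (b := (D * D) * (D * D)) (by linarith)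
      (mul_pos hd2 hd2).le
    have hβ : β ≠ 0 := left_ne_zero_of_mul hβγ.ne'
    have e : comb Z (Pi.single b (β * β) + Pi.single c (β * γ)) = β • (β • Z b + γ • Z c) := by
      simp only [comb_add, comb_single]; module
    have hl' : LinearIndependent ℝ ![Z 0, β • (β • Z b + γ • Z c)] := linearIndependent_of_pl_ne_zero
      (by rw [pl_smul_right]; exact smul_ne_zero hβ (pl_ne_zero hl))
    rw [(lineOf_eq_iff (h' := hl')).2 ⟨β, hβ, pl_smul_right _ _ _⟩]
    have s1 : (0 : Fin n → ℝ) ≤ Pi.single b (β * β) := Pi.single_nonneg.2 (mul_self_nonneg β)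
    have s2 : (0 : Fin n → ℝ) ≤ Pi.single c (β * γ) := Pi.single_nonneg.2 hβγ.le
    exact mem_amplituhedron_of_nonneg (fun k => add_nonneg (s1 k) (s2 k)) e hl'

theorem genericOpen_type2II_one : GenericOpen Z (type2II Z 1) := by
  have h01 := zero_lt_one_fin (n := n)
  have h12 := one_lt_two_fin (n := n)
  have h02 := h01.trans h12
  have e0 : (1 : Fin n) - 1 = 0 := sub_self 1
  have e2 := one_add_one_fin (n := n)
  obtain ⟨d, hd⟩ := hZ.triple h01.ne h02.ne h12.ne
  have hd2 := mul_self_pos.2 hd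
  set D := br (Z 0) (Z 1) (Z 2) (Z d) with hD
  have b1 : br (Z 0) (Z 2) (Z 1) (Z d) = -D := br_swap₂₃ _ _ _ _
  have b2 : br (Z 1) (Z 2) (Z 0) (Z d) = D := by simp only [hD, br]; ring
  have hv : ∀ p q, p < q → VertIn Z (type2II Z 1) p q →
      (p = 0 ∧ (q = 1 ∨ q = 2)) ∨ (p = 1 ∧ q = 2) := by
    intro p q hpq h
    rw [vertIn_type2II hpq.ne, e0, e2] at h
    obtain ⟨rfl | rfl | rfl, rfl | rfl | rfl⟩ := h <;> first | (exfalso; order) | simp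
  refine genericOpen_of_forms (suppDetermined_type2II 1) ![D, -D, D] ![Z 2, Z 1, Z 0]
    (fun _ => Z d) ![type2I Z 2, type2I Z 1, type2I Z 0] ?_ ?_ ?_ ?_ ?_
  · intro i; fin_cases i <;> exact .inr (.inl ⟨_, rfl⟩)
  · intro i p q hpq h
    obtain ⟨rfl, rfl | rfl⟩ | ⟨rfl, rfl⟩ := hv p q hpq h <;> fin_cases i <;>
      simp [← hD, b1, b2, hd2.le]
  · intro i p q hpq h
    obtain ⟨rfl, rfl | rfl⟩ | ⟨rfl, rfl⟩ := hv p q hpq h <;> fin_cases i <;>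
      simp [← hD, b1, b2, hd, vertIn_type2I hpq.ne]
  · intro i
    fin_cases i
    · exact ⟨0, 1, h01.ne, by simp [vertIn_type2II h01.ne],
        by simp [vertIn_type2I h01.ne, h02.ne, h12.ne]⟩
    · exact ⟨0, 2, h02.ne, by simp [vertIn_type2II h02.ne, e2],
        by simp [vertIn_type2I h02.ne, h01.ne, h12.ne']⟩
    · exact ⟨1, 2, h12.ne, by simp [vertIn_type2II h12.ne, e2],
        by simp [vertIn_type2I h12.ne, h01.ne', h02.ne']⟩
  · intro U hO hU
    obtain ⟨p, q, h, rfl, hpos⟩ := exists_pos_of_mem_sameSign' hO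
    rw [realPoints_type2II, e0, e2] at hU
    have hp := hU (left_mem_lineOf p q h)
    have hq := hU (right_mem_lineOf p q h)
    rw [Submodule.mem_span_triple] at hp hq
    obtain ⟨p0, p1, p2, rfl⟩ := hp
    obtain ⟨q0, q1, q2, rfl⟩ := hq
    have g1 := hpos 0
    have g2 := hpos 1
    have g3 := hpos 2
    obtain ⟨x, y, hm, he⟩ := exists_minors (Z := Z) h01 h12 (p0 * q1 - p1 * q0) (p0 * q2 - p2 * q0)
      (p1 * q2 - p2 * q1)
    have he' : pl (comb Z x) (comb Z y) =
        pl (p0 • Z 0 + p1 • Z 1 + p2 • Z 2) (q0 • Z 0 + q1 • Z 1 + q2 • Z 2) := by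
      rw [he]
      ext a b
      simp only [pl, Pi.add_apply, Pi.smul_apply, smul_eq_mul]; ring
    rw [← he'] at g1 g2 g3
    simp only [Matrix.cons_val, LinearMap.smul_apply, smul_eq_mul, he, map_add, map_smul, brL_pl,
      br_self₁₃, br_self₂₃, b1, b2, ← hD] at g1 g2 g3
    refine mem_amplituhedron_iff.2 ⟨x, y, isRep_of_pl (fun a b hab => ?_) h he'⟩
    rw [hm a b hab]
    split_ifs
    · exact (pos_of_mul_pos_left (b := D * D) (by linarith) hd2.le).le
    · exact (pos_of_mul_pos_left (b := D * D) (by linarith) hd2.le).le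
    · exact (pos_of_mul_pos_left (b := D * D) (by linarith) hd2.le).le
    · exact le_rfl

theorem genericOpen_type2III_zero {j : Fin n} (hj0 : j ≠ 0 - 1)
    (hj1 : j ≠ 0) (hj2 : j ≠ 0 + 1) : GenericOpen Z (type2III Z 0 j) := by
  have h01 := zero_lt_one_fin (n := n)
  have h1v := val_one (n := n)
  have e1 : (0 : Fin n) + 1 = 1 := zero_add 1
  have hjs := val_succ j
  rw [if_neg fun h => hj0 (Fin.ext (by rw [val_last]; omega))] at hjs
  have h1j : 1 < j := by
    rw [Fin.lt_def, h1v]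
    omega
  have hjj : j < j + 1 := by omega
  have h0j := h01.trans h1j
  have h1j' := h1j.trans hjj
  have h0j' := h0j.trans hjj
  have hT := suppDetermined_listed
    (.inl (.inr (.inr (.inr ⟨0, j, hj0, hj1, hj2, rfl⟩))) : type2III Z 0 j ∈ listed Z)
  have hTr : realPoints (type2III Z 0 j) = schubertL (Z 0) (Z 1) ∩ schubertL (Z j) (Z (j + 1)) := by
    have := realPoints_type3I 0 (Z := Z)
    rw [e1] at this
    rw [← this, ← realPoints_type3I]; rfl
  have hv : ∀ p q, p < q → VertIn Z (type2III Z 0 j) p q →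
      (p = 0 ∧ (q = j ∨ q = j + 1)) ∨ (p = 1 ∧ (q = j ∨ q = j + 1)) := by
    intro p q hpq h
    rw [vertIn_type2III hpq.ne, e1] at h
    generalize j + 1 = j' at *
    obtain ⟨rfl | rfl | rfl | rfl, rfl | rfl | rfl | rfl⟩ := h <;>
      first | (exfalso; order) | simp
  have hw : ∀ p q, p ≠ q → (p = 0 ∧ (q = j ∨ q = j + 1)) ∨ (p = 1 ∧ (q = j ∨ q = j + 1)) →
      VertIn Z (type2III Z 0 j) p q := by
    intro p q hpq h
    rw [vertIn_type2III hpq, e1]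
    tauto
  generalize j + 1 = j' at *
  set D := br (Z 0) (Z 1) (Z j) (Z j') with hD
  have hd : D ≠ 0 := hZ.br_ne_zero h01.ne h0j.ne h0j'.ne h1j.ne h1j'.ne hjj.ne
  have hd2 := mul_self_pos.2 hd
  have f : ∀ a b c d : ℝ,
      br (a • Z 0 + b • Z 1) (c • Z j + d • Z j') (Z 0 - Z 1) (Z j') = (a + b) * c * D ∧
      br (a • Z 0 + b • Z 1) (c • Z j + d • Z j') (Z 0 - Z 1) (Z j) = -((a + b) * d * D) ∧
      br (a • Z 0 + b • Z 1) (c • Z j + d • Z j') (Z 1) (Z j' - Z j) = -(a * (c + d) * D) ∧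
      br (a • Z 0 + b • Z 1) (c • Z j + d • Z j') (Z 0) (Z j' - Z j) = b * (c + d) * D := by
    intro a b c d
    refine ⟨?_, ?_, ?_, ?_⟩ <;>
    · simp only [hD, br, Pi.add_apply, Pi.sub_apply, Pi.smul_apply, smul_eq_mul]; ring
  have v00 := f 1 0 1 0
  have v01 := f 1 0 0 1
  have v10 := f 0 1 1 0
  have v11 := f 0 1 0 1
  simp only [one_smul, zero_smul, zero_add, add_zero, one_mul, zero_mul, mul_zero, neg_zero]
    at v00 v01 v10 v11
  refine genericOpen_of_forms hT ![D, -D, -D, D] ![Z 0 - Z 1, Z 0 - Z 1, Z 1, Z 0]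
    ![Z j', Z j, Z j' - Z j, Z j' - Z j] ![type2I Z j', type2I Z j, type2I Z 1, type2I Z 0]
    ?_ ?_ ?_ ?_ ?_
  · intro i; fin_cases i <;> exact .inr (.inl ⟨_, rfl⟩)
  · intro i p q hpq h
    obtain ⟨rfl, rfl | rfl⟩ | ⟨rfl, rfl | rfl⟩ := hv p q hpq h <;> fin_cases i <;>
      simp [v00, v01, v10, v11, hd2.le]
  · intro i p q hpq h
    obtain ⟨rfl, rfl | rfl⟩ | ⟨rfl, rfl | rfl⟩ := hv p q hpq h <;> fin_cases i <;>
      simp [v00, v01, v10, v11, hd, vertIn_type2I hpq.ne]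
  · intro i
    fin_cases i
    · exact ⟨0, j, h0j.ne, hw _ _ h0j.ne (by simp), by simp [vertIn_type2I h0j.ne, h0j'.ne, hjj.ne]⟩
    · exact ⟨0, j', h0j'.ne, hw _ _ h0j'.ne (by simp),
        by simp [vertIn_type2I h0j'.ne, h0j.ne, hjj.ne']⟩
    · exact ⟨0, j, h0j.ne, hw _ _ h0j.ne (by simp), by simp [vertIn_type2I h0j.ne, h01.ne, h1j.ne']⟩
    · exact ⟨1, j, h1j.ne, hw _ _ h1j.ne (by simp),
        by simp [vertIn_type2I h1j.ne, h01.ne', h0j.ne']⟩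
  · intro U hO hU
    rw [hTr] at hU
    obtain ⟨p, hp, hp0, hpU⟩ := mem_schubertL_iff_exists.1 hU.1
    obtain ⟨q, hq, hq0, hqU⟩ := mem_schubertL_iff_exists.1 hU.2
    obtain ⟨a, b, rfl⟩ := Submodule.mem_span_pair.1 hp
    obtain ⟨c, d, rfl⟩ := Submodule.mem_span_pair.1 hq
    have hl : LinearIndependent ℝ ![a • Z 0 + b • Z 1, c • Z j + d • Z j'] := by
      refine linearIndependent_of_pl_ne_zero fun h => ?_
      have h4 : ∀ r s t u : ℝ, (a * s - b * r) * (c * u - d * t) * D =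
          brL (r • Z 0 + s • Z 1) (t • Z j + u • Z j') (pl (a • Z 0 + b • Z 1)
            (c • Z j + d • Z j')) * -1 := by
        intro r s t u
        simp only [brL_pl, hD, br, Pi.add_apply, Pi.smul_apply, smul_eq_mul]; ring
      simp only [h, map_zero, zero_mul, mul_eq_zero, hd, or_false] at h4
      have k1 := h4 0 1 0 1
      have k2 := h4 0 1 1 0
      have k3 := h4 1 0 0 1
      have k4 := h4 1 0 1 0
      simp only [mul_one, mul_zero, sub_zero, zero_sub, neg_eq_zero] at k1 k2 k3 k4
      have : (a = 0 ∧ b = 0) ∨ c = 0 ∧ d = 0 := by tauto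
      rcases this with ⟨rfl, rfl⟩ | ⟨rfl, rfl⟩
      · simp at hp0
      · simp at hq0
    obtain rfl := lineOf_eq_of_mem hl hpU hqU
    rw [lineOf_mem_sameSign] at hO
    have o1 := hO 0 1
    have o2 := hO 2 3
    obtain ⟨f1, f2, f3, f4⟩ := f a b c d
    simp only [Matrix.cons_val, LinearMap.smul_apply, smul_eq_mul, brL_pl, f1, f2, f3, f4] at o1 o2
    have h4 := mul_pos hd2 hd2
    have hcd : 0 < c * d := pos_of_mul_pos_left (b := (a + b) * (a + b) * (D * D * (D * D)))
      (by linarith) (mul_nonneg (mul_self_nonneg _) h4.le)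
    have hab : 0 < a * b := pos_of_mul_pos_left (b := (c + d) * (c + d) * (D * D * (D * D)))
      (by linarith) (mul_nonneg (mul_self_nonneg _) h4.le)
    have ha : a ≠ 0 := left_ne_zero_of_mul hab.ne'
    have hc : c ≠ 0 := left_ne_zero_of_mul hcd.ne'
    have he : pl ((a * a) • Z 0 + (a * b) • Z 1) ((c * c) • Z j + (c * d) • Z j') =
        (a * c) • pl (a • Z 0 + b • Z 1) (c • Z j + d • Z j') := by
      simp only [pl_add_left, pl_add_right, pl_smul_left, pl_smul_right]; module
    have hl' : LinearIndependent ℝ ![(a * a) • Z 0 + (a * b) • Z 1,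
        (c * c) • Z j + (c * d) • Z j'] :=
      linearIndependent_of_pl_ne_zero (he ▸ smul_ne_zero (mul_ne_zero ha hc) (pl_ne_zero hl))
    rw [(lineOf_eq_iff (h' := hl')).2 ⟨a * c, mul_ne_zero ha hc, he⟩]
    exact mem_amplituhedron_iff.2 ⟨_, _, isRep_join h01 h1j hjj (mul_self_nonneg a) hab.le
      (mul_self_nonneg c) hcd.le _⟩

theorem genericOpen_type2I_zero : GenericOpen Z (type2I Z 0) := by
  have hn := hn.out
  have v2 := val_two (n := n)
  have hL := val_last (n := n)
  have h01 := zero_lt_one_fin (n := n)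
  have h12 := one_lt_two_fin (n := n)
  have e1 : (0 : Fin n) + 1 = 1 := zero_add 1
  have e2 := one_add_one_fin (n := n)
  have hlt : ∀ p q : Fin n, p < q → VertIn Z (type2I Z 0) p q → p = 0 := by
    intro p q hpq h
    rcases (vertIn_type2I hpq.ne).1 h with h | h
    · exact h
    · rw [h] at hpq; exact absurd hpq (Fin.not_lt_zero _)
  have h2I : ∀ q : Fin n, 0 ≠ q → VertIn Z (type2I Z 0) 0 q :=
    fun q h => (vertIn_type2I h).2 (.inl rfl)
  set L : Fin n := 0 - 1 with hLdef
  have n1L : (1 : Fin n) ≠ L := fun h => by omega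
  have n0L : (0 : Fin n) ≠ L := fun h => by omega
  have n2L : (2 : Fin n) ≠ L := fun h => by omega
  have n02 := (h01.trans h12).ne
  have p1 : ∀ q, 0 < q → q ≠ 1 → q ≠ L → 0 < -ε * br (Z 0) (Z q) (Z 1) (Z L) := by
    intro q q0 q1 qL
    have a := Fin.val_ne_of_ne q1; have b := Fin.val_ne_of_ne qL
    have := hZ.1 0 1 q L h01 (by omega) (by omega)
    rw [br_swap₂₃] at this
    linarith
  have p2 : ∀ q, 0 < q → q ≠ 1 → q ≠ 2 → 0 < ε * br (Z 0) (Z q) (Z 1) (Z 2) := by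
    intro q q0 q1 q2
    have a := Fin.val_ne_of_ne q1; have b := Fin.val_ne_of_ne q2
    have := hZ.1 0 1 2 q h01 h12 (by omega)
    rwa [show br (Z 0) (Z 1) (Z 2) (Z q) = br (Z 0) (Z q) (Z 1) (Z 2) by simp only [br]; ring]
      at this
  have p3 : ∀ (k : FanIndex n) q, 0 < q → q ≠ k.1 → q ≠ k.1 + 1 →
      0 < ε * br (Z 0) (Z q) (Z k.1) (Z (k.1 + 1)) := fun k q hq a b =>
    hZ.fan_pos k hq k.ne.1 k.ne.2.1 a b
  refine genericOpen_of_forms (suppDetermined_type2I 0)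
    (Sum.elim ![-ε, ε] fun _ : FanIndex n => ε) (Sum.elim ![Z 1, Z 1] fun k => Z k.1)
    (Sum.elim ![Z L, Z 2] fun k => Z (k.1 + 1))
    (Sum.elim ![type2II Z 0, type3I Z 1] fun k => type3I Z k.1) ?_ ?_ ?_ ?_ ?_
  · rintro (i | k)
    · fin_cases i
      exacts [.inr (.inr ⟨_, rfl⟩), .inl ⟨_, rfl⟩]
    · exact .inl ⟨_, rfl⟩
  · intro i p q hpq h
    obtain rfl := hlt p q hpq h
    rcases i with i | k
    · fin_cases i
      · by_cases q1 : q = 1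
        · simp [q1]
        by_cases qL : q = L
        · simp [qL]
        exact (p1 q hpq q1 qL).le
      · by_cases q1 : q = 1
        · simp [q1]
        by_cases q2 : q = 2
        · simp [q2]
        exact (p2 q hpq q1 q2).le
    · by_cases q1 : q = k.1
      · simp [q1]
      by_cases q2 : q = k.1 + 1
      · simp [q2]
      exact (p3 k q hpq q1 q2).le
  · intro i p q hpq h hG
    obtain rfl := hlt p q hpq h
    rcases i with i | k
    · fin_cases i
      · have hG' : ¬ VertIn Z (type2II Z 0) 0 q := hG
        rw [vertIn_type2II hpq.ne, e1] at hG'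
        exact (p1 q hpq (by tauto) (by tauto)).ne'
      · have hG' : ¬ VertIn Z (type3I Z 1) 0 q := hG
        rw [vertIn_type3I hpq.ne, e2] at hG'
        exact (p2 q hpq (by tauto) (by tauto)).ne'
    · have hG' : ¬ VertIn Z (type3I Z k.1) 0 q := hG
      rw [vertIn_type3I hpq.ne] at hG'
      exact (p3 k q hpq (by tauto) (by tauto)).ne'
  · rintro (i | k)
    · fin_cases i
      · refine ⟨0, 2, n02, h2I _ n02, ?_⟩
        change ¬ VertIn Z (type2II Z 0) 0 2
        rw [vertIn_type2II n02, e1]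
        exact fun h => by rcases h.2 with h | h | h; exacts [n2L h, n02 h.symm, h12.ne h.symm]
      · refine ⟨0, L, n0L, h2I _ n0L, ?_⟩
        change ¬ VertIn Z (type3I Z 1) 0 L
        rw [vertIn_type3I n0L, e2]
        rintro (h | h | h | h)
        exacts [h01.ne h, n02 h, n1L h.symm, n2L h.symm]
    · refine ⟨0, 1, h01.ne, h2I _ h01.ne, ?_⟩
      change ¬ VertIn Z (type3I Z k.1) 0 1
      have := k.ne
      rw [vertIn_type3I h01.ne]
      tauto
  · intro U hO hU
    rw [realPoints_type2I] at hU
    obtain ⟨q, h, rfl, hq⟩ := exists_pos_of_mem_sameSign hO hU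
      (by simpa using (hZ.pair_independent h01.ne).ne_zero 0)
    have q1 := hq (Sum.inl 1)
    have q2 := hq (Sum.inl 0)
    simp only [Sum.elim_inl, Matrix.cons_val, LinearMap.smul_apply, brL_pl, smul_eq_mul] at q1 q2
    refine lineOf_zero_mem_amplituhedron h q1.le (by linarith) fun k => ?_
    have q3 := hq (Sum.inr k)
    simp only [Sum.elim_inr, LinearMap.smul_apply, brL_pl, smul_eq_mul] at q3
    rw [br_eq_fanCoeff] at q3
    obtain ⟨n1, n2, n3, n4⟩ := k.ne
    exact nonneg_of_mul_nonneg_left (b := ε * br (Z 0) (Z 1) (Z k.1) (Z (k.1 + 1)))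
      (by linarith) (hZ.fan_pos k h01 n1 n2 n3 n4)

theorem genericOpen_type2I (i : Fin n) : GenericOpen Z (type2I Z i) := by
  refine rot_induction (Q := fun Z i => GenericOpen Z (type2I Z i))
    (fun Z _ => genericOpen_type2I_zero) (fun Z i _ h => ?_) Z i
  rwa [genericOpen_rotZ, type2I_rotZ] at h

theorem genericOpen_type2II (i : Fin n) : GenericOpen Z (type2II Z i) := by
  have := rot_induction (Q := fun Z i => GenericOpen Z (type2II Z (i + 1)))
    (fun Z _ => by rw [zero_add]; exact genericOpen_type2II_one)
    (fun Z i _ h => by rwa [genericOpen_rotZ, type2II_rotZ] at h) Z (i - 1)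
  rwa [sub_add_cancel] at this

theorem genericOpen_type2III (i j : Fin n) (h1 : j ≠ i - 1)
    (h2 : j ≠ i) (h3 : j ≠ i + 1) : GenericOpen Z (type2III Z i j) := by
  refine rot_induction (Q := fun Z i => ∀ j, j ≠ i - 1 → j ≠ i → j ≠ i + 1 →
    GenericOpen Z (type2III Z i j)) (fun Z _ j => genericOpen_type2III_zero)
    (fun Z i _ h j h1 h2 h3 => ?_) Z i j h1 h2 h3
  have := h (j - 1) (fun h => h1 ?_) (fun h => h2 ?_) (fun h => h3 ?_)
  · rwa [genericOpen_rotZ, type2III_rotZ, sub_add_cancel] at this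
  · rw [add_sub_cancel_right]; exact sub_left_injective h
  · rw [← h, sub_add_cancel]
  · rw [← h, sub_add_cancel]

theorem genericOpen_type1I (i : Fin n) : GenericOpen Z (type1I Z i) := by
  refine rot_induction (Q := fun Z i => GenericOpen Z (type1I Z i)) (fun Z _ => ?_)
    (fun Z i _ h => by rwa [genericOpen_rotZ, type1I_rotZ] at h) Z i
  refine genericOpen_pencil (pred_ne 0) (succ_ne 0).symm (pred_ne_succ 0) rfl
    (suppDetermined_listed (.inl (.inl (.inr (.inl ⟨_, rfl⟩))))) fun a d had => ?_
  rw [vertIn_type1I had]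
  grind

theorem genericOpen_type1II (i j : Fin n) (h1 : i ≠ j)
    (h2 : i ≠ j + 1) : GenericOpen Z (type1II Z i j) := by
  refine rot_induction (Q := fun Z i => ∀ j, i ≠ j → i ≠ j + 1 → GenericOpen Z (type1II Z i j))
    (fun Z _ j h1 h2 => ?_) (fun Z i _ h j h1 h2 => ?_) Z i j h1 h2
  · refine genericOpen_pencil h1.symm h2.symm (succ_ne j) rfl (suppDetermined_listed
      (.inl (.inl (.inr (.inr ⟨_, _, h1, h2, rfl⟩))))) fun a d had => ?_
    rw [vertIn_type1II had]
    grind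
  · have := h (j - 1) (fun h => h1 (by rw [h, sub_add_cancel]))
      (fun h => h2 (by rw [h, sub_add_cancel]))
    rwa [genericOpen_rotZ, type1II_rotZ, sub_add_cancel] at this

end Openness

section Restriction
variable {G₀ R : Set (Gr ℂ 4)}
  {d : ℕ} {F : Set (Set (Gr ℂ 4))}
include ε

theorem generators_subset_listed : generators Z ⊆ listed Z := by
  rintro _ (⟨i, rfl⟩ | ⟨i, rfl⟩ | ⟨i, rfl⟩)
  · exact .inr ⟨_, rfl⟩
  · exact .inl (.inr (.inl ⟨_, rfl⟩))
  · exact .inl (.inr (.inr (.inl ⟨_, rfl⟩)))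

/-- A facet of a parametrized stratum is parametrized by the corresponding facet of the polytope. -/
theorem PolytopeModel.restrict (h : PolytopeModel Z T (d + 1) F)
    (hG₀ : G₀ ∈ F) (hR : R ∈ listed Z)
    (hv : ∀ a b, a ≠ b → (VertIn Z R a b ↔ VertIn Z T a b ∧ VertIn Z G₀ a b))
    (hu : ∀ G ∈ F, (∀ a b, a ≠ b → VertIn Z R a b → VertIn Z G a b) → G = G₀)
    (hgen : GenericOpen Z R) : PolytopeModel Z R d (F \ {G₀}) := by
  have hsep : ∀ S ∈ listed Z, (∀ a b, a ≠ b → VertIn Z S a b → VertIn Z R a b) →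
      Separated Z R (F \ {G₀}) S := by
    intro S hS hSR a b hab hRab hSab
    have hab' := (hv a b hab).1 hRab
    obtain ⟨G, hG, h1, h2⟩ := h.sep S hS (fun a b hab hs => ((hv a b hab).1 (hSR a b hab hs)).1)
      a b hab hab'.1 hSab
    refine ⟨G, ⟨hG, ?_⟩, fun c e hce hc => h1 c e hce ((hv c e hce).1 hc).1, h2⟩
    rintro rfl
    exact h2 hab'.2
  refine ⟨hR, sdiff_subset.trans h.subset, ?_, hsep⟩
  obtain ⟨K, _, c, f, S, W, hS, rfl, hbd, ⟨x₀, hx₀⟩, hW, hinj, him, hfac, -⟩ := h.model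
  obtain ⟨k, rfl⟩ := hG₀
  have hdet := fun {X} (hX : X ∈ listed Z) => suppDetermined_listed hX
  have hRT : ∀ U ∈ amplituhedron Z, U ∈ realPoints R ↔ U ∈ realPoints T ∧ U ∈ realPoints (S k) := by
    intro U hU
    obtain ⟨x, y, hr⟩ := mem_amplituhedron_iff.1 hU
    rw [hdet hR U x y hr, hdet h.mem U x y hr, hdet (h.subset ⟨k, rfl⟩) U x y hr]
    constructor
    · intro H
      exact ⟨fun a b hm => ((hv a b (minor_ne hm)).1 (H a b hm)).1,
        fun a b hm => ((hv a b (minor_ne hm)).1 (H a b hm)).2⟩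
    · exact fun H a b hm => (hv a b (minor_ne hm)).2 ⟨H.1 a b hm, H.2 a b hm⟩
  have hWA : ∀ x ∈ hpoly c f, W x ∈ amplituhedron Z ∩ realPoints T :=
    fun x hx => him ▸ mem_image_of_mem W hx
  set Q : Set (EuclideanSpace ℝ (Fin (d + 1))) := {x | x ∈ hpoly c f ∧ c k + f k x = 0} with hQ
  have hWQ : W '' Q = amplituhedron Z ∩ realPoints R := by
    apply subset_antisymm
    · rintro _ ⟨x, ⟨hx, hxk⟩, rfl⟩
      exact ⟨(hWA x hx).1, (hRT _ (hWA x hx).1).2 ⟨(hWA x hx).2, (hfac x hx k).1 hxk⟩⟩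
    · rintro U ⟨hA, hU⟩
      have := (hRT U hA).1 hU
      obtain ⟨x, hx, rfl⟩ : U ∈ W '' hpoly c f := him ▸ ⟨hA, this.1⟩
      exact ⟨x, ⟨hx, (hfac x hx k).2 this.2⟩, rfl⟩
  have hQP : Q ⊆ hpoly c f := fun x hx => hx.1
  have hQc : Convex ℝ Q := by
    have := (isExposed_active (c := c) (f := f) {k}).convex convex_hpoly
    simpa using this
  have hQne : Q.Nonempty := by
    obtain ⟨a, b, hab, hRv⟩ := exists_vertIn hR
    have : lineOf (Z a) (Z b) (hZ.pair_independent hab) ∈ W '' Q := by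
      rw [hWQ]
      exact ⟨vertex_mem_amplituhedron hab, (vertIn_iff hab).1 hRv⟩
    exact Nonempty.of_image ⟨_, this⟩
  obtain ⟨y, hy, hyk⟩ := exists_generic_point hQP hQc hQne
  have hypos : ∀ j, j ≠ k → 0 < c j + f j y := by
    intro j hj
    refine lt_of_le_of_ne (hy.1 j) fun h0 => hj (hS (hu _ ⟨j, rfl⟩ ?_))
    refine (inter_subset_iff hR (h.subset ⟨j, rfl⟩)).1 ?_
    rw [← hWQ]
    rintro _ ⟨x, hx, rfl⟩
    exact (hfac x hx.1 j).1 (hyk j h0.symm x hx)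
  have hfk : (f k : EuclideanSpace ℝ (Fin (d + 1)) →ₗ[ℝ] ℝ) ≠ 0 := by
    intro h0
    have e : ∀ x, f k x = 0 := fun x => LinearMap.congr_fun h0 x
    have h1 := hx₀ k
    have h2 := hy.2
    rw [e] at h1 h2
    exact h1.ne' h2
  have hfin : finrank ℝ (LinearMap.ker (f k : EuclideanSpace ℝ (Fin (d + 1)) →ₗ[ℝ] ℝ)) = d := by
    have := Module.Dual.finrank_ker_add_one_of_ne_zero hfk
    rw [finrank_euclideanSpace_fin] at this
    omega
  let N := LinearMap.ker (f k : EuclideanSpace ℝ (Fin (d + 1)) →ₗ[ℝ] ℝ)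
  let e : EuclideanSpace ℝ (Fin d) ≃ₗᵢ[ℝ] N := 
    ((stdOrthonormalBasis ℝ N).reindex (finCongr hfin)).repr.symm
  let E : EuclideanSpace ℝ (Fin d) →L[ℝ] EuclideanSpace ℝ (Fin (d + 1)) :=
    N.subtypeL.comp (e.toContinuousLinearEquiv : EuclideanSpace ℝ (Fin d) →L[ℝ] N)
  have hE0 : ∀ x, f k (E x) = 0 := fun x => (e x).2
  have hEn : ∀ x, ‖E x‖ = ‖x‖ := fun x => e.norm_map x
  have hEs : ∀ z, f k z = 0 → ∃ x, E x = z := fun z hz =>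
    ⟨e.symm ⟨z, hz⟩, congrArg Subtype.val (e.apply_symm_apply ⟨z, hz⟩)⟩
  let c' : {j // j ≠ k} → ℝ := fun j => c j + f j y
  let f' : {j // j ≠ k} → EuclideanSpace ℝ (Fin d) →L[ℝ] ℝ := fun j => (f j).comp E
  have hcf : ∀ x (j : {j // j ≠ k}), c' j + f' j x = c j + f j (y + E x) := by
    intro x j
    rw [map_add, ← add_assoc]; rfl
  have hkx : ∀ x, c k + f k (y + E x) = 0 := by
    intro x; rw [map_add, hE0, add_zero]; exact hy.2
  have hpoly' : ∀ x, x ∈ hpoly c' f' ↔ y + E x ∈ Q := by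
    intro x
    constructor
    · refine fun hx => ⟨fun j => ?_, hkx x⟩
      by_cases hj : j = k
      · rw [hj, hkx]
      · rw [← hcf x ⟨j, hj⟩]; exact hx ⟨j, hj⟩
    · intro hx j
      rw [hcf]; exact hx.1 j
  have himage : (fun x => y + E x) '' hpoly c' f' = Q := by
    apply subset_antisymm
    · rintro _ ⟨x, hx, rfl⟩
      exact (hpoly' x).1 hx
    · intro z hz
      obtain ⟨x, hx⟩ := hEs (z - y) (by rw [map_sub]; linarith [hz.2, hy.2])
      have hx' : y + E x = z := by rw [hx, add_sub_cancel]
      exact ⟨x, (hpoly' x).2 (by rw [hx']; exact hz), hx'⟩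
  refine ⟨{j // j ≠ k}, inferInstance, c', f', fun j => S j, fun x => W (y + E x),
    hS.comp Subtype.val_injective, ?_, ?_, ⟨0, fun j => ?_⟩, ?_, ?_, ?_, fun x hx j => ?_,
    fun x hx => ?_⟩
  · ext G
    constructor
    · rintro ⟨j, rfl⟩
      exact ⟨⟨j, rfl⟩, fun h => j.2 (hS h)⟩
    · rintro ⟨⟨j, rfl⟩, hj⟩
      exact ⟨⟨j, fun h => hj (by rw [h]; rfl)⟩, rfl⟩
  · obtain ⟨C, hC⟩ := isBounded_iff_forall_norm_le.1 hbd
    refine isBounded_iff_forall_norm_le.2 ⟨C + ‖y‖, fun x hx => ?_⟩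
    have h1 := hC _ (hQP ((hpoly' x).1 hx))
    have h2 := norm_sub_le (y + E x) y
    rw [add_sub_cancel_left, hEn] at h2
    linarith
  · rw [hcf, map_zero, add_zero]; exact hypos j j.2
  · exact hW.comp (by fun_prop) fun x hx => hQP ((hpoly' x).1 hx)
  · intro x hx x' hx' he
    have := hinj (hQP ((hpoly' x).1 hx)) (hQP ((hpoly' x').1 hx')) he
    have h0 : E (x - x') = 0 := by rw [map_sub, sub_eq_zero]; exact add_left_cancel this
    rw [← sub_eq_zero, ← norm_eq_zero, ← hEn, h0, norm_zero]
  · rw [← hWQ, ← himage, image_image]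
  · rw [hcf]; exact hfac _ (hQP ((hpoly' x).1 hx)) j
  · have hxQ := (hpoly' x).1 (strict_subset_hpoly hx)
    have hU : W (y + E x) ∈ amplituhedron Z ∩ realPoints R := hWQ ▸ mem_image_of_mem W hxQ
    refine hgen _ hU fun g hg hUg => ?_
    obtain ⟨X, hX, hUX, hXs⟩ := exists_listed_subset_inter hU.1 hR (generators_subset_listed hg)
      hU.2 hUg
    rw [inter_subset_iff hR (generators_subset_listed hg)]
    intro a b hab hRab
    by_contra hgab
    obtain ⟨_, ⟨⟨j, rfl⟩, hj⟩, h1, h2⟩ := hsep X hX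
      (fun a b _ hab => VertIn.mono (hXs.trans inter_subset_left) hab) a b hab hRab
      fun hab => hgab (VertIn.mono (hXs.trans inter_subset_right) hab)
    have hjk : j ≠ k := fun h => hj (by rw [h]; rfl)
    have := hx ⟨j, hjk⟩
    rw [hcf] at this
    refine this.ne' ((hfac _ (hQP hxQ) j).2 ?_)
    obtain ⟨p, q, hr⟩ := mem_amplituhedron_iff.1 hU.1
    rw [hdet (h.subset ⟨j, rfl⟩) _ p q hr]
    intro c e hm
    exact h1 c e (minor_ne hm) ((hdet hR _ p q hr).1 hU.2 c e hm) ((hdet hX _ p q hr).1 hUX c e hm)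

end Restriction

section Models
variable {d : ℕ}
  {F : Set (Set (Gr ℂ 4))}
include ε

theorem polytopeModel_type2I (i : Fin n) :
    PolytopeModel Z (type2I Z i) 2 (facets3I Z i \ {type2I Z i}) := by
  obtain ⟨c1, c2, c3, c4, c5, c6, c7⟩ := cyclic_facts (n := n)
  refine (polytopeModel_type3I i).restrict (.inl (.inr (.inl rfl)))
    (.inl (.inr (.inl ⟨i, rfl⟩))) (fun a b hab => ?_) (fun G hG hR => ?_)
    (genericOpen_type2I i)
  · rw [vertIn_type2I hab, vertIn_type3I hab]
    tauto
  · have r1 := hR i (i + 1) (c3 i) (by simp [vertIn_type2I (c3 i)])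
    have r2 := hR (i - 1) i (c4 i) (by simp [vertIn_type2I (c4 i)])
    have n3 : i ≠ i + 1 + 1 := fun h => c5 (i + 1) (by rw [c2, ← h])
    have r3 := hR i (i + 1 + 1) n3 (by simp [vertIn_type2I n3])
    rcases hG with (⟨j, h1, h2, h3, rfl⟩ | (rfl | rfl)) | (rfl | rfl)
    · rw [vertIn_type2III (c3 i)] at r1
      grind only
    · rfl
    · rw [vertIn_type2I (c4 i)] at r2
      grind only
    · rw [vertIn_type2II n3] at r3
      grind only
    · rw [vertIn_type2II (c4 i)] at r2
      grind only

theorem polytopeModel_type2II (i : Fin n) :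
    PolytopeModel Z (type2II Z i) 2 (facets3I Z i \ {type2II Z i}) := by
  obtain ⟨c1, c2, c3, c4, c5, c6, -⟩ := cyclic_facts (n := n)
  refine (polytopeModel_type3I i).restrict (.inr (.inl rfl))
    (.inl (.inr (.inr (.inl ⟨i, rfl⟩)))) (fun a b hab => ?_) (fun G hG hR => ?_)
    (genericOpen_type2II i)
  · rw [vertIn_type2II hab, vertIn_type3I hab]
    grind only
  · have r1 := hR i (i + 1) (c3 i) (by simp [vertIn_type2II (c3 i)])
    have r2 := hR (i - 1) i (c4 i) (by simp [vertIn_type2II (c4 i)])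
    have r3 := hR (i - 1) (i + 1) (c5 i) (by simp [vertIn_type2II (c5 i)])
    rcases hG with (⟨j, h1, h2, h3, rfl⟩ | (rfl | rfl)) | (rfl | rfl)
    · rw [vertIn_type2III (c3 i)] at r1
      grind only
    · rw [vertIn_type2I (c5 i)] at r3
      grind only
    · rw [vertIn_type2I (c4 i)] at r2
      grind only
    · rfl
    · rw [vertIn_type2II (c4 i)] at r2
      grind only

set_option maxHeartbeats 1000000 in
theorem polytopeModel_type2III (h1 : j ≠ i - 1)
    (h2 : j ≠ i) (h3 : j ≠ i + 1) :
    PolytopeModel Z (type2III Z i j) 2 (facets3I Z i \ {type2III Z i j}) := by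
  obtain ⟨c1, c2, c3, c4, c5, c6, -⟩ := cyclic_facts (n := n)
  have n2 : i ≠ j + 1 := fun h => h1 (by rw [h, c2])
  have n4 : i + 1 ≠ j + 1 := fun h => h2 (add_right_cancel h).symm
  refine (polytopeModel_type3I i).restrict (.inl (.inl ⟨j, h1, h2, h3, rfl⟩))
    (.inl (.inr (.inr (.inr ⟨i, j, h1, h2, h3, rfl⟩)))) (fun a b hab => ?_)
    (fun G hG hR => ?_) (genericOpen_type2III i j h1 h2 h3)
  · rw [vertIn_type2III hab, vertIn_type3I hab]
    tauto
  · have r1 := hR i j h2.symm (by simp [vertIn_type2III h2.symm])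
    have r2 := hR i (j + 1) n2 (by simp [vertIn_type2III n2])
    have r3 := hR (i + 1) j h3.symm (by simp [vertIn_type2III h3.symm])
    have r4 := hR (i + 1) (j + 1) n4 (by simp [vertIn_type2III n4])
    rcases hG with (⟨k, k1, k2, k3, rfl⟩ | (rfl | rfl)) | (rfl | rfl)
    · rw [vertIn_type2III h2.symm] at r1
      rw [vertIn_type2III n2] at r2
      have : k = j := by
        grind only
      rw [this]
    · rw [vertIn_type2I h3.symm] at r3
      grind only
    · rw [vertIn_type2I h2.symm] at r1
      grind only
    · rw [vertIn_type2II h2.symm] at r1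
      grind only
    · rw [vertIn_type2II h2.symm] at r1
      rw [vertIn_type2II n2] at r2
      grind only

theorem polytopeModel_type1I (i : Fin n) : ∃ F, PolytopeModel Z (type1I Z i) 1 F := by
  obtain ⟨c1, c2, c3, c4, c5, c6, -⟩ := cyclic_facts (n := n)
  refine ⟨_, (polytopeModel_type2I i).restrict (G₀ := type2II Z i)
    ⟨.inr (.inl rfl), ?_⟩ (.inl (.inl (.inr (.inl ⟨i, rfl⟩)))) (fun a b hab => ?_)
    (fun G hG hR => ?_) (genericOpen_type1I i)⟩
  · refine VertIn.ne (Z := Z) (a := i - 1) (b := i + 1)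
      (by simp [vertIn_type2II (c5 i)]) ?_
    rw [vertIn_type2I (c5 i)]
    exact fun h => h.elim (c4 i) (c3 i).symm
  · rw [vertIn_type1I hab, vertIn_type2I hab, vertIn_type2II hab]
  · have r1 := hR i (i + 1) (c3 i) (by simp [vertIn_type1I (c3 i)])
    have r2 := hR (i - 1) i (c4 i) (by simp [vertIn_type1I (c4 i)])
    obtain ⟨(⟨j, h1, h2, h3, rfl⟩ | (rfl | rfl)) | (rfl | rfl), hG⟩ := hG
    · rw [vertIn_type2III (c3 i)] at r1
      grind only
    · exact absurd rfl hG
    · rw [vertIn_type2I (c4 i)] at r2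
      grind only
    · rfl
    · rw [vertIn_type2II (c4 i)] at r2
      grind only

theorem polytopeModel_type1II (h1 : i ≠ j)
    (h2 : i ≠ j + 1) : ∃ F, PolytopeModel Z (type1II Z i j) 1 F := by
  obtain ⟨c1, c2, c3, c4, c5, c6, -⟩ := cyclic_facts (n := n)
  have hl : type1II Z i j ∈ listed Z := .inl (.inl (.inr (.inr ⟨i, j, h1, h2, rfl⟩)))
  have h0 : j ≠ i - 1 := fun h => h2 (by rw [h, c1])
  obtain ⟨G₀, hG₀, hne, hv⟩ : ∃ G₀ ∈ facets3I Z i, G₀ ≠ type2I Z i ∧ ∀ a b, a ≠ b →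
      (VertIn Z (type1II Z i j) a b ↔ VertIn Z (type2I Z i) a b ∧ VertIn Z G₀ a b) := by
    by_cases h : j = i + 1
    · refine ⟨type2II Z (i + 1), .inr (.inr rfl), ?_, fun a b hab => ?_⟩
      · refine VertIn.ne (Z := Z) (a := i + 1) (b := i + 1 + 1)
          (by simp [vertIn_type2II (c3 (i + 1))]) ?_
        rw [vertIn_type2I (c3 _)]
        exact fun h' => h'.elim (c3 i).symm fun h' => h2 (by rw [h, h'])
      · rw [vertIn_type1II hab, vertIn_type2I hab, vertIn_type2II hab]
        grind only
    · refine ⟨type2III Z i j, .inl (.inl ⟨j, h0, h1.symm, h, rfl⟩), ?_, fun a b hab => ?_⟩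
      · refine VertIn.ne (Z := Z) (a := i + 1) (b := j)
          (by simp [vertIn_type2III (Ne.symm h)]) ?_
        rw [vertIn_type2I (Ne.symm h)]
        exact fun h' => h'.elim (c3 i).symm h1.symm
      · rw [vertIn_type1II hab, vertIn_type2I hab, vertIn_type2III hab]
        tauto
  refine ⟨_, (polytopeModel_type2I i).restrict (G₀ := G₀) ⟨hG₀, hne⟩ hl hv
    (fun G hG hR => ?_) (genericOpen_type1II i j h1 h2)⟩
  have q : ∀ X, (∀ a b, a ≠ b → VertIn Z (type1II Z i j) a b → VertIn Z X a b) →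
      VertIn Z X i j ∧ VertIn Z X i (j + 1) := fun X h =>
    ⟨h i j h1 (by simp [vertIn_type1II h1]), h i (j + 1) h2 (by simp [vertIn_type1II h2])⟩
  have key : ∀ X ∈ facets3I Z i, X ≠ type2I Z i → VertIn Z X i j ∧ VertIn Z X i (j + 1) →
      X = if j = i + 1 then type2II Z (i + 1) else type2III Z i j := by
    rintro X ((⟨k, k1, k2, k3, rfl⟩ | (rfl | rfl)) | (rfl | rfl)) hX ⟨r1, r2⟩
    · rw [vertIn_type2III h1] at r1
      rw [vertIn_type2III h2] at r2
      have : k = j := by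
        grind only
      rw [if_neg (this ▸ k3), this]
    · exact absurd rfl hX
    · rw [vertIn_type2I h1] at r1
      rw [vertIn_type2I h2] at r2
      grind only
    · rw [vertIn_type2II h1] at r1
      rw [vertIn_type2II h2] at r2
      grind only
    · rw [vertIn_type2II h1] at r1
      rw [vertIn_type2II h2] at r2
      have : j = i + 1 := by
        grind only
      rw [if_pos this]
  rw [key G hG.1 hG.2 (q G hR), key G₀ hG₀ hne (q G₀ fun a b hab h => ((hv a b hab).1 h).2)]

theorem exists_polytopeModel (hS : S ∈ listed Z) : ∃ d F, PolytopeModel Z S d F := by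
  rcases hS with ((⟨i, j, hij, rfl⟩ | (⟨i, rfl⟩ | ⟨i, j, h1, h2, rfl⟩)) |
    (⟨i, rfl⟩ | ⟨i, rfl⟩ | ⟨i, j, h1, h2, h3, rfl⟩)) | ⟨i, rfl⟩
  · exact ⟨_, _, polytopeModel_type0I hij⟩
  · exact ⟨_, polytopeModel_type1I i⟩
  · exact ⟨_, polytopeModel_type1II h1 h2⟩
  · exact ⟨_, _, polytopeModel_type2I i⟩
  · exact ⟨_, _, polytopeModel_type2II i⟩
  · exact ⟨_, _, polytopeModel_type2III h1 h2 h3⟩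
  · exact ⟨_, _, polytopeModel_type3I i⟩

theorem closedFace_listed
    (hS : S ∈ listed Z) : closedFace Z S = amplituhedron Z ∩ realPoints S := by
  obtain ⟨d, F, h⟩ := exists_polytopeModel hS
  exact h.model.closedFace_eq

theorem isBoundaryStratum_iff (S : Set (Gr ℂ 4)) : IsBoundaryStratum Z S ↔ S ∈ listed Z := by
  constructor
  · rintro ⟨hS, hne⟩
    have : (interior ((Subtype.val : realPoints S → Gr ℝ 4) ⁻¹' amplituhedron Z)).Nonempty := by
      by_contra h
      rw [not_nonempty_iff_eq_empty] at h
      rw [face, h, closure_empty, interior_empty, image_empty] at hne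
      exact hne.ne_empty rfl
    obtain ⟨U, hU⟩ := this
    have h1 : U ∈ (Subtype.val : realPoints S → Gr ℝ 4) ⁻¹' amplituhedron Z := interior_subset hU
    exact hS.mem_listed (U := U.1) h1 U.2
  · intro hS
    obtain ⟨d, F, h⟩ := exists_polytopeModel hS
    exact ⟨isStratum_listed hS, h.model.face_nonempty⟩

theorem closedFace_subset_iff
    (hS : S ∈ listed Z) (hT : T ∈ listed Z) :
    closedFace Z S ⊆ closedFace Z T ↔ ∀ a b, a ≠ b → VertIn Z S a b → VertIn Z T a b := by
  rw [← inter_subset_iff hS hT, closedFace_listed hS, closedFace_listed hT]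
  exact ⟨fun h => h.trans inter_subset_right, fun h => subset_inter inter_subset_left h⟩

theorem PolytopeModel.isPolytopeFace
    (h : PolytopeModel Z T d F) : IsPolytopeFace Z d T := by
  refine h.model.isPolytopeFace (𝓛 := listed Z) (isBoundaryStratum_iff)
    (fun S hS => closedFace_listed hS) (fun S hS => ?_) h.mem h.subset
    (fun U hU S hS S' hS' h1 h2 => exists_listed_subset_inter hU hS hS' h1 h2)
    (fun S hS hST U hU hUS => ?_)
  · obtain ⟨d, F, h⟩ := exists_polytopeModel hS
    have := h.model.face_nonempty
    rw [← closedFace_listed hS]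
    exact this.mono (image_mono interior_subset)
  · obtain ⟨x, y, hr⟩ := mem_amplituhedron_iff.1 hU.1
    have hUT := (suppDetermined_listed h.mem U x y hr).1 hU.2
    rw [suppDetermined_listed hS U x y hr] at hUS
    push Not at hUS
    obtain ⟨a, b, hm, hv⟩ := hUS
    have hvs := (inter_subset_iff hS h.mem).1 hST
    obtain ⟨G, hG, h1, h2⟩ := h.sep S hS hvs a b (minor_ne hm) (hUT a b hm) hv
    refine ⟨G, hG, (inter_subset_iff hS (h.subset hG)).2
      fun c d hcd hc => h1 c d hcd (hvs c d hcd hc) hc, fun hUG => h2 ?_⟩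
    exact (suppDetermined_listed (h.subset hG) U x y hr).1 hUG a b hm

end Models

section Chart

theorem extremePoints_convexHull_of_forall {E : Type*} [AddCommGroup E] [Module ℝ E] {V : Set E}
    (h : ∀ v ∈ V, ∃ φ : E →ₗ[ℝ] ℝ, φ v = 0 ∧ ∀ w ∈ V, w ≠ v → 0 < φ w) :
    (convexHull ℝ V).extremePoints ℝ = V := by
  refine subset_antisymm extremePoints_convexHull_subset fun v hv => ?_
  obtain ⟨φ, h0, h1⟩ := h v hv
  have key : convexHull ℝ V ⊆ {x | 0 < φ x ∨ x = v} := by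
    refine convexHull_min (fun w hw => ?_) fun x hx y hy a b ha hb hab => ?_
    · by_cases hwv : w = v
      · exact .inr hwv
      · exact .inl (h1 w hw hwv)
    · rcases ha.eq_or_lt with rfl | ha
      · rw [zero_add] at hab
        simpa [hab] using hy
      rcases hb.eq_or_lt with rfl | hb
      · rw [add_zero] at hab
        simpa [hab] using hx
      rcases hx with hx | rfl
      · refine .inl ?_
        rw [map_add, map_smul, map_smul]
        have : 0 ≤ φ y := by
          rcases hy with hy | rfl
          exacts [hy.le, h0.ge]
        have := mul_pos ha hx
        have := mul_nonneg hb.le ‹0 ≤ φ y›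
        simp only [smul_eq_mul]
        linarith
      · rcases hy with hy | rfl
        · refine .inl ?_
          rw [map_add, map_smul, map_smul, h0, smul_zero, zero_add]
          exact mul_pos hb hy
        · exact .inr (by rw [← add_smul, hab, one_smul])
  rw [mem_extremePoints]
  refine ⟨subset_convexHull ℝ V hv, fun x hx y hy ⟨a, b, ha, hb, hab, e⟩ => ?_⟩
  have e' := congrArg φ e
  rw [map_add, map_smul, map_smul, h0, smul_eq_mul, smul_eq_mul] at e'
  rcases key hx with hx' | rfl <;> rcases key hy with hy' | rfl
  · have := mul_pos ha hx'; have := mul_pos hb hy'; linarith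
  · have := mul_pos ha hx'; rw [h0] at e'; linarith
  · have := mul_pos hb hy'; rw [h0] at e'; linarith
  · exact ⟨rfl, rfl⟩

theorem mem_chartPoints {ℓ : (Fin 4 → Fin 4 → ℝ) →ₗ[ℝ] ℝ} {T : Set (Gr ℝ 4)}
    {q : Fin 4 → Fin 4 → ℝ} : q ∈ chartPoints ℓ T ↔ ∃ W ∈ T, q ∈ chartPoints ℓ {W} := by
  constructor
  · rintro ⟨h, M, hM, rfl⟩
    exact ⟨_, hM, h, M, rfl, rfl⟩
  · rintro ⟨W, hW, h, M, rfl, rfl⟩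
    exact ⟨h, M, hW, rfl⟩

theorem mem_chartPoints_lineOf {ℓ : (Fin 4 → Fin 4 → ℝ) →ₗ[ℝ] ℝ} {u v : Fin 4 → ℝ} (h)
    {q : Fin 4 → Fin 4 → ℝ} : q ∈ chartPoints ℓ {lineOf u v h} ↔
      ℓ (pl u v) ≠ 0 ∧ q = (ℓ (pl u v))⁻¹ • pl u v := by
  constructor
  · rintro ⟨h1, M, hM, rfl⟩
    rw [mem_singleton_iff, rowSpan_eq_lineOf, eq_comm] at hM
    obtain ⟨k, hk, e⟩ := lineOf_eq_iff.1 hM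
    rw [plucker_eq_pl, e] at h1 ⊢
    rw [map_smul, smul_eq_mul] at h1
    have h0 : ℓ (pl u v) ≠ 0 := right_ne_zero_of_mul_eq_one h1
    exact ⟨h0, by rw [eq_inv_of_mul_eq_one_left h1]⟩
  · rintro ⟨h0, rfl⟩
    have e : pl ((ℓ (pl u v))⁻¹ • u) v = (ℓ (pl u v))⁻¹ • pl u v := pl_smul_left _ _ _
    have hl : LinearIndependent ℝ ![(ℓ (pl u v))⁻¹ • u, v] := linearIndependent_of_pl_ne_zero (by
        rw [e]; exact smul_ne_zero (inv_ne_zero h0) (pl_ne_zero h))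
    refine ⟨by rw [map_smul, smul_eq_mul, inv_mul_cancel₀ h0], frameOf _ _ hl, ?_, ?_⟩
    · rw [mem_singleton_iff, rowSpan_frameOf, eq_comm]
      exact lineOf_eq_iff.2 ⟨_, inv_ne_zero h0, e⟩
    · rw [← e]; rfl

include ε

theorem verticesOf_listed (hT : T ∈ listed Z) :
    verticesOf Z T = {S | ∃ a b, a ≠ b ∧ VertIn Z T a b ∧ S = type0I Z a b} := by
  have key : ∀ a b, a ≠ b → (closedFace Z (type0I Z a b) ⊆ closedFace Z T ↔ VertIn Z T a b) := by
    intro a b hab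
    rw [closedFace_subset_iff (.inl (.inl (.inl ⟨a, b, hab, rfl⟩))) hT]
    refine ⟨fun h => h a b hab subset_rfl, fun h c d hcd h' => h'.trans h⟩
  ext S
  constructor
  · rintro ⟨⟨a, b, hab, rfl⟩, h⟩
    exact ⟨a, b, hab, (key a b hab).1 h, rfl⟩
  · rintro ⟨a, b, hab, h, rfl⟩
    exact ⟨⟨a, b, hab, rfl⟩, (key a b hab).2 h⟩

theorem closedFace_type0I (hab : a ≠ b) :
    closedFace Z (type0I Z a b) = {lineOf (Z a) (Z b) (hZ.pair_independent hab)} := by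
  rw [closedFace_listed (.inl (.inl (.inl ⟨a, b, hab, rfl⟩))), realPoints_type0I hab]
  exact inter_eq_self_of_subset_right (by simpa using vertex_mem_amplituhedron hab)

/-- The sum of Plücker vectors of vertices with the given coefficients. -/
def plSum (Z : Matrix (Fin n) (Fin 4) ℝ) (c : Fin n → Fin n → ℝ) : Fin 4 → Fin 4 → ℝ :=
  ∑ a, ∑ b, c a b • pl (Z a) (Z b)

theorem pl_comb_eq_plSum (x y : Fin n → ℝ) :
    pl (comb Z x) (comb Z y) = plSum Z fun a b => if a < b then minor x y a b else 0 := by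
  have h2 := two_smul_pl_comb (Z := Z) x y
  have h3 : ∑ a, ∑ b, minor x y a b • pl (Z a) (Z b) =
      plSum Z (fun a b => if a < b then minor x y a b else 0) +
        ∑ a, ∑ b, (if b < a then minor x y b a else 0) • pl (Z b) (Z a) := by
    simp only [plSum, ← Finset.sum_add_distrib]
    refine Finset.sum_congr rfl fun a _ => Finset.sum_congr rfl fun b _ => ?_
    rcases lt_trichotomy a b with h | h | h
    · simp [h, h.not_gt]
    · subst h; simp [minor]
    · rw [if_neg h.not_gt, if_pos h, minor_swap, pl_swap]; module
  rw [Finset.sum_comm (f := fun a b => (if b < a then minor x y b a else 0) • pl (Z b) (Z a))] at h3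
  have h4 : (2 : ℝ) • pl (comb Z x) (comb Z y) =
      (2 : ℝ) • plSum Z fun a b => if a < b then minor x y a b else 0 := by
    rw [h2, h3, two_smul]; rfl
  exact smul_right_injective _ (two_ne_zero' ℝ) h4

theorem isConvexFace_of_functionals
    (hT : T ∈ listed Z)
    (hcone : ∀ c : Fin n → Fin n → ℝ, (∀ a b, 0 ≤ c a b) →
      (∀ a b, c a b ≠ 0 → a < b ∧ VertIn Z T a b) →
      ∃ x y : Fin n → ℝ, ∀ a b, a < b → minor x y a b = c a b)
    {ℓ : (Fin 4 → Fin 4 → ℝ) →ₗ[ℝ] ℝ}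
    (hℓ : ∀ a b, a < b → VertIn Z T a b → 0 < ℓ (pl (Z a) (Z b)))
    (hφ : ∀ a b, a < b → VertIn Z T a b → ∃ φ : (Fin 4 → Fin 4 → ℝ) →ₗ[ℝ] ℝ,
      φ (pl (Z a) (Z b)) = 0 ∧
        ∀ c d, c < d → VertIn Z T c d → (c ≠ a ∨ d ≠ b) → 0 < φ (pl (Z c) (Z d))) :
    IsConvexFace Z T := by
  have hsupp := suppDetermined_listed hT
  set V : Set (Fin 4 → Fin 4 → ℝ) :=
    {q | ∃ a b, a < b ∧ VertIn Z T a b ∧ q = (ℓ (pl (Z a) (Z b)))⁻¹ • pl (Z a) (Z b)} with hV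
  have hvert : chartPoints ℓ (⋃ S ∈ verticesOf Z T, closedFace Z S) = V := by
    rw [verticesOf_listed hT]
    ext q
    rw [mem_chartPoints]
    constructor
    · rintro ⟨W, hW, hq⟩
      simp only [mem_iUnion] at hW
      obtain ⟨_, ⟨a, b, hab, hv, rfl⟩, hW⟩ := hW
      wlog h : a < b generalizing a b
      · exact this b a hab.symm hv.symm (by rwa [type0I_comm]) (hab.lt_or_gt.resolve_left h)
      rw [closedFace_type0I hab, mem_singleton_iff] at hW
      subst hW
      exact ⟨a, b, h, hv, ((mem_chartPoints_lineOf _).1 hq).2⟩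
    · rintro ⟨a, b, hab, hv, rfl⟩
      refine ⟨lineOf _ _ (hZ.pair_independent hab.ne), ?_,
        (mem_chartPoints_lineOf _).2 ⟨(hℓ a b hab hv).ne', rfl⟩⟩
      simp only [mem_iUnion]
      exact ⟨_, ⟨a, b, hab.ne, hv, rfl⟩, by rw [closedFace_type0I hab.ne]; rfl⟩
  have hpos : ∀ x y : Fin n → ℝ, (∀ a b, a < b → 0 ≤ minor x y a b) →
      (∀ a b, minor x y a b ≠ 0 → VertIn Z T a b) → (∃ a b, minor x y a b ≠ 0) →
      0 < ℓ (pl (comb Z x) (comb Z y)) := by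
    rintro x y h0 h1 ⟨a, b, hab⟩
    wlog h : a < b generalizing a b
    · refine this b a ?_ ((minor_ne hab).lt_or_gt.resolve_left h)
      rw [minor_swap]; exact neg_ne_zero.2 hab
    have hterm : ∀ c d, 0 ≤ (if c < d then minor x y c d else 0) * ℓ (pl (Z c) (Z d)) := by
      intro c d
      split_ifs with hcd
      · by_cases hm : minor x y c d = 0
        · rw [hm, zero_mul]
        · exact mul_nonneg (h0 c d hcd) (hℓ c d hcd (h1 c d hm)).le
      · rw [zero_mul]
    rw [pl_comb_eq_plSum, plSum]
    simp only [map_sum, map_smul, smul_eq_mul]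
    refine Finset.sum_pos' (fun c _ => Finset.sum_nonneg fun d _ => hterm c d)
      ⟨a, Finset.mem_univ a, Finset.sum_pos' (fun d _ => hterm a d) ⟨b, Finset.mem_univ b, ?_⟩⟩
    rw [if_pos h]
    exact mul_pos ((h0 a b h).lt_of_ne' hab) (hℓ a b h (h1 a b hab))
  have hface : ∀ W ∈ closedFace Z T, ∃ x y : Fin n → ℝ, ∃ h, W = lineOf (comb Z x) (comb Z y) h ∧
      (∀ a b, a < b → 0 ≤ minor x y a b) ∧ (∀ a b, minor x y a b ≠ 0 → VertIn Z T a b) ∧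
      0 < ℓ (pl (comb Z x) (comb Z y)) := by
    intro W hW
    rw [closedFace_listed hT] at hW
    obtain ⟨x, y, hr⟩ := mem_amplituhedron_iff.1 hW.1
    have h1 := (hsupp W x y hr).1 hW.2
    obtain ⟨h0, h, e⟩ := id hr
    exact ⟨x, y, h, e, h0, h1, hpos x y h0 h1 hr.exists_minor_ne_zero⟩
  have hhull : chartPoints ℓ (closedFace Z T) = convexHull ℝ V := by
    refine subset_antisymm (fun q hq => ?_) ?_
    · obtain ⟨W, hW, hq⟩ := mem_chartPoints.1 hq
      obtain ⟨x, y, h, rfl, h0, h1, h2⟩ := hface W hW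
      obtain ⟨-, rfl⟩ := (mem_chartPoints_lineOf _).1 hq
      set s : Finset (Fin n × Fin n) :=
        Finset.univ.filter fun p => p.1 < p.2 ∧ minor x y p.1 p.2 ≠ 0
      have hs : pl (comb Z x) (comb Z y) = ∑ p ∈ s, minor x y p.1 p.2 • pl (Z p.1) (Z p.2) := by
        rw [pl_comb_eq_plSum, plSum, ← Finset.sum_product', Finset.sum_filter]
        refine Finset.sum_congr rfl fun p _ => ?_
        by_cases h3 : p.1 < p.2 <;> by_cases h4 : minor x y p.1 p.2 = 0 <;> simp [h3, h4]
      have hm : ∀ p ∈ s, p.1 < p.2 ∧ minor x y p.1 p.2 ≠ 0 := fun p hp =>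
        (Finset.mem_filter.1 hp).2
      have hl : ∀ p ∈ s, 0 < ℓ (pl (Z p.1) (Z p.2)) := fun p hp =>
        hℓ _ _ (hm p hp).1 (h1 _ _ (hm p hp).2)
      have e : ∀ r : ℝ, r • pl (comb Z x) (comb Z y) =
          ∑ p ∈ s, (r * minor x y p.1 p.2 * ℓ (pl (Z p.1) (Z p.2))) •
            ((ℓ (pl (Z p.1) (Z p.2)))⁻¹ • pl (Z p.1) (Z p.2)) := by
        intro r
        rw [hs, Finset.smul_sum]
        refine Finset.sum_congr rfl fun p hp => ?_
        rw [smul_smul, smul_smul, mul_assoc, mul_assoc, mul_inv_cancel₀ (hl p hp).ne', mul_one]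
      rw [e]
      refine (convex_convexHull ℝ V).sum_mem (fun p hp => ?_) ?_ fun p hp => ?_
      · exact mul_nonneg (mul_nonneg (inv_nonneg.2 h2.le) (h0 _ _ (hm p hp).1)) (hl p hp).le
      · have := congrArg ℓ hs
        simp only [map_sum, map_smul, smul_eq_mul] at this
        simp only [mul_assoc]
        rw [← Finset.mul_sum, ← this, inv_mul_cancel₀ h2.ne']
      · exact subset_convexHull ℝ V ⟨_, _, (hm p hp).1, h1 _ _ (hm p hp).2, rfl⟩
    · have hC : Convex ℝ {q | ℓ q = 1 ∧ ∃ c : Fin n → Fin n → ℝ, (∀ a b, 0 ≤ c a b) ∧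
          (∀ a b, c a b ≠ 0 → a < b ∧ VertIn Z T a b) ∧ q = plSum Z c} := by
        rintro _ ⟨hq, c, hc, hc', rfl⟩ _ ⟨hr, d, hd, hd', rfl⟩ s t hs ht hst
        refine ⟨by rw [map_add, map_smul, map_smul, hq, hr]; simpa using hst,
          fun a b => s * c a b + t * d a b, fun a b => add_nonneg (mul_nonneg hs (hc a b))
            (mul_nonneg ht (hd a b)), fun a b h => ?_, ?_⟩
        · by_cases h1 : c a b = 0
          · by_cases h2 : d a b = 0
            · simp [h1, h2] at h
            · exact hd' a b h2
          · exact hc' a b h1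
        · simp only [plSum, Finset.smul_sum, ← Finset.sum_add_distrib]
          exact Finset.sum_congr rfl fun a _ => Finset.sum_congr rfl fun b _ => by module
      refine (convexHull_min ?_ hC).trans ?_
      · rintro _ ⟨a, b, hab, hv, rfl⟩
        have h0 := hℓ a b hab hv
        refine ⟨by rw [map_smul, smul_eq_mul, inv_mul_cancel₀ h0.ne'],
          fun c d => if c = a ∧ d = b then (ℓ (pl (Z a) (Z b)))⁻¹ else 0, fun c d => ?_,
          fun c d h => ?_, ?_⟩
        · beta_reduce
          split_ifs
          exacts [inv_nonneg.2 h0.le, le_rfl]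
        · obtain ⟨rfl, rfl⟩ := (ite_ne_right_iff.1 h).1
          exact ⟨hab, hv⟩
        · rw [plSum, Finset.sum_eq_single a, Finset.sum_eq_single b]
          · simp
          · intro d _ hd; simp [hd]
          · simp
          · intro c _ hc; simp [hc]
          · simp
      · rintro _ ⟨hq, c, hc, hc', rfl⟩
        obtain ⟨x, y, hxy⟩ := hcone c hc hc'
        have e : pl (comb Z x) (comb Z y) = plSum Z c := by
          rw [pl_comb_eq_plSum]
          congr 1
          ext a b
          split_ifs with h
          · exact hxy a b h
          · by_contra h'
            exact h (hc' a b (Ne.symm h')).1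
        have hl : LinearIndependent ℝ ![comb Z x, comb Z y] := linearIndependent_of_pl_ne_zero (by
            rw [e]; intro h; rw [h, map_zero] at hq; exact zero_ne_one hq)
        have hr : IsRep Z (lineOf _ _ hl) x y :=
          ⟨fun a b hab => by rw [hxy a b hab]; exact hc a b, hl, rfl⟩
        refine mem_chartPoints.2 ⟨lineOf _ _ hl, ?_, (mem_chartPoints_lineOf _).2 ?_⟩
        · rw [closedFace_listed hT]
          refine ⟨mem_amplituhedron_iff.2 ⟨x, y, hr⟩, (hsupp _ x y hr).2 fun a b hm => ?_⟩
          rcases (minor_ne hm).lt_or_gt with h | h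
          · rw [hxy a b h] at hm
            exact (hc' a b hm).2
          · rw [minor_swap, neg_ne_zero, hxy b a h] at hm
            exact (hc' b a hm).2.symm
        · rw [e, hq]; simp
  refine ⟨ℓ, fun W hW => ?_, by rw [hvert, hhull], ?_⟩
  · obtain ⟨x, y, h, rfl, -, -, h2⟩ := hface W hW
    exact ⟨_, (mem_chartPoints_lineOf _).2 ⟨h2.ne', rfl⟩⟩
  · rw [hvert, hhull]
    refine extremePoints_convexHull_of_forall ?_
    rintro _ ⟨a, b, hab, hv, rfl⟩
    obtain ⟨φ, h1, h2⟩ := hφ a b hab hv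
    refine ⟨φ, by rw [map_smul, h1, smul_zero], ?_⟩
    rintro _ ⟨c, d, hcd, hv', rfl⟩ hne
    rw [map_smul]
    refine mul_pos (inv_pos.2 (hℓ c d hcd hv')) (h2 c d hcd hv' ?_)
    by_contra! h
    obtain ⟨rfl, rfl⟩ := h
    exact hne rfl

end Chart

section Chart
include ε

theorem exists_fan_functional {b : Fin n} (hb : b ≠ 0) :
    ∃ φ : (Fin 4 → Fin 4 → ℝ) →ₗ[ℝ] ℝ, φ (pl (Z 0) (Z b)) = 0 ∧
      ∀ c, c ≠ 0 → c ≠ b → 0 < φ (pl (Z 0) (Z c)) := by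
  have hn := hn.out
  have h0 := val_zero_fin (n := n)
  have hL := val_last (n := n)
  have cons : ∀ k : Fin n, k.val ≠ 0 → k.val + 1 < n → ∀ c, c ≠ 0 →
      0 ≤ ε * br (Z 0) (Z c) (Z k) (Z (k + 1)) ∧
        (c ≠ k → c ≠ k + 1 → 0 < ε * br (Z 0) (Z c) (Z k) (Z (k + 1))) := by
    intro k hk hk' c hc
    have e := val_succ k
    rw [if_neg (by omega)] at e
    have hpos : c ≠ k → c ≠ k + 1 → 0 < ε * br (Z 0) (Z c) (Z k) (Z (k + 1)) := by
      intro h1 h2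
      have := hZ.consecutive (a := 0) (b := c) (k := k)
        (by rw [Fin.lt_def, h0]; omega)
        (by rintro rfl; omega) (by intro h; rw [← h] at e; omega) h1 h2
      rwa [sgn_of_lt hk', mul_one] at this
    refine ⟨?_, hpos⟩
    by_cases h1 : c = k
    · rw [h1, show br (Z 0) (Z k) (Z k) (Z (k + 1)) = 0 by simp only [br]; ring, mul_zero]
    by_cases h2 : c = k + 1
    · rw [h2, show br (Z 0) (Z (k + 1)) (Z k) (Z (k + 1)) = 0 by simp only [br]; ring, mul_zero]
    exact (hpos h1 h2).le
  have chord : ∀ c : Fin n, c ≠ 0 → 0 ≤ -(ε * br (Z 0) (Z c) (Z 1) (Z (0 - 1))) ∧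
      (c ≠ 1 → c ≠ 0 - 1 → 0 < -(ε * br (Z 0) (Z c) (Z 1) (Z (0 - 1)))) := by
    intro c hc
    have v1 := val_one (n := n)
    have hpos : c ≠ 1 → c ≠ 0 - 1 → 0 < -(ε * br (Z 0) (Z c) (Z 1) (Z (0 - 1))) := by
      intro h1 h2
      have := hZ.1 0 1 c (0 - 1) (by omega) (by omega)
        (by omega)
      rw [show br (Z 0) (Z 1) (Z c) (Z (0 - 1)) = -br (Z 0) (Z c) (Z 1) (Z (0 - 1)) by
        simp only [br]; ring] at this
      linarith
    refine ⟨?_, hpos⟩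
    by_cases h1 : c = 1
    · rw [h1, show br (Z 0) (Z 1) (Z 1) (Z (0 - 1)) = 0 by simp only [br]; ring]; simp
    by_cases h2 : c = 0 - 1
    · rw [h2, show br (Z 0) (Z (0 - 1)) (Z 1) (Z (0 - 1)) = 0 by simp only [br]; ring]; simp
    exact (hpos h1 h2).le
  have v1 := val_one (n := n)
  by_cases hb1 : b = 1
  · refine ⟨ε • brL (Z 1) (Z (1 + 1)) - ε • brL (Z 1) (Z (0 - 1)), ?_, fun c hc hcb => ?_⟩
    · simp only [LinearMap.sub_apply, LinearMap.smul_apply, brL_pl, hb1, br, smul_eq_mul]; ring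
    · simp only [LinearMap.sub_apply, LinearMap.smul_apply, brL_pl, smul_eq_mul]
      have h1 := cons 1 (by omega) (by omega) c hc
      have h2 := chord c hc
      rw [hb1] at hcb
      by_cases h3 : c = 0 - 1
      · have := h1.2 hcb (by
          intro h; have := congrArg Fin.val h
          rw [val_succ, if_neg (by omega), h3] at this; omega)
        linarith [h2.1]
      · linarith [h1.1, h2.2 hcb h3]
  have ep := val_pred b
  rw [if_neg (by omega)] at ep
  by_cases hb2 : b = 0 - 1
  · refine ⟨ε • brL (Z (b - 1)) (Z b) - ε • brL (Z 1) (Z (0 - 1)), ?_, fun c hc hcb => ?_⟩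
    · simp only [LinearMap.sub_apply, LinearMap.smul_apply, brL_pl, hb2, br, smul_eq_mul]; ring
    · simp only [LinearMap.sub_apply, LinearMap.smul_apply, brL_pl, smul_eq_mul]
      have h1 := cons (b - 1) (by omega) (by omega) c hc
      rw [sub_add_cancel] at h1
      have h2 := chord c hc
      by_cases h3 : c = 1
      · have := h1.2 (by
          intro h
          omega) hcb
        linarith [h2.1]
      · linarith [h1.1, h2.2 h3 (hb2 ▸ hcb)]
  refine ⟨ε • brL (Z b) (Z (b + 1)) + ε • brL (Z (b - 1)) (Z b), ?_, fun c hc hcb => ?_⟩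
  · simp only [LinearMap.add_apply, LinearMap.smul_apply, brL_pl, br, smul_eq_mul]; ring
  · simp only [LinearMap.add_apply, LinearMap.smul_apply, brL_pl, smul_eq_mul]
    have h1 := cons b (by omega) (by omega) c hc
    have h2 := cons (b - 1) (by omega) (by omega) c hc
    rw [sub_add_cancel] at h2
    by_cases h3 : c = b + 1
    · have := h2.2 (by rw [h3]; exact (pred_ne_succ b).symm) hcb
      linarith [h1.1]
    · linarith [h2.1, h1.2 hcb h3]

theorem isConvexFace_pencil_zero
    (hT : T ∈ listed Z) (h0 : ∀ a b, a ≠ b → VertIn Z T a b → a = 0 ∨ b = 0) :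
    IsConvexFace Z T := by
  have h0' : ∀ a b, a < b → VertIn Z T a b → a = 0 ∧ b ≠ 0 := by
    intro a b hab hv
    rcases h0 a b hab.ne hv with rfl | rfl
    · exact ⟨rfl, hab.ne'⟩
    · exact absurd hab (Fin.not_lt_zero a)
  have v1 := val_one (n := n)
  have v0 := val_zero_fin (n := n)
  have h10 : (1 : Fin n) ≠ 0 := fun h => by rw [h] at v1; omega
  have hL0 : (0 - 1 : Fin n) ≠ 0 := pred_ne 0
  have hL1 : (0 - 1 : Fin n) ≠ 1 := by simpa using pred_ne_succ (0 : Fin n)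
  obtain ⟨φ, h1, h2⟩ := exists_fan_functional (Z := Z) h10
  obtain ⟨ψ, h3, h4⟩ := exists_fan_functional (Z := Z) hL0
  refine isConvexFace_of_functionals hT (fun c hc hc' => ?_) (ℓ := φ + ψ)
    (fun a b hab hv => ?_) fun a b hab hv => ?_
  · refine ⟨Pi.single 0 1, c 0, fun a b hab => ?_⟩
    have hb : b ≠ 0 := by rintro rfl; exact Fin.not_lt_zero a hab
    by_cases ha : a = 0
    · subst ha
      simp [minor, hb]
    · have : c a b = 0 := by
        by_contra h
        exact ha (h0' a b hab (hc' a b h).2).1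
      simp [minor, hb, ha, this]
  · obtain ⟨rfl, hb⟩ := h0' a b hab hv
    rw [LinearMap.add_apply]
    by_cases hb1 : b = 1
    · rw [hb1, h1, zero_add]
      exact h4 1 h10 hL1.symm
    · have := h2 b hb hb1
      by_cases hbL : b = 0 - 1
      · rw [hbL] at this ⊢
        rwa [h3, add_zero]
      · exact add_pos this (h4 b hb hbL)
  · obtain ⟨rfl, hb⟩ := h0' a b hab hv
    obtain ⟨χ, h5, h6⟩ := exists_fan_functional (Z := Z) hb
    refine ⟨χ, h5, fun c d hcd hv' hne => ?_⟩
    obtain ⟨rfl, hd⟩ := h0' c d hcd hv'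
    exact h6 d hd (by simpa using hne)

theorem isConvexFace_rotZ (h : IsConvexFace (rotZ Z) T) : IsConvexFace Z T := by
  have h1 : ∀ S, closedFace (rotZ Z) S = closedFace Z S := fun S => by
    rw [closedFace, closedFace, amplituhedron_rotZ]
  have h2 : vertexStrata (rotZ Z) = vertexStrata Z := by
    ext S
    constructor
    · rintro ⟨i, j, hij, rfl⟩
      exact ⟨i + 1, j + 1, fun h => hij (add_right_cancel h), type0I_rotZ i j⟩
    · rintro ⟨i, j, hij, rfl⟩
      refine ⟨i - 1, j - 1, fun h => hij (sub_left_injective h), ?_⟩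
      rw [type0I_rotZ, sub_add_cancel, sub_add_cancel]
  have h3 : ∀ S, verticesOf (rotZ Z) S = verticesOf Z S := fun S => by
    simp only [verticesOf, h1, h2]
  simpa only [IsConvexFace, h1, h3] using h

theorem isConvexFace_type2I (i : Fin n) : IsConvexFace Z (type2I Z i) := by
  refine rot_induction (Q := fun Z i => IsConvexFace Z (type2I Z i)) (fun Z _ => ?_)
    (fun Z i _ h => ?_) Z i
  · exact isConvexFace_pencil_zero (.inl (.inr (.inl ⟨0, rfl⟩)))
      fun a b hab h => (vertIn_type2I hab).1 h
  · rw [type2I_rotZ] at h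
    exact isConvexFace_rotZ h

theorem isConvexFace_type1I (i : Fin n) : IsConvexFace Z (type1I Z i) := by
  refine rot_induction (Q := fun Z i => IsConvexFace Z (type1I Z i)) (fun Z _ => ?_)
    (fun Z i _ h => ?_) Z i
  · exact isConvexFace_pencil_zero (.inl (.inl (.inr (.inl ⟨0, rfl⟩))))
      fun a b hab h => ((vertIn_type1I hab).1 h).1
  · rw [type1I_rotZ] at h
    exact isConvexFace_rotZ h

theorem isConvexFace_type1II (i j : Fin n) (h1 : i ≠ j)
    (h2 : i ≠ j + 1) : IsConvexFace Z (type1II Z i j) := by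
  refine rot_induction (Q := fun Z i => ∀ j, i ≠ j → i ≠ j + 1 →
    IsConvexFace Z (type1II Z i j)) (fun Z _ j h1 h2 => ?_) (fun Z i _ h j h1 h2 => ?_)
    Z i j h1 h2
  · exact isConvexFace_pencil_zero (.inl (.inl (.inr (.inr ⟨0, j, h1, h2, rfl⟩))))
      fun a b hab h => ((vertIn_type1II hab).1 h).1
  · have := h (j - 1) (fun h => h1 (by rw [h, sub_add_cancel]))
      (fun h => h2 (by rw [h, sub_add_cancel]))
    rw [type1II_rotZ, sub_add_cancel] at this
    exact isConvexFace_rotZ this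

theorem isConvexFace_type2II_one :
    IsConvexFace Z (type2II Z 1) := by
  have hn := hn.out
  have h01 := zero_lt_one_fin (n := n)
  have h12 := one_lt_two_fin (n := n)
  have v2 := val_two (n := n)
  have h23 : (2 : Fin n) < ⟨3, by omega⟩ := by rw [Fin.lt_def, v2]; norm_num
  have hp := hZ.1 0 1 2 ⟨3, by omega⟩ h01 h12 h23
  set w := Z ⟨3, by omega⟩ with hw
  have hvert : ∀ a b, a < b → VertIn Z (type2II Z 1) a b →
      (a = 0 ∧ b = 1) ∨ (a = 0 ∧ b = 2) ∨ (a = 1 ∧ b = 2) := by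
    intro a b hab h
    rw [vertIn_type2II hab.ne, sub_self, one_add_one_fin] at h
    have h1 := h01.not_gt
    have h2 := h12.not_gt
    have h3 := (h01.trans h12).not_gt
    grind only
  have e01 : br (Z 0) (Z 1) (Z 0) w = 0 ∧ br (Z 0) (Z 1) (Z 1) w = 0 := by
    constructor <;> simp only [br] <;> ring
  have e02 : br (Z 0) (Z 2) (Z 0) w = 0 ∧ br (Z 0) (Z 2) (Z 1) w = -br (Z 0) (Z 1) (Z 2) w ∧
      br (Z 0) (Z 2) (Z 2) w = 0 := by
    refine ⟨?_, ?_, ?_⟩ <;> simp only [br] <;> ring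
  have e12 : br (Z 1) (Z 2) (Z 0) w = br (Z 0) (Z 1) (Z 2) w ∧ br (Z 1) (Z 2) (Z 1) w = 0 ∧
      br (Z 1) (Z 2) (Z 2) w = 0 := by
    refine ⟨?_, ?_, ?_⟩ <;> simp only [br] <;> ring
  have main : ∀ α β γ : ℝ, ∃ φ : (Fin 4 → Fin 4 → ℝ) →ₗ[ℝ] ℝ,
      φ (pl (Z 0) (Z 1)) = α * (ε * br (Z 0) (Z 1) (Z 2) w) ∧
      φ (pl (Z 0) (Z 2)) = β * (ε * br (Z 0) (Z 1) (Z 2) w) ∧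
      φ (pl (Z 1) (Z 2)) = γ * (ε * br (Z 0) (Z 1) (Z 2) w) := by
    intro α β γ
    refine ⟨ε • (α • brL (Z 2) w - β • brL (Z 1) w + γ • brL (Z 0) w), ?_, ?_, ?_⟩ <;>
      simp only [LinearMap.add_apply, LinearMap.sub_apply, LinearMap.smul_apply, brL_pl,
        smul_eq_mul, e01, e02, e12] <;> ring
  obtain ⟨ℓ, l1, l2, l3⟩ := main 1 1 1
  refine isConvexFace_of_functionals (.inl (.inr (.inr (.inl ⟨1, rfl⟩))))
    (fun c hc hc' => ?_) (ℓ := ℓ) (fun a b hab hv => ?_) fun a b hab hv => ?_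
  · obtain ⟨x, y, hxy, -⟩ := exists_minors (Z := Z) h01 h12 (c 0 1) (c 0 2) (c 1 2)
    refine ⟨x, y, fun a b hab => ?_⟩
    rw [hxy a b hab]
    split_ifs with h1 h2 h3
    · rw [h1.1, h1.2]
    · rw [h2.1, h2.2]
    · rw [h3.1, h3.2]
    · by_contra h
      rcases hvert a b hab (hc' a b (Ne.symm h)).2 with h4 | h4 | h4
      exacts [h1 h4, h2 h4, h3 h4]
  · rcases hvert a b hab hv with ⟨rfl, rfl⟩ | ⟨rfl, rfl⟩ | ⟨rfl, rfl⟩ <;> simpa only [l1, l2, l3, one_mul]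
  · rcases hvert a b hab hv with ⟨rfl, rfl⟩ | ⟨rfl, rfl⟩ | ⟨rfl, rfl⟩
    · obtain ⟨φ, p1, p2, p3⟩ := main 0 1 1
      refine ⟨φ, by rw [p1, zero_mul], fun c d hcd hv' hne => ?_⟩
      rcases hvert c d hcd hv' with ⟨rfl, rfl⟩ | ⟨rfl, rfl⟩ | ⟨rfl, rfl⟩
      · simp at hne
      · rwa [p2, one_mul]
      · rwa [p3, one_mul]
    · obtain ⟨φ, p1, p2, p3⟩ := main 1 0 1
      refine ⟨φ, by rw [p2, zero_mul], fun c d hcd hv' hne => ?_⟩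
      rcases hvert c d hcd hv' with ⟨rfl, rfl⟩ | ⟨rfl, rfl⟩ | ⟨rfl, rfl⟩
      · rwa [p1, one_mul]
      · simp at hne
      · rwa [p3, one_mul]
    · obtain ⟨φ, p1, p2, p3⟩ := main 1 1 0
      refine ⟨φ, by rw [p3, zero_mul], fun c d hcd hv' hne => ?_⟩
      rcases hvert c d hcd hv' with ⟨rfl, rfl⟩ | ⟨rfl, rfl⟩ | ⟨rfl, rfl⟩
      · rwa [p1, one_mul]
      · rwa [p2, one_mul]
      · simp at hne

theorem isConvexFace_type2II (i : Fin n) : IsConvexFace Z (type2II Z i) := by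
  have := rot_induction (Q := fun Z i => IsConvexFace Z (type2II Z (i + 1)))
    (fun Z _ => by rw [zero_add]; exact isConvexFace_type2II_one)
    (fun Z i _ h => by rw [type2II_rotZ] at h; exact isConvexFace_rotZ h) Z (i - 1)
  rwa [sub_add_cancel] at this

theorem type0I_eq_iff {a b c d : Fin n} (hab : a ≠ b)
    (hcd : c ≠ d) : type0I Z a b = type0I Z c d ↔ (a = c ∧ b = d) ∨ (a = d ∧ b = c) := by
  constructor
  · intro h
    have := (vertIn_type0I hab).1 h.subset
    grind
  · rintro (⟨rfl, rfl⟩ | ⟨rfl, rfl⟩)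
    · rfl
    · exact type0I_comm _ _

theorem type2I_injective
    (h : type2I Z i = type2I Z j) : i = j := by
  have h1 : VertIn Z (type2I Z j) i (i + 1) := by
    rw [← h, vertIn_type2I (succ_ne i)]; exact .inl rfl
  have h2 : VertIn Z (type2I Z j) (i - 1) i := by
    rw [← h, vertIn_type2I (pred_ne i)]; exact .inr rfl
  rw [vertIn_type2I (succ_ne i)] at h1
  rw [vertIn_type2I (pred_ne i)] at h2
  have := pred_ne_succ i
  grind

theorem type1I_ne_type1II {i j k : Fin n} (hj : j ≠ k)
    (hj' : j ≠ k + 1) : type1I Z i ≠ type1II Z j k := by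
  obtain ⟨c1, c2, c3, c4, c5, c6, c7⟩ := cyclic_facts (n := n)
  intro h
  have h1 : VertIn Z (type1II Z j k) i (i + 1) := by
    rw [← h, vertIn_type1I (c3 i)]; simp
  have h2 : VertIn Z (type1II Z j k) (i - 1) i := by
    rw [← h, vertIn_type1I (c4 i)]; simp
  rw [vertIn_type1II (c3 i)] at h1
  rw [vertIn_type1II (c4 i)] at h2
  grind only

theorem type1I_injective
    (h : type1I Z i = type1I Z j) : i = j := by
  obtain ⟨c1, c2, c3, c4, c5, c6, c7⟩ := cyclic_facts (n := n)
  have h1 : VertIn Z (type1I Z j) i (i + 1) := by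
    rw [← h, vertIn_type1I (c3 i)]; simp
  have h2 : VertIn Z (type1I Z j) (i - 1) i := by
    rw [← h, vertIn_type1I (c4 i)]; simp
  rw [vertIn_type1I (c3 i)] at h1
  rw [vertIn_type1I (c4 i)] at h2
  grind only

theorem type1II_injective {i j k l : Fin n} (h1 : i ≠ j)
    (h2 : i ≠ j + 1) (h3 : k ≠ l) (h4 : k ≠ l + 1) (h : type1II Z i j = type1II Z k l) :
    i = k ∧ j = l := by
  obtain ⟨c1, c2, c3, c4, c5, c6, c7⟩ := cyclic_facts (n := n)
  have h5 : VertIn Z (type1II Z k l) i j := by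
    rw [← h, vertIn_type1II h1]; simp
  have h6 : VertIn Z (type1II Z k l) i (j + 1) := by
    rw [← h, vertIn_type1II h2]; simp
  rw [vertIn_type1II h1] at h5
  rw [vertIn_type1II h2] at h6
  grind only

theorem type2III_injective {i j k : Fin n} (h1 : j ≠ i - 1)
    (h2 : j ≠ i) (k1 : k ≠ i - 1) (k2 : k ≠ i) (h : type2III Z i j = type2III Z i k) : j = k := by
  obtain ⟨c1, c2, c3, c4, c5, c6, c7⟩ := cyclic_facts (n := n)
  have h4 : i ≠ j + 1 := fun h => h1 (by rw [h, c2])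
  have h5 : VertIn Z (type2III Z i k) i j := by
    rw [← h, vertIn_type2III h2.symm]; simp
  have h6 : VertIn Z (type2III Z i k) i (j + 1) := by
    rw [← h, vertIn_type2III h4]; simp
  rw [vertIn_type2III h2.symm] at h5
  rw [vertIn_type2III h4] at h6
  grind only

theorem type2II_injective
    (h : type2II Z i = type2II Z j) : i = j := by
  obtain ⟨c1, c2, c3, c4, c5, c6, c7⟩ := cyclic_facts (n := n)
  have h1 : VertIn Z (type2II Z j) i (i + 1) := by
    rw [← h, vertIn_type2II (c3 i)]; simp
  have h2 : VertIn Z (type2II Z j) (i - 1) i := by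
    rw [← h, vertIn_type2II (c4 i)]; simp
  rw [vertIn_type2II (c3 i)] at h1
  rw [vertIn_type2II (c4 i)] at h2
  grind only

theorem type2I_ne_type2II (i j : Fin n) : type2I Z i ≠ type2II Z j := by
  obtain ⟨c1, c2, c3, c4, c5, c6, c7⟩ := cyclic_facts (n := n)
  have h3 : i ≠ i + 1 + 1 := fun h => c5 (i + 1) (by rw [c2, ← h])
  intro h
  have h1 : VertIn Z (type2II Z j) i (i + 1) := by
    rw [← h, vertIn_type2I (c3 i)]; simp
  have h2 : VertIn Z (type2II Z j) (i - 1) i := by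
    rw [← h, vertIn_type2I (c4 i)]; simp
  have h4 : VertIn Z (type2II Z j) i (i + 1 + 1) := by
    rw [← h, vertIn_type2I h3]; simp
  rw [vertIn_type2II (c3 i)] at h1
  rw [vertIn_type2II (c4 i)] at h2
  rw [vertIn_type2II h3] at h4
  grind only

theorem closedFace_type1I_subset_iff (hT : T ∈ listed Z)
    (k : Fin n) : closedFace Z (type1I Z k) ⊆ closedFace Z T ↔
      VertIn Z T (k - 1) k ∧ VertIn Z T k (k + 1) := by
  have c4 := pred_ne k
  have c3 := succ_ne k
  rw [closedFace_subset_iff (.inl (.inl (.inr (.inl ⟨k, rfl⟩)))) hT]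
  refine ⟨fun h => ⟨h _ _ c4 ?_, h _ _ c3 ?_⟩, fun ⟨h1, h2⟩ a b hab h => ?_⟩
  · simp [vertIn_type1I c4]
  · simp [vertIn_type1I c3]
  · rw [vertIn_type1I hab] at h
    obtain ⟨h0 | h0, h3, h4⟩ := h <;> subst h0
    · rcases h4 with rfl | rfl | rfl
      exacts [h1.symm, (hab rfl).elim, h2]
    · rcases h3 with rfl | rfl | rfl
      exacts [h1, (hab rfl).elim, h2.symm]

theorem closedFace_type1II_subset_iff (hT : T ∈ listed Z)
    {k l : Fin n} (h1 : k ≠ l) (h2 : k ≠ l + 1) :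
    closedFace Z (type1II Z k l) ⊆ closedFace Z T ↔ VertIn Z T k l ∧ VertIn Z T k (l + 1) := by
  rw [closedFace_subset_iff (.inl (.inl (.inr (.inr ⟨k, l, h1, h2, rfl⟩)))) hT]
  refine ⟨fun h => ⟨h _ _ h1 ?_, h _ _ h2 ?_⟩, fun ⟨h3, h4⟩ a b hab h => ?_⟩
  · simp [vertIn_type1II h1]
  · simp [vertIn_type1II h2]
  · rw [vertIn_type1II hab] at h
    obtain ⟨h0 | h0, h⟩ := h <;> subst h0
    · rcases h with h | h | rfl | rfl
      exacts [(h1 h).elim, (h2 h).elim, h3, h4]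
    · rcases h with rfl | rfl | h | h
      exacts [h3.symm, h4.symm, (h1 h).elim, (h2 h).elim]

theorem mem_face_type0I_iff (hij : i ≠ j)
    (W : Gr ℝ 4) : W ∈ face Z (type0I Z i j) ↔ W.toSubmodule = Submodule.span ℝ {Z i, Z j} := by
  have h1 : face Z (type0I Z i j) = {lineOf (Z i) (Z j) (hZ.pair_independent hij)} := by
    refine (Set.Nonempty.subset_singleton_iff (hasModel_type0I hij).face_nonempty).1 ?_
    rw [← closedFace_type0I hij]
    exact image_mono interior_subset
  rw [h1, mem_singleton_iff, Gr.ext_iff]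
  rfl

theorem type0I_subset_lines_succ (i : Fin n) : {T | T ∈ lineStrata Z ∧ type0I Z i (i + 1) ⊆ T} =
        {type1I Z i, type1I Z (i + 1), type1II Z i (i + 1), type1II Z (i + 1) (i - 1)} ∧
      {T | T ∈ lineStrata Z ∧ type0I Z i (i + 1) ⊆ T}.ncard = 4 := by
  obtain ⟨c1, c2, c3, c4, c5, c6, c7⟩ := cyclic_facts (n := n)
  have h3 : i ≠ i + 1 + 1 := fun h => c5 (i + 1) (by rw [c2, ← h])
  have h4 : i + 1 ≠ i - 1 := (c5 i).symm
  have h5 : i + 1 ≠ i - 1 + 1 := by rw [c1]; exact (c3 i).symm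
  have e : {T | T ∈ lineStrata Z ∧ type0I Z i (i + 1) ⊆ T} =
      {type1I Z i, type1I Z (i + 1), type1II Z i (i + 1), type1II Z (i + 1) (i - 1)} := by
    ext T
    constructor
    · rintro ⟨⟨k, rfl⟩ | ⟨k, l, h1, h2, rfl⟩, h⟩
      · rcases ((vertIn_type1I (c3 i)).1 h).1 with rfl | rfl <;> simp
      · have := (vertIn_type1II (c3 i)).1 h
        have : (k = i ∧ l = i + 1) ∨ (k = i + 1 ∧ l = i - 1) := by
          grind only
        rcases this with ⟨rfl, rfl⟩ | ⟨rfl, rfl⟩ <;> simp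
    · rintro (rfl | rfl | rfl | rfl)
      · exact ⟨.inl ⟨_, rfl⟩, (vertIn_type1I (c3 i)).2 (by simp)⟩
      · exact ⟨.inl ⟨_, rfl⟩, (vertIn_type1I (c3 i)).2 (by simp)⟩
      · exact ⟨.inr ⟨_, _, c3 i, h3, rfl⟩, (vertIn_type1II (c3 i)).2 (by simp)⟩
      · exact ⟨.inr ⟨_, _, h4, h5, rfl⟩, (vertIn_type1II (c3 i)).2 (by simp)⟩
  refine ⟨e, ?_⟩
  rw [e, ncard_insert_of_notMem, ncard_insert_of_notMem, ncard_pair]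
  · exact fun h => c3 i (type1II_injective (c3 i) h3 h4 h5 h).1
  · rintro (h | h)
    exacts [type1I_ne_type1II (c3 i) h3 h, type1I_ne_type1II h4 h5 h]
  · rintro (h | h | h)
    exacts [c3 i (type1I_injective h), type1I_ne_type1II (c3 i) h3 h, type1I_ne_type1II h4 h5 h]

theorem type0I_subset_lines (h1 : j ≠ i - 1)
    (h2 : j ≠ i) (h3 : j ≠ i + 1) : {T | T ∈ lineStrata Z ∧ type0I Z i j ⊆ T} =
        {type1II Z i (j - 1), type1II Z i j, type1II Z j (i - 1), type1II Z j i} ∧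
      {T | T ∈ lineStrata Z ∧ type0I Z i j ⊆ T}.ncard = 4 := by
  obtain ⟨c1, c2, c3, c4, c5, c6, c7⟩ := cyclic_facts (n := n)
  have a1 : i ≠ j - 1 := fun h => h3 (by rw [h, c1])
  have a2 : i ≠ j - 1 + 1 := by rw [c1]; exact h2.symm
  have a3 : i ≠ j + 1 := fun h => h1 (by rw [h, c2])
  have a4 : j ≠ i - 1 + 1 := by rw [c1]; exact h2
  have e : {T | T ∈ lineStrata Z ∧ type0I Z i j ⊆ T} =
      {type1II Z i (j - 1), type1II Z i j, type1II Z j (i - 1), type1II Z j i} := by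
    ext T
    constructor
    · rintro ⟨⟨k, rfl⟩ | ⟨k, l, h4, h5, rfl⟩, h⟩
      · have := (vertIn_type1I h2.symm).1 h
        exfalso
        grind only
      · have := (vertIn_type1II h2.symm).1 h
        have : ((k = i ∧ l = j - 1) ∨ (k = i ∧ l = j)) ∨ (k = j ∧ l = i - 1) ∨ (k = j ∧ l = i) := by
          grind only
        rcases this with (⟨rfl, rfl⟩ | ⟨rfl, rfl⟩) | ⟨rfl, rfl⟩ | ⟨rfl, rfl⟩ <;> simp
    · rintro (rfl | rfl | rfl | rfl)
      · exact ⟨.inr ⟨_, _, a1, a2, rfl⟩, (vertIn_type1II h2.symm).2 (by simp)⟩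
      · exact ⟨.inr ⟨_, _, h2.symm, a3, rfl⟩, (vertIn_type1II h2.symm).2 (by simp)⟩
      · exact ⟨.inr ⟨_, _, h1, a4, rfl⟩, (vertIn_type1II h2.symm).2 (by simp)⟩
      · exact ⟨.inr ⟨_, _, h2, h3, rfl⟩, (vertIn_type1II h2.symm).2 (by simp)⟩
  refine ⟨e, ?_⟩
  rw [e, ncard_insert_of_notMem, ncard_insert_of_notMem, ncard_pair]
  · exact fun h => c4 i (type1II_injective h1 a4 h2 h3 h).2
  · rintro (h | h)
    exacts [h2.symm (type1II_injective h2.symm a3 h1 a4 h).1,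
      h2.symm (type1II_injective h2.symm a3 h2 h3 h).1]
  · rintro (h | h | h)
    exacts [c4 j (type1II_injective a1 a2 h2.symm a3 h).2,
      h2.symm (type1II_injective a1 a2 h1 a4 h).1, h2.symm (type1II_injective a1 a2 h2 h3 h).1]

theorem verticesOf_type1I (i : Fin n) :
    verticesOf Z (type1I Z i) = {type0I Z (i - 1) i, type0I Z i (i + 1)} := by
  rw [verticesOf_listed (.inl (.inl (.inr (.inl ⟨i, rfl⟩))))]
  ext S
  constructor
  · rintro ⟨a, b, hab, h, rfl⟩
    rw [vertIn_type1I hab] at h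
    obtain ⟨rfl | rfl, h3, h4⟩ := h
    · rcases h4 with rfl | rfl | rfl
      exacts [.inl (type0I_comm _ _), (hab rfl).elim, .inr rfl]
    · rcases h3 with rfl | rfl | rfl
      exacts [.inl rfl, (hab rfl).elim, .inr (type0I_comm _ _)]
  · rintro (rfl | rfl)
    · exact ⟨_, _, pred_ne i, by simp [vertIn_type1I (pred_ne i)], rfl⟩
    · exact ⟨_, _, succ_ne i, by simp [vertIn_type1I (succ_ne i)], rfl⟩

theorem verticesOf_type1II (h1 : i ≠ j)
    (h2 : i ≠ j + 1) : verticesOf Z (type1II Z i j) = {type0I Z i j, type0I Z i (j + 1)} := by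
  rw [verticesOf_listed (.inl (.inl (.inr (.inr ⟨i, j, h1, h2, rfl⟩))))]
  ext S
  constructor
  · rintro ⟨a, b, hab, h, rfl⟩
    rw [vertIn_type1II hab] at h
    obtain ⟨h0 | h0, h⟩ := h <;> subst h0
    · rcases h with h | h | rfl | rfl
      exacts [(h1 h).elim, (h2 h).elim, .inl rfl, .inr rfl]
    · rcases h with rfl | rfl | h | h
      exacts [.inl (type0I_comm _ _), .inr (type0I_comm _ _), (h1 h).elim, (h2 h).elim]
  · rintro (rfl | rfl)
    · exact ⟨_, _, h1, by simp [vertIn_type1II h1], rfl⟩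
    · exact ⟨_, _, h2, by simp [vertIn_type1II h2], rfl⟩

theorem ncard_verticesOf_type1I (i : Fin n) : (verticesOf Z (type1I Z i)).ncard = 2 := by
  rw [verticesOf_type1I, ncard_pair]
  rw [Ne, type0I_eq_iff (pred_ne i) (succ_ne i)]
  have := pred_ne_succ i
  have := pred_ne i
  tauto

theorem ncard_verticesOf_type1II (h1 : i ≠ j)
    (h2 : i ≠ j + 1) : (verticesOf Z (type1II Z i j)).ncard = 2 := by
  rw [verticesOf_type1II h1 h2, ncard_pair]
  rw [Ne, type0I_eq_iff h1 h2]
  have := succ_ne j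
  tauto

end Chart

theorem val_finRotate {m : ℕ} (k : Fin m) :
    (finRotate m k).val = if k.val + 1 = m then 0 else k.val + 1 := by
  obtain _ | m := m
  · exact k.elim0
  · rw [coe_finRotate]
    simp [Fin.ext_iff]

section Polygons
include ε

theorem hasCyclicVertices_of {m : ℕ} {v E : Fin m → Set (Gr ℂ 4)} (hv : Function.Injective v)
    (hT : verticesOf Z T = range v) (hE : edgesOf Z T = range E)
    (h : ∀ k, verticesOf Z (E k) = {v k, v (finRotate m k)}) : HasCyclicVertices Z T v := by
  refine ⟨hv, hT, fun k => ⟨E k, hE ▸ mem_range_self k, h k⟩, fun E' hE' => ?_⟩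
  rw [hE] at hE'
  obtain ⟨k, rfl⟩ := hE'
  exact ⟨k, h k⟩

theorem edgesOf_type2I (i : Fin n) : edgesOf Z (type2I Z i) =
      {type1I Z i} ∪ {S | ∃ j, j ≠ i - 1 ∧ j ≠ i ∧ S = type1II Z i j} := by
  obtain ⟨c1, c2, c3, c4, c5, c6, c7⟩ := cyclic_facts (n := n)
  have hT : type2I Z i ∈ listed Z := .inl (.inr (.inl ⟨i, rfl⟩))
  ext S
  constructor
  · rintro ⟨⟨k, rfl⟩ | ⟨k, l, h1, h2, rfl⟩, h⟩
    · rw [closedFace_type1I_subset_iff hT, vertIn_type2I (c4 k), vertIn_type2I (c3 k)] at h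
      have : k = i := by grind only
      exact .inl (by rw [this]; rfl)
    · rw [closedFace_type1II_subset_iff hT h1 h2, vertIn_type2I h1, vertIn_type2I h2] at h
      have : k = i := by grind only
      subst this
      exact .inr ⟨l, fun h => h2 (by rw [h, c1]), h1.symm, rfl⟩
  · rintro (rfl | ⟨j, h1, h2, rfl⟩)
    · refine ⟨.inl ⟨i, rfl⟩, (closedFace_type1I_subset_iff hT i).2 ?_⟩
      rw [vertIn_type2I (c4 i), vertIn_type2I (c3 i)]
      simp
    · have h3 : i ≠ j + 1 := fun h => h1 (by rw [h, c2])
      refine ⟨.inr ⟨i, j, h2.symm, h3, rfl⟩, (closedFace_type1II_subset_iff hT h2.symm h3).2 ?_⟩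
      rw [vertIn_type2I h2.symm, vertIn_type2I h3]
      simp

theorem edgesOf_type2II (i : Fin n) : edgesOf Z (type2II Z i) =
      {type1II Z (i - 1) i, type1I Z i, type1II Z (i + 1) (i - 1)} := by
  obtain ⟨c1, c2, c3, c4, c5, c6, c7⟩ := cyclic_facts (n := n)
  have hT : type2II Z i ∈ listed Z := .inl (.inr (.inr (.inl ⟨i, rfl⟩)))
  ext S
  constructor
  · rintro ⟨⟨k, rfl⟩ | ⟨k, l, h1, h2, rfl⟩, h⟩
    · rw [closedFace_type1I_subset_iff hT, vertIn_type2II (c4 k), vertIn_type2II (c3 k)] at h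
      have : k = i := by grind only
      simp [this]
    · rw [closedFace_type1II_subset_iff hT h1 h2, vertIn_type2II h1, vertIn_type2II h2] at h
      have : (k = i - 1 ∧ l = i) ∨ (k = i + 1 ∧ l = i - 1) := by
        grind only
      rcases this with ⟨rfl, rfl⟩ | ⟨rfl, rfl⟩ <;> simp
  · have h5 : i + 1 ≠ i - 1 + 1 := by rw [c1]; exact (c3 i).symm
    rintro (rfl | rfl | rfl)
    · refine ⟨.inr ⟨_, _, c4 i, c5 i, rfl⟩, (closedFace_type1II_subset_iff hT (c4 i) (c5 i)).2 ?_⟩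
      rw [vertIn_type2II (c4 i), vertIn_type2II (c5 i)]
      simp
    · refine ⟨.inl ⟨i, rfl⟩, (closedFace_type1I_subset_iff hT i).2 ?_⟩
      rw [vertIn_type2II (c4 i), vertIn_type2II (c3 i)]
      simp
    · refine ⟨.inr ⟨_, _, (c5 i).symm, h5, rfl⟩,
        (closedFace_type1II_subset_iff hT (c5 i).symm h5).2 ?_⟩
      rw [vertIn_type2II (c5 i).symm, vertIn_type2II h5, c1]
      simp

theorem edgesOf_type2III (h1 : j ≠ i - 1)
    (h2 : j ≠ i) (h3 : j ≠ i + 1) : edgesOf Z (type2III Z i j) =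
      {type1II Z j i, type1II Z (i + 1) j, type1II Z (j + 1) i, type1II Z i j} := by
  obtain ⟨c1, c2, c3, c4, c5, c6, c7⟩ := cyclic_facts (n := n)
  have hT : type2III Z i j ∈ listed Z := .inl (.inr (.inr (.inr ⟨i, j, h1, h2, h3, rfl⟩)))
  have d1 : j + 1 ≠ i := fun h => h1 (by rw [← h, c2])
  have d2 : j + 1 ≠ i + 1 := fun h => h2 (add_right_cancel h)
  ext S
  constructor
  · rintro ⟨⟨k, rfl⟩ | ⟨k, l, h4, h5, rfl⟩, h⟩
    · rw [closedFace_type1I_subset_iff hT, vertIn_type2III (c4 k), vertIn_type2III (c3 k)] at h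
      exfalso
      grind only
    · rw [closedFace_type1II_subset_iff hT h4 h5, vertIn_type2III h4, vertIn_type2III h5] at h
      have : (k = j ∧ l = i ∨ k = i + 1 ∧ l = j) ∨ k = j + 1 ∧ l = i ∨ k = i ∧ l = j := by
        grind only
      rcases this with (⟨rfl, rfl⟩ | ⟨rfl, rfl⟩) | ⟨rfl, rfl⟩ | ⟨rfl, rfl⟩ <;> simp
  · have key : ∀ k l, k ≠ l → k ≠ l + 1 → VertIn Z (type2III Z i j) k l →
        VertIn Z (type2III Z i j) k (l + 1) → type1II Z k l ∈ edgesOf Z (type2III Z i j) :=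
      fun k l h4 h5 h6 h7 => ⟨.inr ⟨k, l, h4, h5, rfl⟩,
        (closedFace_type1II_subset_iff hT h4 h5).2 ⟨h6, h7⟩⟩
    rintro (rfl | rfl | rfl | rfl)
    · refine key _ _ h2 h3 ?_ ?_ <;> rw [vertIn_type2III (by assumption)] <;> simp
    · refine key _ _ h3.symm d2.symm ?_ ?_
      · rw [vertIn_type2III h3.symm]; simp
      · rw [vertIn_type2III d2.symm]; simp
    · refine key _ _ d1 d2 ?_ ?_ <;> rw [vertIn_type2III (by assumption)] <;> simp
    · refine key _ _ h2.symm d1.symm ?_ ?_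
      · rw [vertIn_type2III h2.symm]; simp
      · rw [vertIn_type2III d1.symm]; simp

theorem ncard_edgesOf_type2I (i : Fin n) : (edgesOf Z (type2I Z i)).ncard = n - 1 := by
  have hn := hn.out
  obtain ⟨c1, c2, c3, c4, c5, c6, c7⟩ := cyclic_facts (n := n)
  have hne : ∀ j, j ≠ i - 1 → i ≠ j + 1 := fun j h1 h => h1 (by rw [h, c2])
  have e : {S | ∃ j, j ≠ i - 1 ∧ j ≠ i ∧ S = type1II Z i j} = type1II Z i '' {i - 1, i}ᶜ := by
    ext S
    constructor
    · rintro ⟨j, h1, h2, rfl⟩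
      exact ⟨j, by simp [h1, h2], rfl⟩
    · rintro ⟨j, hj, rfl⟩
      simp only [mem_compl_iff, mem_insert_iff, mem_singleton_iff, not_or] at hj
      exact ⟨j, hj.1, hj.2, rfl⟩
  rw [edgesOf_type2I, singleton_union, e, ncard_insert_of_notMem, InjOn.ncard_image,
    ncard_compl, ncard_pair (c4 i), Nat.card_eq_fintype_card, Fintype.card_fin]
  · omega
  · intro j hj k hk h
    simp only [mem_compl_iff, mem_insert_iff, mem_singleton_iff, not_or] at hj hk
    exact (type1II_injective (Ne.symm hj.2) (hne j hj.1) (Ne.symm hk.2) (hne k hk.1) h).2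
  · rintro ⟨j, hj, h⟩
    simp only [mem_compl_iff, mem_insert_iff, mem_singleton_iff, not_or] at hj
    exact type1I_ne_type1II (Ne.symm hj.2) (hne j hj.1) h.symm

theorem ncard_edgesOf_type2II (i : Fin n) : (edgesOf Z (type2II Z i)).ncard = 3 := by
  obtain ⟨c1, c2, c3, c4, c5, c6, c7⟩ := cyclic_facts (n := n)
  have h5 : i + 1 ≠ i - 1 + 1 := by rw [c1]; exact (c3 i).symm
  rw [edgesOf_type2II, ncard_insert_of_notMem, ncard_pair]
  · exact type1I_ne_type1II (c5 i).symm h5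
  · rintro (h | h)
    exacts [type1I_ne_type1II (c4 i) (c5 i) h.symm,
      c5 i (type1II_injective (c4 i) (c5 i) (c5 i).symm h5 h).1]

theorem ncard_edgesOf_type2III (h1 : j ≠ i - 1)
    (h2 : j ≠ i) (h3 : j ≠ i + 1) : (edgesOf Z (type2III Z i j)).ncard = 4 := by
  obtain ⟨c1, c2, c3, c4, c5, c6, c7⟩ := cyclic_facts (n := n)
  have d1 : j + 1 ≠ i := fun h => h1 (by rw [← h, c2])
  have d2 : j + 1 ≠ i + 1 := fun h => h2 (add_right_cancel h)
  rw [edgesOf_type2III h1 h2 h3, ncard_insert_of_notMem, ncard_insert_of_notMem, ncard_pair]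
  · exact fun h => d1 (type1II_injective d1 d2 h2.symm d1.symm h).1
  · rintro (h | h)
    exacts [h2 (type1II_injective h3.symm d2.symm d1 d2 h).2,
      c3 i (type1II_injective h3.symm d2.symm h2.symm d1.symm h).1.symm]
  · rintro (h | h | h)
    exacts [h3 (type1II_injective h2 h3 h3.symm d2.symm h).1,
      c3 j (type1II_injective h2 h3 d1 d2 h).1, h2 (type1II_injective h2 h3 h2.symm d1.symm h).1]

theorem hasCyclicVertices_type2I (i : Fin n) : HasCyclicVertices Z (type2I Z i)
      (fun k : Fin (n - 1) => type0I Z i (i + 1 + Fin.castLE (Nat.sub_le n 1) k)) := by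
  have hn := hn.out
  obtain ⟨c1, c2, c3, c4, c5, c6, c7⟩ := cyclic_facts (n := n)
  set f : Fin (n - 1) → Fin n := fun k => i + 1 + Fin.castLE (Nat.sub_le n 1) k with hf
  have hlast : ∀ k : Fin (n - 1), k.val + 1 = n - 1 → f k = i - 1 := by
    intro k hk
    have : Fin.castLE (Nat.sub_le n 1) k = 0 - 1 - 1 := by
      ext
      rw [val_pred, val_last, Fin.val_castLE, if_neg (by omega)]
      omega
    rw [hf]; beta_reduce; rw [this]; abel
  have hzero : ∀ k : Fin (n - 1), k.val = 0 → f k = i + 1 := by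
    intro k hk
    have : Fin.castLE (Nat.sub_le n 1) k = 0 := by
      ext
      rw [Fin.val_castLE, hk, val_zero_fin]
    rw [hf]; beta_reduce; rw [this, add_zero]
  have hsucc : ∀ k l : Fin (n - 1), l.val = k.val + 1 → f l = f k + 1 := by
    intro k l hk
    have : Fin.castLE (Nat.sub_le n 1) l = Fin.castLE (Nat.sub_le n 1) k + 1 := by
      ext
      rw [val_succ, Fin.val_castLE, Fin.val_castLE, if_neg (by omega), hk]
    rw [hf]; beta_reduce; rw [this, add_assoc _ _ (1 : Fin n)]
  have hinj : Function.Injective f := fun k l h => Fin.castLE_injective _ (add_left_cancel h)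
  have hsurj : ∀ j, j ≠ i → ∃ k, f k = j := by
    intro j hj
    have h1 : (j - (i + 1)).val < n - 1 := by
      have h2 : j - (i + 1) ≠ 0 - 1 := fun h => hj (by
        rw [← sub_eq_zero, ← add_left_inj (-1 : Fin n)]
        rw [show j - i + -1 = j - (i + 1) by abel, h]; abel)
      have := Fin.val_ne_of_ne h2
      rw [val_last] at this
      omega
    refine ⟨⟨_, h1⟩, ?_⟩
    have : Fin.castLE (Nat.sub_le n 1) ⟨(j - (i + 1)).val, h1⟩ = j - (i + 1) := by ext; rfl
    rw [hf]; beta_reduce; rw [this]; abel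
  have hne : ∀ k, f k ≠ i := by
    intro k h
    by_cases hk : k.val + 1 = n - 1
    · exact c4 i (by rw [← hlast k hk, h])
    · obtain ⟨l, hl⟩ : ∃ l : Fin (n - 1), l.val + 1 = n - 1 := ⟨⟨n - 2, by omega⟩, by simp; omega⟩
      have h1 : (Fin.castLE (Nat.sub_le n 1) k) = 0 - 1 := by
        have : f k - (i + 1) = i - (i + 1) := by rw [h]
        beta_reduce at this
        rw [add_sub_cancel_left] at this
        rw [this]; abel
      have := congrArg Fin.val h1
      rw [val_last, Fin.val_castLE] at this
      omega
  refine hasCyclicVertices_of (E := fun k => if k.val + 1 = n - 1 then type1I Z i else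
    type1II Z i (f k)) (fun k l h => ?_) ?_ ?_ fun k => ?_
  · rcases (type0I_eq_iff (hne k).symm (hne l).symm).1 h with h | h
    exacts [hinj h.2, (hne l h.1.symm).elim]
  · rw [verticesOf_listed (.inl (.inr (.inl ⟨i, rfl⟩)))]
    ext S
    constructor
    · rintro ⟨a, b, hab, h, rfl⟩
      rcases (vertIn_type2I hab).1 h with rfl | rfl
      · obtain ⟨k, rfl⟩ := hsurj b hab.symm
        exact ⟨k, rfl⟩
      · obtain ⟨k, rfl⟩ := hsurj a hab
        exact ⟨k, type0I_comm _ _⟩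
    · rintro ⟨k, rfl⟩
      exact ⟨i, f k, (hne k).symm, (vertIn_type2I (hne k).symm).2 (.inl rfl), rfl⟩
  · rw [edgesOf_type2I]
    ext S
    constructor
    · rintro (rfl | ⟨j, h1, h2, rfl⟩)
      · exact ⟨⟨n - 2, by omega⟩, if_pos (show n - 2 + 1 = n - 1 by omega)⟩
      · obtain ⟨k, rfl⟩ := hsurj j h2
        exact ⟨k, if_neg fun h => h1 (hlast k h)⟩
    · rintro ⟨k, rfl⟩
      by_cases hk : k.val + 1 = n - 1
      · exact .inl (if_pos hk)
      · refine .inr ⟨f k, fun h => ?_, hne k, if_neg hk⟩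
        obtain ⟨l, hl⟩ : ∃ l : Fin (n - 1), l.val = n - 2 := ⟨⟨n - 2, by omega⟩, rfl⟩
        rw [← hlast l (by omega)] at h
        rw [hinj h] at hk
        omega
  · have hr := val_finRotate k
    split_ifs with hk
    · rw [if_pos hk] at hr
      change _ = {type0I Z i (f k), type0I Z i (f (finRotate _ k))}
      rw [verticesOf_type1I, type0I_comm (i - 1), hlast k hk, hzero _ hr]
    · rw [if_neg hk] at hr
      have h1 := hsucc _ _ hr
      rw [verticesOf_type1II (hne k).symm (by rw [← h1]; exact (hne _).symm), ← h1]

theorem hasCyclicVertices_type2II (i : Fin n) : HasCyclicVertices Z (type2II Z i)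
      ![type0I Z (i - 1) i, type0I Z i (i + 1), type0I Z (i - 1) (i + 1)] := by
  obtain ⟨c1, c2, c3, c4, c5, c6, c7⟩ := cyclic_facts (n := n)
  have h5 : i + 1 ≠ i - 1 + 1 := by rw [c1]; exact (c3 i).symm
  have a1 := c3 i
  have a2 := c4 i
  have a3 := c5 i
  refine hasCyclicVertices_of (E := ![type1I Z i, type1II Z (i + 1) (i - 1),
    type1II Z (i - 1) i]) (fun k l h => ?_) ?_ ?_ fun k => ?_
  · fin_cases k <;> fin_cases l <;> first
      | rfl
      | (exfalso
         simp only [Fin.zero_eta, Fin.mk_one, Fin.reduceFinMk, Matrix.cons_val] at h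
         rw [type0I_eq_iff (by assumption) (by assumption)] at h
         grind only)
  · rw [verticesOf_listed (.inl (.inr (.inr (.inl ⟨i, rfl⟩)))), Matrix.range_cons,
      Matrix.range_cons, Matrix.range_cons, Matrix.range_empty, union_empty, singleton_union,
      singleton_union]
    ext S
    constructor
    · rintro ⟨a, b, hab, h, rfl⟩
      obtain ⟨h1, h2⟩ := (vertIn_type2II hab).1 h
      rcases h1 with rfl | rfl | rfl <;> rcases h2 with rfl | rfl | rfl <;>
        first | exact (hab rfl).elim | simp [type0I_comm]
    · rintro (rfl | rfl | rfl)
      · exact ⟨_, _, a2, (vertIn_type2II a2).2 (by simp), rfl⟩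
      · exact ⟨_, _, a1, (vertIn_type2II a1).2 (by simp), rfl⟩
      · exact ⟨_, _, a3, (vertIn_type2II a3).2 (by simp), rfl⟩
  · rw [edgesOf_type2II, Matrix.range_cons,
      Matrix.range_cons, Matrix.range_cons, Matrix.range_empty, union_empty, singleton_union,
      singleton_union]
    ext S
    simp only [mem_insert_iff, mem_singleton_iff]
    tauto
  · fin_cases k
    · exact verticesOf_type1I i
    · refine (verticesOf_type1II a3.symm h5).trans ?_
      rw [c1, pair_comm, type0I_comm, type0I_comm (i + 1)]
      rfl
    · refine (verticesOf_type1II a2 a3).trans ?_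
      rw [pair_comm]
      rfl

theorem hasCyclicVertices_type2III (h1 : j ≠ i - 1)
    (h2 : j ≠ i) (h3 : j ≠ i + 1) : HasCyclicVertices Z (type2III Z i j)
      ![type0I Z i j, type0I Z (i + 1) j, type0I Z (i + 1) (j + 1), type0I Z i (j + 1)] := by
  obtain ⟨c1, c2, c3, c4, c5, c6, c7⟩ := cyclic_facts (n := n)
  have d0 := h2.symm
  have d1 : i ≠ j + 1 := fun h => h1 (by rw [h, c2])
  have d2 : i + 1 ≠ j + 1 := fun h => h2 (add_right_cancel h).symm
  have d3 := h3.symm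
  have a1 := c3 i
  have a2 := c3 j
  refine hasCyclicVertices_of (E := ![type1II Z j i, type1II Z (i + 1) j, type1II Z (j + 1) i,
    type1II Z i j]) (fun k l h => ?_) ?_ ?_ fun k => ?_
  · fin_cases k <;> fin_cases l <;> first
      | rfl
      | (exfalso
         simp only [Fin.zero_eta, Fin.mk_one, Fin.reduceFinMk, Matrix.cons_val] at h
         rw [type0I_eq_iff (by assumption) (by assumption)] at h
         grind only)
  · rw [verticesOf_listed (.inl (.inr (.inr (.inr ⟨i, j, h1, h2, h3, rfl⟩)))),
      Matrix.range_cons, Matrix.range_cons, Matrix.range_cons, Matrix.range_cons,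
      Matrix.range_empty, union_empty, singleton_union, singleton_union, singleton_union]
    ext S
    constructor
    · rintro ⟨a, b, hab, h, rfl⟩
      have h := (vertIn_type2III hab).1 h
      have : ((a = i ∨ a = i + 1) ∧ (b = j ∨ b = j + 1)) ∨
          ((b = i ∨ b = i + 1) ∧ (a = j ∨ a = j + 1)) := by
        grind only
      rcases this with ⟨rfl | rfl, rfl | rfl⟩ | ⟨rfl | rfl, rfl | rfl⟩ <;> simp [type0I_comm]
    · rintro (rfl | rfl | rfl | rfl)
      · exact ⟨_, _, d0, (vertIn_type2III d0).2 (by simp), rfl⟩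
      · exact ⟨_, _, d3, (vertIn_type2III d3).2 (by simp), rfl⟩
      · exact ⟨_, _, d2, (vertIn_type2III d2).2 (by simp), rfl⟩
      · exact ⟨_, _, d1, (vertIn_type2III d1).2 (by simp), rfl⟩
  · rw [edgesOf_type2III h1 h2 h3, Matrix.range_cons, Matrix.range_cons, Matrix.range_cons,
      Matrix.range_cons, Matrix.range_empty, union_empty, singleton_union, singleton_union,
      singleton_union]
  · fin_cases k
    · refine (verticesOf_type1II h2 h3).trans ?_
      rw [type0I_comm j, type0I_comm j]
      rfl
    · exact verticesOf_type1II d3 d2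
    · refine (verticesOf_type1II d1.symm d2.symm).trans ?_
      rw [pair_comm, type0I_comm (j + 1), type0I_comm (j + 1)]
      rfl
    · refine (verticesOf_type1II d0 d1).trans ?_
      rw [pair_comm]
      rfl

theorem quadrics_eq_image (i : Fin n)  : quadrics3I Z i = type2III Z i '' {i - 1, i, i + 1}ᶜ := by
  ext S
  constructor
  · rintro ⟨j, h1, h2, h3, rfl⟩
    exact ⟨j, by simp [h1, h2, h3], rfl⟩
  · rintro ⟨j, hj, rfl⟩
    simp only [mem_compl_iff, mem_insert_iff, mem_singleton_iff, not_or] at hj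
    exact ⟨j, hj.1, hj.2.1, hj.2.2, rfl⟩

theorem finite_quadrics (i : Fin n) : (quadrics3I Z i).Finite := by
  rw [quadrics_eq_image]
  exact toFinite _

theorem ncard_quadrics (i : Fin n) : (quadrics3I Z i).ncard = n - 3 := by
  have c3 := succ_ne i
  have c4 := pred_ne i
  have c5 := pred_ne_succ i
  rw [quadrics_eq_image, InjOn.ncard_image, ncard_compl, ncard_insert_of_notMem, ncard_pair c3,
    Nat.card_eq_fintype_card, Fintype.card_fin]
  · rintro (h | h)
    exacts [c4 h, c5 h]
  · intro j hj k hk h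
    simp only [mem_compl_iff, mem_insert_iff, mem_singleton_iff, not_or] at hj hk
    exact type2III_injective hj.1 hj.2.1 hk.1 hk.2.1 h

theorem vertIn_succ (i : Fin n) :
    VertIn Z (type2I Z i) i (i + 1) ∧ VertIn Z (type2I Z (i + 1)) i (i + 1) ∧
      VertIn Z (type2II Z i) i (i + 1) ∧ VertIn Z (type2II Z (i + 1)) i (i + 1) := by
  have c3 := succ_ne i
  rw [vertIn_type2I c3, vertIn_type2I c3, vertIn_type2II c3,
    vertIn_type2II c3, add_sub_cancel_right]
  simp

theorem not_vertIn_succ_type2III (h1 : j ≠ i - 1)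
    (h2 : j ≠ i) (h3 : j ≠ i + 1) : ¬ VertIn Z (type2III Z i j) i (i + 1) := by
  rw [vertIn_type2III (succ_ne i)]
  rintro ⟨-, h | h | h | h⟩
  exacts [h2 h.symm, h1 (by rw [h, add_sub_cancel_right]), h3 h.symm, h2 (add_right_cancel h).symm]

theorem polygonsOf_type3I (i : Fin n) : polygonsOf Z (type3I Z i) = facets3I Z i := by
  obtain ⟨c1, c2, c3, c4, c5, c6, c7⟩ := cyclic_facts (n := n)
  have hT : type3I Z i ∈ listed Z := .inr ⟨i, rfl⟩
  have key : ∀ S ∈ surfaceStrata Z, S ⊆ type3I Z i → S ∈ polygonsOf Z (type3I Z i) :=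
    fun S hS h => ⟨hS, (closedFace_subset_iff (.inl (.inr hS)) hT).2
      fun a b _ h' => h'.trans h⟩
  ext S
  constructor
  · rintro ⟨hS, h⟩
    rw [closedFace_subset_iff (.inl (.inr hS)) hT] at h
    rcases hS with ⟨k, rfl⟩ | ⟨k, rfl⟩ | ⟨k, l, h1, h2, h3, rfl⟩
    · have e1 := h k (k + 1) (c3 k) ((vertIn_type2I (c3 k)).2 (by simp))
      have e2 := h (k - 1) k (c4 k) ((vertIn_type2I (c4 k)).2 (by simp))
      rw [vertIn_type3I (c3 k)] at e1
      rw [vertIn_type3I (c4 k)] at e2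
      have : k = i ∨ k = i + 1 := by
        grind only
      refine .inl (.inr ?_)
      rcases this with rfl | rfl <;> simp
    · have e1 := h k (k + 1) (c3 k) ((vertIn_type2II (c3 k)).2 (by simp))
      have e2 := h (k - 1) k (c4 k) ((vertIn_type2II (c4 k)).2 (by simp))
      have e3 := h (k - 1) (k + 1) (c5 k) ((vertIn_type2II (c5 k)).2 (by simp))
      rw [vertIn_type3I (c3 k)] at e1
      rw [vertIn_type3I (c4 k)] at e2
      have : k = i ∨ k = i + 1 := by
        grind only
      refine .inr ?_
      rcases this with rfl | rfl <;> simp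
    · have h4 : k ≠ l + 1 := fun h => h1 (by rw [h, c2])
      have h5 : k + 1 ≠ l + 1 := fun h => h2 (add_right_cancel h).symm
      have e1 := h k l h2.symm ((vertIn_type2III h2.symm).2 (by simp))
      have e2 := h (k + 1) l h3.symm ((vertIn_type2III h3.symm).2 (by simp))
      have e3 := h k (l + 1) h4 ((vertIn_type2III h4).2 (by simp))
      have e4 := h (k + 1) (l + 1) h5 ((vertIn_type2III h5).2 (by simp))
      rw [vertIn_type3I h3.symm] at e2
      rw [vertIn_type3I h4] at e3
      have : k = i ∨ l = i := by
        grind only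
      refine .inl (.inl ?_)
      rcases this with rfl | rfl
      · exact ⟨l, h1, h2, h3, rfl⟩
      · exact ⟨k, fun h => h3 (by rw [h, c1]), h2.symm, h4, inter_comm _ _⟩
  · rintro ((⟨j, h1, h2, h3, rfl⟩ | (rfl | rfl)) | (rfl | rfl))
    · exact key _ (.inr (.inr ⟨i, j, h1, h2, h3, rfl⟩)) inter_subset_left
    · exact key _ (.inl ⟨_, rfl⟩) (type2I_subset_type3I i)
    · exact key _ (.inl ⟨_, rfl⟩) (type2I_succ_subset_type3I i)
    · exact key _ (.inr (.inl ⟨_, rfl⟩)) (type2II_subset_type3I i)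
    · exact key _ (.inr (.inl ⟨_, rfl⟩)) (type2II_succ_subset_type3I i)

theorem ncard_polygonsOf_type3I (i : Fin n) : (polygonsOf Z (type3I Z i)).ncard = n + 1 := by
  have hn := hn.out
  obtain ⟨v1, v2, v3, v4⟩ := vertIn_succ (Z := Z) i
  have c3 := succ_ne i
  rw [polygonsOf_type3I, facets3I, union_assoc, ncard_union_eq ?_ (finite_quadrics i),
    ncard_quadrics, ncard_union_eq, ncard_pair, ncard_pair]
  · omega
  · exact fun h => c3 (type2II_injective h)
  · exact fun h => c3 (type2I_injective h)
  · rw [disjoint_left]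
    rintro _ (rfl | rfl) (h | h) <;> exact type2I_ne_type2II _ _ h
  · rw [disjoint_left]
    rintro _ ⟨j, h1, h2, h3, rfl⟩ h
    have h0 := not_vertIn_succ_type2III (Z := Z) h1 h2 h3
    rcases h with (h | h) | (h | h)
    exacts [v1.ne h0 h.symm, v2.ne h0 h.symm, v3.ne h0 h.symm, v4.ne h0 h.symm]

theorem isHyperplaneSection_inter (hij : i ≠ j) :
    IsHyperplaneSection (type3I Z i) (type3I Z i ∩ type3I Z j) := by
  obtain ⟨c1, c2, c3, c4, c5, c6, c7⟩ := cyclic_facts (n := n)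
  have e : {W : Gr ℂ 4 | ∀ M : Frame ℂ 4, rowSpan M = W →
      brL (toComplex (Z j)) (toComplex (Z (j + 1))) (plucker M) = 0} = type3I Z j := by
    have hl := toComplex_independent (hZ.pair_independent (c3 j))
    ext W
    constructor
    · intro h
      obtain ⟨u, v, h', rfl⟩ := exists_lineOf W
      refine (mem_schubertL_lineOf h' hl).2 ?_
      rw [← brL_pl]
      exact h (frameOf u v h') (rowSpan_frameOf u v h')
    · rintro h M rfl
      rw [rowSpan_eq_lineOf] at h
      rw [plucker_eq_pl, brL_pl]
      exact (mem_schubertL_lineOf M.linearIndependent hl).1 h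
  refine ⟨brL (toComplex (Z j)) (toComplex (Z (j + 1))), ?_, by rw [e]⟩
  rw [e]
  intro h
  have h1 : VertIn Z (type3I Z j) i (i + 1) :=
    (vertIn_succ i).1.trans ((type2I_subset_type3I i).trans h)
  have h2 : VertIn Z (type3I Z j) (i - 1) i :=
    ((vertIn_type2I (c4 i)).2 (.inr rfl)).trans ((type2I_subset_type3I i).trans h)
  have h3 : VertIn Z (type3I Z j) (i + 1) (i + 1 + 1) :=
    ((vertIn_type2I (c3 (i + 1))).2 (.inl rfl)).trans
      ((type2I_succ_subset_type3I i).trans h)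
  have h4 : VertIn Z (type3I Z j) (i - 1) (i + 1) := ((vertIn_type2I (c5 i)).2 (.inr rfl)).trans
      ((type2I_succ_subset_type3I i).trans h)
  have c8 : i ≠ i + 1 + 1 := fun h => c5 (i + 1) (by rw [c2, ← h])
  have h5 : VertIn Z (type3I Z j) i (i + 1 + 1) :=
    ((vertIn_type2I c8).2 (.inl rfl)).trans ((type2I_subset_type3I i).trans h)
  rw [vertIn_type3I (c3 i)] at h1
  rw [vertIn_type3I (c4 i)] at h2
  rw [vertIn_type3I (c3 _)] at h3
  grind only

theorem isHyperplaneSection_surfaces (i : Fin n) : ∀ S ∈ quadrics3I Z i ∪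
      {type2I Z i ∪ type2II Z i, type2I Z (i + 1) ∪ type2II Z (i + 1)},
      IsHyperplaneSection (type3I Z i) S := by
  rintro _ (⟨j, -, h2, -, rfl⟩ | (rfl | rfl))
  · exact isHyperplaneSection_inter h2.symm
  · rw [← type3I_pred_inter, inter_comm]
    exact isHyperplaneSection_inter (pred_ne i).symm
  · rw [← type3I_inter_succ]
    exact isHyperplaneSection_inter (succ_ne i)

theorem ncard_hyperplaneSections (i : Fin n) : (quadrics3I Z i ∪
      {type2I Z i ∪ type2II Z i, type2I Z (i + 1) ∪ type2II Z (i + 1)}).ncard = n - 1 := by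
  have hn := hn.out
  obtain ⟨c1, c2, c3, c4, c5, c6, c7⟩ := cyclic_facts (n := n)
  obtain ⟨v1, v2, v3, v4⟩ := vertIn_succ (Z := Z) i
  rw [ncard_union_eq ?_ (finite_quadrics i), ncard_quadrics, ncard_pair]
  · omega
  · rw [← type3I_pred_inter, ← type3I_inter_succ]
    intro h
    have h1 : VertIn Z (type3I Z i ∩ type3I Z (i + 1)) (i + 1) (i + 1 + 1) := by
      rw [vertIn_inter, vertIn_type3I (c3 _), vertIn_type3I (c3 _)]
      simp
    rw [← h, vertIn_inter, vertIn_type3I (c3 _)] at h1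
    grind only
  · rw [disjoint_left]
    rintro _ ⟨j, h1, h2, h3, rfl⟩ h
    have h0 := not_vertIn_succ_type2III (Z := Z) h1 h2 h3
    rcases h with h | h
    · exact VertIn.ne (v1.trans subset_union_left) h0 h.symm
    · exact VertIn.ne (v2.trans subset_union_left) h0 h.symm

end Polygons

theorem proposition4p7 (n : ℕ) [NeZero n] (hn : 4 ≤ n) (Z : Matrix (Fin n) (Fin 4) ℝ)
    (hZ : IsTotallyPositive Z) (hgen : IsGeneral Z) :
    -- the list of strata that carry boundary faces is exhaustive
    (∀ S : Set (Gr ℂ 4), IsBoundaryStratum Z S ↔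
      S ∈ vertexStrata Z ∪ lineStrata Z ∪ surfaceStrata Z ∪ threefoldStrata Z) ∧
    -- their faces are polytopes of dimension 0, 1, 2 and 3
    (∀ S ∈ vertexStrata Z, IsPolytopeFace Z 0 S) ∧
    (∀ S ∈ lineStrata Z, IsPolytopeFace Z 1 S) ∧
    (∀ S ∈ surfaceStrata Z, IsPolytopeFace Z 2 S) ∧
    (∀ S ∈ threefoldStrata Z, IsPolytopeFace Z 3 S) ∧
    -- vertices
    (∀ i j : Fin n, i ≠ j → ∀ W : Gr ℝ 4,
      W ∈ face Z (type0I Z i j) ↔ W.toSubmodule = Submodule.span ℝ {Z i, Z j}) ∧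
    (∀ i : Fin n,
      {T | T ∈ lineStrata Z ∧ type0I Z i (i + 1) ⊆ T} =
        {type1I Z i, type1I Z (i + 1), type1II Z i (i + 1), type1II Z (i + 1) (i - 1)} ∧
      {T | T ∈ lineStrata Z ∧ type0I Z i (i + 1) ⊆ T}.ncard = 4) ∧
    (∀ i j : Fin n, j ≠ i - 1 → j ≠ i → j ≠ i + 1 →
      {T | T ∈ lineStrata Z ∧ type0I Z i j ⊆ T} =
        {type1II Z i (j - 1), type1II Z i j, type1II Z j (i - 1), type1II Z j i} ∧
      {T | T ∈ lineStrata Z ∧ type0I Z i j ⊆ T}.ncard = 4) ∧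
    -- line segments
    (∀ i : Fin n, IsConvexFace Z (type1I Z i) ∧
      verticesOf Z (type1I Z i) = {type0I Z (i - 1) i, type0I Z i (i + 1)} ∧
      (verticesOf Z (type1I Z i)).ncard = 2) ∧
    (∀ i j : Fin n, i ≠ j → i ≠ j + 1 → IsConvexFace Z (type1II Z i j) ∧
      verticesOf Z (type1II Z i j) = {type0I Z i j, type0I Z i (j + 1)} ∧
      (verticesOf Z (type1II Z i j)).ncard = 2) ∧
    -- convex (n - 1)-gons
    (∀ i : Fin n, IsConvexFace Z (type2I Z i) ∧
      HasCyclicVertices Z (type2I Z i)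
        (fun k : Fin (n - 1) => type0I Z i (i + 1 + Fin.castLE (Nat.sub_le n 1) k)) ∧
      edgesOf Z (type2I Z i) =
        {type1I Z i} ∪ {S | ∃ j, j ≠ i - 1 ∧ j ≠ i ∧ S = type1II Z i j} ∧
      (edgesOf Z (type2I Z i)).ncard = n - 1) ∧
    -- triangles
    (∀ i : Fin n, IsConvexFace Z (type2II Z i) ∧
      HasCyclicVertices Z (type2II Z i)
        ![type0I Z (i - 1) i, type0I Z i (i + 1), type0I Z (i - 1) (i + 1)] ∧
      edgesOf Z (type2II Z i) =
        {type1II Z (i - 1) i, type1I Z i, type1II Z (i + 1) (i - 1)} ∧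
      (edgesOf Z (type2II Z i)).ncard = 3) ∧
    -- quadrilaterals
    (∀ i j : Fin n, j ≠ i - 1 → j ≠ i → j ≠ i + 1 →
      HasCyclicVertices Z (type2III Z i j)
        ![type0I Z i j, type0I Z (i + 1) j, type0I Z (i + 1) (j + 1), type0I Z i (j + 1)] ∧
      edgesOf Z (type2III Z i j) =
        {type1II Z j i, type1II Z (i + 1) j, type1II Z (j + 1) i, type1II Z i j} ∧
      (edgesOf Z (type2III Z i j)).ncard = 4) ∧
    -- three-dimensional polytopes with n + 1 facets
    (∀ i : Fin n,
      polygonsOf Z (type3I Z i) =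
        {S | ∃ j, j ≠ i - 1 ∧ j ≠ i ∧ j ≠ i + 1 ∧ S = type2III Z i j} ∪
          {type2I Z i, type2I Z (i + 1)} ∪ {type2II Z i, type2II Z (i + 1)} ∧
      {S | ∃ j, j ≠ i - 1 ∧ j ≠ i ∧ j ≠ i + 1 ∧ S = type2III Z i j}.ncard = n - 3 ∧
      (polygonsOf Z (type3I Z i)).ncard = n + 1) ∧
    -- the surfaces in a threefold form n - 1 hyperplane sections
    (∀ i : Fin n,
      (∀ S ∈ {S | ∃ j, j ≠ i - 1 ∧ j ≠ i ∧ j ≠ i + 1 ∧ S = type2III Z i j} ∪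
          {type2I Z i ∪ type2II Z i, type2I Z (i + 1) ∪ type2II Z (i + 1)},
        IsHyperplaneSection (type3I Z i) S) ∧
      ({S | ∃ j, j ≠ i - 1 ∧ j ≠ i ∧ j ≠ i + 1 ∧ S = type2III Z i j} ∪
        {type2I Z i ∪ type2II Z i, type2I Z (i + 1) ∪ type2II Z (i + 1)}).ncard = n - 1) := by
  obtain ⟨ε, _⟩ := hZ.exists_posConf hn
  haveI := Fact.mk hn
  refine ⟨isBoundaryStratum_iff, ?_, ?_, ?_, ?_, fun i j hij W => mem_face_type0I_iff hij W,
    type0I_subset_lines_succ, fun i j h1 h2 h3 => type0I_subset_lines h1 h2 h3,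
    fun i => ⟨isConvexFace_type1I i, verticesOf_type1I i,
      ncard_verticesOf_type1I i⟩,
    fun i j h1 h2 => ⟨isConvexFace_type1II i j h1 h2, verticesOf_type1II h1 h2,
      ncard_verticesOf_type1II h1 h2⟩,
    fun i => ⟨isConvexFace_type2I i, hasCyclicVertices_type2I i,
      edgesOf_type2I i, ncard_edgesOf_type2I i⟩,
    fun i => ⟨isConvexFace_type2II i, hasCyclicVertices_type2II i,
      edgesOf_type2II i, ncard_edgesOf_type2II i⟩,
    fun i j h1 h2 h3 => ⟨hasCyclicVertices_type2III h1 h2 h3,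
      edgesOf_type2III h1 h2 h3, ncard_edgesOf_type2III h1 h2 h3⟩,
    fun i => ⟨polygonsOf_type3I i, ncard_quadrics i, ncard_polygonsOf_type3I i⟩,
    fun i => ⟨isHyperplaneSection_surfaces i, ncard_hyperplaneSections i⟩⟩
  · rintro _ ⟨i, j, hij, rfl⟩
    exact (polytopeModel_type0I hij).isPolytopeFace
  · rintro _ (⟨i, rfl⟩ | ⟨i, j, h1, h2, rfl⟩)
    · exact (polytopeModel_type1I i).elim fun _ h => h.isPolytopeFace
    · exact (polytopeModel_type1II h1 h2).elim fun _ h => h.isPolytopeFace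
  · rintro _ (⟨i, rfl⟩ | ⟨i, rfl⟩ | ⟨i, j, h1, h2, h3, rfl⟩)
    · exact (polytopeModel_type2I i).isPolytopeFace
    · exact (polytopeModel_type2II i).isPolytopeFace
    · exact (polytopeModel_type2III h1 h2 h3).isPolytopeFace
  · rintro _ ⟨i, rfl⟩
    exact (polytopeModel_type3I i).isPolytopeFace
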